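/- **Setting.** Let $\theta_j\ge 0$, $\kappa_j\ge 0$ ($j\ge1$) be real sequences, and for $N\ge1$ let $P_N$ be the surrogate-spatial measure on the symmetric group $S_N$, $$P_N(\sigma)=\frac{1}{N!\,H_N}\prod_{j=1}^N(\theta_j+N\kappa_j)^{C_j(\sigma)},\qquad H_N=\frac1{N!}\sum_{\sigma\in S_N}\prod_{j=1}^N(\theta_j+N\kappa_j)^{C_j(\sigma)},$$ where $C_j(\sigma)$ is the number of cycles of length $j$ of $\sigma$ (defined whenever $H_N>0$, which holds for all large $N$). Let $T_N=\sum_{j=1}^N C_j$ be the total number of cycles. Put $$g_\theta(z)=\sum_{j\ge1}\frac{\theta_j}{j}z^j,\qquad g_\kappa(z)=\sum_{j\ge1}\frac{\kappa_j}{j}z^j,\qquad g^{\{n\}}(z)=z^n g^{(n)}(z).$$ Assume that $(\kappa_j)$ is non-arithmetic (no integer $j_0>1$ divides every $j$ with $\kappa_j\neq0$) and that $\kappa_j>0$ for some $j\ge2$. Let $R\in(0,\infty]$ be the radius of convergence of $g_\kappa$, and assume that the radius of convergence of $g_\theta$ is at least $R$. Write $g^{\{n\}}(R)=\lim_{r\uparrow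 R}g^{\{n\}}(r)\in[0,\infty]$ and $b_2(r)=g_\kappa^{\{1\}}(r)+g_\kappa^{\{2\}}(r)$ for $r\in(0,R]$. For $\eta>0$, $\varphi\in(0,\pi/2)$ and $R<\infty$ let $$\Delta_0=\Delta_0(R,\eta,\varphi)=\{z\in\mathbb C: |z|<|R(1+\eta e^{i\varphi})|,\ z\ne R,\ |\arg(z-R)|>\varphi\}.$$ All limits in distribution are as $N\to\infty$, under $P_N$; $\mathcal N(0,1)$ is the standard normal law. **(a)** If $1<g_\kappa^{\{1\}}(R)\le\infty$, the equation $g_\kappa^{\{1\}}(r)=1$ has a unique root $r_1\in(0,R)$, one has $g_\kappa(r_1)-1/b_2(r_1)>0$, and $$\frac{T_N-Ng_\kappa(r_1)}{\sqrt{N[g_\kappa(r_1)-1/b_2(r_1)]}}\xrightarrow{d}\mathcal N(0,1).$$ **(b)** Let $g_\kappa^{\{1\}}(R)<1$, and suppose that $g_\theta$ and $g_\kappa$ extend holomorphically to some $\Delta_0$. Assume that one of the following holds. * For some $\theta^*>0$, $\delta>0$, as $z\to R$ in $\Delta_0$: $g_\theta(z)=-\theta^*\log(1-z/R)+O((1-z/R)^\delta)$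 and $g_\kappa(z)=g_\kappa(R)-g_\kappa^{\{1\}}(R)(1-z/R)+O((1-z/R)^{1+\delta})$. * $g_\theta$ is regular at $z=R$, and for some non-integer $s>1$ one has $g_\kappa^{\{n\}}(R)<\infty$ for all $n<s$, $g_\kappa^{\{n\}}(R)=\infty$ for all $n>s$ and, for some $a_s\neq0$, $\delta>0$, as $z\to R$ in $\Delta_0$: $$g_\kappa(z)=\sum_{0\le n<s}\frac{(-1)^n g_\kappa^{\{n\}}(R)}{n!}(1-z/R)^n+a_s(1-z/R)^s+O((1-z/R)^{s+\delta}).$$ Then $$\frac{T_N-Ng_\kappa(R)}{\sqrt{N g_\kappa(R)}}\xrightarrow{d}\mathcal N(0,1).$$ **(c)** Let $g_\kappa^{\{1\}}(R)=1$. **(c-i)** If $g_\theta(R)<\infty$, $g_\kappa(R)<\infty$ and $0<g_\kappa^{\{2\}}(R)<\infty$, then $g_\kappa(R)-1/b_2(R)>0$ and $$\frac{T_N-Ng_\kappa(R)}{\sqrt{N[g_\kappa(R)-1/b_2(R)]}}\xrightarrow{d}\mathcal N(0,1).$$ **(c-ii)** Suppose that $g_\theta$ and $g_\kappa$ extend holomorphically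 to some $\Delta_0$ and that, for some $\theta^*\ge0$, $s\in(1,2)$, $a_s>0$, $\delta>0$, as $z\to R$ in $\Delta_0$: $g_\theta(z)=-\theta^*\log(1-z/R)+O((1-z/R)^\delta)$ and $g_\kappa(z)=g_\kappa(R)-(1-z/R)+a_s(1-z/R)^s+O((1-z/R)^{s+\delta})$. Then $$\frac{T_N-Ng_\kappa(R)}{\sqrt{N g_\kappa(R)}}\xrightarrow{d}\mathcal N(0,1).$$ **(c-iii)** Suppose that $0<g_\kappa^{\{2\}}(R)<\infty$, that $g_\theta$ and $g_\kappa$ extend holomorphically to some $\Delta_0$ and that, for some $\theta^*>0$, $\delta>0$, as $z\to R$ in $\Delta_0$: $g_\theta(z)=-\theta^*\log(1-z/R)+O((1-z/R)^\delta)$ and $g_\kappa(z)=g_\kappa(R)-(1-z/R)+\tfrac12 g_\kappa^{\{2\}}(R)(1-z/R)^2+O((1-z/R)^{2+\delta})$. Then $g_\kappa(R)-1/b_2(R)>0$ and $$\frac{T_N-Ng_\kappa(R)}{\sqrt{N[g_\kappa(R)-1/b_2(R)]}}\xrightarrow{d} Z-\sqrt{\frac{2X}{g_\kappa(R)b_2(R)-1}},$$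 where $Z$ is standard normal and $X$ is independent of $Z$ with density $\Gamma(\theta^*/2)^{-1}x^{\theta^*/2-1}e^{-x}$, $x>0$. -/

import Mathlib

open MeasureTheory ProbabilityTheory Filter Topology Asymptotics
open scoped ENNReal NNReal

namespace SurrogateSpatial

noncomputable section

/-! ### Random permutations -/

/-- All subsets of the finite symmetric group are measurable. -/
instance permMeasurableSpace (N : ℕ) : MeasurableSpace (Equiv.Perm (Fin N)) := ⊤

/-- `C_j(σ)`: the number of cycles of length `j` of `σ`; fixed points are cycles of length `1`
(`Equiv.Perm.partition` lists the lengths of all cycles, fixed points included). -/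
def cycleCount {N : ℕ} (j : ℕ) (σ : Equiv.Perm (Fin N)) : ℕ :=
  σ.partition.parts.count j

/-- `T_N(σ) = ∑_{j=1}^N C_j(σ)`: the total number of cycles. -/
def totalCycles {N : ℕ} (σ : Equiv.Perm (Fin N)) : ℕ :=
  ∑ j ∈ Finset.Icc 1 N, cycleCount j σ

/-- The multiplicative weight `∏_{j=1}^N (θ_j + N κ_j)^{C_j(σ)}`. -/
def weight (θ κ : ℕ → ℝ) {N : ℕ} (σ : Equiv.Perm (Fin N)) : ℝ :=
  ∏ j ∈ Finset.Icc 1 N, (θ j + N * κ j) ^ cycleCount j σ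

/-- The normalization constant `H_N = (1 / N!) ∑_σ ∏_{j=1}^N (θ_j + N κ_j)^{C_j(σ)}`. -/
def normConst (θ κ : ℕ → ℝ) (N : ℕ) : ℝ :=
  (1 / (N.factorial : ℝ)) * ∑ σ : Equiv.Perm (Fin N), weight θ κ σ

/-- The surrogate-spatial measure `P_N` on the symmetric group, giving mass
`∏_{j=1}^N (θ_j + N κ_j)^{C_j(σ)} / (N! H_N)` to the permutation `σ`
(a probability measure as soon as `H_N > 0`). -/
def surrogateMeasure (θ κ : ℕ → ℝ) (N : ℕ) : Measure (Equiv.Perm (Fin N)) :=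
  ∑ σ : Equiv.Perm (Fin N),
    ENNReal.ofReal (weight θ κ σ / ((N.factorial : ℝ) * normConst θ κ N)) • Measure.dirac σ

/-- Convergence in distribution, under the measures `P_N`, of the random variables `Y N` on the
symmetric groups to `Z`. For small `N` it may happen that `H_N = 0`, so that there is no
measure `P_N`; this definition demands that from some `N₀` on `P_N` is a probability measure, and
that the sequence starting at `N₀` converges. -/
def ConvergesInLaw (θ κ : ℕ → ℝ) (Y : (N : ℕ) → Equiv.Perm (Fin N) → ℝ)
    {Ω : Type*} [MeasurableSpace Ω] (Z : Ω → ℝ) (P : Measure Ω) [IsProbabilityMeasure P] : Prop :=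
  ∃ N₀ : ℕ, ∃ _ : ∀ k : ℕ, IsProbabilityMeasure (surrogateMeasure θ κ (N₀ + k)),
    TendstoInDistribution (fun k : ℕ => Y (N₀ + k)) atTop Z
      (fun k : ℕ => surrogateMeasure θ κ (N₀ + k)) P

/-- `(T_N - N m) / √(N v)`. -/
def normalizedTotal (m v : ℝ) (N : ℕ) (σ : Equiv.Perm (Fin N)) : ℝ :=
  ((totalCycles σ : ℝ) - N * m) / Real.sqrt (N * v)

/-! ### Generating functions -/

/-- The coefficients `a_j / j`, `j ≥ 1`, of `g_a`; the coefficient with index `0` is `0`. -/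
def genCoeff (a : ℕ → ℝ) (j : ℕ) : ℝ := a j / j

/-- The function `g_a(x) = ∑_{j ≥ 1} (a_j / j) x^j` of a real variable. -/
def gen (a : ℕ → ℝ) (x : ℝ) : ℝ := ∑' j : ℕ, genCoeff a j * x ^ j

/-- The function `g_a(z) = ∑_{j ≥ 1} (a_j / j) z^j` of a complex variable. -/
def genC (a : ℕ → ℝ) (z : ℂ) : ℂ := ∑' j : ℕ, (genCoeff a j : ℂ) * z ^ j

/-- The radius of convergence of `g_a`. -/
def genRadius (a : ℕ → ℝ) : ℝ≥0∞ :=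
  (FormalMultilinearSeries.ofScalars ℝ (genCoeff a)).radius

/-- The modified derivative `g_a^{\{n\}}(x) = x^n g_a^{(n)}(x)`. -/
def modDeriv (a : ℕ → ℝ) (n : ℕ) (x : ℝ) : ℝ := x ^ n * iteratedDeriv n (gen a) x

/-- `g_a^{\{n\}}(R) = lim_{r ↑ R} g_a^{\{n\}}(r)`, possibly `+∞`. For coefficients `a_j ≥ 0` and
`R` at most the radius of convergence, `g_a^{\{n\}}` is nondecreasing on `(0, R)`, so that the
limit is the supremum. -/
def modDerivAt (a : ℕ → ℝ) (n : ℕ) (R : ℝ≥0∞) : EReal :=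
  ⨆ r : {r : ℝ // 0 < r ∧ ENNReal.ofReal r < R}, ((modDeriv a n r : ℝ) : EReal)

/-- `b_2(r) = g_κ^{\{1\}}(r) + g_κ^{\{2\}}(r)` for `0 < r < R`. -/
def bTwo (κ : ℕ → ℝ) (r : ℝ) : ℝ := modDeriv κ 1 r + modDeriv κ 2 r

/-- `b_2(R) = g_κ^{\{1\}}(R) + g_κ^{\{2\}}(R)`, used when both terms are finite. -/
def bTwoAt (κ : ℕ → ℝ) (R : ℝ≥0∞) : ℝ :=
  (modDerivAt κ 1 R).toReal + (modDerivAt κ 2 R).toReal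

/-- `r` is a solution `r_1` in `(0, R)` of the equation `g_κ^{\{1\}}(r) = 1`. -/
def IsSaddlePoint (κ : ℕ → ℝ) (R : ℝ≥0∞) (r : ℝ) : Prop :=
  0 < r ∧ ENNReal.ofReal r < R ∧ modDeriv κ 1 r = 1

/-- The sequence is non-arithmetic: no integer `j₀ > 1` divides all `j ≥ 1` with `κ_j ≠ 0`. -/
def NonArithmetic (κ : ℕ → ℝ) : Prop :=
  ¬ ∃ j₀ : ℕ, 1 < j₀ ∧ ∀ j : ℕ, 1 ≤ j → κ j ≠ 0 → j₀ ∣ j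

/-! ### Analytic continuation and singular expansions -/

/-- The domain `Δ₀(R, η, φ)`: all `z ≠ R` with `|z| < |R (1 + η e^{iφ})|` and
`|arg (z - R)| > φ`. -/
def deltaDomain (R η φ : ℝ) : Set ℂ :=
  {z : ℂ | ‖z‖ < ‖(R : ℂ) * (1 + (η : ℂ) * Complex.exp (Complex.I * (φ : ℂ)))‖ ∧
    z ≠ (R : ℂ) ∧ φ < |Complex.arg (z - (R : ℂ))|}

/-- `G` is a holomorphic function on `Δ₀(R, η, φ)` that continues `g_a`. -/
def IsContinuation (a : ℕ → ℝ) (R η φ : ℝ) (G : ℂ → ℂ) : Prop :=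
  DifferentiableOn ℂ G (deltaDomain R η φ) ∧ ∀ z : ℂ, ‖z‖ < R → G z = genC a z

/-- `G(z) = F(z) + O((1 - z/R)^t)` as `z → R`, `z ∈ Δ₀(R, η, φ)`. -/
def HasExpansion (R η φ : ℝ) (G F : ℂ → ℂ) (t : ℝ) : Prop :=
  (fun z : ℂ => G z - F z) =O[𝓝[deltaDomain R η φ] (R : ℂ)]
    (fun z : ℂ => ‖1 - z / (R : ℂ)‖ ^ t)

end

end SurrogateSpatial

open SurrogateSpatial

/-! Write E for the expectation under P_N and Z_N(u) for the coefficient of z^N in exp(u(g_θ + N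
g_κ)). Then E u^{T_N} = Z_N(u) / Z_N(1) (`partitionFunction_eq`), so by Lévy's continuity theorem it
is enough to find the asymptotics of Z_N(e^{iτ}), τ = t/√(Nv), up to a factor that does not depend
on t (`convergesInLaw_of_tendsto`). Put z = r e^{-w} in Cauchy's formula, with r = r_1 in case (a)
and r = R otherwise, and m = g_κ(r). The factor e^{uNm} comes out, and after centring it contributes
e^{-mt²/(2v)} (`tendsto_exp_second_order`, `convergesInLaw_of_tilted`). What remains is the integral
of exp(u(g_θ + N(g_κ - m)) + Nw) along a vertical segment. Non-arithmeticity makes the part away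
from w = 0 exponentially small (`exists_norm_exp_phase_le`). Near w = 0 one has g_κ - m = -cw + o(w)
with c = g_κ^{1}(r), and the value of c decides what happens.

If c = 1, the linear terms cancel up to N(1 - u)w ≈ -iNτw. The next term A w^s has s = 2 for a
finite second moment and 1 < s < 2 otherwise, and it sets the scale w ~ N^{-1/s}
(`tendsto_expCoeff_circle`). The limit is the integral of x^{-θ*} exp(A x^s - iσx) over the line Re
x = 1, where σ = lim Nτ N^{-1/s}. For s = 2, σ = t/√v and A = b/2 with b = b_2(r); the Gaussian
integral gives e^{t²/(2bv)}, which lowers the variance from m to m - 1/b. If also θ* > 0, writing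
x^{-θ*} as a mixture of the exponentials e^{-xy} produces the characteristic function of minus the
square root of a Gamma variable (`integral_circleLimit_two_eq_gamma`). For s < 2, σ = 0 and the
limit does not depend on t, so the variance is m; the limit must then be shown to be nonzero
(`integral_circleLimit_ne_zero`), which uses that the coefficients are nonnegative.

If c < 1, there is no saddle point: the term (1 - c)Nw pulls the contour to the left and the
singularity at w = 0 acts at the scale 1/N. The Δ₀-continuation allows the contour to be bent into
two rays, and the limit is a Hankel integral (`tendsto_expCoeff_wedge`). For an algebraic
singularity the exponential of the regular part is subtracted first: it is holomorphic near 0, so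
its contour can be pushed left, where it is exponentially small. The limit is again independent of
t, and nonzero by `wedgeIntegral_hankel_ne_zero`. -/

namespace SurrogateSpatial

/-! ### The cycle index as a coefficient of an exponential -/

/-- `(1 / n!) ∑_σ ∏_{j ≤ n} (j c_j)^{C_j(σ)}`, which is the coefficient of `z^n` in
`exp (∑_{j ≥ 1} c_j z^j)`. -/
noncomputable def expCoeff (c : ℕ → ℂ) (n : ℕ) : ℂ :=
  (1 / (n.factorial : ℂ)) * ∑ σ : Equiv.Perm (Fin n),
    ∏ j ∈ Finset.Icc 1 n, ((j : ℂ) * c j) ^ cycleCount j σ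

/-- `f` is an everywhere absolutely convergent power series with sum `F`. -/
def HasEntireSum (f : PowerSeries ℂ) (F : ℂ → ℂ) : Prop :=
  ∀ z : ℂ, (Summable fun n : ℕ => ‖f.coeff n * z ^ n‖) ∧ ∑' n : ℕ, f.coeff n * z ^ n = F z

lemma HasEntireSum.one : HasEntireSum 1 (fun _ => 1) := by
  intro z
  have h : ∀ n : ℕ, n ∉ ({0} : Finset ℕ) →
      (PowerSeries.coeff n (1 : PowerSeries ℂ)) * z ^ n = 0 := by
    intro n hn
    have : n ≠ 0 := by simpa using hn
    simp [PowerSeries.coeff_one, this]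
  refine ⟨summable_of_ne_finset_zero (s := {0}) fun n hn => by rw [h n hn, norm_zero], ?_⟩
  rw [tsum_eq_sum h]
  simp

lemma HasEntireSum.mul {f g : PowerSeries ℂ} {F G : ℂ → ℂ} (hf : HasEntireSum f F)
    (hg : HasEntireSum g G) : HasEntireSum (f * g) (fun z => F z * G z) := by
  intro z
  have key : ∀ n : ℕ, PowerSeries.coeff n (f * g) * z ^ n =
      ∑ p ∈ Finset.HasAntidiagonal.antidiagonal n, (f.coeff p.1 * z ^ p.1) * (g.coeff p.2 * z ^ p.2) := by
    intro n
    rw [PowerSeries.coeff_mul, Finset.sum_mul]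
    refine Finset.sum_congr rfl fun p hp => ?_
    rw [← Finset.HasAntidiagonal.mem_antidiagonal.1 hp, pow_add]
    ring
  constructor
  · simp_rw [key]
    exact summable_norm_sum_mul_antidiagonal_of_summable_norm
      (f := fun n => f.coeff n * z ^ n) (g := fun n => g.coeff n * z ^ n) (hf z).1 (hg z).1
  · simp_rw [key]
    simp only [← (hf z).2, ← (hg z).2]
    exact (tsum_mul_tsum_eq_tsum_sum_antidiagonal_of_summable_norm
      (f := fun n => f.coeff n * z ^ n) (g := fun n => g.coeff n * z ^ n) (hf z).1 (hg z).1).symm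

lemma HasEntireSum.prod {ι : Type*} (s : Finset ι) {f : ι → PowerSeries ℂ} {F : ι → ℂ → ℂ}
    (h : ∀ i ∈ s, HasEntireSum (f i) (F i)) :
    HasEntireSum (∏ i ∈ s, f i) (fun z => ∏ i ∈ s, F i z) := by
  classical
  induction s using Finset.induction_on with
  | empty => simpa using HasEntireSum.one
  | insert a s ha ih =>
    simp_rw [Finset.prod_insert ha]
    exact (h a (Finset.mem_insert_self _ _)).mul
      (ih fun i hi => h i (Finset.mem_insert_of_mem hi))

-- This series is the factor which the product formula `Nat.Partition.hasProd_genFun` attaches to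
-- the parts of size `i` when m such parts have weight c^m / m!. Its coefficients live on the
-- multiples of `i` and are those of the exponential series.
open scoped PowerSeries.WithPiTopology in
lemma hasEntireSum_exp_monomial (c : ℂ) {i : ℕ} (hi : i ≠ 0) :
    HasEntireSum (1 + ∑' j : ℕ, (c ^ (j + 1) / ((j + 1).factorial : ℂ)) •
      (PowerSeries.X : PowerSeries ℂ) ^ (i * (j + 1))) (fun z => Complex.exp (c * z ^ i)) := by
  set f : PowerSeries ℂ := 1 + ∑' j : ℕ, (c ^ (j + 1) / ((j + 1).factorial : ℂ)) •
      (PowerSeries.X : PowerSeries ℂ) ^ (i * (j + 1)) with hf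
  have hsum := Nat.Partition.summable_genFun_term' (R := ℂ)
    (fun _ m => c ^ m / (m.factorial : ℂ)) hi
  have hcoeff : ∀ n : ℕ, f.coeff n = (if n = 0 then 1 else 0) +
      ∑' j : ℕ, (c ^ (j + 1) / ((j + 1).factorial : ℂ)) * (if n = i * (j + 1) then 1 else 0) := by
    intro n
    rw [hf, map_add, hsum.map_tsum _ (PowerSeries.WithPiTopology.continuous_coeff _ _)]
    simp [PowerSeries.coeff_one, PowerSeries.coeff_X_pow]
  have hmul : ∀ m : ℕ, f.coeff (i * m) = c ^ m / (m.factorial : ℂ) := by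
    intro m
    rw [hcoeff]
    rcases Nat.eq_zero_or_pos m with rfl | hm
    · simp [hi]
    · rw [tsum_eq_single (m - 1)]
      · have : m - 1 + 1 = m := by omega
        simp [this, hi, hm.ne']
      · intro b hb
        have : i * m ≠ i * (b + 1) := by
          intro h
          have := Nat.eq_of_mul_eq_mul_left (Nat.pos_of_ne_zero hi) h
          omega
        simp only [this, if_false, mul_zero]
  have hnot : ∀ n : ℕ, n ∉ Set.range (fun m : ℕ => i * m) → f.coeff n = 0 := by
    intro n hn
    rw [hcoeff]
    have h0 : n ≠ 0 := fun h => hn ⟨0, by simp [h]⟩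
    have h1 : ∀ j : ℕ, n ≠ i * (j + 1) := fun j h => hn ⟨j + 1, h.symm⟩
    simp [h0, h1]
  have hinj : Function.Injective (fun m : ℕ => i * m) := fun a b h =>
    Nat.eq_of_mul_eq_mul_left (Nat.pos_of_ne_zero hi) h
  intro z
  have hterm : ∀ m : ℕ, f.coeff (i * m) * z ^ (i * m) = (c * z ^ i) ^ m / (m.factorial : ℂ) := by
    intro m
    rw [hmul, mul_pow, pow_mul]
    ring
  constructor
  · rw [← hinj.summable_iff]
    · have : (fun n : ℕ => ‖f.coeff n * z ^ n‖) ∘ (fun m : ℕ => i * m) =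
          fun m : ℕ => ‖(c * z ^ i) ^ m / (m.factorial : ℂ)‖ := by
        funext m
        simp only [Function.comp, hterm]
      rw [this]
      exact NormedSpace.norm_expSeries_div_summable (c * z ^ i)
    · intro n hn
      rw [hnot n hn, zero_mul, norm_zero]
  · have h2 : HasSum (fun n : ℕ => f.coeff n * z ^ n) (Complex.exp (c * z ^ i)) := by
      rw [← hinj.hasSum_iff]
      · have : (fun n : ℕ => f.coeff n * z ^ n) ∘ (fun m : ℕ => i * m) =
            fun m : ℕ => (c * z ^ i) ^ m / (m.factorial : ℂ) := by
          funext m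
          simp only [Function.comp, hterm]
        rw [this, Complex.exp_eq_exp_ℂ]
        exact NormedSpace.expSeries_div_hasSum_exp (c * z ^ i)
      · intro n hn
        rw [hnot n hn, zero_mul]
    exact h2.tsum_eq

/-! ### Extraction of a coefficient by integration over a circle. -/

lemma integral_exp_int (k : ℤ) :
    ∫ y in (-Real.pi)..Real.pi, Complex.exp (Complex.I * k * y) =
      if k = 0 then 2 * (Real.pi : ℂ) else 0 := by
  split_ifs with hk
  · subst hk
    simp
    ring
  · have hc : Complex.I * (k : ℂ) ≠ 0 := by simp [hk]
    rw [integral_exp_mul_complex hc]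
    have : Complex.exp (Complex.I * k * (Real.pi : ℝ)) =
        Complex.exp (Complex.I * k * (-Real.pi : ℝ)) := by
      rw [Complex.exp_eq_exp_iff_exists_int]
      refine ⟨k, ?_⟩
      push_cast
      ring
    rw [this, sub_self, zero_div]

lemma HasEntireSum.integral_eq {f : PowerSeries ℂ} {F : ℂ → ℂ} (h : HasEntireSum f F)
    (n : ℕ) (ξ : ℝ) :
    ∫ y in (-Real.pi)..Real.pi, F (Complex.exp (-((ξ : ℂ) + Complex.I * y))) *
      Complex.exp (n * ((ξ : ℂ) + Complex.I * y)) = 2 * Real.pi * f.coeff n := by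
  set b : ℕ → ℝ := fun k => ‖f.coeff k * (Complex.exp (-(ξ : ℂ))) ^ k‖ * Real.exp (n * ξ)
  have hb : Summable b := (h (Complex.exp (-(ξ : ℂ)))).1.mul_right _
  set G : ℕ → ℝ → ℂ := fun k y => f.coeff k * (Complex.exp (-((ξ : ℂ) + Complex.I * y))) ^ k *
      Complex.exp (n * ((ξ : ℂ) + Complex.I * y))
  have hGn : ∀ k y, ‖G k y‖ = b k := by
    intro k y
    simp only [G, b, norm_mul, norm_pow, Complex.norm_exp]
    simp
  have hint := intervalIntegral.hasSum_integral_of_dominated_convergence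
    (μ := volume) (a := -Real.pi) (b := Real.pi) (F := G)
    (f := fun y : ℝ => F (Complex.exp (-((ξ : ℂ) + Complex.I * y))) *
      Complex.exp (n * ((ξ : ℂ) + Complex.I * y))) (fun k _ => b k)
    (fun k => by
      apply Continuous.aestronglyMeasurable
      fun_prop)
    (fun k => Eventually.of_forall fun y _ => (hGn k y).le)
    (Eventually.of_forall fun y _ => hb) (by simp)
    (Eventually.of_forall fun y _ => by
      have h1 := h (Complex.exp (-((ξ : ℂ) + Complex.I * y)))
      have h2 := (h1.1.of_norm.hasSum)
      rw [h1.2] at h2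
      exact h2.mul_right _)
  have hval : ∀ k, ∫ y in (-Real.pi)..Real.pi, G k y =
      if k = n then 2 * Real.pi * f.coeff n else 0 := by
    intro k
    have : ∀ y : ℝ, G k y = f.coeff k * Complex.exp (((n : ℂ) - k) * ξ) *
        Complex.exp (Complex.I * ((n : ℤ) - (k : ℤ) : ℤ) * y) := by
      intro y
      simp only [G, ← Complex.exp_nat_mul]
      rw [mul_assoc, mul_assoc, ← Complex.exp_add, ← Complex.exp_add]
      congr 2
      push_cast
      ring
    simp_rw [this]
    rw [intervalIntegral.integral_const_mul, integral_exp_int]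
    by_cases hkn : k = n
    · subst hkn
      simp
      ring
    · have : ((n : ℤ) - (k : ℤ)) ≠ 0 := by omega
      rw [if_neg this, if_neg hkn, mul_zero]
  simp_rw [hval] at hint
  exact (hint.unique (hasSum_ite_eq n _))

/-! ### Counting permutations by cycle type. -/

lemma partition_parts_subset {n : ℕ} (p : n.Partition) :
    p.parts.toFinset ⊆ Finset.Icc 1 n := by
  intro i hi
  have hi' := Multiset.mem_toFinset.1 hi
  exact Finset.mem_Icc.2 ⟨p.parts_pos hi', p.le_of_mem_parts hi'⟩

/-- The number of permutations with prescribed cycle lengths. -/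
lemma card_perm_partition_mul {n : ℕ} (p : n.Partition) :
    (Finset.univ.filter fun σ : Equiv.Perm (Fin n) => σ.partition.parts = p.parts).card *
      ∏ j ∈ Finset.Icc 1 n, (j ^ p.parts.count j * (p.parts.count j).factorial) = n.factorial := by
  classical
  -- `Equiv.Perm.cycleType` omits fixed points while the partition lists them as ones, so the ones
  -- are split off before the class formula is applied.
  set m : Multiset ℕ := p.parts.filter (2 ≤ ·) with hm
  have hsplit : p.parts = m + Multiset.replicate (p.parts.count 1) 1 := by
    have h1 := Multiset.filter_add_not (2 ≤ ·) p.parts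
    have h2 : p.parts.filter (fun a => ¬ 2 ≤ a) = Multiset.replicate (p.parts.count 1) 1 := by
      rw [← Multiset.filter_eq']
      refine Multiset.filter_congr fun x hx => ?_
      have := p.parts_pos hx
      omega
    rw [h2] at h1
    exact h1.symm
  have hsum : n - m.sum = p.parts.count 1 := by
    have h := p.parts_sum
    rw [hsplit, Multiset.sum_add, Multiset.sum_replicate, smul_eq_mul, mul_one] at h
    omega
  have hle : m.sum ≤ n := by
    have h := p.parts_sum
    rw [hsplit, Multiset.sum_add, Multiset.sum_replicate, smul_eq_mul, mul_one] at h
    omega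
  have hset : (Finset.univ.filter fun σ : Equiv.Perm (Fin n) => σ.partition.parts = p.parts) =
      Finset.univ.filter fun σ : Equiv.Perm (Fin n) => σ.cycleType = m := by
    ext σ
    simp only [Finset.mem_filter, Finset.mem_univ, true_and]
    constructor
    · intro h
      rw [← Equiv.Perm.filter_parts_partition_eq_cycleType, h]
    · intro h
      have hs := σ.sum_cycleType
      rw [Equiv.Perm.parts_partition, h, ← hs, h, Fintype.card_fin, hsum, ← hsplit]
  have hcard := Equiv.Perm.card_of_cycleType_mul_eq (Fin n) m
  rw [if_pos ⟨by rw [Fintype.card_fin]; exact hle, fun a ha => (Multiset.mem_filter.1 ha).2⟩,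
    Fintype.card_fin, hsum] at hcard
  rw [hset, ← hcard]
  congr 1
  have hcm : ∀ j, 2 ≤ j → m.count j = p.parts.count j := fun j hj =>
    Multiset.count_filter_of_pos (p := (2 ≤ ·)) hj
  have hprod : m.prod = ∏ j ∈ Finset.Icc 1 n, j ^ p.parts.count j := by
    have h1 : p.parts.prod = m.prod := by
      conv_lhs => rw [hsplit]
      simp
    rw [← h1, Finset.prod_multiset_count]
    refine Finset.prod_subset (partition_parts_subset p) fun j _ hj => ?_
    rw [Multiset.count_eq_zero_of_notMem (fun h => hj (Multiset.mem_toFinset.2 h)), pow_zero]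
  have hfac : (p.parts.count 1).factorial * ∏ k ∈ m.toFinset, (m.count k).factorial =
      ∏ j ∈ Finset.Icc 1 n, (p.parts.count j).factorial := by
    have hm1 : m.toFinset ⊆ p.parts.toFinset := Multiset.toFinset_subset.2
      (Multiset.filter_subset _ _)
    have h1m : 1 ∉ m.toFinset := by simp [hm]
    have : ∏ k ∈ m.toFinset, (m.count k).factorial =
        ∏ k ∈ m.toFinset, (p.parts.count k).factorial := by
      refine Finset.prod_congr rfl fun k hk => ?_
      rw [hcm k (Multiset.mem_filter.1 (Multiset.mem_toFinset.1 hk)).2]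
    rw [this, ← Finset.prod_insert (f := fun k => (p.parts.count k).factorial) h1m]
    have hzero : ∀ j, j ∉ insert 1 m.toFinset → p.parts.count j = 0 := by
      intro j hj
      rw [Multiset.count_eq_zero]
      intro hjp
      apply hj
      by_cases h1 : j = 1
      · simp [h1]
      · have := p.parts_pos hjp
        refine Finset.mem_insert_of_mem (Multiset.mem_toFinset.2 ?_)
        exact Multiset.mem_filter.2 ⟨hjp, by omega⟩
    by_cases hn : 1 ≤ n
    · refine Finset.prod_subset ?_ fun j _ hj => by rw [hzero j hj, Nat.factorial_zero]
      intro j hj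
      rcases Finset.mem_insert.1 hj with rfl | hj
      · exact Finset.mem_Icc.2 ⟨le_rfl, hn⟩
      · exact partition_parts_subset p (hm1 hj)
    · have hn0 : n = 0 := by omega
      subst hn0
      simp
  rw [Finset.prod_mul_distrib, ← hprod, ← hfac]
  ring

/-- Group the permutations by cycle type. A type with m_j cycles of length j has n! / ∏ j^{m_j} m_j!
elements, so the factors n! and j^{m_j} cancel and ∏ c_j^{m_j} / m_j! is left for each partition. -/
lemma expCoeff_eq_coeff_genFun (c : ℕ → ℂ) (n : ℕ) :
    expCoeff c n =
      (Nat.Partition.genFun fun i m => c i ^ m / (m.factorial : ℂ)).coeff n := by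
  classical
  rw [Nat.Partition.coeff_genFun, expCoeff]
  -- `σ.partition` is indexed by `Fintype.card (Fin n)`; it is repackaged as a partition of `n`.
  let toP : Equiv.Perm (Fin n) → n.Partition := fun σ =>
    ⟨σ.partition.parts, fun h => σ.partition.parts_pos h, by
      rw [σ.partition.parts_sum, Fintype.card_fin]⟩
  rw [← Finset.sum_fiberwise Finset.univ toP, Finset.mul_sum]
  refine Finset.sum_congr rfl fun p _ => ?_
  have hf : (Finset.univ.filter fun σ => toP σ = p) =
      Finset.univ.filter fun σ : Equiv.Perm (Fin n) => σ.partition.parts = p.parts := by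
    ext σ
    simp only [Finset.mem_filter, Finset.mem_univ, true_and, toP]
    exact ⟨fun h => by rw [← h], fun h => Nat.Partition.ext h⟩
  rw [hf]
  have hconst : ∀ σ ∈ (Finset.univ.filter fun σ : Equiv.Perm (Fin n) =>
      σ.partition.parts = p.parts), ∏ j ∈ Finset.Icc 1 n, ((j : ℂ) * c j) ^ cycleCount j σ =
      ∏ j ∈ Finset.Icc 1 n, ((j : ℂ) * c j) ^ p.parts.count j := by
    intro σ hσ
    simp only [cycleCount, (Finset.mem_filter.1 hσ).2]
  rw [Finset.sum_congr rfl hconst, Finset.sum_const, nsmul_eq_mul]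
  have hR : p.parts.toFinsupp.prod (fun i m => c i ^ m / (m.factorial : ℂ)) =
      ∏ j ∈ Finset.Icc 1 n, (c j ^ p.parts.count j / ((p.parts.count j).factorial : ℂ)) := by
    simp_rw [Finsupp.prod, Multiset.toFinsupp_support, Multiset.toFinsupp_apply]
    refine Finset.prod_subset (partition_parts_subset p) fun j _ hj => ?_
    rw [Multiset.count_eq_zero_of_notMem (fun h => hj (Multiset.mem_toFinset.2 h))]
    simp
  rw [hR]
  have hcard := card_perm_partition_mul p
  have hcardC : ((Finset.univ.filter fun σ : Equiv.Perm (Fin n) =>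
      σ.partition.parts = p.parts).card : ℂ) *
      ∏ j ∈ Finset.Icc 1 n, ((j : ℂ) ^ p.parts.count j * ((p.parts.count j).factorial : ℂ)) =
      (n.factorial : ℂ) := by
    exact_mod_cast hcard
  rw [← hcardC]
  have hne : ∏ j ∈ Finset.Icc 1 n,
      ((j : ℂ) ^ p.parts.count j * ((p.parts.count j).factorial : ℂ)) ≠ 0 := by
    refine Finset.prod_ne_zero_iff.2 fun j hj => mul_ne_zero (pow_ne_zero _ ?_) ?_
    · have := (Finset.mem_Icc.1 hj).1
      exact_mod_cast (by omega : j ≠ 0)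
    · exact_mod_cast Nat.factorial_ne_zero _
  have hcne : ((Finset.univ.filter fun σ : Equiv.Perm (Fin n) =>
      σ.partition.parts = p.parts).card : ℂ) ≠ 0 := by
    intro h
    rw [h, zero_mul] at hcardC
    exact Nat.factorial_ne_zero n (by exact_mod_cast hcardC.symm)
  have hsplit : ∏ j ∈ Finset.Icc 1 n, ((j : ℂ) * c j) ^ p.parts.count j =
      (∏ j ∈ Finset.Icc 1 n,
        ((j : ℂ) ^ p.parts.count j * ((p.parts.count j).factorial : ℂ))) *
      ∏ j ∈ Finset.Icc 1 n, (c j ^ p.parts.count j / ((p.parts.count j).factorial : ℂ)) := by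
    rw [← Finset.prod_mul_distrib]
    refine Finset.prod_congr rfl fun j _ => ?_
    have : ((p.parts.count j).factorial : ℂ) ≠ 0 := by exact_mod_cast Nat.factorial_ne_zero _
    rw [mul_pow]
    field_simp
  rw [hsplit]
  field_simp

open scoped PowerSeries.WithPiTopology in
/-- Cauchy's formula for the coefficients of the exponential of a power series, on a circle of
absolute convergence. -/
lemma integral_exp_eq_expCoeff (c : ℕ → ℂ) (hc0 : c 0 = 0) (ξ : ℝ)
    (hc : Summable fun j : ℕ => ‖c j‖ * Real.exp (-(ξ * j))) (n : ℕ) :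
    ∫ y in (-Real.pi)..Real.pi,
      Complex.exp (∑' j : ℕ, c j * Complex.exp (-(((ξ : ℂ) + Complex.I * y) * j)) +
        n * ((ξ : ℂ) + Complex.I * y)) = 2 * Real.pi * expCoeff c n := by
  -- Convergence is only assumed on the circle itself, so the exponential is approached through
  -- finite products of exp(c_i z^i). These are entire, `HasEntireSum.integral_eq` applies to them,
  -- and both sides pass to the limit: the coefficients by the product formula, the integrals by
  -- dominated convergence. The shift to `i + 1` drops the index 0, where `c` vanishes.
  set P : ℕ → PowerSeries ℂ := fun i => 1 + ∑' j : ℕ,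
    (c (i + 1) ^ (j + 1) / ((j + 1).factorial : ℂ)) •
      (PowerSeries.X : PowerSeries ℂ) ^ ((i + 1) * (j + 1)) with hP
  have hPsum : ∀ s : Finset ℕ, HasEntireSum (∏ i ∈ s, P i)
      (fun z => ∏ i ∈ s, Complex.exp (c (i + 1) * z ^ (i + 1))) := fun s =>
    HasEntireSum.prod s fun i _ => hasEntireSum_exp_monomial (c (i + 1)) (Nat.succ_ne_zero i)
  have hcoef : Tendsto (fun N : ℕ => (∏ i ∈ Finset.range N, P i).coeff n) atTop
      (𝓝 (expCoeff c n)) := by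
    rw [expCoeff_eq_coeff_genFun]
    have h := Nat.Partition.hasProd_genFun (R := ℂ) fun i m => c i ^ m / (m.factorial : ℂ)
    have h2 := h.tendsto_prod_nat
    exact ((PowerSeries.WithPiTopology.continuous_coeff ℂ n).tendsto _).comp h2
  set u : ℕ → ℝ → ℂ := fun i y =>
    c (i + 1) * Complex.exp (-((ξ : ℂ) + Complex.I * y)) ^ (i + 1)
  have hu : ∀ i y, u i y = c (i + 1) *
      Complex.exp (-(((ξ : ℂ) + Complex.I * y) * ((i + 1 : ℕ) : ℂ))) := by
    intro i y
    simp only [u, ← Complex.exp_nat_mul]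
    congr 2
    ring
  have hun : ∀ i y, ‖u i y‖ = ‖c (i + 1)‖ * Real.exp (-(ξ * ((i + 1 : ℕ) : ℝ))) := by
    intro i y
    rw [hu, norm_mul, Complex.norm_exp]
    simp
  have hc' : Summable fun i : ℕ => ‖c (i + 1)‖ * Real.exp (-(ξ * ((i + 1 : ℕ) : ℝ))) :=
    (summable_nat_add_iff (f := fun j : ℕ => ‖c j‖ * Real.exp (-(ξ * (j : ℝ)))) 1).2 hc
  have husum : ∀ y, HasSum (fun i => u i y)
      (∑' j : ℕ, c j * Complex.exp (-(((ξ : ℂ) + Complex.I * y) * j))) := by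
    intro y
    have hs : Summable fun j : ℕ => c j * Complex.exp (-(((ξ : ℂ) + Complex.I * y) * j)) := by
      refine Summable.of_norm (hc.congr fun j => ?_)
      rw [norm_mul, Complex.norm_exp]
      simp
    have h1 := (hasSum_nat_add_iff' 1).2 hs.hasSum
    simp only [Finset.range_one, Finset.sum_singleton, hc0, zero_mul, sub_zero] at h1
    exact h1.congr_fun fun i => hu i y
  have hlim : Tendsto (fun N : ℕ => ∫ y in (-Real.pi)..Real.pi,
      (∏ i ∈ Finset.range N, Complex.exp (u i y)) *
        Complex.exp (n * ((ξ : ℂ) + Complex.I * y))) atTop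
      (𝓝 (∫ y in (-Real.pi)..Real.pi,
      Complex.exp (∑' j : ℕ, c j * Complex.exp (-(((ξ : ℂ) + Complex.I * y) * j)) +
        n * ((ξ : ℂ) + Complex.I * y)))) := by
    refine intervalIntegral.tendsto_integral_filter_of_dominated_convergence
      (fun _ => Real.exp (∑' i : ℕ, ‖c (i + 1)‖ * Real.exp (-(ξ * ((i + 1 : ℕ) : ℝ)))) *
        Real.exp (n * ξ)) ?_ ?_ (by simp) ?_
    · refine Eventually.of_forall fun N => Continuous.aestronglyMeasurable ?_
      simp only [u]
      fun_prop
    · refine Eventually.of_forall fun N => Eventually.of_forall fun y _ => ?_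
      rw [norm_mul, ← Complex.exp_sum, Complex.norm_exp, Complex.norm_exp]
      have h2 : ((n : ℂ) * ((ξ : ℂ) + Complex.I * y)).re = n * ξ := by simp
      rw [h2]
      refine mul_le_mul_of_nonneg_right (Real.exp_le_exp.2 ?_) (Real.exp_pos _).le
      calc (∑ i ∈ Finset.range N, u i y).re ≤ ‖∑ i ∈ Finset.range N, u i y‖ :=
            Complex.re_le_norm _
        _ ≤ ∑ i ∈ Finset.range N, ‖u i y‖ := norm_sum_le _ _
        _ = ∑ i ∈ Finset.range N, ‖c (i + 1)‖ * Real.exp (-(ξ * ((i + 1 : ℕ) : ℝ))) := by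
            simp_rw [hun]
        _ ≤ _ := hc'.sum_le_tsum _ fun i _ => by positivity
    · refine Eventually.of_forall fun y _ => ?_
      simp_rw [← Complex.exp_sum]
      rw [Complex.exp_add]
      exact ((Complex.continuous_exp.tendsto _).comp (husum y).tendsto_sum_nat).mul_const _
  refine tendsto_nhds_unique hlim ?_
  have heq : ∀ N : ℕ, ∫ y in (-Real.pi)..Real.pi,
      (∏ i ∈ Finset.range N, Complex.exp (u i y)) *
        Complex.exp (n * ((ξ : ℂ) + Complex.I * y)) =
      2 * Real.pi * (∏ i ∈ Finset.range N, P i).coeff n := fun N =>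
    (hPsum (Finset.range N)).integral_eq n ξ
  simp_rw [heq]
  exact hcoef.const_mul _

/-- Homogeneity of the coefficients. -/
lemma expCoeff_mul_pow (c : ℕ → ℂ) (r : ℂ) (n : ℕ) :
    expCoeff (fun j => c j * r ^ j) n = expCoeff c n * r ^ n := by
  unfold expCoeff
  rw [mul_assoc, Finset.sum_mul]
  congr 1
  refine Finset.sum_congr rfl fun σ _ => ?_
  -- The cycle lengths of a permutation add up to `n`, so every summand is homogeneous of weight
  -- `n`.
  have hsum : ∑ j ∈ Finset.Icc 1 n, j * cycleCount j σ = n := by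
    have h1 := σ.partition.parts_sum.trans (Fintype.card_fin n)
    rw [Finset.sum_multiset_count] at h1
    conv_rhs => rw [← h1]
    symm
    have hsub : σ.partition.parts.toFinset ⊆ Finset.Icc 1 n := by
      intro i hi
      have hi' := Multiset.mem_toFinset.1 hi
      have h2 := (σ.partition.le_of_mem_parts hi').trans (Fintype.card_fin n).le
      exact Finset.mem_Icc.2 ⟨σ.partition.parts_pos hi', h2⟩
    rw [← Finset.sum_subset hsub]
    · refine Finset.sum_congr rfl fun j _ => ?_
      rw [cycleCount, smul_eq_mul, mul_comm]
    · intro j _ hj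
      rw [cycleCount, Multiset.count_eq_zero_of_notMem (fun h => hj (Multiset.mem_toFinset.2 h)),
        mul_zero]
  have hr : r ^ n = ∏ j ∈ Finset.Icc 1 n, (r ^ j) ^ cycleCount j σ := by
    simp_rw [← pow_mul]
    rw [Finset.prod_pow_eq_pow_sum, hsum]
  rw [hr, ← Finset.prod_mul_distrib]
  refine Finset.prod_congr rfl fun j _ => ?_
  rw [← mul_pow, mul_assoc]

/-! ### Characteristic functions under the surrogate-spatial measure -/

/-- The coefficient of `z^n` in `exp (u (g_θ + N g_κ))`. -/
noncomputable def partitionFunction (θ κ : ℕ → ℝ) (N : ℕ) (u : ℂ) : ℂ :=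
  expCoeff (fun j => u * ((genCoeff θ j : ℂ) + N * (genCoeff κ j : ℂ))) N

/-- The factor j in `expCoeff` undoes the division by j in `genCoeff`, and each cycle carries one
factor `u`. Hence the partition function is, up to the factor H_N, the probability generating
function of the number of cycles. -/
lemma partitionFunction_eq (θ κ : ℕ → ℝ) (N : ℕ) (u : ℂ) :
    partitionFunction θ κ N u = (1 / (N.factorial : ℂ)) *
      ∑ σ : Equiv.Perm (Fin N), u ^ totalCycles σ * (weight θ κ σ : ℂ) := by
  unfold partitionFunction expCoeff
  congr 1
  refine Finset.sum_congr rfl fun σ _ => ?_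
  rw [totalCycles, ← Finset.prod_pow_eq_pow_sum, weight]
  push_cast
  rw [← Finset.prod_mul_distrib]
  refine Finset.prod_congr rfl fun j hj => ?_
  have hj0 : (j : ℂ) ≠ 0 := by
    have := (Finset.mem_Icc.1 hj).1
    exact_mod_cast (by omega : j ≠ 0)
  rw [← mul_pow, genCoeff, genCoeff]
  push_cast
  congr 1
  field_simp

lemma partitionFunction_one (θ κ : ℕ → ℝ) (N : ℕ) :
    partitionFunction θ κ N 1 = (normConst θ κ N : ℂ) := by
  rw [partitionFunction_eq, normConst]
  push_cast
  simp

lemma weight_nonneg {θ κ : ℕ → ℝ} (hθ : ∀ j : ℕ, 1 ≤ j → 0 ≤ θ j)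
    (hκ : ∀ j : ℕ, 1 ≤ j → 0 ≤ κ j) {N : ℕ} (σ : Equiv.Perm (Fin N)) : 0 ≤ weight θ κ σ := by
  refine Finset.prod_nonneg fun j hj => pow_nonneg ?_ _
  have h1 := (Finset.mem_Icc.1 hj).1
  have := hθ j h1
  have := hκ j h1
  positivity

lemma normConst_nonneg {θ κ : ℕ → ℝ} (hθ : ∀ j : ℕ, 1 ≤ j → 0 ≤ θ j)
    (hκ : ∀ j : ℕ, 1 ≤ j → 0 ≤ κ j) (N : ℕ) : 0 ≤ normConst θ κ N :=
  mul_nonneg (by positivity) (Finset.sum_nonneg fun σ _ => weight_nonneg hθ hκ σ)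

lemma integral_surrogateMeasure {θ κ : ℕ → ℝ} (hθ : ∀ j : ℕ, 1 ≤ j → 0 ≤ θ j)
    (hκ : ∀ j : ℕ, 1 ≤ j → 0 ≤ κ j) {N : ℕ} (f : Equiv.Perm (Fin N) → ℂ) :
    ∫ σ, f σ ∂(surrogateMeasure θ κ N) =
      ∑ σ : Equiv.Perm (Fin N), ((weight θ κ σ / ((N.factorial : ℝ) * normConst θ κ N) : ℝ) : ℂ)
        * f σ := by
  unfold surrogateMeasure
  rw [integral_finsetSum_measure]
  · refine Finset.sum_congr rfl fun σ _ => ?_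
    rw [integral_smul_measure, integral_dirac, ENNReal.toReal_ofReal]
    · simp
    · have := weight_nonneg hθ hκ σ
      have := normConst_nonneg hθ hκ N
      positivity
  · intro σ _
    exact (integrable_dirac (by simp)).smul_measure ENNReal.ofReal_ne_top

lemma isProbabilityMeasure_surrogateMeasure {θ κ : ℕ → ℝ} (hθ : ∀ j : ℕ, 1 ≤ j → 0 ≤ θ j)
    (hκ : ∀ j : ℕ, 1 ≤ j → 0 ≤ κ j) {N : ℕ} (hN : 0 < normConst θ κ N) :
    IsProbabilityMeasure (surrogateMeasure θ κ N) := by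
  constructor
  unfold surrogateMeasure
  simp only [Measure.coe_finsetSum, Finset.sum_apply, Measure.smul_apply, measure_univ,
    smul_eq_mul, mul_one]
  have hfac : (0 : ℝ) < N.factorial := by exact_mod_cast Nat.factorial_pos N
  rw [← ENNReal.ofReal_sum_of_nonneg]
  · rw [← Finset.sum_div]
    have : ∑ σ : Equiv.Perm (Fin N), weight θ κ σ = (N.factorial : ℝ) * normConst θ κ N := by
      rw [normConst]
      field_simp
    rw [this, div_self (by positivity), ENNReal.ofReal_one]
  · intro σ _
    have := weight_nonneg hθ hκ σ
    positivity

lemma charFun_normalizedTotal {θ κ : ℕ → ℝ} (hθ : ∀ j : ℕ, 1 ≤ j → 0 ≤ θ j)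
    (hκ : ∀ j : ℕ, 1 ≤ j → 0 ≤ κ j) (m v : ℝ) (N : ℕ) (t : ℝ) :
    charFun ((surrogateMeasure θ κ N).map (normalizedTotal m v N)) t =
      Complex.exp (-(Complex.I * (t / Real.sqrt (N * v) : ℝ) * (N * m))) *
        partitionFunction θ κ N (Complex.exp (Complex.I * (t / Real.sqrt (N * v) : ℝ))) /
        partitionFunction θ κ N 1 := by
  rw [charFun_apply_real, integral_map (measurable_from_top.aemeasurable)
    (by fun_prop), integral_surrogateMeasure hθ hκ, partitionFunction_one, partitionFunction_eq,
    Finset.mul_sum, Finset.mul_sum, Finset.sum_div]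
  refine Finset.sum_congr rfl fun σ _ => ?_
  have : Complex.exp ((t : ℂ) * ((normalizedTotal m v N σ : ℝ) : ℂ) * Complex.I) =
      Complex.exp (-(Complex.I * (t / Real.sqrt (N * v) : ℝ) * (N * m))) *
      Complex.exp (Complex.I * (t / Real.sqrt (N * v) : ℝ)) ^ totalCycles σ := by
    rw [← Complex.exp_nat_mul, ← Complex.exp_add, normalizedTotal]
    push_cast
    congr 1
    ring
  rw [this]
  push_cast
  ring

/-- A criterion for convergence in law in terms of asymptotics of the partition function. -/
lemma convergesInLaw_of_tendsto {θ κ : ℕ → ℝ} (hθ : ∀ j : ℕ, 1 ≤ j → 0 ≤ θ j)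
    (hκ : ∀ j : ℕ, 1 ≤ j → 0 ≤ κ j) {m v : ℝ} {Ω : Type*} [MeasurableSpace Ω] {Z : Ω → ℝ}
    {P : Measure Ω} [IsProbabilityMeasure P] (hZ : AEMeasurable Z P) (D : ℕ → ℂ) (L : ℝ → ℂ)
    (hL : ∀ t : ℝ, Tendsto (fun N : ℕ => D N *
      Complex.exp (-(Complex.I * (t / Real.sqrt (N * v) : ℝ) * (N * m))) *
      partitionFunction θ κ N (Complex.exp (Complex.I * (t / Real.sqrt (N * v) : ℝ))))
      atTop (𝓝 (L t)))
    (h0 : L 0 ≠ 0) (hchar : ∀ t : ℝ, charFun (P.map Z) t = L t / L 0) :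
    ConvergesInLaw θ κ (normalizedTotal m v) Z P := by
  -- The case t = 0 gives D_N H_N → L(0) ≠ 0, hence H_N > 0 from some `N₀` on, so that P_N is a
  -- probability measure there. The factor `D N` then cancels in the quotient of partition
  -- functions.
  have h1 : Tendsto (fun N : ℕ => D N * partitionFunction θ κ N 1) atTop (𝓝 (L 0)) := by
    simpa using hL 0
  have hev : ∀ᶠ N : ℕ in atTop, D N * partitionFunction θ κ N 1 ≠ 0 := h1.eventually_ne h0
  obtain ⟨N₀, hN₀⟩ := eventually_atTop.1 hev
  have hpos : ∀ N ≥ N₀, 0 < normConst θ κ N := by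
    intro N hN
    refine lt_of_le_of_ne (normConst_nonneg hθ hκ N) fun h => hN₀ N hN ?_
    rw [partitionFunction_one, ← h]
    simp
  have hprob : ∀ k : ℕ, IsProbabilityMeasure (surrogateMeasure θ κ (N₀ + k)) := fun k =>
    isProbabilityMeasure_surrogateMeasure hθ hκ (hpos _ (Nat.le_add_right _ _))
  refine ⟨N₀, hprob, ?_⟩
  have hmeas : ∀ k : ℕ, AEMeasurable (normalizedTotal m v (N₀ + k))
      (surrogateMeasure θ κ (N₀ + k)) := fun k => measurable_from_top.aemeasurable
  refine ⟨hmeas, hZ, ?_⟩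
  refine ProbabilityMeasure.tendsto_of_tendsto_charFun fun t => ?_
  simp only [ProbabilityMeasure.coe_mk]
  rw [hchar t]
  have hlim : Tendsto (fun N : ℕ =>
      charFun ((surrogateMeasure θ κ N).map (normalizedTotal m v N)) t) atTop
      (𝓝 (L t / L 0)) := by
    refine ((hL t).div h1 h0).congr' ?_
    filter_upwards [eventually_ge_atTop N₀] with N hN
    have hD : D N ≠ 0 := left_ne_zero_of_mul (hN₀ N hN)
    rw [charFun_normalizedTotal hθ hκ, Pi.div_apply, mul_assoc (D N), mul_div_mul_left _ _ hD]
  refine (hlim.comp (tendsto_add_atTop_nat N₀)).congr fun k => ?_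
  rw [Function.comp, Nat.add_comm k N₀]

/-! ### Dirichlet-type series and the phase function -/

/-- `∑_j a_j e^{-jw}`. -/
noncomputable def lap (a : ℕ → ℝ) (w : ℂ) : ℂ := ∑' j : ℕ, (a j : ℂ) * Complex.exp (-(w * j))

lemma norm_lap_term {a : ℕ → ℝ} (ha : ∀ j, 0 ≤ a j) (w : ℂ) (j : ℕ) :
    ‖(a j : ℂ) * Complex.exp (-(w * j))‖ = a j * Real.exp (-(w.re * j)) := by
  rw [norm_mul, Complex.norm_exp, Complex.norm_real, Real.norm_of_nonneg (ha j)]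
  simp

lemma summable_lap {a : ℕ → ℝ} (ha : ∀ j, 0 ≤ a j) {w : ℂ}
    (h : Summable fun j : ℕ => a j * Real.exp (-(w.re * j))) :
    Summable fun j : ℕ => (a j : ℂ) * Complex.exp (-(w * j)) :=
  Summable.of_norm (h.congr fun j => (norm_lap_term ha w j).symm)

lemma lap_ofReal (a : ℕ → ℝ) (ξ : ℝ) :
    lap a ξ = ((∑' j : ℕ, a j * Real.exp (-(ξ * j)) : ℝ) : ℂ) := by
  rw [lap, Complex.ofReal_tsum]
  refine tsum_congr fun j => ?_
  push_cast
  rfl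

lemma lap_zero (a : ℕ → ℝ) : lap a 0 = ((∑' j : ℕ, a j : ℝ) : ℂ) := by
  have := lap_ofReal a 0
  simpa using this

lemma norm_lap_le {a : ℕ → ℝ} (ha : ∀ j, 0 ≤ a j) {w : ℂ}
    (h : Summable fun j : ℕ => a j * Real.exp (-(w.re * j))) :
    ‖lap a w‖ ≤ (lap a (w.re : ℂ)).re := by
  rw [lap_ofReal, Complex.ofReal_re, lap]
  have h' : Summable fun j : ℕ => ‖(a j : ℂ) * Complex.exp (-(w * j))‖ :=
    h.congr fun j => (norm_lap_term ha w j).symm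
  refine (norm_tsum_le_tsum_norm h').trans (le_of_eq (tsum_congr fun j => norm_lap_term ha w j))

lemma summable_mul_exp_neg {a : ℕ → ℝ} (ha : ∀ j, 0 ≤ a j) (h : Summable a) {ξ : ℝ}
    (hξ : 0 ≤ ξ) : Summable fun j : ℕ => a j * Real.exp (-(ξ * j)) :=
  Summable.of_nonneg_of_le (fun j => mul_nonneg (ha j) (Real.exp_pos _).le)
    (fun j => mul_le_of_le_one_right (ha j) (Real.exp_le_one_iff.2 (by
      have : 0 ≤ ξ * j := by positivity
      linarith))) h

/-- The logarithm of the integrand of Cauchy's formula in the variable `w`, `z = r e^{-w}`. -/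
noncomputable def phase (α β : ℕ → ℝ) (u : ℂ) (N n : ℕ) (w : ℂ) : ℂ :=
  u * (lap α w + N * (lap β w - (∑' j : ℕ, β j : ℝ))) + n * w

/-- `phase` subtracts N times the sum of `β`, which accounts for the exponential prefactor. The
index `n` is kept separate from `N` because coefficients of index N - k are needed in
`exists_nonneg_integral_circleLimit`. -/
lemma integral_exp_phase {α β : ℕ → ℝ} (hα : ∀ j, 0 ≤ α j) (hβ : ∀ j, 0 ≤ β j)
    (hα0 : α 0 = 0) (hβ0 : β 0 = 0) {ξ : ℝ}
    (hαs : Summable fun j : ℕ => α j * Real.exp (-(ξ * j)))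
    (hβs : Summable fun j : ℕ => β j * Real.exp (-(ξ * j))) (u : ℂ) (N n : ℕ) :
    ∫ y in (-Real.pi)..Real.pi, Complex.exp (phase α β u N n ((ξ : ℂ) + Complex.I * y)) =
      2 * Real.pi * (Complex.exp (-(u * N * (∑' j : ℕ, β j : ℝ))) *
        expCoeff (fun j => u * ((α j : ℂ) + N * (β j : ℂ))) n) := by
  set c : ℕ → ℂ := fun j => u * ((α j : ℂ) + N * (β j : ℂ)) with hc
  have hcs : Summable fun j : ℕ => ‖c j‖ * Real.exp (-(ξ * j)) := by
    refine Summable.of_nonneg_of_le (fun j => by positivity) (fun j => ?_)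
      ((hαs.add (hβs.mul_left (N : ℝ))).mul_left ‖u‖)
    have : ‖c j‖ ≤ ‖u‖ * (α j + N * β j) := by
      rw [hc, norm_mul]
      refine mul_le_mul_of_nonneg_left ((norm_add_le _ _).trans ?_) (norm_nonneg _)
      rw [norm_mul, Complex.norm_real, Complex.norm_real, Complex.norm_natCast,
        Real.norm_of_nonneg (hα j), Real.norm_of_nonneg (hβ j)]
    calc ‖c j‖ * Real.exp (-(ξ * j)) ≤ ‖u‖ * (α j + N * β j) * Real.exp (-(ξ * j)) :=
          mul_le_mul_of_nonneg_right this (Real.exp_pos _).le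
      _ = _ := by ring
  have h := integral_exp_eq_expCoeff c (by simp [hc, hα0, hβ0]) ξ hcs n
  have key : ∀ y : ℝ, Complex.exp (phase α β u N n ((ξ : ℂ) + Complex.I * y)) =
      Complex.exp (-(u * N * (∑' j : ℕ, β j : ℝ))) *
      Complex.exp (∑' j : ℕ, c j * Complex.exp (-(((ξ : ℂ) + Complex.I * y) * j)) +
        n * ((ξ : ℂ) + Complex.I * y)) := by
    intro y
    have hre : ((ξ : ℂ) + Complex.I * y).re = ξ := by simp
    have h1 := summable_lap hα (w := (ξ : ℂ) + Complex.I * y) (by rw [hre]; exact hαs)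
    have h2 := summable_lap hβ (w := (ξ : ℂ) + Complex.I * y) (by rw [hre]; exact hβs)
    have : ∑' j : ℕ, c j * Complex.exp (-(((ξ : ℂ) + Complex.I * y) * j)) =
        u * (lap α ((ξ : ℂ) + Complex.I * y) + N * lap β ((ξ : ℂ) + Complex.I * y)) := by
      rw [lap, lap, ← tsum_mul_left, ← h1.tsum_add (h2.mul_left _), ← tsum_mul_left]
      refine tsum_congr fun j => ?_
      rw [hc]
      ring
    rw [this, ← Complex.exp_add, phase]
    congr 1
    ring
  simp_rw [key]
  rw [intervalIntegral.integral_const_mul, h]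
  ring

/-! ### Decay of the integrand away from the positive axis. -/

lemma half_one_sub_cos_le (a b : ℝ) :
    (1 / 2) * (1 - Real.cos b) ≤ (1 - Real.cos (a - b)) + (1 - Real.cos a) := by
  have h : ∀ x : ℝ, 1 - Real.cos x = 2 * Real.sin (x / 2) ^ 2 := by
    intro x
    have h1 := Real.cos_two_mul (x / 2)
    have h2 := Real.sin_sq_add_cos_sq (x / 2)
    rw [mul_div_cancel₀ x two_ne_zero] at h1
    linarith
  have hb : b / 2 = a / 2 - (a - b) / 2 := by ring
  rw [h, h, h, hb, Real.sin_sub]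
  set x := a / 2
  set y := (a - b) / 2
  have h1 := Real.sin_sq_add_cos_sq x
  have h2 := Real.sin_sq_add_cos_sq y
  -- In half angles the claim is sin²(x - y) ≤ 2(sin² x + sin² y). It serves to separate the angle
  -- jy from the small tilt τ in cos(τ - jy).
  nlinarith [sq_nonneg (Real.sin x * Real.cos y + Real.cos x * Real.sin y),
    sq_nonneg (Real.sin x * Real.sin y)]

/-- The real part of the phase per unit `N`. -/
lemma re_phase_le {β : ℕ → ℝ} (hβ : ∀ j, 0 ≤ β j) (hβs : Summable β) {ξ : ℝ} (hξ : 0 ≤ ξ)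
    (τ y : ℝ) :
    (Complex.exp (Complex.I * τ) * (lap β ((ξ : ℂ) + Complex.I * y) - (∑' j : ℕ, β j : ℝ)) +
      ((ξ : ℂ) + Complex.I * y)).re ≤
    -(1 / 2) * ∑' j : ℕ, β j * Real.exp (-(ξ * j)) * (1 - Real.cos (j * y)) +
      (∑' j : ℕ, β j) * τ ^ 2 + ((∑' j : ℕ, β j * Real.exp (-(ξ * j))) - ∑' j : ℕ, β j + ξ) := by
  have hre : ((ξ : ℂ) + Complex.I * y).re = ξ := by simp
  have hβe := summable_mul_exp_neg hβ hβs hξ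
  have h2 := summable_lap hβ (w := (ξ : ℂ) + Complex.I * y) (by rw [hre]; exact hβe)
  have hre2 : (Complex.exp (Complex.I * τ) *
      (lap β ((ξ : ℂ) + Complex.I * y) - (∑' j : ℕ, β j : ℝ))).re =
      ∑' j : ℕ, (β j * Real.exp (-(ξ * j)) * Real.cos (τ - j * y) - β j * Real.cos τ) := by
    have hs2 : Summable fun j : ℕ => (β j : ℂ) := by exact_mod_cast hβs
    rw [lap, Complex.ofReal_tsum, ← h2.tsum_sub hs2, ← tsum_mul_left,
      Complex.re_tsum ((h2.sub hs2).mul_left _)]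
    refine tsum_congr fun j => ?_
    have : Complex.exp (Complex.I * τ) *
        ((β j : ℂ) * Complex.exp (-(((ξ : ℂ) + Complex.I * y) * j)) - (β j : ℂ)) =
        ((β j * Real.exp (-(ξ * j)) : ℝ) : ℂ) * Complex.exp (((τ - j * y : ℝ) : ℂ) * Complex.I) -
        (β j : ℂ) * Complex.exp ((τ : ℂ) * Complex.I) := by
      have e1 : Complex.exp (Complex.I * τ) * Complex.exp (-(((ξ : ℂ) + Complex.I * y) * j)) =
          Complex.exp (-((ξ : ℂ) * j)) * Complex.exp (((τ - j * y : ℝ) : ℂ) * Complex.I) := by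
        rw [← Complex.exp_add, ← Complex.exp_add]
        congr 1
        push_cast
        ring
      rw [mul_sub, mul_left_comm, e1, mul_comm Complex.I]
      push_cast
      ring
    rw [this, Complex.sub_re, Complex.re_ofReal_mul, Complex.re_ofReal_mul,
      Complex.exp_ofReal_mul_I_re, Complex.exp_ofReal_mul_I_re]
  have hs3 : Summable fun j : ℕ => β j * Real.exp (-(ξ * j)) * (1 - Real.cos (j * y)) := by
    refine Summable.of_nonneg_of_le (fun j => ?_) (fun j => ?_) (hβe.mul_right 2)
    · exact mul_nonneg (mul_nonneg (hβ j) (Real.exp_pos _).le)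
        (by linarith [Real.cos_le_one (j * y)])
    · exact mul_le_mul_of_nonneg_left (by linarith [Real.neg_one_le_cos (j * y)])
        (mul_nonneg (hβ j) (Real.exp_pos _).le)
  have hs4 : Summable fun j : ℕ =>
      (β j * Real.exp (-(ξ * j)) * Real.cos (τ - j * y) - β j * Real.cos τ) := by
    refine Summable.sub ?_ (hβs.mul_right _)
    refine Summable.of_norm_bounded hβe fun j => ?_
    rw [norm_mul, Real.norm_of_nonneg (mul_nonneg (hβ j) (Real.exp_pos _).le)]
    exact mul_le_of_le_one_right (mul_nonneg (hβ j) (Real.exp_pos _).le) (Real.abs_cos_le_one _)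
  rw [Complex.add_re, hre2, hre]
  have hterm : ∀ j : ℕ,
      (β j * Real.exp (-(ξ * j)) * Real.cos (τ - j * y) - β j * Real.cos τ) ≤
      -(1 / 2) * (β j * Real.exp (-(ξ * j)) * (1 - Real.cos (j * y))) + β j * τ ^ 2 +
        (β j * Real.exp (-(ξ * j)) - β j) := by
    intro j
    have e1 : Real.exp (-(ξ * j)) ≤ 1 := Real.exp_le_one_iff.2 (by
      have : 0 ≤ ξ * j := by positivity
      linarith)
    have e0 := Real.exp_pos (-(ξ * j))
    have c1 := half_one_sub_cos_le τ (j * y)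
    have c2 := Real.one_sub_sq_div_two_le_cos (x := τ)
    have c3 := Real.cos_le_one τ
    set e := Real.exp (-(ξ * j))
    -- Separating the tilt from the angle costs (1 + e)(1 - cos τ), which is at most τ² because e ≤
    -- 1.
    have h5 : e * Real.cos (τ - j * y) - Real.cos τ ≤
        -(1 / 2) * (e * (1 - Real.cos (j * y))) + τ ^ 2 + (e - 1) := by
      nlinarith [mul_le_mul_of_nonneg_left c1 e0.le,
        mul_nonneg (sub_nonneg.2 e1) (sub_nonneg.2 c3)]
    nlinarith [mul_le_mul_of_nonneg_left h5 (hβ j)]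
  have hsum := hs4.tsum_le_tsum hterm
    (((hs3.mul_left _).add (hβs.mul_right _)).add (hβe.sub hβs))
  rw [((hs3.mul_left _).add (hβs.mul_right _)).tsum_add (hβe.sub hβs),
    (hs3.mul_left _).tsum_add (hβs.mul_right _), tsum_mul_left, tsum_mul_right,
    hβe.tsum_sub hβs] at hsum
  linarith

/-- By compactness and continuity it is enough that the sum never vanishes. If it did, jy would lie
in 2πℤ for every j in the support. The integers with this property form a subgroup, which by
non-arithmeticity contains 1, so y itself would be in 2πℤ; this is impossible for 0 < |y| ≤ π. -/
lemma exists_pos_le_of_nonArithmetic {β : ℕ → ℝ} (hβ : ∀ j, 0 ≤ β j) (hβs : Summable β)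
    (hna : NonArithmetic β) {ε : ℝ} (hε : 0 < ε) :
    ∃ c > 0, ∀ ξ ∈ Set.Icc (0 : ℝ) 1, ∀ y : ℝ, ε ≤ |y| → |y| ≤ Real.pi →
      c ≤ ∑' j : ℕ, β j * Real.exp (-(ξ * j)) * (1 - Real.cos (j * y)) := by
  -- The absolute value makes the bound 2β_j valid on the whole plane, so that `F` is continuous
  -- everywhere.
  set F : ℝ × ℝ → ℝ := fun p =>
    ∑' j : ℕ, β j * Real.exp (-(|p.1| * j)) * (1 - Real.cos (j * p.2)) with hF
  have hterm0 : ∀ (p : ℝ × ℝ) (j : ℕ),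
      0 ≤ β j * Real.exp (-(|p.1| * j)) * (1 - Real.cos (j * p.2)) := fun p j =>
    mul_nonneg (mul_nonneg (hβ j) (Real.exp_pos _).le) (by linarith [Real.cos_le_one (j * p.2)])
  have hterm : ∀ (p : ℝ × ℝ) (j : ℕ),
      β j * Real.exp (-(|p.1| * j)) * (1 - Real.cos (j * p.2)) ≤ β j * 2 := by
    intro p j
    have e1 : Real.exp (-(|p.1| * j)) ≤ 1 := Real.exp_le_one_iff.2 (by
      have : 0 ≤ |p.1| * j := by positivity
      linarith)
    exact mul_le_mul (mul_le_of_le_one_right (hβ j) e1)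
      (by linarith [Real.neg_one_le_cos (j * p.2)])
      (by linarith [Real.cos_le_one (j * p.2)]) (hβ j)
  have hcont : Continuous F := by
    refine continuous_tsum (u := fun j => β j * 2) (fun j => by fun_prop) (hβs.mul_right 2) ?_
    intro j p
    rw [Real.norm_of_nonneg (hterm0 p j)]
    exact hterm p j
  have hsumF : ∀ p : ℝ × ℝ, Summable fun j : ℕ =>
      β j * Real.exp (-(|p.1| * j)) * (1 - Real.cos (j * p.2)) := fun p =>
    Summable.of_nonneg_of_le (hterm0 p) (hterm p) (hβs.mul_right 2)
  set K : Set (ℝ × ℝ) := Set.Icc (0 : ℝ) 1 ×ˢ {y : ℝ | ε ≤ |y| ∧ |y| ≤ Real.pi} with hK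
  have hKc : IsCompact K := by
    refine isCompact_Icc.prod ?_
    have : {y : ℝ | ε ≤ |y| ∧ |y| ≤ Real.pi} =
        Set.Icc (-Real.pi) Real.pi ∩ {y : ℝ | ε ≤ |y|} := by
      ext y
      simp only [Set.mem_ofPred_eq, Set.mem_inter_iff, Set.mem_Icc, abs_le]
      tauto
    rw [this]
    exact isCompact_Icc.inter_right (isClosed_le continuous_const continuous_abs)
  have hpos : ∀ p ∈ K, 0 < F p := by
    rintro ⟨ξ, y⟩ ⟨_, hy1, hy2⟩
    refine lt_of_le_of_ne (tsum_nonneg (hterm0 _)) fun h0 => ?_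
    have hz := (hasSum_zero_iff_of_nonneg (hterm0 (ξ, y))).1 (by
      have := (hsumF (ξ, y)).hasSum
      rwa [show ∑' j : ℕ, β j * Real.exp (-(|(ξ, y).1| * j)) * (1 - Real.cos (j * (ξ, y).2)) = 0
        from h0.symm] at this)
    have hcos : ∀ j : ℕ, β j ≠ 0 → Real.cos (j * y) = 1 := by
      intro j hj
      have := congrFun hz j
      simp only [Pi.zero_apply, mul_eq_zero, hj, (Real.exp_pos _).ne', false_or] at this
      linarith
    let H : AddSubgroup ℤ :=
      { carrier := {k | ∃ n : ℤ, (n : ℝ) * (2 * Real.pi) = k * y}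
        add_mem' := by
          rintro a b ⟨n, hn⟩ ⟨l, hl⟩
          exact ⟨n + l, by push_cast; linarith⟩
        zero_mem' := ⟨0, by simp⟩
        neg_mem' := by
          rintro a ⟨n, hn⟩
          exact ⟨-n, by push_cast; linarith⟩ }
    obtain ⟨d, hd⟩ := Int.subgroup_cyclic H
    have hmem : ∀ j : ℕ, β j ≠ 0 → (d.natAbs ∣ j) := by
      intro j hj
      have hjH : (j : ℤ) ∈ H := by
        obtain ⟨n, hn⟩ := (Real.cos_eq_one_iff _).1 (hcos j hj)
        exact ⟨n, by push_cast; linarith⟩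
      rw [hd, AddSubgroup.mem_closure_singleton] at hjH
      obtain ⟨n, hn⟩ := hjH
      rw [← Int.natCast_dvd_natCast, Int.natCast_natAbs, abs_dvd]
      exact ⟨n, by rw [← hn, smul_eq_mul, mul_comm]⟩
    have hd1 : d.natAbs = 1 := by
      have h1 : ¬ 1 < d.natAbs := fun h => hna ⟨d.natAbs, h, fun j _ hj => hmem j hj⟩
      have h2 : d.natAbs ≠ 0 := by
        intro h
        -- If the generator is 0, no positive index is in the support, and 2 divides all of them
        -- vacuously.
        refine hna ⟨2, one_lt_two, fun j hj1 hj => ?_⟩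
        have := hmem j hj
        rw [h, Nat.zero_dvd] at this
        omega
      omega
    have h1H : (1 : ℤ) ∈ H := by
      rw [hd, AddSubgroup.mem_closure_singleton]
      rcases Int.natAbs_eq_iff.1 hd1 with h | h
      · exact ⟨1, by simp [h]⟩
      · exact ⟨-1, by simp [h]⟩
    obtain ⟨n, hn⟩ := h1H
    have hπ := Real.pi_pos
    simp only [Int.cast_one, one_mul] at hn
    rw [← hn, abs_mul, abs_of_pos (by positivity : 0 < 2 * Real.pi)] at hy1 hy2
    have hn0 : n ≠ 0 := by
      rintro rfl
      simp at hy1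
      linarith
    have : (1 : ℝ) ≤ |(n : ℝ)| := by exact_mod_cast Int.one_le_abs hn0
    nlinarith
  rcases K.eq_empty_or_nonempty with hKe | hKn
  · refine ⟨1, one_pos, fun ξ hξ y h1 h2 => ?_⟩
    have : (ξ, y) ∈ K := ⟨hξ, h1, h2⟩
    rw [hKe] at this
    exact this.elim
  · obtain ⟨p, hpK, hp⟩ := hKc.exists_isMinOn hKn hcont.continuousOn
    refine ⟨F p, hpos p hpK, fun ξ hξ y h1 h2 => ?_⟩
    have := hp (show (ξ, y) ∈ K from ⟨hξ, h1, h2⟩)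
    simpa [hF, abs_of_nonneg hξ.1] using this

lemma continuous_lap_line {a : ℕ → ℝ} (ha : ∀ j, 0 ≤ a j) {ξ : ℝ}
    (h : Summable fun j : ℕ => a j * Real.exp (-(ξ * j))) :
    Continuous fun y : ℝ => lap a ((ξ : ℂ) + Complex.I * y) := by
  unfold lap
  refine continuous_tsum (u := fun j : ℕ => a j * Real.exp (-(ξ * j))) (fun j => by fun_prop) h ?_
  intro j y
  rw [norm_lap_term ha]
  simp

lemma continuous_phase_line {α β : ℕ → ℝ} (hα : ∀ j, 0 ≤ α j) (hβ : ∀ j, 0 ≤ β j) {ξ : ℝ}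
    (hαs : Summable fun j : ℕ => α j * Real.exp (-(ξ * j)))
    (hβs : Summable fun j : ℕ => β j * Real.exp (-(ξ * j))) (u : ℂ) (N n : ℕ) :
    Continuous fun y : ℝ => phase α β u N n ((ξ : ℂ) + Complex.I * y) := by
  have h1 := continuous_lap_line hα hαs
  have h2 := continuous_lap_line hβ hβs
  unfold phase
  fun_prop

/-- Away from the positive axis the integrand of Cauchy's formula is exponentially small. -/
lemma exists_norm_exp_phase_le {α β : ℕ → ℝ} (hα : ∀ j, 0 ≤ α j) (hβ : ∀ j, 0 ≤ β j)
    (hβs : Summable β) (hna : NonArithmetic β)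
    (hαs : ∀ ξ : ℝ, 0 < ξ → Summable fun j : ℕ => α j * Real.exp (-(ξ * j)))
    {τ ξ : ℕ → ℝ} {n : ℕ → ℕ} {K p : ℝ} (hξ : ∀ᶠ N in atTop, 0 < ξ N ∧ ξ N ≤ 1)
    (hτ : ∀ᶠ N : ℕ in atTop, N * τ N ^ 2 ≤ K)
    (hβξ : ∀ᶠ N : ℕ in atTop,
      N * ((∑' j : ℕ, β j * Real.exp (-(ξ N * j))) - (∑' j : ℕ, β j) + ξ N) ≤ K)
    (hαξ : ∀ᶠ N : ℕ in atTop,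
      Real.exp (∑' j : ℕ, α j * Real.exp (-(ξ N * j))) ≤ K * (N : ℝ) ^ p)
    (hn : ∀ N, n N ≤ N) {ε : ℝ} (hε : 0 < ε) :
    ∃ c > 0, ∃ K' : ℝ, ∀ᶠ N : ℕ in atTop, ∀ y : ℝ, ε ≤ |y| → |y| ≤ Real.pi →
      ‖Complex.exp (phase α β (Complex.exp (Complex.I * τ N)) N (n N)
        ((ξ N : ℂ) + Complex.I * y))‖ ≤ K' * (N : ℝ) ^ p * Real.exp (-(c * N)) := by
  obtain ⟨c, hc, hcy⟩ := exists_pos_le_of_nonArithmetic hβ hβs hna hε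
  have hm : 0 ≤ ∑' j : ℕ, β j := tsum_nonneg hβ
  refine ⟨c / 2, by positivity, K * Real.exp ((∑' j : ℕ, β j) * K + K), ?_⟩
  filter_upwards [hξ, hτ, hβξ, hαξ] with N hξN hτN hβN hαN y hy1 hy2
  set u := Complex.exp (Complex.I * τ N)
  set w : ℂ := (ξ N : ℂ) + Complex.I * y with hw
  have hre : w.re = ξ N := by simp [hw]
  have hu : ‖u‖ = 1 := by simp [u, Complex.norm_exp]
  -- When n < N the missing multiple (N - n)w of w has nonnegative real part, so it can only lower
  -- the modulus.
  have hsplit : phase α β u N (n N) w = u * lap α w +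
      (N * (u * (lap β w - (∑' j : ℕ, β j : ℝ)) + w) - ((N - n N : ℕ) : ℂ) * w) := by
    rw [phase, Nat.cast_sub (hn N)]
    ring
  have h1 : (u * lap α w).re ≤ ∑' j : ℕ, α j * Real.exp (-(ξ N * j)) := by
    refine (Complex.re_le_norm _).trans ?_
    rw [norm_mul, hu, one_mul]
    refine (norm_lap_le hα (by rw [hre]; exact hαs _ hξN.1)).trans (le_of_eq ?_)
    rw [hre, lap_ofReal, Complex.ofReal_re]
  have h2 := re_phase_le hβ hβs hξN.1.le (τ N) y
  have h3 := hcy (ξ N) ⟨hξN.1.le, hξN.2⟩ y hy1 hy2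
  have h4 : ((N : ℂ) * (u * (lap β w - (∑' j : ℕ, β j : ℝ)) + w)).re ≤
      (∑' j : ℕ, β j) * K + K - c / 2 * N := by
    rw [← Complex.ofReal_natCast, Complex.re_ofReal_mul]
    have hN : (0 : ℝ) ≤ N := N.cast_nonneg
    have h5 := mul_le_mul_of_nonneg_left h2 hN
    refine h5.trans ?_
    nlinarith [mul_le_mul_of_nonneg_left hτN hm, mul_le_mul_of_nonneg_left h3 hN]
  have h6 : 0 ≤ (((N - n N : ℕ) : ℂ) * w).re := by
    rw [← Complex.ofReal_natCast, Complex.re_ofReal_mul, hre]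
    exact mul_nonneg (Nat.cast_nonneg _) hξN.1.le
  rw [Complex.norm_exp, hsplit, Complex.add_re, Complex.sub_re]
  calc Real.exp _ ≤ Real.exp ((∑' j : ℕ, α j * Real.exp (-(ξ N * j))) +
        (((∑' j : ℕ, β j) * K + K) + -(c / 2 * N))) := Real.exp_le_exp.2 (by linarith)
    _ = Real.exp (∑' j : ℕ, α j * Real.exp (-(ξ N * j))) *
        (Real.exp ((∑' j : ℕ, β j) * K + K) * Real.exp (-(c / 2 * N))) := by
        rw [Real.exp_add, Real.exp_add]
    _ ≤ (K * (N : ℝ) ^ p) * (Real.exp ((∑' j : ℕ, β j) * K + K) * Real.exp (-(c / 2 * N))) :=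
        mul_le_mul_of_nonneg_right hαN (by positivity)
    _ = _ := by ring

lemma tendsto_rpow_mul_exp_neg_natCast (p : ℝ) {c : ℝ} (hc : 0 < c) :
    Tendsto (fun N : ℕ => (N : ℝ) ^ p * Real.exp (-(c * N))) atTop (𝓝 0) := by
  have := (tendsto_rpow_mul_exp_neg_mul_atTop_nhds_zero p c hc).comp
    (tendsto_natCast_atTop_atTop (R := ℝ))
  refine this.congr fun N => ?_
  simp [Function.comp]

/-- The contribution of the arc away from the positive axis is negligible. -/
lemma tendsto_outer_integral {f : ℕ → ℝ → ℂ} {ε K p c : ℝ} (hc : 0 < c) (hε : 0 < ε)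
    (hεπ : ε ≤ Real.pi)
    (h : ∀ᶠ N : ℕ in atTop, ∀ y : ℝ, ε ≤ |y| → |y| ≤ Real.pi →
      ‖f N y‖ ≤ K * (N : ℝ) ^ p * Real.exp (-(c * N))) (q : ℝ) :
    Tendsto (fun N : ℕ => (((N : ℝ) ^ q : ℝ) : ℂ) *
      ((∫ y in (-Real.pi)..(-ε), f N y) + ∫ y in ε..Real.pi, f N y)) atTop (𝓝 0) := by
  have hlim := (tendsto_rpow_mul_exp_neg_natCast (q + p) hc).mul_const (K * (2 * Real.pi))
  rw [zero_mul] at hlim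
  refine squeeze_zero_norm' ?_ hlim
  filter_upwards [h, eventually_gt_atTop 0] with N hN hN0
  have hN0' : (0 : ℝ) < N := by exact_mod_cast hN0
  set B := K * (N : ℝ) ^ p * Real.exp (-(c * N)) with hB
  have hB0 : 0 ≤ B := (norm_nonneg _).trans (hN ε (le_abs_self ε) (by rwa [abs_of_pos hε]))
  have h1 : ‖∫ y in (-Real.pi)..(-ε), f N y‖ ≤ B * |-ε - -Real.pi| := by
    refine intervalIntegral.norm_integral_le_of_norm_le_const fun y hy => ?_
    rw [Set.uIoc_of_le (by linarith)] at hy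
    have : |y| = -y := abs_of_nonpos (by linarith [hy.2])
    exact hN y (by rw [this]; linarith [hy.2]) (by rw [this]; linarith [hy.1])
  have h2 : ‖∫ y in ε..Real.pi, f N y‖ ≤ B * |Real.pi - ε| := by
    refine intervalIntegral.norm_integral_le_of_norm_le_const fun y hy => ?_
    rw [Set.uIoc_of_le hεπ] at hy
    have : |y| = y := abs_of_nonneg (by linarith [hy.1])
    exact hN y (by rw [this]; linarith [hy.1]) (by rw [this]; linarith [hy.2])
  rw [abs_of_nonneg (by linarith)] at h1 h2
  rw [norm_mul, Complex.norm_real, Real.norm_of_nonneg (by positivity)]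
  calc (N : ℝ) ^ q * ‖(∫ y in (-Real.pi)..(-ε), f N y) + ∫ y in ε..Real.pi, f N y‖
      ≤ (N : ℝ) ^ q * (B * (2 * Real.pi)) := by
        refine mul_le_mul_of_nonneg_left ((norm_add_le _ _).trans ?_) (by positivity)
        nlinarith
    _ = _ := by
        rw [hB, Real.rpow_add hN0']
        ring

/-! ### Elementary estimates for the rescaled integrand. -/

lemma exp_I_mul_sub_one_bound {τ : ℝ} (hτ : |τ| ≤ 1) :
    ‖Complex.exp (Complex.I * τ) - 1 - Complex.I * τ‖ ≤ τ ^ 2 := by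
  have h := Complex.norm_exp_sub_one_sub_id_le (x := Complex.I * τ) (by simpa using hτ)
  simpa using h

lemma norm_exp_I_mul_sub_one_le (τ : ℝ) : ‖Complex.exp (Complex.I * τ) - 1‖ ≤ |τ| := by
  have := Real.norm_exp_I_mul_ofReal_sub_one_le (x := τ)
  simpa using this

lemma ofReal_mul_cpow {ρ : ℝ} (hρ : 0 < ρ) {x : ℂ} (hx : x ≠ 0) (s : ℝ) :
    ((ρ : ℂ) * x) ^ (s : ℂ) = ((ρ ^ s : ℝ) : ℂ) * x ^ (s : ℂ) := by
  have hρ' : (ρ : ℂ) ≠ 0 := by exact_mod_cast hρ.ne'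
  rw [Complex.cpow_def_of_ne_zero (mul_ne_zero hρ' hx), Complex.cpow_def_of_ne_zero hx,
    Complex.log_ofReal_mul hρ hx, add_mul, Complex.exp_add, Real.rpow_def_of_pos hρ]
  push_cast
  rfl

/-- In the right half-plane |arg x| is compared with π/2, where cos(s arg x) takes the value
cos(sπ/2), negative for 1 < s ≤ 2. The cosine is Lipschitz, and π/2 - |arg x| ≤ (π/2) Re x / |x| by
Jordan's inequality, so the correction has order |x|^{s-1} on vertical lines. -/
lemma re_cpow_le {x : ℂ} (hx : x ≠ 0) (hre : 0 ≤ x.re) {s : ℝ} (hs : 0 < s) :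
    (x ^ (s : ℂ)).re ≤ Real.cos (s * (Real.pi / 2)) * ‖x‖ ^ s +
      s * (Real.pi / 2) * x.re * ‖x‖ ^ (s - 1) := by
  have hx0 : 0 < ‖x‖ := norm_pos_iff.2 hx
  have harg : |x.arg| ≤ Real.pi / 2 := Complex.abs_arg_le_pi_div_two_iff.2 hre
  rw [Complex.cpow_ofReal_re, ← Real.cos_abs, abs_mul, abs_of_pos hs]
  have hcos : Real.cos (|x.arg| * s) ≤
      Real.cos (s * (Real.pi / 2)) + s * (Real.pi / 2 - |x.arg|) := by
    have h := Real.abs_cos_sub_cos_le (|x.arg| * s) (s * (Real.pi / 2))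
    have h' := (abs_le.1 h).2
    have h4 : |x.arg| * s ≤ s * (Real.pi / 2) := by
      rw [mul_comm]
      exact mul_le_mul_of_nonneg_left harg hs.le
    rw [abs_of_nonpos (sub_nonpos.2 h4)] at h'
    linarith
  have hsin : Real.pi / 2 - |x.arg| ≤ Real.pi / 2 * (x.re / ‖x‖) := by
    have h := Real.mul_le_sin (x := Real.pi / 2 - |x.arg|) (by linarith)
      (by linarith [abs_nonneg x.arg])
    rw [Real.sin_pi_div_two_sub, Real.cos_abs, Complex.cos_arg hx] at h
    have hπ := Real.pi_pos
    have h2 := mul_le_mul_of_nonneg_left h (by positivity : 0 ≤ Real.pi / 2)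
    have : Real.pi / 2 * (2 / Real.pi * (Real.pi / 2 - |x.arg|)) = Real.pi / 2 - |x.arg| := by
      field_simp
    linarith
  have h3 : ‖x‖ ^ (s - 1) = ‖x‖ ^ s / ‖x‖ := by rw [Real.rpow_sub_one hx0.ne']
  rw [h3]
  have hp : 0 < ‖x‖ ^ s := by positivity
  calc ‖x‖ ^ s * Real.cos (|x.arg| * s)
      ≤ ‖x‖ ^ s * (Real.cos (s * (Real.pi / 2)) + s * (Real.pi / 2 * (x.re / ‖x‖))) := by
        refine mul_le_mul_of_nonneg_left (hcos.trans ?_) hp.le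
        have := mul_le_mul_of_nonneg_left hsin hs.le
        linarith
    _ = _ := by ring

lemma exists_linear_sub_rpow_le {s : ℝ} (hs : 1 < s) {c : ℝ} (hc : 0 < c) (a : ℝ) :
    ∃ M : ℝ, ∀ X : ℝ, 0 ≤ X → a * X - c * X ^ s ≤ M := by
  -- Beyond this threshold c X^{s-1} ≥ |a|, so the power beats the linear term.
  set X₀ := (|a| / c) ^ (1 / (s - 1)) with hX₀
  have hX₀0 : 0 ≤ X₀ := by positivity
  refine ⟨|a| * X₀, fun X hX => ?_⟩
  rcases le_total X X₀ with h | h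
  · have h1 : 0 ≤ c * X ^ s := by positivity
    have h2 : a * X ≤ |a| * X₀ := by
      calc a * X ≤ |a| * X := mul_le_mul_of_nonneg_right (le_abs_self a) hX
        _ ≤ _ := mul_le_mul_of_nonneg_left h (abs_nonneg a)
    linarith
  · rcases hX.eq_or_lt with h0 | h0
    · rw [← h0, Real.zero_rpow (by linarith)]
      have : 0 ≤ |a| * X₀ := by positivity
      simpa using this
    · have h1 : |a| / c ≤ X ^ (s - 1) := by
        have := Real.rpow_le_rpow hX₀0 h (by linarith : 0 ≤ s - 1)
        rwa [hX₀, ← Real.rpow_mul (by positivity), one_div_mul_cancel (by linarith),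
          Real.rpow_one] at this
      have h2 : X ^ s = X ^ (s - 1) * X := by
        rw [Real.rpow_sub_one h0.ne', div_mul_cancel₀ _ h0.ne']
      have h3 : |a| ≤ c * X ^ (s - 1) := by
        rw [div_le_iff₀ hc] at h1
        linarith
      have h4 : a * X ≤ c * X ^ s := by
        rw [h2, ← mul_assoc]
        exact mul_le_mul_of_nonneg_right ((le_abs_self a).trans h3) hX
      have : 0 ≤ |a| * X₀ := by positivity
      linarith

/-! ### Asymptotics on a circle inside the disc of convergence -/

/-- The limit of the rescaled integrand of Cauchy's formula. -/
noncomputable def circleLimit (θ A s : ℝ) (q x : ℂ) : ℂ :=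
  Complex.exp (-(θ * Complex.log x) + A * x ^ (s : ℂ) - q * x)

/-- Substitute w = ρx with Nρ^s = 1, so that N A w^s becomes A x^s. The added θ log ρ compensates
the size of w^{-θ}, the linear terms leave only N(1 - u)ρx, and lowering the index by k subtracts
kρx. -/
lemma phase_rescaled (α β : ℕ → ℝ) (u : ℂ) {N k : ℕ} (hk : k ≤ N) {ρ θ A s : ℝ} (hρ : 0 < ρ)
    (hN : N * ρ ^ s = 1) {x : ℂ} (hx : x ≠ 0) :
    θ * Real.log ρ + phase α β u N (N - k) (ρ * x) =
      u * (lap α (ρ * x) + θ * Complex.log (ρ * x)) + (1 - u) * (θ * Real.log ρ) -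
      u * (θ * Complex.log x) + (N * (1 - u) * ρ) * x + u * (A * x ^ (s : ℂ)) +
      u * (N * (lap β (ρ * x) - (∑' j : ℕ, β j : ℝ) + ρ * x - A * (ρ * x) ^ (s : ℂ))) -
      (k * ρ : ℝ) * x := by
  have hNC : (N : ℂ) * ((ρ ^ s : ℝ) : ℂ) = 1 := by exact_mod_cast hN
  rw [ofReal_mul_cpow hρ hx, Complex.log_ofReal_mul hρ hx, phase, Nat.cast_sub hk]
  push_cast at hNC ⊢
  linear_combination (u * A * x ^ (s : ℂ)) * hNC

section

variable {α β : ℕ → ℝ} {s A θ C : ℝ}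

/-- The dominating function on the line Re x = 1. There the real part of A x^s is about -c|x|^s with
c > 0; it absorbs the error terms and all terms linear in |x|, and still leaves a factor e^{-2|x|} ≤
1/(1 + v²). -/
lemma exists_norm_exp_rescaled_le (hs : 1 < s) (hs2 : s ≤ 2) (hA : 0 < A) (hθ : 0 ≤ θ)
    (hEβ : (fun w => lap β w - (∑' j : ℕ, β j : ℝ) + w - A * w ^ (s : ℂ))
      =o[𝓝[{w : ℂ | 0 < w.re}] 0] fun w => ‖w‖ ^ s)
    (hEα : Tendsto (fun w => lap α w + θ * Complex.log w) (𝓝[{w : ℂ | 0 < w.re}] 0)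
      (𝓝 (C : ℂ)))
    {τ ρ : ℕ → ℝ} {σ : ℝ} (hτ0 : Tendsto τ atTop (𝓝 0))
    (hρ : ∀ᶠ N : ℕ in atTop, 0 < ρ N ∧ N * ρ N ^ s = 1)
    (hσ : Tendsto (fun N : ℕ => (N : ℂ) * (1 - Complex.exp (Complex.I * τ N)) * ρ N) atTop
      (𝓝 (-(Complex.I * σ))))
    (hlog : Tendsto (fun N : ℕ => (1 - Complex.exp (Complex.I * τ N)) * (θ * Real.log (ρ N)))
      atTop (𝓝 0)) :
    ∃ δ > 0, ∃ M : ℝ, ∀ᶠ N : ℕ in atTop, ∀ k ≤ N, ∀ v : ℝ,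
      ‖(ρ N : ℂ) * (1 + Complex.I * v)‖ < δ →
      ‖Complex.exp (θ * Real.log (ρ N) +
        phase α β (Complex.exp (Complex.I * τ N)) N (N - k) (ρ N * (1 + Complex.I * v)))‖ ≤
        M * (1 + v ^ 2)⁻¹ := by
  have hπ := Real.pi_pos
  have hcos : Real.cos (s * (Real.pi / 2)) < 0 :=
    Real.cos_neg_of_pi_div_two_lt_of_lt (by nlinarith) (by nlinarith)
  set c := -(A * Real.cos (s * (Real.pi / 2))) with hc
  have hc0 : 0 < c := by rw [hc]; nlinarith
  have h1 := (isLittleO_iff.1 hEβ) (show 0 < c / 4 by positivity)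
  have h2 : ∀ᶠ w in 𝓝[{w : ℂ | 0 < w.re}] (0 : ℂ), ‖lap α w + θ * Complex.log w‖ < |C| + 1 := by
    have := hEα.norm
    rw [Complex.norm_real, Real.norm_eq_abs] at this
    exact this.eventually_lt_const (by linarith)
  obtain ⟨δ, hδ, hδ'⟩ := Metric.mem_nhdsWithin_iff.1 (h1.and h2)
  -- Two quarters of c|x|^s are spent on the errors in `b5` and `b6`, so c/2 remains. The summand 2
  -- in the linear coefficient reserves the factor e^{-2|x|}.
  obtain ⟨M, hM⟩ := exists_linear_sub_rpow_le hs (show 0 < c / 2 by positivity)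
    (|σ| + 1 + A * (s * (Real.pi / 2)) + 2)
  refine ⟨δ, hδ, Real.exp (|C| + 1 + 1 + θ * Real.pi + M), ?_⟩
  have hu : Tendsto (fun N : ℕ => Complex.exp (Complex.I * τ N)) atTop (𝓝 1) := by
    have h : Tendsto (fun N : ℕ => Complex.exp (Complex.I * τ N)) atTop
        (𝓝 (Complex.exp (Complex.I * (0 : ℝ)))) :=
      (Complex.continuous_exp.tendsto _).comp
        (((Complex.continuous_ofReal.tendsto 0).comp hτ0).const_mul _)
    simpa using h
  have hu1 : ∀ᶠ N : ℕ in atTop, A * ‖Complex.exp (Complex.I * τ N) - 1‖ < c / 4 := by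
    have : Tendsto (fun N : ℕ => A * ‖Complex.exp (Complex.I * τ N) - 1‖) atTop (𝓝 (A * ‖(1 : ℂ) - 1‖)) :=
      ((hu.sub_const 1).norm).const_mul A
    rw [sub_self, norm_zero, mul_zero] at this
    exact this.eventually_lt_const (by positivity)
  have hu2 : ∀ᶠ N : ℕ in atTop, 0 < (Complex.exp (Complex.I * τ N)).re := by
    have : Tendsto (fun N : ℕ => (Complex.exp (Complex.I * τ N)).re) atTop (𝓝 (1 : ℂ).re) :=
      (Complex.continuous_re.tendsto _).comp hu
    exact this.eventually_const_lt (by simp)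
  have hσ1 : ∀ᶠ N : ℕ in atTop,
      ‖(N : ℂ) * (1 - Complex.exp (Complex.I * τ N)) * ρ N‖ < |σ| + 1 := by
    have := hσ.norm
    refine this.eventually_lt_const ?_
    simp
  have hlog1 : ∀ᶠ N : ℕ in atTop,
      ‖(1 - Complex.exp (Complex.I * τ N)) * (θ * Real.log (ρ N))‖ < 1 := by
    have := hlog.norm
    rw [norm_zero] at this
    exact this.eventually_lt_const one_pos
  filter_upwards [hρ, hu1, hu2, hσ1, hlog1] with N hρN hu1N hu2N hσN hlogN k hk v hv
  set u := Complex.exp (Complex.I * τ N) with hudef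
  set x : ℂ := 1 + Complex.I * v with hx
  have hxre : x.re = 1 := by simp [hx]
  have hxsq : ‖x‖ ^ 2 = 1 + v ^ 2 := by
    rw [Complex.sq_norm, Complex.normSq_apply]
    simp [hx]
    ring
  have hx1 : 1 ≤ ‖x‖ := by
    have := Complex.abs_re_le_norm x
    rwa [hxre, abs_one] at this
  have hx0 : x ≠ 0 := norm_pos_iff.1 (by linarith)
  have hun : ‖u‖ = 1 := by simp [u, Complex.norm_exp]
  have hmem := hδ' ⟨show (ρ N : ℂ) * x ∈ Metric.ball 0 δ by simpa using hv,
    show 0 < ((ρ N : ℂ) * x).re by rw [Complex.re_ofReal_mul, hxre, mul_one]; exact hρN.1⟩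
  obtain ⟨hm1, hm2⟩ : _ ∧ _ := hmem
  have hNρ : (N : ℝ) * ‖(ρ N : ℂ) * x‖ ^ s = ‖x‖ ^ s := by
    rw [norm_mul, Complex.norm_real, Real.norm_of_nonneg hρN.1.le,
      Real.mul_rpow hρN.1.le (norm_nonneg _), ← mul_assoc, hρN.2, one_mul]
  have hXs0 : 0 ≤ ‖x‖ ^ s := by positivity
  have b1 : (u * (lap α (ρ N * x) + θ * Complex.log (ρ N * x))).re ≤ |C| + 1 := by
    refine (Complex.re_le_norm _).trans ?_
    rw [norm_mul, hun, one_mul]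
    exact hm2.le
  have b2 : ((1 - u) * (θ * Real.log (ρ N))).re ≤ 1 :=
    (Complex.re_le_norm _).trans hlogN.le
  -- Since |x| ≥ 1 and Re u > 0, the term with log|x| has a favourable sign; only the argument of x
  -- has to be bounded.
  have b3 : -(u * (θ * Complex.log x)).re ≤ θ * Real.pi := by
    have e : u * (θ * Complex.log x) = ((θ : ℝ) : ℂ) * (u * Complex.log x) := by ring
    rw [e, Complex.re_ofReal_mul, Complex.mul_re, Complex.log_re, Complex.log_im]
    have l0 : 0 ≤ Real.log ‖x‖ := Real.log_nonneg hx1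
    have i1 : u.im * x.arg ≤ Real.pi := by
      calc u.im * x.arg ≤ |u.im * x.arg| := le_abs_self _
        _ = |u.im| * |x.arg| := abs_mul _ _
        _ ≤ 1 * Real.pi := mul_le_mul (hun ▸ Complex.abs_im_le_norm u)
            (Complex.abs_arg_le_pi x) (abs_nonneg _) zero_le_one
        _ = Real.pi := one_mul _
    nlinarith [mul_nonneg hu2N.le l0, mul_le_mul_of_nonneg_left i1 hθ,
      mul_nonneg hθ (mul_nonneg hu2N.le l0)]
  have b4 : ((N * (1 - u) * ρ N) * x).re ≤ (|σ| + 1) * ‖x‖ := by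
    refine (Complex.re_le_norm _).trans ?_
    rw [norm_mul]
    exact mul_le_mul_of_nonneg_right hσN.le (norm_nonneg _)
  have hXle : ‖x‖ ^ (s - 1) ≤ ‖x‖ := by
    conv_rhs => rw [← Real.rpow_one ‖x‖]
    exact Real.rpow_le_rpow_of_exponent_le hx1 (by linarith)
  have b5 : (u * (A * x ^ (s : ℂ))).re ≤
      -(3 * c / 4) * ‖x‖ ^ s + A * (s * (Real.pi / 2)) * ‖x‖ := by
    have e : u * (A * x ^ (s : ℂ)) = (A : ℂ) * x ^ (s : ℂ) + (A * (u - 1)) * x ^ (s : ℂ) := by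
      ring
    have r1 := re_cpow_le hx0 (by rw [hxre]; exact zero_le_one) (by linarith : 0 < s)
    rw [hxre, mul_one] at r1
    have r2 : ((A * (u - 1)) * x ^ (s : ℂ)).re ≤ c / 4 * ‖x‖ ^ s := by
      refine (Complex.re_le_norm _).trans ?_
      rw [norm_mul, norm_mul, Complex.norm_real, Real.norm_of_nonneg hA.le,
        Complex.norm_cpow_of_ne_zero hx0]
      simp only [Complex.ofReal_re, Complex.ofReal_im, mul_zero, Real.exp_zero, div_one]
      exact mul_le_mul_of_nonneg_right hu1N.le hXs0
    rw [e, Complex.add_re, Complex.re_ofReal_mul]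
    have r3 := mul_le_mul_of_nonneg_left r1 hA.le
    have r4 : s * (Real.pi / 2) * ‖x‖ ^ (s - 1) ≤ s * (Real.pi / 2) * ‖x‖ :=
      mul_le_mul_of_nonneg_left hXle (by positivity)
    have r5 := mul_le_mul_of_nonneg_left r4 hA.le
    have r6 : A * (Real.cos (s * (Real.pi / 2)) * ‖x‖ ^ s) = -c * ‖x‖ ^ s := by rw [hc]; ring
    nlinarith
  have b6 : (u * (N * (lap β (ρ N * x) - (∑' j : ℕ, β j : ℝ) + ρ N * x -
      A * (ρ N * x) ^ (s : ℂ)))).re ≤ c / 4 * ‖x‖ ^ s := by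
    refine (Complex.re_le_norm _).trans ?_
    rw [norm_mul, hun, one_mul, norm_mul, Complex.norm_natCast]
    have := mul_le_mul_of_nonneg_left hm1 (Nat.cast_nonneg (α := ℝ) N)
    refine this.trans (le_of_eq ?_)
    rw [Real.norm_of_nonneg (by positivity), ← hNρ]
    ring
  have b7 : 0 ≤ (((k * ρ N : ℝ) : ℂ) * x).re := by
    rw [Complex.re_ofReal_mul, hxre, mul_one]
    exact mul_nonneg (Nat.cast_nonneg _) hρN.1.le
  rw [phase_rescaled α β u hk hρN.1 hρN.2 (θ := θ) (A := A) hx0, Complex.norm_exp]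
  simp only [Complex.add_re, Complex.sub_re]
  have hM' := hM ‖x‖ (norm_nonneg _)
  have hfin : Real.exp (-(2 * ‖x‖)) ≤ (1 + v ^ 2)⁻¹ := by
    rw [← hxsq, Real.exp_neg]
    refine inv_anti₀ (by positivity) ?_
    have : ‖x‖ ≤ Real.exp ‖x‖ := by linarith [Real.add_one_le_exp ‖x‖]
    calc ‖x‖ ^ 2 ≤ Real.exp ‖x‖ ^ 2 := by gcongr
      _ = Real.exp (2 * ‖x‖) := by rw [← Real.exp_nat_mul]; norm_num
  refine le_trans (Real.exp_le_exp.2 (?_ : _ ≤ (|C| + 1 + 1 + θ * Real.pi + M) + -(2 * ‖x‖))) ?_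
  · linarith
  · rw [Real.exp_add]
    exact mul_le_mul_of_nonneg_left hfin (Real.exp_pos _).le

end

section

variable {α β : ℕ → ℝ} {s A θ C : ℝ}

lemma tendsto_exp_I_mul {τ : ℕ → ℝ} (hτ0 : Tendsto τ atTop (𝓝 0)) :
    Tendsto (fun N : ℕ => Complex.exp (Complex.I * τ N)) atTop (𝓝 1) := by
  have h : Tendsto (fun N : ℕ => Complex.exp (Complex.I * τ N)) atTop
      (𝓝 (Complex.exp (Complex.I * (0 : ℝ)))) :=
    (Complex.continuous_exp.tendsto _).comp
      (((Complex.continuous_ofReal.tendsto 0).comp hτ0).const_mul _)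
  simpa using h

/-- The pointwise limit that accompanies the domination of `exists_norm_exp_rescaled_le`. -/
lemma tendsto_exp_rescaled
    (hEβ : (fun w => lap β w - (∑' j : ℕ, β j : ℝ) + w - A * w ^ (s : ℂ))
      =o[𝓝[{w : ℂ | 0 < w.re}] 0] fun w => ‖w‖ ^ s)
    (hEα : Tendsto (fun w => lap α w + θ * Complex.log w) (𝓝[{w : ℂ | 0 < w.re}] 0)
      (𝓝 (C : ℂ)))
    {τ ρ : ℕ → ℝ} {σ : ℝ} (hτ0 : Tendsto τ atTop (𝓝 0))
    (hρ : ∀ᶠ N : ℕ in atTop, 0 < ρ N ∧ N * ρ N ^ s = 1) (hρ0 : Tendsto ρ atTop (𝓝 0))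
    (hσ : Tendsto (fun N : ℕ => (N : ℂ) * (1 - Complex.exp (Complex.I * τ N)) * ρ N) atTop
      (𝓝 (-(Complex.I * σ))))
    (hlog : Tendsto (fun N : ℕ => (1 - Complex.exp (Complex.I * τ N)) * (θ * Real.log (ρ N)))
      atTop (𝓝 0))
    {k : ℕ → ℕ} (hk : ∀ᶠ N in atTop, k N ≤ N) {κ : ℝ}
    (hkκ : Tendsto (fun N : ℕ => k N * ρ N) atTop (𝓝 κ)) (v : ℝ) :
    Tendsto (fun N : ℕ => Complex.exp (θ * Real.log (ρ N) +
        phase α β (Complex.exp (Complex.I * τ N)) N (N - k N) (ρ N * (1 + Complex.I * v))))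
      atTop (𝓝 (Complex.exp C * circleLimit θ A s (Complex.I * σ + κ) (1 + Complex.I * v))) := by
  set x : ℂ := 1 + Complex.I * v with hx
  have hxre : x.re = 1 := by simp [hx]
  have hx0 : x ≠ 0 := by
    intro h
    rw [h] at hxre
    simp at hxre
  have hu := tendsto_exp_I_mul hτ0
  have hw : Tendsto (fun N : ℕ => (ρ N : ℂ) * x) atTop (𝓝[{w : ℂ | 0 < w.re}] 0) := by
    refine tendsto_nhdsWithin_iff.2 ⟨?_, ?_⟩
    · have := ((Complex.continuous_ofReal.tendsto 0).comp hρ0).mul_const x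
      simpa using this
    · filter_upwards [hρ] with N hN
      show 0 < ((ρ N : ℂ) * x).re
      rw [Complex.re_ofReal_mul, hxre, mul_one]
      exact hN.1
  have e1 := hu.mul (hEα.comp hw)
  have e3 := hu.mul_const (θ * Complex.log x)
  have e4 := hσ.mul_const x
  have e5 := hu.mul_const (A * x ^ (s : ℂ))
  have e6 : Tendsto (fun N : ℕ => (N : ℂ) * (lap β (ρ N * x) - (∑' j : ℕ, β j : ℝ) + ρ N * x -
      A * (ρ N * x) ^ (s : ℂ))) atTop (𝓝 0) := by
    have h := hEβ.comp_tendsto hw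
    have h2 : (fun N : ℕ => (N : ℂ) * (lap β (ρ N * x) - (∑' j : ℕ, β j : ℝ) + ρ N * x -
      A * (ρ N * x) ^ (s : ℂ))) =o[atTop] fun N : ℕ => (N : ℝ) * ‖(ρ N : ℂ) * x‖ ^ s := by
      refine IsBigO.mul_isLittleO ?_ h
      exact IsBigO.of_bound 1 (Eventually.of_forall fun N => by simp)
    have h3 : (fun N : ℕ => (N : ℝ) * ‖(ρ N : ℂ) * x‖ ^ s) =ᶠ[atTop] fun _ => ‖x‖ ^ s := by
      filter_upwards [hρ] with N hN
      rw [norm_mul, Complex.norm_real, Real.norm_of_nonneg hN.1.le,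
        Real.mul_rpow hN.1.le (norm_nonneg _), ← mul_assoc, hN.2, one_mul]
    have h4 := h2.trans_eventuallyEq h3
    exact (isLittleO_const_iff (by positivity)).1 h4
  have e7 : Tendsto (fun N : ℕ => ((k N * ρ N : ℝ) : ℂ) * x) atTop (𝓝 ((κ : ℂ) * x)) :=
    ((Complex.continuous_ofReal.tendsto κ).comp hkκ).mul_const x
  have htot := (((((e1.add hlog).sub e3).add e4).add e5).add (hu.mul e6)).sub e7
  have hexp := (Complex.continuous_exp.tendsto _).comp htot
  have hval : Complex.exp C * circleLimit θ A s (Complex.I * σ + κ) x =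
      Complex.exp (1 * (C : ℂ) + 0 - 1 * (θ * Complex.log x) + -(Complex.I * σ) * x +
        1 * (A * x ^ (s : ℂ)) + 1 * 0 - κ * x) := by
    rw [circleLimit, ← Complex.exp_add]
    congr 1
    ring
  rw [hval]
  refine hexp.congr' ?_
  filter_upwards [hρ, hk] with N hN hkN
  rw [phase_rescaled α β _ hkN hN.1 hN.2 (θ := θ) (A := A) hx0]
  rfl

/-- The asymptotics of the coefficients of `exp (u (g_θ + N g_κ))` when the circle of integration
passes at distance of order `N^{-1/s}` from the dominant singularity or saddle point. -/
theorem tendsto_expCoeff_circle (hα : ∀ j, 0 ≤ α j) (hβ : ∀ j, 0 ≤ β j)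
    (hα0 : α 0 = 0) (hβ0 : β 0 = 0) (hβs : Summable β) (hna : NonArithmetic β)
    (hαs : ∀ ξ : ℝ, 0 < ξ → Summable fun j : ℕ => α j * Real.exp (-(ξ * j)))
    (hs : 1 < s) (hs2 : s ≤ 2) (hA : 0 < A) (hθ : 0 ≤ θ)
    (hEβ : (fun w => lap β w - (∑' j : ℕ, β j : ℝ) + w - A * w ^ (s : ℂ))
      =o[𝓝[{w : ℂ | 0 < w.re}] 0] fun w => ‖w‖ ^ s)
    (hEα : Tendsto (fun w => lap α w + θ * Complex.log w) (𝓝[{w : ℂ | 0 < w.re}] 0)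
      (𝓝 (C : ℂ)))
    {τ : ℕ → ℝ} {σ K : ℝ} (hτ0 : Tendsto τ atTop (𝓝 0))
    (hτK : ∀ᶠ N : ℕ in atTop, N * τ N ^ 2 ≤ K)
    (hσ : Tendsto (fun N : ℕ => N * τ N * (N : ℝ) ^ (-(1 / s))) atTop (𝓝 σ))
    (hlog : Tendsto (fun N : ℕ => τ N * Real.log N) atTop (𝓝 0))
    {k : ℕ → ℕ} (hk : ∀ N, k N ≤ N) {κ : ℝ}
    (hkκ : Tendsto (fun N : ℕ => k N * (N : ℝ) ^ (-(1 / s))) atTop (𝓝 κ)) :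
    Tendsto (fun N : ℕ => (((N : ℝ) ^ ((1 - θ) / s) : ℝ) : ℂ) *
      (Complex.exp (-(Complex.exp (Complex.I * τ N) * N * (∑' j : ℕ, β j : ℝ))) *
        expCoeff (fun j => Complex.exp (Complex.I * τ N) * ((α j : ℂ) + N * (β j : ℂ)))
          (N - k N))) atTop
      (𝓝 (Complex.exp C / (2 * Real.pi) *
        ∫ v : ℝ, circleLimit θ A s (Complex.I * σ + κ) (1 + Complex.I * v))) := by
  have hs0 : 0 < s := by linarith
  have hπ := Real.pi_pos
  -- The circle is |z| = r e^{-ρ} with Nρ^s = 1: at this distance the term N A w^s is of order one.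
  set ρ : ℕ → ℝ := fun N => (N : ℝ) ^ (-(1 / s)) with hρdef
  have hρ0 : Tendsto ρ atTop (𝓝 0) :=
    (tendsto_rpow_neg_atTop (by positivity : 0 < 1 / s)).comp tendsto_natCast_atTop_atTop
  have hρ : ∀ᶠ N : ℕ in atTop, 0 < ρ N ∧ N * ρ N ^ s = 1 := by
    filter_upwards [eventually_gt_atTop 0] with N hN
    have hN' : (0 : ℝ) < N := by exact_mod_cast hN
    refine ⟨by positivity, ?_⟩
    rw [hρdef]
    simp only
    rw [← Real.rpow_mul hN'.le, neg_mul, one_div_mul_cancel hs0.ne', Real.rpow_neg_one,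
      mul_inv_cancel₀ hN'.ne']
  have hτ1 : ∀ᶠ N : ℕ in atTop, |τ N| ≤ 1 := by
    have := hτ0.abs
    rw [abs_zero] at this
    exact (this.eventually_lt_const one_pos).mono fun N h => h.le
  -- N(1 - u)ρ is -iNτρ up to Nρτ², which tends to 0 because Nτρ converges and τ → 0.
  have hσ' : Tendsto (fun N : ℕ => (N : ℂ) * (1 - Complex.exp (Complex.I * τ N)) * ρ N) atTop
      (𝓝 (-(Complex.I * σ))) := by
    have h1 : Tendsto (fun N : ℕ => -(Complex.I * ((N * τ N * ρ N : ℝ) : ℂ))) atTop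
        (𝓝 (-(Complex.I * σ))) :=
      (((Complex.continuous_ofReal.tendsto σ).comp hσ).const_mul _).neg
    have h2 : Tendsto (fun N : ℕ => (N : ℂ) * (1 - Complex.exp (Complex.I * τ N)) * ρ N -
        -(Complex.I * ((N * τ N * ρ N : ℝ) : ℂ))) atTop (𝓝 0) := by
      have h3 : Tendsto (fun N : ℕ => |N * τ N * ρ N| * |τ N|) atTop (𝓝 0) := by
        have := hσ.abs.mul hτ0.abs
        rwa [abs_zero, mul_zero] at this
      refine squeeze_zero_norm' ?_ h3
      filter_upwards [hτ1, hρ] with N hN hρN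
      have e : (N : ℂ) * (1 - Complex.exp (Complex.I * τ N)) * ρ N -
          -(Complex.I * ((N * τ N * ρ N : ℝ) : ℂ)) =
          -((N * ρ N : ℝ) : ℂ) * (Complex.exp (Complex.I * τ N) - 1 - Complex.I * τ N) := by
        push_cast
        ring
      have hNρ : 0 ≤ N * ρ N := mul_nonneg (Nat.cast_nonneg _) hρN.1.le
      rw [e, norm_mul, norm_neg, Complex.norm_real, Real.norm_of_nonneg hNρ]
      calc (N * ρ N) * ‖Complex.exp (Complex.I * τ N) - 1 - Complex.I * τ N‖
          ≤ (N * ρ N) * τ N ^ 2 :=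
            mul_le_mul_of_nonneg_left (exp_I_mul_sub_one_bound hN) hNρ
        _ = |N * τ N * ρ N| * |τ N| := by
            rw [show N * τ N * ρ N = (N * ρ N) * τ N by ring, abs_mul, abs_of_nonneg hNρ,
              mul_assoc (N * ρ N) |τ N|, abs_mul_abs_self, sq]
    have := h2.add h1
    simpa using this
  have hlog' : Tendsto (fun N : ℕ =>
      (1 - Complex.exp (Complex.I * τ N)) * (θ * Real.log (ρ N))) atTop (𝓝 0) := by
    have h3 : Tendsto (fun N : ℕ => |τ N * Real.log N| * (|θ| * (1 / s))) atTop (𝓝 0) := by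
      have := hlog.abs.mul_const (|θ| * (1 / s))
      rwa [abs_zero, zero_mul] at this
    refine squeeze_zero_norm' ?_ h3
    filter_upwards [eventually_gt_atTop 0] with N hN
    have hN' : (0 : ℝ) < N := by exact_mod_cast hN
    have hl : Real.log (ρ N) = -(1 / s) * Real.log N := by
      rw [hρdef]
      exact Real.log_rpow hN' _
    rw [hl, norm_mul, norm_sub_rev, norm_mul, Complex.norm_real, Complex.norm_real,
      Real.norm_eq_abs, Real.norm_eq_abs, abs_mul, abs_neg, abs_of_pos (by positivity : 0 < 1 / s)]
    calc ‖Complex.exp (Complex.I * τ N) - 1‖ * (|θ| * (1 / s * |Real.log N|))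
        ≤ |τ N| * (|θ| * (1 / s * |Real.log N|)) :=
          mul_le_mul_of_nonneg_right (norm_exp_I_mul_sub_one_le _) (by positivity)
      _ = _ := by rw [abs_mul]; ring
  obtain ⟨δ, hδ, M, hM⟩ := exists_norm_exp_rescaled_le hs hs2 hA hθ hEβ hEα hτ0 hρ hσ' hlog'
  -- Half of δ is for the imaginary part of w, the other half for its real part ρ.
  set ε : ℝ := min (δ / 2) Real.pi with hε
  have hε0 : 0 < ε := lt_min (by positivity) hπ
  have hεπ : ε ≤ Real.pi := min_le_right _ _
  have hεδ : ε ≤ δ / 2 := min_le_left _ _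
  set g : ℕ → ℝ → ℂ := fun N y => Complex.exp
    (phase α β (Complex.exp (Complex.I * τ N)) N (N - k N) ((ρ N : ℂ) + Complex.I * y)) with hg
  have hwρ : Tendsto (fun N : ℕ => (ρ N : ℂ)) atTop (𝓝[{w : ℂ | 0 < w.re}] 0) := by
    refine tendsto_nhdsWithin_iff.2 ⟨?_, ?_⟩
    · have := (Complex.continuous_ofReal.tendsto 0).comp hρ0
      simpa [Function.comp_def] using this
    · filter_upwards [hρ] with N hN
      show 0 < (ρ N : ℂ).re
      rw [Complex.ofReal_re]
      exact hN.1
  -- the outer part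
  have houter : Tendsto (fun N : ℕ => (((N : ℝ) ^ ((1 - θ) / s) : ℝ) : ℂ) *
      ((∫ y in (-Real.pi)..(-ε), g N y) + ∫ y in ε..Real.pi, g N y)) atTop (𝓝 0) := by
    -- At w = ρ the expansion of `β` with error A|w|^s bounds N times the excess by 2A. The
    -- logarithm of `α` bounds its exponential by e^{C+1} ρ^{-θ} = e^{C+1} N^{θ/s}.
    obtain ⟨c, hc, K', hK'⟩ := exists_norm_exp_phase_le (p := θ / s)
      (K := max K (max (2 * A + 1) (Real.exp (C + 1))))
      hα hβ hβs hna hαs (τ := τ) (ξ := ρ) (n := fun N => N - k N) (by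
        filter_upwards [hρ, hρ0.eventually_lt_const one_pos] with N h1 h2
        exact ⟨h1.1, h2.le⟩)
      (hτK.mono fun N h => h.trans (le_max_left _ _)) (by
        have h1 := hwρ.eventually (isLittleO_iff.1 hEβ (show 0 < A by exact hA))
        filter_upwards [hρ, h1] with N hN h1
        refine le_trans ?_ ((le_max_left (2 * A + 1) _).trans (le_max_right _ _))
        rw [lap_ofReal, ← Complex.ofReal_cpow hN.1.le, ← Complex.ofReal_sub, ← Complex.ofReal_add,
          ← Complex.ofReal_mul, ← Complex.ofReal_sub, Complex.norm_real, Complex.norm_real,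
          Real.norm_eq_abs, Real.norm_of_nonneg hN.1.le,
          Real.norm_of_nonneg (Real.rpow_nonneg hN.1.le _)] at h1
        have h2 := (abs_le.1 h1).2
        have h3 := mul_le_mul_of_nonneg_left h2 (Nat.cast_nonneg (α := ℝ) N)
        have h4 : (N : ℝ) * (A * ρ N ^ s) = A := by rw [mul_left_comm, hN.2, mul_one]
        nlinarith)
      (by
        have h1 := hwρ.eventually ((hEα.sub_const (C : ℂ)).norm.eventually_lt_const
          (u := 1) (by simp))
        filter_upwards [hρ, h1, eventually_gt_atTop 0] with N hN h1 hN0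
        have hN' : (0 : ℝ) < N := by exact_mod_cast hN0
        rw [lap_ofReal, ← Complex.ofReal_log hN.1.le, ← Complex.ofReal_mul, ← Complex.ofReal_add,
          ← Complex.ofReal_sub, Complex.norm_real] at h1
        have h2 := (abs_lt.1 h1).2
        have hl : Real.log (ρ N) = -(1 / s) * Real.log N := Real.log_rpow hN' _
        have h3 : (∑' j : ℕ, α j * Real.exp (-(ρ N * j))) ≤ (C + 1) + Real.log N * (θ / s) := by
          have : θ * Real.log (ρ N) = -(Real.log N * (θ / s)) := by rw [hl]; ring
          linarith
        refine (Real.exp_le_exp.2 h3).trans ?_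
        rw [Real.exp_add, ← Real.rpow_def_of_pos hN']
        exact mul_le_mul_of_nonneg_right ((le_max_right _ _).trans (le_max_right _ _))
          (by positivity))
      (fun N => Nat.sub_le _ _) hε0
    exact tendsto_outer_integral hc hε0 hεπ hK' _
  -- the inner part
  have hinner : Tendsto (fun N : ℕ => (((N : ℝ) ^ ((1 - θ) / s) : ℝ) : ℂ) *
      ∫ y in (-ε)..ε, g N y) atTop (𝓝 (∫ v : ℝ,
        Complex.exp C * circleLimit θ A s (Complex.I * σ + κ) (1 + Complex.I * v))) := by
    -- Substituting y = ρv contributes ρ, and the compensating factor contributes ρ^{θ}; together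
    -- they explain the normalization N^{(1-θ)/s}.
    set F : ℕ → ℝ → ℂ := fun N => (Set.Ioc (-(ε / ρ N)) (ε / ρ N)).indicator fun v =>
      Complex.exp (θ * Real.log (ρ N) +
        phase α β (Complex.exp (Complex.I * τ N)) N (N - k N) (ρ N * (1 + Complex.I * v))) with hF
    have hFint : ∀ᶠ N : ℕ in atTop, ∫ v, F N v = (((N : ℝ) ^ ((1 - θ) / s) : ℝ) : ℂ) *
        ∫ y in (-ε)..ε, g N y := by
      filter_upwards [hρ, eventually_gt_atTop 0] with N hN hN0
      have hN' : (0 : ℝ) < N := by exact_mod_cast hN0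
      have h1 := intervalIntegral.integral_comp_mul_left (a := -(ε / ρ N)) (b := ε / ρ N)
        (fun y => g N y) hN.1.ne'
      have h2 : ρ N * -(ε / ρ N) = -ε := by
        have := hN.1.ne'
        field_simp
      have h3 : ρ N * (ε / ρ N) = ε := mul_div_cancel₀ _ hN.1.ne'
      rw [h2, h3] at h1
      have hle : -(ε / ρ N) ≤ ε / ρ N := by
        have := hN.1
        have : 0 < ε / ρ N := by positivity
        linarith
      rw [hF]
      simp only
      rw [integral_indicator measurableSet_Ioc, ← intervalIntegral.integral_of_le hle]
      have h4 : ∀ v : ℝ, Complex.exp (θ * Real.log (ρ N) +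
          phase α β (Complex.exp (Complex.I * τ N)) N (N - k N) (ρ N * (1 + Complex.I * v))) =
          ((ρ N ^ θ : ℝ) : ℂ) * g N (ρ N * v) := by
        intro v
        rw [Complex.exp_add, hg]
        simp only
        congr 2
        · rw [Real.rpow_def_of_pos hN.1]
          push_cast
          rw [mul_comm]
        · congr 1
          push_cast
          ring
      simp_rw [h4]
      rw [intervalIntegral.integral_const_mul, h1, Complex.real_smul, ← mul_assoc,
        ← Complex.ofReal_mul]
      congr 2
      rw [hρdef]
      simp only
      rw [← Real.rpow_neg_one, ← Real.rpow_mul hN'.le, ← Real.rpow_mul hN'.le,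
        ← Real.rpow_add hN']
      congr 1
      field_simp
      ring
    refine Tendsto.congr' hFint ?_
    refine tendsto_integral_filter_of_dominated_convergence (fun v => M * (1 + v ^ 2)⁻¹) ?_ ?_
      (integrable_inv_one_add_sq.const_mul M) ?_
    · filter_upwards [hρ] with N hN
      refine Measurable.aestronglyMeasurable ?_
      refine Measurable.indicator ?_ measurableSet_Ioc
      refine Continuous.measurable ?_
      have h1 : Continuous fun v : ℝ => phase α β (Complex.exp (Complex.I * τ N)) N (N - k N)
          ((ρ N : ℂ) + Complex.I * ((ρ N * v : ℝ) : ℂ)) :=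
        (continuous_phase_line hα hβ (hαs _ hN.1) (summable_mul_exp_neg hβ hβs hN.1.le) _ _ _).comp
          (continuous_const.mul continuous_id)
      have h2 : ∀ v : ℝ, (ρ N : ℂ) * (1 + Complex.I * v) =
          (ρ N : ℂ) + Complex.I * ((ρ N * v : ℝ) : ℂ) := by
        intro v
        push_cast
        ring
      simp_rw [h2]
      fun_prop
    · filter_upwards [hM, hρ, hρ0.eventually_lt_const (show 0 < δ / 2 by positivity)] with
        N hMN hN hNδ
      refine Eventually.of_forall fun v => ?_
      rw [hF]
      simp only
      by_cases hv : v ∈ Set.Ioc (-(ε / ρ N)) (ε / ρ N)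
      · rw [Set.indicator_of_mem hv]
        refine hMN (k N) (hk N) v ?_
        have h1 : |v| ≤ ε / ρ N := abs_le.2 ⟨hv.1.le, hv.2⟩
        rw [le_div_iff₀ hN.1] at h1
        have h2 : ‖(1 : ℂ) + Complex.I * v‖ ≤ 1 + |v| := by
          refine (norm_add_le _ _).trans ?_
          simp
        rw [norm_mul, Complex.norm_real, Real.norm_of_nonneg hN.1.le]
        nlinarith [mul_le_mul_of_nonneg_left h2 hN.1.le]
      · rw [Set.indicator_of_notMem hv, norm_zero]
        have h0 := hMN (k N) (hk N) 0 (by simpa [abs_of_pos hN.1] using by linarith)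
        have hM0 : 0 ≤ M := by
          have := (norm_nonneg _).trans h0
          simpa using this
        positivity
    · refine Eventually.of_forall fun v => ?_
      have h1 := tendsto_exp_rescaled hEβ hEα hτ0 hρ hρ0 hσ' hlog'
        (Eventually.of_forall hk) hkκ v
      refine h1.congr' ?_
      have h2 : ∀ᶠ N : ℕ in atTop, |v| < ε / ρ N := by
        have h3 : Tendsto (fun N => |v| * ρ N) atTop (𝓝 0) := by
          simpa using hρ0.const_mul |v|
        filter_upwards [h3.eventually_lt_const hε0, hρ] with N h hN
        rwa [lt_div_iff₀ hN.1]
      filter_upwards [h2] with N hN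
      rw [hF]
      simp only
      rw [Set.indicator_of_mem]
      have := abs_lt.1 hN
      exact ⟨this.1, this.2.le⟩
  have htot := (houter.add hinner).const_mul (1 / (2 * Real.pi) : ℂ)
  rw [zero_add, integral_const_mul] at htot
  have hval : (1 / (2 * Real.pi) : ℂ) * (Complex.exp C *
      ∫ v : ℝ, circleLimit θ A s (Complex.I * σ + κ) (1 + Complex.I * v)) =
      Complex.exp C / (2 * Real.pi) *
        ∫ v : ℝ, circleLimit θ A s (Complex.I * σ + κ) (1 + Complex.I * v) := by
    ring
  rw [hval] at htot
  refine htot.congr' ?_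
  filter_upwards [hρ] with N hN
  have hβe := summable_mul_exp_neg hβ hβs hN.1.le
  have hcont : Continuous (g N) := Complex.continuous_exp.comp
    (continuous_phase_line hα hβ (hαs _ hN.1) hβe _ _ _)
  have hI := integral_exp_phase hα hβ hα0 hβ0 (hαs _ hN.1) hβe (Complex.exp (Complex.I * τ N)) N
    (N - k N)
  have hsplit : (∫ y in (-Real.pi)..Real.pi, g N y) = (∫ y in (-Real.pi)..(-ε), g N y) +
      (∫ y in (-ε)..ε, g N y) + ∫ y in ε..Real.pi, g N y := by
    rw [intervalIntegral.integral_add_adjacent_intervals (hcont.intervalIntegrable _ _)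
      (hcont.intervalIntegrable _ _), intervalIntegral.integral_add_adjacent_intervals
      (hcont.intervalIntegrable _ _) (hcont.intervalIntegrable _ _)]
  rw [hsplit] at hI
  have hπC : (Real.pi : ℂ) ≠ 0 := by exact_mod_cast hπ.ne'
  rw [← mul_add, show (∫ y in (-Real.pi)..(-ε), g N y) + (∫ y in ε..Real.pi, g N y) +
    ∫ y in (-ε)..ε, g N y = (∫ y in (-Real.pi)..(-ε), g N y) +
      (∫ y in (-ε)..ε, g N y) + ∫ y in ε..Real.pi, g N y by ring, hI]
  field_simp

end

/-! ### Gamma integrals with a complex rate -/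

lemma integrableOn_rpow_mul_exp_neg {a ε : ℝ} (ha : 0 < a) (hε : 0 < ε) :
    IntegrableOn (fun t : ℝ => t ^ (a - 1) * Real.exp (-(ε * t))) (Set.Ioi 0) := by
  have := integrableOn_rpow_mul_exp_neg_mul_rpow (s := a - 1) (p := 1) (by linarith) one_pos hε
  refine this.congr_fun (fun t _ => ?_) measurableSet_Ioi
  simp

lemma norm_rpow_mul_cexp {a : ℝ} (r : ℂ) {t : ℝ} (ht : 0 < t) :
    ‖((t ^ (a - 1) : ℝ) : ℂ) * Complex.exp (-(r * t))‖ =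
      t ^ (a - 1) * Real.exp (-(r.re * t)) := by
  rw [norm_mul, Complex.norm_real, Real.norm_of_nonneg (by positivity), Complex.norm_exp]
  simp

lemma continuousOn_rpow_Ioi (a : ℝ) : ContinuousOn (fun t : ℝ => ((t ^ (a - 1) : ℝ) : ℂ))
    (Set.Ioi 0) :=
  Complex.continuous_ofReal.comp_continuousOn
    (fun _ ht => (Real.continuousAt_rpow_const _ _ (Or.inl (ne_of_gt ht))).continuousWithinAt)

lemma integrableOn_rpow_mul_cexp {a : ℝ} (ha : 0 < a) {r : ℂ} (hr : 0 < r.re) :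
    IntegrableOn (fun t : ℝ => ((t ^ (a - 1) : ℝ) : ℂ) * Complex.exp (-(r * t)))
      (Set.Ioi 0) := by
  refine Integrable.mono' (integrableOn_rpow_mul_exp_neg ha hr) ?_ ?_
  · exact ((continuousOn_rpow_Ioi a).mul (by fun_prop)).aestronglyMeasurable measurableSet_Ioi
  · refine (ae_restrict_iff' measurableSet_Ioi).2 (Eventually.of_forall fun t ht => ?_)
    exact (norm_rpow_mul_cexp r ht).le

/-- Both sides are holomorphic in the right half-plane and agree on the positive reals, where this
is Euler's integral; the identity theorem does the rest. -/
lemma integral_rpow_mul_cexp {a : ℝ} (ha : 0 < a) {r : ℂ} (hr : 0 < r.re) :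
    ∫ t in Set.Ioi (0 : ℝ), ((t ^ (a - 1) : ℝ) : ℂ) * Complex.exp (-(r * t)) =
      Real.Gamma a * Complex.exp (-(a * Complex.log r)) := by
  set F : ℂ → ℂ := fun r =>
    ∫ t in Set.Ioi (0 : ℝ), ((t ^ (a - 1) : ℝ) : ℂ) * Complex.exp (-(r * t)) with hF
  set U : Set ℂ := {r : ℂ | 0 < r.re} with hU
  have hUo : IsOpen U := isOpen_lt continuous_const Complex.continuous_re
  have hUc : IsPreconnected U := (convex_halfSpace_re_gt 0).isPreconnected
  have hFd : DifferentiableOn ℂ F U := by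
    intro r hr
    have hr' : 0 < r.re := hr
    refine DifferentiableAt.differentiableWithinAt ?_
    have hball : ∀ x ∈ Metric.ball r (r.re / 2), r.re / 2 < x.re := by
      intro x hx
      have h1 := (Complex.abs_re_le_norm (x - r)).trans_lt (mem_ball_iff_norm.1 hx)
      rw [Complex.sub_re] at h1
      linarith [(abs_lt.1 h1).1]
    have := hasDerivAt_integral_of_dominated_loc_of_deriv_le
      (μ := volume.restrict (Set.Ioi (0 : ℝ)))
      (F := fun (r : ℂ) (t : ℝ) => ((t ^ (a - 1) : ℝ) : ℂ) * Complex.exp (-(r * t)))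
      (F' := fun (r : ℂ) (t : ℝ) => ((t ^ (a - 1) : ℝ) : ℂ) * (Complex.exp (-(r * t)) * (-t)))
      (x₀ := r) (s := Metric.ball r (r.re / 2))
      (bound := fun t => t ^ ((a + 1) - 1) * Real.exp (-(r.re / 2 * t)))
      (Metric.ball_mem_nhds r (by positivity))
      (Eventually.of_forall fun x =>
        ((continuousOn_rpow_Ioi a).mul (by fun_prop)).aestronglyMeasurable measurableSet_Ioi)
      (integrableOn_rpow_mul_cexp ha hr)
      (((continuousOn_rpow_Ioi a).mul (by fun_prop)).aestronglyMeasurable measurableSet_Ioi)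
      ((ae_restrict_iff' measurableSet_Ioi).2 (Eventually.of_forall fun t ht x hx => by
        have ht' : (0 : ℝ) < t := ht
        rw [← mul_assoc, norm_mul, norm_rpow_mul_cexp x ht', norm_neg, Complex.norm_real,
          Real.norm_of_nonneg ht'.le, add_sub_cancel_right, mul_right_comm]
        have e : t ^ (a - 1) * t = t ^ a := by
          rw [Real.rpow_sub_one ht'.ne', div_mul_cancel₀ _ ht'.ne']
        rw [e]
        refine mul_le_mul_of_nonneg_left (Real.exp_le_exp.2 ?_) (by positivity)
        nlinarith [hball x hx]))
      (integrableOn_rpow_mul_exp_neg (by linarith) (by positivity))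
      ((ae_restrict_iff' measurableSet_Ioi).2 (Eventually.of_forall fun t ht x hx => by
        have h1 : HasDerivAt (fun r : ℂ => -(r * (t : ℂ))) (-(t : ℂ)) x := by
          have h2 : HasDerivAt (fun r : ℂ => -(r * (t : ℂ))) (-(1 * (t : ℂ))) x :=
            ((hasDerivAt_id x).mul_const (t : ℂ)).neg
          simpa only [one_mul] using h2
        exact (h1.cexp).const_mul _))
    exact this.2.differentiableAt
  have hGd : DifferentiableOn ℂ
      (fun r : ℂ => (Real.Gamma a : ℂ) * Complex.exp (-(a * Complex.log r))) U := by
    intro r hr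
    have : r ∈ Complex.slitPlane := Or.inl hr
    have h1 := (Complex.differentiableAt_log this)
    exact (((h1.const_mul (a : ℂ)).neg.cexp).const_mul _).differentiableWithinAt
  have hreal : ∀ x : ℝ, 0 < x →
      F x = (Real.Gamma a : ℂ) * Complex.exp (-(a * Complex.log x)) := by
    intro x hx
    have h := Real.integral_rpow_mul_exp_neg_mul_Ioi ha hx
    have h2 : F x = ((∫ t in Set.Ioi (0 : ℝ), t ^ (a - 1) * Real.exp (-(x * t)) : ℝ) : ℂ) := by
      rw [hF, ← integral_complex_ofReal]
      simp only
      refine integral_congr_ae (Eventually.of_forall fun t => ?_)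
      push_cast
      rfl
    rw [h2, h, one_div, Real.inv_rpow hx.le, ← Real.rpow_neg hx.le, Real.rpow_def_of_pos hx]
    push_cast
    rw [mul_comm]
    congr 2
    rw [Complex.ofReal_log hx.le]
    ring
  have hfreq : ∃ᶠ z in 𝓝[≠] (1 : ℂ),
      F z = (Real.Gamma a : ℂ) * Complex.exp (-(a * Complex.log z)) := by
    have ht : Tendsto (fun n : ℕ => ((1 + 1 / ((n : ℝ) + 1) : ℝ) : ℂ)) atTop (𝓝[≠] (1 : ℂ)) := by
      refine tendsto_nhdsWithin_iff.2 ⟨?_, Eventually.of_forall fun n => ?_⟩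
      · have h1 : Tendsto (fun n : ℕ => (1 + 1 / ((n : ℝ) + 1) : ℝ)) atTop (𝓝 (1 + 0)) :=
          tendsto_one_div_add_atTop_nhds_zero_nat.const_add 1
        have := (Complex.continuous_ofReal.tendsto _).comp h1
        simpa [Function.comp_def] using this
      · simp only [Set.mem_compl_iff, Set.mem_singleton_iff]
        intro h
        have h2 : (1 + 1 / ((n : ℝ) + 1) : ℝ) = 1 := by exact_mod_cast h
        have : 0 < 1 / ((n : ℝ) + 1) := by positivity
        linarith
    refine ht.frequently (Eventually.of_forall fun n => ?_).frequently
    exact hreal _ (by positivity)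
  exact (hFd.analyticOnNhd hUo).eqOn_of_preconnected_of_frequently_eq (hGd.analyticOnNhd hUo)
    hUc (show (1 : ℂ) ∈ U by simp [hU]) hfreq hr

/-! ### The limit integrals -/

/-- Since s > 1, a linear decay of any rate can be extracted from A x^s, uniformly in the strip 0 ≤
Re x ≤ 1. This gives integrability on vertical lines and lets them be moved to the imaginary axis.
-/
lemma exists_re_mul_cpow_le {s A : ℝ} (hs : 1 < s) (hs2 : s ≤ 2) (hA : 0 < A) (a : ℝ) :
    ∃ M : ℝ, ∀ x : ℂ, 0 ≤ x.re → x.re ≤ 1 → ((A : ℂ) * x ^ (s : ℂ)).re ≤ M - a * ‖x‖ := by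
  have hπ := Real.pi_pos
  have hs0 : 0 < s := by linarith
  have hcos : Real.cos (s * (Real.pi / 2)) < 0 :=
    Real.cos_neg_of_pi_div_two_lt_of_lt (by nlinarith) (by nlinarith)
  obtain ⟨M, hM⟩ := exists_linear_sub_rpow_le hs
    (show 0 < -(A * Real.cos (s * (Real.pi / 2))) by nlinarith) (A * (s * (Real.pi / 2)) + a)
  refine ⟨max M (A + |a|), fun x h0 h1 => ?_⟩
  rw [Complex.re_ofReal_mul]
  rcases lt_or_ge ‖x‖ 1 with hx | hx
  · have h2 : (x ^ (s : ℂ)).re ≤ 1 := by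
      refine (Complex.re_le_norm _).trans ?_
      rw [Complex.norm_cpow_real]
      exact Real.rpow_le_one (norm_nonneg _) hx.le hs0.le
    have h3 : a * ‖x‖ ≤ |a| := by
      calc a * ‖x‖ ≤ |a| * ‖x‖ := mul_le_mul_of_nonneg_right (le_abs_self a) (norm_nonneg _)
        _ ≤ |a| * 1 := mul_le_mul_of_nonneg_left hx.le (abs_nonneg a)
        _ = |a| := mul_one _
    have := le_max_right M (A + |a|)
    nlinarith
  · have hx0 : x ≠ 0 := norm_pos_iff.1 (by linarith)
    have h2 := mul_le_mul_of_nonneg_left (re_cpow_le hx0 h0 hs0) hA.le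
    have h3 : ‖x‖ ^ (s - 1) ≤ ‖x‖ := by
      conv_rhs => rw [← Real.rpow_one ‖x‖]
      exact Real.rpow_le_rpow_of_exponent_le hx (by linarith)
    have h4 : s * (Real.pi / 2) * x.re * ‖x‖ ^ (s - 1) ≤ s * (Real.pi / 2) * ‖x‖ := by
      calc s * (Real.pi / 2) * x.re * ‖x‖ ^ (s - 1) ≤ s * (Real.pi / 2) * 1 * ‖x‖ := by gcongr
        _ = _ := by ring
    have h5 := mul_le_mul_of_nonneg_left h4 hA.le
    have h6 := hM ‖x‖ (norm_nonneg _)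
    have := le_max_left M (A + |a|)
    nlinarith

lemma one_le_norm_one_add (v : ℝ) : 1 ≤ ‖(1 : ℂ) + Complex.I * v‖ := by
  have := Complex.abs_re_le_norm (1 + Complex.I * v)
  simpa using this

lemma exp_neg_two_mul_norm_le (v : ℝ) :
    Real.exp (-(2 * ‖(1 : ℂ) + Complex.I * v‖)) ≤ (1 + v ^ 2)⁻¹ := by
  have hxsq : ‖(1 : ℂ) + Complex.I * v‖ ^ 2 = 1 + v ^ 2 := by
    rw [Complex.sq_norm, Complex.normSq_apply]
    simp
    ring
  rw [← hxsq, Real.exp_neg]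
  have h1 := one_le_norm_one_add v
  refine inv_anti₀ (by positivity) ?_
  have : ‖(1 : ℂ) + Complex.I * v‖ ≤ Real.exp ‖(1 : ℂ) + Complex.I * v‖ := by
    linarith [Real.add_one_le_exp ‖(1 : ℂ) + Complex.I * v‖]
  calc ‖(1 : ℂ) + Complex.I * v‖ ^ 2 ≤ Real.exp ‖(1 : ℂ) + Complex.I * v‖ ^ 2 := by gcongr
    _ = _ := by rw [← Real.exp_nat_mul]; norm_num

lemma continuous_circleLimit (θ A s : ℝ) (q : ℂ) :
    Continuous fun v : ℝ => circleLimit θ A s q (1 + Complex.I * v) := by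
  unfold circleLimit
  have hsl : ∀ v : ℝ, (1 : ℂ) + Complex.I * v ∈ Complex.slitPlane := fun v => Or.inl (by simp)
  have h1 : Continuous fun v : ℝ => (1 : ℂ) + Complex.I * v := by fun_prop
  have h2 : Continuous fun v : ℝ => Complex.log (1 + Complex.I * v) := h1.clog hsl
  have h3 : Continuous fun v : ℝ => ((1 : ℂ) + Complex.I * v) ^ (s : ℂ) :=
    h1.cpow continuous_const hsl
  fun_prop

lemma integrable_circleLimit_zero {s A : ℝ} (hs : 1 < s) (hs2 : s ≤ 2) (hA : 0 < A) (q : ℂ) :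
    Integrable fun v : ℝ => circleLimit 0 A s q (1 + Complex.I * v) := by
  obtain ⟨M, hM⟩ := exists_re_mul_cpow_le hs hs2 hA (‖q‖ + 2)
  refine Integrable.mono' (integrable_inv_one_add_sq.const_mul (Real.exp M))
    (continuous_circleLimit _ _ _ _).aestronglyMeasurable (Eventually.of_forall fun v => ?_)
  have h1 := hM (1 + Complex.I * v) (by simp) (by simp)
  have h2 : -(q * (1 + Complex.I * v)).re ≤ ‖q‖ * ‖(1 : ℂ) + Complex.I * v‖ := by
    rw [← norm_mul, ← Complex.neg_re, ← norm_neg]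
    exact Complex.re_le_norm _
  rw [circleLimit, Complex.norm_exp]
  refine le_trans (Real.exp_le_exp.2 (?_ : _ ≤ M + -(2 * ‖(1 : ℂ) + Complex.I * v‖))) ?_
  · simp only [Complex.ofReal_zero, zero_mul, neg_zero, zero_add, Complex.sub_re]
    linarith
  · rw [Real.exp_add]
    exact mul_le_mul_of_nonneg_left (exp_neg_two_mul_norm_le v) (Real.exp_pos _).le

lemma circleLimit_zero_add (A s : ℝ) (q : ℂ) (y : ℝ) (x : ℂ) :
    circleLimit 0 A s (q + y) x = circleLimit 0 A s q x * Complex.exp (-(x * y)) := by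
  rw [circleLimit, circleLimit, ← Complex.exp_add]
  congr 1
  ring

/-- The factor `x^{-θ}` as a mixture of exponentials. -/
lemma integral_circleLimit_eq {s A θ : ℝ} (hs : 1 < s) (hs2 : s ≤ 2) (hA : 0 < A) (hθ : 0 < θ)
    (q : ℂ) :
    (Real.Gamma θ : ℂ) * ∫ v : ℝ, circleLimit θ A s q (1 + Complex.I * v) =
      ∫ y in Set.Ioi (0 : ℝ), ((y ^ (θ - 1) : ℝ) : ℂ) *
        ∫ v : ℝ, circleLimit 0 A s (q + y) (1 + Complex.I * v) := by
  -- On Re x = 1 the modulus of e^{-xy} is e^{-y}, so the double integrand is dominated by a product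
  -- of integrable functions and Fubini applies.
  have hswap := integral_integral_swap (μ := volume) (ν := volume.restrict (Set.Ioi (0 : ℝ)))
    (f := fun (v y : ℝ) => circleLimit 0 A s q (1 + Complex.I * v) *
      (((y ^ (θ - 1) : ℝ) : ℂ) * Complex.exp (-((1 + Complex.I * v) * y)))) (by
      have hint := (integrable_circleLimit_zero hs hs2 hA q).mul_prod
        (show Integrable (fun y : ℝ => ((y ^ (θ - 1) : ℝ) : ℂ) * Complex.exp (-((1 : ℂ) * y)))
          (volume.restrict (Set.Ioi (0 : ℝ))) from
          integrableOn_rpow_mul_cexp hθ (by simp))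
      refine hint.mono ?_ (Eventually.of_forall fun p => ?_)
      · have hm : Measurable fun p : ℝ × ℝ => circleLimit 0 A s q (1 + Complex.I * p.1) :=
          (continuous_circleLimit 0 A s q).measurable.comp measurable_fst
        refine Measurable.aestronglyMeasurable ?_
        refine hm.mul (Measurable.mul ?_ ?_)
        · exact Complex.measurable_ofReal.comp (measurable_snd.pow_const _)
        · exact Continuous.measurable (by fun_prop)
      · simp only [Function.uncurry, norm_mul, Complex.norm_exp]
        simp)
  have h1 : ∀ v : ℝ, ∫ y in Set.Ioi (0 : ℝ), circleLimit 0 A s q (1 + Complex.I * v) *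
      (((y ^ (θ - 1) : ℝ) : ℂ) * Complex.exp (-((1 + Complex.I * v) * y))) =
      Real.Gamma θ * circleLimit θ A s q (1 + Complex.I * v) := by
    intro v
    rw [integral_const_mul, integral_rpow_mul_cexp hθ (by simp), mul_left_comm, circleLimit,
      circleLimit, ← Complex.exp_add]
    congr 2
    push_cast
    ring
  simp_rw [h1] at hswap
  rw [integral_const_mul] at hswap
  rw [hswap]
  refine integral_congr_ae (Eventually.of_forall fun y => ?_)
  simp only
  rw [← integral_const_mul]
  refine integral_congr_ae (Eventually.of_forall fun v => ?_)
  simp only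
  rw [circleLimit_zero_add]
  ring

/-- The Gaussian case. -/
lemma integral_circleLimit_two {A : ℝ} (hA : 0 < A) (q : ℂ) :
    ∫ v : ℝ, circleLimit 0 A 2 q (1 + Complex.I * v) =
      (Real.pi / A : ℂ) ^ (1 / 2 : ℂ) * Complex.exp (-(q ^ 2 / (4 * A))) := by
  have hAC : (A : ℂ) ≠ 0 := by exact_mod_cast hA.ne'
  -- On x = 1 + iv the exponent A x² - qx equals -Av² + i(2A - q)v + (A - q).
  have h := integral_cexp_quadratic (b := -(A : ℂ)) (by simpa using hA)
    (Complex.I * (2 * A - q)) (A - q)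
  have e : ∀ v : ℝ, circleLimit 0 A 2 q (1 + Complex.I * v) =
      Complex.exp (-(A : ℂ) * v ^ 2 + Complex.I * (2 * A - q) * v + (A - q)) := by
    intro v
    have h2 : ((2 : ℝ) : ℂ) = ((2 : ℕ) : ℂ) := by norm_num
    rw [circleLimit, h2, Complex.cpow_natCast]
    congr 1
    push_cast
    linear_combination (A * (v : ℂ) ^ 2) * Complex.I_sq
  simp_rw [e]
  rw [h, neg_neg]
  congr 2
  field_simp
  linear_combination ((2 * A - q) ^ 2) * Complex.I_sq

/-! ### Nonvanishing of the limit integrals for s < 2. -/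

section

variable {s A : ℝ}

lemma continuousOn_exp_mul_cpow (hs : 0 < s) (A : ℝ) :
    ContinuousOn (fun x : ℂ => Complex.exp (A * x ^ (s : ℂ))) {x : ℂ | 0 ≤ x.re} := by
  intro x hx
  refine ContinuousAt.continuousWithinAt ?_
  have h1 : ContinuousAt (fun p : ℂ × ℂ => p.1 ^ p.2) (x, (s : ℂ)) :=
    Complex.continuousAt_cpow_of_re_pos (Or.inl hx) (by simpa using hs)
  have h2 : ContinuousAt (fun x : ℂ => x ^ (s : ℂ)) x :=
    ContinuousAt.comp (f := fun x : ℂ => (x, (s : ℂ))) h1 (by fun_prop)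
  exact (continuousAt_const.mul h2).cexp

/-- Cauchy's theorem on the rectangle with vertices ±iT and 1 ± iT, whose horizontal sides decay
like e^{-2T}. The branch point 0 of x^s lies on the boundary, so the version with continuity on the
closed rectangle and holomorphy inside is used. -/
lemma integral_line_shift (hs : 1 < s) (hs2 : s ≤ 2) (hA : 0 < A) :
    Integrable (fun v : ℝ => Complex.exp (A * (Complex.I * v) ^ (s : ℂ))) ∧
    ∫ v : ℝ, circleLimit 0 A s 0 (1 + Complex.I * v) =
      ∫ v : ℝ, Complex.exp (A * (Complex.I * v) ^ (s : ℂ)) := by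
  set f : ℂ → ℂ := fun x => Complex.exp (A * x ^ (s : ℂ)) with hf
  have hfc := continuousOn_exp_mul_cpow (by linarith : 0 < s) A
  obtain ⟨M, hM⟩ := exists_re_mul_cpow_le hs hs2 hA 2
  have hfn : ∀ x : ℂ, 0 ≤ x.re → x.re ≤ 1 → ‖f x‖ ≤ Real.exp (M - 2 * ‖x‖) := by
    intro x h0 h1
    rw [hf, Complex.norm_exp]
    exact Real.exp_le_exp.2 (hM x h0 h1)
  have hcont0 : Continuous fun v : ℝ => f (Complex.I * v) := by
    refine hfc.comp_continuous (by fun_prop) fun v => ?_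
    show 0 ≤ (Complex.I * v).re
    simp
  have hint0 : Integrable fun v : ℝ => f (Complex.I * v) := by
    refine Integrable.mono' (integrable_inv_one_add_sq.const_mul (Real.exp (M + 2)))
      hcont0.aestronglyMeasurable (Eventually.of_forall fun v => ?_)
    refine (hfn _ (by simp) (by simp)).trans ?_
    have h3 : ‖(1 : ℂ) + Complex.I * v‖ ≤ 1 + ‖Complex.I * (v : ℂ)‖ := by
      refine (norm_add_le _ _).trans ?_
      simp
    refine le_trans (Real.exp_le_exp.2
      (?_ : _ ≤ (M + 2) + -(2 * ‖(1 : ℂ) + Complex.I * v‖))) ?_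
    · linarith
    · rw [Real.exp_add]
      exact mul_le_mul_of_nonneg_left (exp_neg_two_mul_norm_le v) (Real.exp_pos _).le
  refine ⟨hint0, ?_⟩
  have hint1 := integrable_circleLimit_zero hs hs2 hA 0
  have hrw : ∀ v : ℝ, circleLimit 0 A s 0 (1 + Complex.I * v) = f (1 + Complex.I * v) := by
    intro v
    rw [circleLimit, hf]
    simp
  simp_rw [hrw] at hint1 ⊢
  have hT : Tendsto (fun n : ℕ => (n : ℝ)) atTop atTop := tendsto_natCast_atTop_atTop
  have l1 := intervalIntegral_tendsto_integral hint1 (tendsto_neg_atTop_atBot.comp hT) hT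
  have l0 := intervalIntegral_tendsto_integral hint0 (tendsto_neg_atTop_atBot.comp hT) hT
  refine tendsto_nhds_unique l1 ?_
  have hhor : ∀ T : ℝ, ‖∫ x in (0 : ℝ)..1, f ((x : ℂ) + (T : ℂ) * Complex.I)‖ ≤
      Real.exp (M - 2 * |T|) := by
    intro T
    have := intervalIntegral.norm_integral_le_of_norm_le_const (a := (0 : ℝ)) (b := 1)
      (C := Real.exp (M - 2 * |T|)) (f := fun x : ℝ => f ((x : ℂ) + (T : ℂ) * Complex.I))
      (fun x hx => by
        rw [Set.uIoc_of_le zero_le_one] at hx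
        refine (hfn _ (by simpa using hx.1.le) (by simpa using hx.2)).trans
          (Real.exp_le_exp.2 ?_)
        have := Complex.abs_im_le_norm ((x : ℂ) + (T : ℂ) * Complex.I)
        simp only [Complex.add_im, Complex.ofReal_im, Complex.mul_im, Complex.ofReal_re,
          Complex.I_im, Complex.I_re, mul_one, mul_zero, add_zero, zero_add] at this
        linarith)
    simpa using this
  have hrect : ∀ T : ℝ, 0 ≤ T → Complex.I • (∫ y in (-T)..T, f (1 + Complex.I * y)) -
      Complex.I • (∫ y in (-T)..T, f (Complex.I * y)) =
      (∫ x in (0 : ℝ)..1, f ((x : ℂ) + (T : ℂ) * Complex.I)) -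
        ∫ x in (0 : ℝ)..1, f ((x : ℂ) + ((-T : ℝ) : ℂ) * Complex.I) := by
    intro T hT0
    have h := Complex.integral_boundary_rect_eq_zero_of_continuousOn_of_differentiableOn f
      ⟨0, -T⟩ ⟨1, T⟩ (hfc.mono (by
        intro x hx
        have := hx.1
        simp only [Set.mem_preimage, Set.uIcc_of_le (zero_le_one' ℝ)] at this
        exact this.1)) (by
        intro x hx
        have h0 := hx.1
        simp only [Set.mem_preimage, min_eq_left (zero_le_one' ℝ)] at h0
        have hsl : x ∈ Complex.slitPlane := Or.inl h0.1
        refine DifferentiableAt.differentiableWithinAt ?_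
        exact (((differentiableAt_id.cpow (differentiableAt_const _) hsl).const_mul _).cexp))
    simp only [Complex.ofReal_zero, zero_add, Complex.ofReal_one] at h
    simp_rw [mul_comm Complex.I]
    linear_combination h
  have hzero : Tendsto (fun n : ℕ => (∫ y in (-(n : ℝ))..n, f (1 + Complex.I * y)) -
      ∫ y in (-(n : ℝ))..n, f (Complex.I * y)) atTop (𝓝 0) := by
    have hlim : Tendsto (fun n : ℕ => 2 * Real.exp (M - 2 * |(n : ℝ)|)) atTop (𝓝 0) := by
      have h1 : Tendsto (fun n : ℕ => M - 2 * |(n : ℝ)|) atTop atBot := by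
        have h2 : Tendsto (fun n : ℕ => -(2 * (n : ℝ)) + M) atTop atBot :=
          tendsto_atBot_add_const_right _ _
            (tendsto_neg_atTop_atBot.comp (hT.const_mul_atTop two_pos))
        refine h2.congr fun n => ?_
        rw [abs_of_nonneg (Nat.cast_nonneg n)]
        ring
      have := (Real.tendsto_exp_atBot.comp h1).const_mul 2
      simpa using this
    refine squeeze_zero_norm (fun n => ?_) hlim
    have h := hrect n (Nat.cast_nonneg n)
    rw [← smul_sub] at h
    have h2 : ‖Complex.I • ((∫ y in (-(n : ℝ))..n, f (1 + Complex.I * y)) -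
      ∫ y in (-(n : ℝ))..n, f (Complex.I * y))‖ = ‖(∫ y in (-(n : ℝ))..n, f (1 + Complex.I * y)) -
      ∫ y in (-(n : ℝ))..n, f (Complex.I * y)‖ := by
      rw [norm_smul, Complex.norm_I, one_mul]
    rw [← h2, h]
    refine (norm_sub_le _ _).trans ?_
    have e1 := hhor n
    have e2 := hhor (-n)
    rw [abs_neg] at e2
    linarith
  have := hzero.add l0
  rw [zero_add] at this
  refine this.congr fun n => ?_
  simp only [Function.comp]
  ring

lemma I_mul_ofReal_cpow {v : ℝ} (hv : 0 < v) (s : ℝ) :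
    (Complex.I * v) ^ (s : ℂ) =
      ((v ^ s : ℝ) : ℂ) * Complex.exp (((s * (Real.pi / 2) : ℝ) : ℂ) * Complex.I) := by
  rw [mul_comm, ofReal_mul_cpow hv Complex.I_ne_zero, Complex.cpow_def_of_ne_zero Complex.I_ne_zero,
    Complex.log_I]
  congr 2
  push_cast
  ring

/-- The substitution y = v^s turns the integral into (1/s) Γ(1/s) r^{-1/s} with r = -A e^{isπ/2}.
Here |arg r| < π/2 and 1/s ≤ 1, so the power stays in the right half-plane. -/
lemma re_integral_Ioi_pos (hs : 1 < s) (hs2 : s < 2) (hA : 0 < A) :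
    0 < (∫ v in Set.Ioi (0 : ℝ), Complex.exp (A * (Complex.I * v) ^ (s : ℂ))).re := by
  have hπ := Real.pi_pos
  have hs0 : 0 < s := by linarith
  set r : ℂ := -((A : ℂ) * Complex.exp (((s * (Real.pi / 2) : ℝ) : ℂ) * Complex.I)) with hr
  have hrre : 0 < r.re := by
    rw [hr, Complex.neg_re, Complex.re_ofReal_mul, Complex.exp_ofReal_mul_I_re]
    have : Real.cos (s * (Real.pi / 2)) < 0 :=
      Real.cos_neg_of_pi_div_two_lt_of_lt (by nlinarith) (by nlinarith)
    nlinarith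
  have h1 := integral_comp_rpow_Ioi_of_pos
    (g := fun y : ℝ => ((y ^ (1 / s - 1) : ℝ) : ℂ) * Complex.exp (-(r * y))) hs0
  rw [integral_rpow_mul_cexp (by positivity : 0 < 1 / s) hrre] at h1
  have h2 : ∫ v in Set.Ioi (0 : ℝ), (s * v ^ (s - 1)) •
      ((((v ^ s) ^ (1 / s - 1) : ℝ) : ℂ) * Complex.exp (-(r * (v ^ s : ℝ)))) =
      s * ∫ v in Set.Ioi (0 : ℝ), Complex.exp (A * (Complex.I * v) ^ (s : ℂ)) := by
    rw [← integral_const_mul]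
    refine setIntegral_congr_fun measurableSet_Ioi fun v hv => ?_
    have hv' : (0 : ℝ) < v := hv
    rw [I_mul_ofReal_cpow hv', Complex.real_smul, ← mul_assoc, ← Complex.ofReal_mul]
    have e1 : s * v ^ (s - 1) * (v ^ s) ^ (1 / s - 1) = s := by
      rw [← Real.rpow_mul hv'.le, mul_assoc, ← Real.rpow_add hv']
      have : s - 1 + s * (1 / s - 1) = 0 := by field_simp; ring
      rw [this, Real.rpow_zero, mul_one]
    rw [e1]
    congr 2
    rw [hr]
    ring
  rw [h2] at h1
  have h3 : 0 < ((s : ℂ) *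
      ∫ v in Set.Ioi (0 : ℝ), Complex.exp (A * (Complex.I * v) ^ (s : ℂ))).re := by
    rw [h1, Complex.re_ofReal_mul, Complex.exp_re]
    refine mul_pos (Real.Gamma_pos_of_pos (by positivity)) (mul_pos (Real.exp_pos _) ?_)
    have harg : |r.arg| < Real.pi / 2 := Complex.abs_arg_lt_pi_div_two_iff.2 (Or.inl hrre)
    rw [Complex.neg_im, Complex.im_ofReal_mul, Complex.log_im, Real.cos_neg]
    have hs1 : 1 / s ≤ 1 := by rw [div_le_one hs0]; exact hs.le
    have h4 : |1 / s * r.arg| < Real.pi / 2 := by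
      rw [abs_mul, abs_of_pos (by positivity : 0 < 1 / s)]
      calc 1 / s * |r.arg| ≤ 1 * |r.arg| := mul_le_mul_of_nonneg_right hs1 (abs_nonneg _)
        _ < _ := by rw [one_mul]; exact harg
    exact Real.cos_pos_of_mem_Ioo ⟨(abs_lt.1 h4).1, (abs_lt.1 h4).2⟩
  rw [Complex.re_ofReal_mul] at h3
  exact pos_of_mul_pos_right h3 hs0.le

/-- After the shift to the imaginary axis the two half-lines contribute complex conjugates, so the
integral is twice the positive real part found in `re_integral_Ioi_pos`. -/
lemma integral_circleLimit_zero_ne_zero (hs : 1 < s) (hs2 : s < 2) (hA : 0 < A) :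
    ∫ v : ℝ, circleLimit 0 A s 0 (1 + Complex.I * v) ≠ 0 := by
  obtain ⟨hint, heq⟩ := integral_line_shift hs hs2.le hA
  rw [heq]
  have hpos := re_integral_Ioi_pos hs hs2 hA
  intro h0
  have hsplit := intervalIntegral.integral_Iic_add_Ioi (b := (0 : ℝ)) hint.integrableOn
    hint.integrableOn
  have hneg := integral_comp_neg_Ioi 0 fun v : ℝ => Complex.exp (A * (Complex.I * v) ^ (s : ℂ))
  rw [neg_zero] at hneg
  have hconj : ∫ v in Set.Ioi (0 : ℝ), Complex.exp (A * (Complex.I * ((-v : ℝ) : ℂ)) ^ (s : ℂ)) =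
      (starRingEnd ℂ) (∫ v in Set.Ioi (0 : ℝ), Complex.exp (A * (Complex.I * v) ^ (s : ℂ))) := by
    rw [← integral_conj]
    refine setIntegral_congr_fun measurableSet_Ioi fun v hv => ?_
    have hv' : (0 : ℝ) < v := hv
    rw [← Complex.exp_conj, map_mul, Complex.conj_ofReal]
    congr 2
    have harg : (Complex.I * ((-v : ℝ) : ℂ)).arg ≠ Real.pi := by
      intro h
      have := (Complex.arg_eq_pi_iff.1 h).1
      simp at this
    have h := Complex.cpow_conj (Complex.I * ((-v : ℝ) : ℂ)) (s : ℂ) harg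
    rw [Complex.conj_ofReal] at h
    rw [h, map_mul, Complex.conj_I, Complex.conj_ofReal]
    congr 2
    push_cast
    ring
  rw [h0, ← hneg, hconj] at hsplit
  have := congrArg Complex.re hsplit
  rw [Complex.add_re, Complex.conj_re, Complex.zero_re] at this
  linarith

lemma continuous_integral_circleLimit (hs : 1 < s) (hs2 : s ≤ 2) (hA : 0 < A) :
    ContinuousOn (fun y : ℝ => ∫ v : ℝ, circleLimit 0 A s (y : ℂ) (1 + Complex.I * v))
      (Set.Ici 0) := by
  have h0 := integrable_circleLimit_zero hs hs2 hA 0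
  have hrw : ∀ (y v : ℝ), circleLimit 0 A s (y : ℂ) (1 + Complex.I * v) =
      circleLimit 0 A s 0 (1 + Complex.I * v) * Complex.exp (-((1 + Complex.I * v) * y)) := by
    intro y v
    rw [← circleLimit_zero_add, zero_add]
  refine continuousOn_of_dominated (bound := fun v : ℝ => ‖circleLimit 0 A s 0 (1 + Complex.I * v)‖)
    ?_ ?_ h0.norm ?_
  · exact fun y _ => (continuous_circleLimit _ _ _ _).aestronglyMeasurable
  · intro y hy
    refine Eventually.of_forall fun v => ?_
    rw [hrw, norm_mul, Complex.norm_exp]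
    refine mul_le_of_le_one_right (norm_nonneg _) (Real.exp_le_one_iff.2 ?_)
    have : (0 : ℝ) ≤ y := hy
    simpa using this
  · refine Eventually.of_forall fun v => ?_
    simp_rw [hrw]
    exact Continuous.continuousOn (by fun_prop)

/-- For θ > 0 the integral is, up to Γ(θ), a mixture with weight y^{θ-1} of the integrals for θ = 0
and q = y. These are nonnegative by `hP`, continuous in y and positive at y = 0, so the mixture is
positive. -/
lemma integral_circleLimit_ne_zero (hs : 1 < s) (hs2 : s < 2) (hA : 0 < A) {θ : ℝ} (hθ : 0 ≤ θ)
    (hP : ∀ y : ℝ, 0 ≤ y → ∃ p : ℝ, 0 ≤ p ∧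
      ∫ v : ℝ, circleLimit 0 A s (y : ℂ) (1 + Complex.I * v) = p) :
    ∫ v : ℝ, circleLimit θ A s 0 (1 + Complex.I * v) ≠ 0 := by
  rcases hθ.eq_or_lt with rfl | hθ
  · exact integral_circleLimit_zero_ne_zero hs hs2 hA
  intro hzero
  have h := integral_circleLimit_eq hs hs2.le hA hθ 0
  rw [hzero, mul_zero] at h
  set p : ℝ → ℝ := fun y => (∫ v : ℝ, circleLimit 0 A s (y : ℂ) (1 + Complex.I * v)).re with hp
  have hpc : ContinuousOn p (Set.Ici 0) :=
    Complex.continuous_re.comp_continuousOn (continuous_integral_circleLimit hs hs2.le hA)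
  have hpv : ∀ y : ℝ, 0 ≤ y → ∫ v : ℝ, circleLimit 0 A s (y : ℂ) (1 + Complex.I * v) = p y ∧
      0 ≤ p y := by
    intro y hy
    obtain ⟨q, hq0, hq⟩ := hP y hy
    rw [hp]
    simp only [hq, Complex.ofReal_re]
    exact ⟨trivial, hq0⟩
  have hp0 : 0 < p 0 := by
    refine lt_of_le_of_ne (hpv 0 le_rfl).2 fun h0 => ?_
    have h1 := (hpv 0 le_rfl).1
    rw [← h0, Complex.ofReal_zero] at h1
    exact integral_circleLimit_zero_ne_zero hs hs2 hA h1
  have hint : IntegrableOn (fun y : ℝ => y ^ (θ - 1) * p y) (Set.Ioi 0) := by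
    refine Integrable.mono' ((integrableOn_rpow_mul_exp_neg hθ one_pos).mul_const
      (∫ v : ℝ, ‖circleLimit 0 A s 0 (1 + Complex.I * v)‖)) ?_ ?_
    · refine ContinuousOn.aestronglyMeasurable ?_ measurableSet_Ioi
      refine ContinuousOn.mul ?_ (hpc.mono Set.Ioi_subset_Ici_self)
      exact fun t ht => (Real.continuousAt_rpow_const _ _ (Or.inl (ne_of_gt ht))).continuousWithinAt
    · refine (ae_restrict_iff' measurableSet_Ioi).2 (Eventually.of_forall fun y hy => ?_)
      have hy' : (0 : ℝ) < y := hy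
      rw [norm_mul, Real.norm_of_nonneg (by positivity : 0 ≤ y ^ (θ - 1)), mul_assoc]
      refine mul_le_mul_of_nonneg_left ?_ (by positivity)
      rw [hp, Real.norm_eq_abs]
      refine (Complex.abs_re_le_norm _).trans ((norm_integral_le_integral_norm _).trans ?_)
      rw [← integral_const_mul]
      refine le_of_eq (integral_congr_ae (Eventually.of_forall fun v => ?_))
      have : circleLimit 0 A s (y : ℂ) (1 + Complex.I * v) =
          circleLimit 0 A s 0 (1 + Complex.I * v) * Complex.exp (-((1 + Complex.I * v) * y)) := by
        rw [← circleLimit_zero_add, zero_add]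
      simp only
      rw [this, norm_mul, Complex.norm_exp, mul_comm]
      simp
  have hreal : ∫ y in Set.Ioi (0 : ℝ), y ^ (θ - 1) * p y = 0 := by
    have h2 : ((∫ y in Set.Ioi (0 : ℝ), y ^ (θ - 1) * p y : ℝ) : ℂ) = 0 := by
      rw [← integral_complex_ofReal, h]
      refine setIntegral_congr_fun measurableSet_Ioi fun y hy => ?_
      rw [zero_add, (hpv y (le_of_lt hy)).1]
      push_cast
      rfl
    exact_mod_cast h2
  have hpos := (setIntegral_pos_iff_support_of_nonneg_ae ((ae_restrict_iff' measurableSet_Ioi).2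
    (Eventually.of_forall fun y hy => by
      have hy' : (0 : ℝ) < y := hy
      have := (hpv y hy'.le).2
      show 0 ≤ y ^ (θ - 1) * p y
      positivity)) hint).2 (by
    obtain ⟨ε, hε, hεp⟩ := Metric.mem_nhdsWithin_iff.1
      ((hpc 0 Set.self_mem_Ici).eventually_const_lt hp0)
    refine lt_of_lt_of_le (?_ : 0 < volume (Set.Ioo (0 : ℝ) ε)) (measure_mono fun y hy => ?_)
    · rw [Real.volume_Ioo]
      simpa using hε
    · have hy0 : 0 < p y := hεp ⟨by
        rw [Metric.mem_ball, dist_zero_right, Real.norm_of_nonneg hy.1.le]; exact hy.2, hy.1.le⟩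
      refine ⟨?_, hy.1⟩
      rw [Function.mem_support]
      have := Real.rpow_pos_of_pos hy.1 (θ - 1)
      positivity)
  rw [hreal] at hpos
  exact lt_irrefl _ hpos

end

/-! ### From coefficient asymptotics to limit laws -/

lemma div_sqrt_mul_eq (t v : ℝ) (N : ℕ) :
    t / Real.sqrt (N * v) = t / Real.sqrt v * (N : ℝ) ^ (-(1 / 2) : ℝ) := by
  rw [Real.sqrt_mul (Nat.cast_nonneg N), Real.rpow_neg (Nat.cast_nonneg N), ← Real.sqrt_eq_rpow]
  rw [div_mul_eq_div_div_swap, div_eq_mul_inv (t / _)]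

lemma natCast_mul_div_sqrt_sq {v : ℝ} (hv : 0 < v) (t : ℝ) {N : ℕ} (hN : 0 < N) :
    N * (t / Real.sqrt (N * v)) ^ 2 = t ^ 2 / v := by
  have hN' : (0 : ℝ) < N := by exact_mod_cast hN
  rw [div_pow, Real.sq_sqrt (by positivity)]
  field_simp

lemma tendsto_div_sqrt_mul (t v : ℝ) :
    Tendsto (fun N : ℕ => t / Real.sqrt (N * v)) atTop (𝓝 0) := by
  simp_rw [div_sqrt_mul_eq]
  have := ((tendsto_rpow_neg_atTop (show (0 : ℝ) < 1 / 2 by norm_num)).comp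
    tendsto_natCast_atTop_atTop).const_mul (t / Real.sqrt v)
  simpa [Function.comp_def] using this

lemma tendsto_div_sqrt_mul_log (t v : ℝ) :
    Tendsto (fun N : ℕ => t / Real.sqrt (N * v) * Real.log N) atTop (𝓝 0) := by
  simp_rw [div_sqrt_mul_eq]
  have h := (isLittleO_log_rpow_atTop (show (0 : ℝ) < 1 / 2 by norm_num)).tendsto_div_nhds_zero
  have := (h.comp tendsto_natCast_atTop_atTop).const_mul (t / Real.sqrt v)
  rw [mul_zero] at this
  refine this.congr fun N => ?_
  simp only [Function.comp]
  rw [Real.rpow_neg (Nat.cast_nonneg N)]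
  ring

/-- With Nτ² = t²/v, the second-order Taylor term of e^{iτ} gives -mt²/(2v) and the remainder is at
most |m|(t²/v)|τ|. This is the fluctuation of a Poisson variable of mean Nm, which the number of
cycles would have without the constraint on the total size. -/
lemma tendsto_exp_second_order (m t : ℝ) {v : ℝ} (hv : 0 < v) :
    Tendsto (fun N : ℕ => Complex.exp (N * m * (Complex.exp (Complex.I *
      (t / Real.sqrt (N * v) : ℝ)) - 1 - Complex.I * (t / Real.sqrt (N * v) : ℝ)))) atTop
      (𝓝 (Complex.exp (-(m * t ^ 2 / (2 * v))))) := by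
  refine (Complex.continuous_exp.tendsto _).comp ?_
  rw [tendsto_iff_norm_sub_tendsto_zero]
  set τ : ℕ → ℝ := fun N => t / Real.sqrt (N * v) with hτ
  have hτ0 : Tendsto (fun N => |τ N|) atTop (𝓝 0) := by
    have := (tendsto_div_sqrt_mul t v).abs
    rwa [abs_zero] at this
  have hb : Tendsto (fun N => |m| * (t ^ 2 / v) * |τ N|) atTop (𝓝 0) := by
    simpa using hτ0.const_mul (|m| * (t ^ 2 / v))
  refine squeeze_zero' (Eventually.of_forall fun _ => norm_nonneg _) ?_ hb
  filter_upwards [eventually_gt_atTop 0, hτ0.eventually (eventually_le_nhds zero_lt_one)]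
    with N hN h1
  have hb3 := Complex.exp_bound (x := Complex.I * τ N) (by simpa using h1) (n := 3) (by norm_num)
  have hN2 : (N : ℝ) * τ N ^ 2 = t ^ 2 / v := natCast_mul_div_sqrt_sq hv t hN
  have hsum : ∑ i ∈ Finset.range 3, (Complex.I * (τ N : ℂ)) ^ i / (i.factorial : ℂ) =
      1 + Complex.I * τ N - (τ N : ℂ) ^ 2 / 2 := by
    simp [Finset.sum_range_succ, Nat.factorial, mul_pow, Complex.I_sq]
    ring
  rw [hsum] at hb3
  have e : (N : ℂ) * m * (Complex.exp (Complex.I * τ N) - 1 - Complex.I * τ N) -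
      -(m * t ^ 2 / (2 * v)) = N * m * (Complex.exp (Complex.I * τ N) -
        (1 + Complex.I * τ N - (τ N : ℂ) ^ 2 / 2)) := by
    have : (N : ℂ) * (τ N : ℂ) ^ 2 = t ^ 2 / v := by exact_mod_cast hN2
    have hv' : (v : ℂ) ≠ 0 := by exact_mod_cast hv.ne'
    have e2 : (m : ℂ) * t ^ 2 / (2 * v) = m / 2 * (t ^ 2 / v) := by field_simp
    rw [e2, ← this]
    ring
  rw [e, norm_mul, norm_mul, Complex.norm_natCast, Complex.norm_real, Real.norm_eq_abs]
  have hx : ‖Complex.I * (τ N : ℂ)‖ = |τ N| := by simp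
  rw [hx] at hb3
  have h4 : (((3 : ℕ).succ : ℕ) : ℝ) * (((3 : ℕ).factorial : ℝ) * ((3 : ℕ) : ℝ))⁻¹ ≤ 1 := by
    norm_num [Nat.factorial]
  have h5 : ‖Complex.exp (Complex.I * τ N) - (1 + Complex.I * τ N - (τ N : ℂ) ^ 2 / 2)‖ ≤
      |τ N| ^ 3 := by
    refine hb3.trans ?_
    have h6 : (0 : ℝ) ≤ |τ N| ^ 3 := by positivity
    exact mul_le_of_le_one_right h6 h4
  calc (N : ℝ) * |m| * ‖Complex.exp (Complex.I * τ N) -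
        (1 + Complex.I * τ N - (τ N : ℂ) ^ 2 / 2)‖ ≤ N * |m| * |τ N| ^ 3 := by gcongr
    _ = |m| * (N * τ N ^ 2) * |τ N| := by rw [← sq_abs (τ N)]; ring
    _ = _ := by rw [hN2]

/-- Convergence in law follows from the asymptotics of the coefficients of the tilted
generating functions. -/
lemma convergesInLaw_of_tilted {θ κ : ℕ → ℝ} (hθ : ∀ j : ℕ, 1 ≤ j → 0 ≤ θ j)
    (hκ : ∀ j : ℕ, 1 ≤ j → 0 ≤ κ j) {m v r : ℝ} (hv : 0 < v)
    {Ω : Type*} [MeasurableSpace Ω] {Z : Ω → ℝ}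
    {P : Measure Ω} [IsProbabilityMeasure P] (hZ : AEMeasurable Z P) (D : ℕ → ℂ) (J : ℝ → ℂ)
    (hJ : ∀ t : ℝ, Tendsto (fun N : ℕ => D N *
      (Complex.exp (-(Complex.exp (Complex.I * (t / Real.sqrt (N * v) : ℝ)) * N * m)) *
        expCoeff (fun j => Complex.exp (Complex.I * (t / Real.sqrt (N * v) : ℝ)) *
          (((genCoeff θ j * r ^ j : ℝ) : ℂ) + N * ((genCoeff κ j * r ^ j : ℝ) : ℂ))) N))
      atTop (𝓝 (J t)))
    (h0 : J 0 ≠ 0)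
    (hchar : ∀ t : ℝ, charFun (P.map Z) t =
      Complex.exp (-(m * t ^ 2 / (2 * v))) * (J t / J 0)) :
    ConvergesInLaw θ κ (normalizedTotal m v) Z P := by
  -- The factor r^N undoes the tilt, by homogeneity. With e^{-Nm} included in the normalization,
  -- e^{uNm} and the centring e^{-iτNm} combine to exp(Nm(u - 1 - iτ)).
  refine convergesInLaw_of_tendsto hθ hκ hZ
    (fun N => D N * Complex.exp (-(N * m)) * (r : ℂ) ^ N)
    (fun t => Complex.exp (-(m * t ^ 2 / (2 * v))) * J t) (fun t => ?_) (by simpa using h0)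
    (fun t => by rw [hchar t]; simp; ring)
  refine ((tendsto_exp_second_order m t hv).mul (hJ t)).congr fun N => ?_
  set u := Complex.exp (Complex.I * (t / Real.sqrt (N * v) : ℝ))
  have e : expCoeff (fun j => u *
      (((genCoeff θ j * r ^ j : ℝ) : ℂ) + N * ((genCoeff κ j * r ^ j : ℝ) : ℂ))) N =
      partitionFunction θ κ N u * (r : ℂ) ^ N := by
    rw [partitionFunction, ← expCoeff_mul_pow]
    congr 1
    funext j
    push_cast
    ring
  rw [e]
  have e2 : Complex.exp (N * m * (u - 1 - Complex.I * (t / Real.sqrt (N * v) : ℝ))) =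
      Complex.exp (u * N * m) * Complex.exp (-(N * m)) *
        Complex.exp (-(Complex.I * (t / Real.sqrt (N * v) : ℝ) * (N * m))) := by
    rw [← Complex.exp_add, ← Complex.exp_add]
    congr 1
    ring
  have e3 : Complex.exp (u * N * m) * Complex.exp (-(u * N * m)) = 1 := by
    rw [← Complex.exp_add]; simp
  rw [e2]
  linear_combination (D N * Complex.exp (-(N * m)) * (r : ℂ) ^ N *
    Complex.exp (-(Complex.I * (t / Real.sqrt (N * v) : ℝ) * (N * m))) *
    partitionFunction θ κ N u) * e3

lemma expCoeff_ofReal_nonneg {c : ℕ → ℝ} (hc : ∀ j, 0 ≤ c j) (n : ℕ) :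
    ∃ p : ℝ, 0 ≤ p ∧ expCoeff (fun j => (c j : ℂ)) n = p := by
  refine ⟨(1 / (n.factorial : ℝ)) * ∑ σ : Equiv.Perm (Fin n),
    ∏ j ∈ Finset.Icc 1 n, ((j : ℝ) * c j) ^ cycleCount j σ, ?_, ?_⟩
  · refine mul_nonneg (by positivity) (Finset.sum_nonneg fun σ _ => Finset.prod_nonneg fun j _ =>
      pow_nonneg (mul_nonneg (Nat.cast_nonneg j) (hc j)) _)
  · rw [expCoeff]
    push_cast
    rfl

/-- An integer shift k ~ y N^{1/s}, which realizes q = y in the limit integral. The minimum with N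
keeps k ≤ N for every N and is eventually inactive because 1/s < 1. -/
lemma tendsto_floor_mul_rpow {s : ℝ} (hs : 1 < s) {y : ℝ} (hy : 0 ≤ y) :
    Tendsto (fun N : ℕ => ((min ⌊y * (N : ℝ) ^ (1 / s)⌋₊ N : ℕ) : ℝ) * (N : ℝ) ^ (-(1 / s)))
      atTop (𝓝 y) := by
  have hs0 : 0 < 1 / s := by positivity
  have h1 : Tendsto (fun N : ℕ => (N : ℝ) ^ (1 / s)) atTop atTop :=
    (tendsto_rpow_atTop hs0).comp tendsto_natCast_atTop_atTop
  have h2 := (tendsto_nat_floor_mul_div_atTop hy).comp h1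
  refine h2.congr' ?_
  have h3 : Tendsto (fun N : ℕ => (N : ℝ) ^ (1 - 1 / s)) atTop atTop :=
    (tendsto_rpow_atTop (by rw [sub_pos, div_lt_one (by linarith)]; exact hs)).comp
      tendsto_natCast_atTop_atTop
  filter_upwards [eventually_gt_atTop 0, h3.eventually (eventually_ge_atTop y)] with N hN hyN
  have hN' : (0 : ℝ) < N := by exact_mod_cast hN
  have h4 : y * (N : ℝ) ^ (1 / s) ≤ N := by
    calc y * (N : ℝ) ^ (1 / s) ≤ (N : ℝ) ^ (1 - 1 / s) * (N : ℝ) ^ (1 / s) := by gcongr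
      _ = N := by rw [← Real.rpow_add hN']; simp
  have h5 : ⌊y * (N : ℝ) ^ (1 / s)⌋₊ ≤ N := Nat.floor_le_of_le h4
  rw [min_eq_left h5, Real.rpow_neg hN'.le]
  simp only [Function.comp]
  rw [div_eq_mul_inv]

lemma lap_fun_zero (w : ℂ) : lap (fun _ => 0) w = 0 := by simp [lap]

/-- The limit integrals are nonnegative, as limits of coefficients of power series with
nonnegative coefficients. -/
lemma exists_nonneg_integral_circleLimit {β : ℕ → ℝ} {s A : ℝ} (hβ : ∀ j, 0 ≤ β j)
    (hβ0 : β 0 = 0) (hβs : Summable β) (hna : NonArithmetic β) (hs : 1 < s) (hs2 : s ≤ 2)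
    (hA : 0 < A)
    (hEβ : (fun w => lap β w - (∑' j : ℕ, β j : ℝ) + w - A * w ^ (s : ℂ))
      =o[𝓝[{w : ℂ | 0 < w.re}] 0] fun w => ‖w‖ ^ s) (y : ℝ) (hy : 0 ≤ y) :
    ∃ p : ℝ, 0 ≤ p ∧ ∫ v : ℝ, circleLimit 0 A s (y : ℂ) (1 + Complex.I * v) = p := by
  -- With u = 1, no first function and index N - k, the left side is a nonnegative multiple of a
  -- coefficient of a power series with nonnegative coefficients, and its limit is the integral in
  -- question divided by 2π.
  have h := tendsto_expCoeff_circle (α := fun _ => 0) (β := β) (θ := 0) (C := 0) (A := A)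
    (fun _ => le_rfl) hβ rfl hβ0 hβs hna (fun _ _ => by simp) hs hs2 hA le_rfl
    hEβ (by simpa [lap_fun_zero] using tendsto_const_nhds) (τ := fun _ => 0) (σ := 0) (K := 0) tendsto_const_nhds
    (by simp) (by simp) (by simp)
    (k := fun N => min ⌊y * (N : ℝ) ^ (1 / s)⌋₊ N) (fun N => min_le_right _ _)
    (tendsto_floor_mul_rpow hs hy)
  simp only [Complex.ofReal_zero, mul_zero, Complex.exp_zero, one_mul, zero_add] at h
  set I := ∫ v : ℝ, circleLimit 0 A s (y : ℂ) (1 + Complex.I * v) with hI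
  have hreal : ∀ N : ℕ, ∃ p : ℝ, 0 ≤ p ∧ (((N : ℝ) ^ ((1 - 0) / s) : ℝ) : ℂ) *
      (Complex.exp (-(N * (∑' j : ℕ, β j : ℝ))) *
        expCoeff (fun j => (N * (β j : ℂ))) (N - min ⌊y * (N : ℝ) ^ (1 / s)⌋₊ N)) = p := by
    intro N
    obtain ⟨p, hp, he⟩ := expCoeff_ofReal_nonneg (c := fun j => N * β j)
      (fun j => mul_nonneg (Nat.cast_nonneg N) (hβ j)) (N - min ⌊y * (N : ℝ) ^ (1 / s)⌋₊ N)
    refine ⟨(N : ℝ) ^ ((1 - 0) / s) * (Real.exp (-(N * (∑' j : ℕ, β j))) * p), by positivity, ?_⟩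
    push_cast at he ⊢
    rw [he]
  choose p hp he using hreal
  have h' : Tendsto (fun N => (p N : ℂ)) atTop (𝓝 (1 / (2 * Real.pi) * I)) := h.congr he
  have e : (1 / (2 * Real.pi) * I : ℂ) = ((1 / (2 * Real.pi) : ℝ) : ℂ) * I := by push_cast; rfl
  rw [e] at h'
  have hre := (Complex.continuous_re.tendsto _).comp h'
  have him := (Complex.continuous_im.tendsto _).comp h'
  simp only [Function.comp_def, Complex.ofReal_re, Complex.ofReal_im, Complex.re_ofReal_mul,
    Complex.im_ofReal_mul] at hre him
  have h1 := ge_of_tendsto' hre hp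
  have h2 := tendsto_nhds_unique him tendsto_const_nhds
  have hπ : 0 < 1 / (2 * Real.pi) := by positivity
  refine ⟨I.re, (mul_nonneg_iff_of_pos_left hπ).1 h1, ?_⟩
  have h3 : I.im = 0 := (mul_eq_zero.1 h2).resolve_left hπ.ne'
  apply Complex.ext <;> simp [h3]

lemma genCoeff_nonneg {a : ℕ → ℝ} (ha : ∀ j : ℕ, 1 ≤ j → 0 ≤ a j) (j : ℕ) : 0 ≤ genCoeff a j := by
  rcases Nat.eq_zero_or_pos j with rfl | hj
  · simp [genCoeff]
  · exact div_nonneg (ha j hj) (Nat.cast_nonneg j)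

@[simp] lemma genCoeff_zero (a : ℕ → ℝ) : genCoeff a 0 = 0 := by simp [genCoeff]

lemma NonArithmetic.genCoeff_mul_pow {κ : ℕ → ℝ} (h : NonArithmetic κ) {r : ℝ} (hr : 0 < r) :
    NonArithmetic fun j => genCoeff κ j * r ^ j := by
  rintro ⟨j₀, hj₀, hd⟩
  refine h ⟨j₀, hj₀, fun j hj hne => hd j hj ?_⟩
  have : (j : ℝ) ≠ 0 := by exact_mod_cast (by omega : j ≠ 0)
  exact mul_ne_zero (div_ne_zero hne this) (pow_ne_zero _ hr.ne')

section

variable {θ κ : ℕ → ℝ} {r : ℝ} {s A θs C v e : ℝ}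

/-- The limit law in the cases where the saddle point is at the boundary of the disc, or inside. -/
theorem convergesInLaw_of_circle (hθ : ∀ j : ℕ, 1 ≤ j → 0 ≤ θ j) (hκ : ∀ j : ℕ, 1 ≤ j → 0 ≤ κ j)
    (hna : NonArithmetic κ) (hr : 0 < r)
    (hβs : Summable fun j => genCoeff κ j * r ^ j)
    (hαs : ∀ ξ : ℝ, 0 < ξ → Summable fun j : ℕ => genCoeff θ j * r ^ j * Real.exp (-(ξ * j)))
    (hs : 1 < s) (hs2 : s ≤ 2) (hA : 0 < A) (hθs : 0 ≤ θs)
    (hEβ : (fun w => lap (fun j => genCoeff κ j * r ^ j) w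
      - (∑' j : ℕ, genCoeff κ j * r ^ j : ℝ) + w - A * w ^ (s : ℂ))
      =o[𝓝[{w : ℂ | 0 < w.re}] 0] fun w => ‖w‖ ^ s)
    (hEα : Tendsto (fun w => lap (fun j => genCoeff θ j * r ^ j) w + θs * Complex.log w)
      (𝓝[{w : ℂ | 0 < w.re}] 0) (𝓝 (C : ℂ)))
    (hv : 0 < v) (he : Tendsto (fun N : ℕ => (N : ℝ) ^ (1 / 2 - 1 / s)) atTop (𝓝 e))
    {Ω : Type*} [MeasurableSpace Ω] {Z : Ω → ℝ}
    {P : Measure Ω} [IsProbabilityMeasure P] (hZ : AEMeasurable Z P)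
    (h0 : ∫ x : ℝ, circleLimit θs A s 0 (1 + Complex.I * x) ≠ 0)
    (hchar : ∀ t : ℝ, charFun (P.map Z) t =
      Complex.exp (-((∑' j : ℕ, genCoeff κ j * r ^ j : ℝ) * t ^ 2 / (2 * v))) *
      ((∫ x : ℝ, circleLimit θs A s (Complex.I * (t / Real.sqrt v * e : ℝ)) (1 + Complex.I * x)) /
        ∫ x : ℝ, circleLimit θs A s 0 (1 + Complex.I * x))) :
    ConvergesInLaw θ κ (normalizedTotal (∑' j : ℕ, genCoeff κ j * r ^ j) v) Z P := by
  have hc : Complex.exp C / (2 * Real.pi) ≠ 0 := by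
    have := Real.pi_ne_zero
    exact div_ne_zero (Complex.exp_ne_zero _) (by simp)
  refine convergesInLaw_of_tilted (r := r) hθ hκ hv hZ (fun N => (((N : ℝ) ^ ((1 - θs) / s) : ℝ) : ℂ))
    (fun t => Complex.exp C / (2 * Real.pi) * ∫ x : ℝ, circleLimit θs A s
      (Complex.I * (t / Real.sqrt v * e : ℝ)) (1 + Complex.I * x)) (fun t => ?_) ?_ fun t => ?_
  · have h := tendsto_expCoeff_circle (α := fun j => genCoeff θ j * r ^ j)
      (β := fun j => genCoeff κ j * r ^ j) (θ := θs) (C := C) (A := A)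
      (fun j => mul_nonneg (genCoeff_nonneg hθ j) (by positivity))
      (fun j => mul_nonneg (genCoeff_nonneg hκ j) (by positivity)) (by simp) (by simp) hβs
      (hna.genCoeff_mul_pow hr) hαs hs hs2 hA hθs hEβ hEα
      (τ := fun N => t / Real.sqrt (N * v)) (σ := t / Real.sqrt v * e) (K := t ^ 2 / v)
      (tendsto_div_sqrt_mul t v) (by
        filter_upwards [eventually_gt_atTop 0] with N hN
        exact (natCast_mul_div_sqrt_sq hv t hN).le) (by
        -- For τ = t/√(Nv) one has Nτ N^{-1/s} = (t/√v) N^{1/2-1/s}. Hence `e` is 1 for s = 2 and 0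
        -- for s < 2.
        refine (he.const_mul (t / Real.sqrt v)).congr' ?_
        filter_upwards [eventually_gt_atTop 0] with N hN
        have hN' : (0 : ℝ) < N := by exact_mod_cast hN
        have e1 : (N : ℝ) ^ (1 / 2 - 1 / s) =
            N * (N : ℝ) ^ (-(1 / 2) : ℝ) * (N : ℝ) ^ (-(1 / s)) := by
          nth_rewrite 2 [← Real.rpow_one (N : ℝ)]
          rw [← Real.rpow_add hN', ← Real.rpow_add hN']
          congr 1
          ring
        rw [div_sqrt_mul_eq, e1]
        ring) (tendsto_div_sqrt_mul_log t v)
      (k := fun _ => 0) (κ := 0) (fun N => Nat.zero_le N) (by simp)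
    simpa only [Nat.sub_zero, Complex.ofReal_zero, add_zero] using h
  · simpa [hc] using h0
  · rw [hchar t, mul_div_mul_left _ _ hc]
    simp

end

/-! ### The limit laws on the circle -/

lemma integral_gammaMeasure {a : ℝ} (ha : 0 < a) (g : ℝ → ℂ) :
    ∫ x, g x ∂gammaMeasure a 1 =
      ∫ x in Set.Ioi (0 : ℝ), ((x ^ (a - 1) * Real.exp (-x) / Real.Gamma a : ℝ) : ℂ) * g x := by
  have hpdf : Measurable (gammaPDF a 1) := (measurable_gammaPDFReal a 1).ennreal_ofReal
  rw [gammaMeasure, integral_withDensity_eq_integral_toReal_smul hpdf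
    (Eventually.of_forall fun _ => by simp [gammaPDF]), ← integral_Ici_eq_integral_Ioi, ← integral_indicator measurableSet_Ici]
  refine integral_congr_ae (Eventually.of_forall fun x => ?_)
  simp only [gammaPDF]
  rw [ENNReal.toReal_ofReal (gammaPDFReal_nonneg ha one_pos x)]
  by_cases hx : 0 ≤ x
  · rw [Set.indicator_of_mem (Set.mem_Ici.2 hx), gammaPDFReal, if_pos hx, Complex.real_smul]
    congr 2
    simp
    ring
  · rw [Set.indicator_of_notMem (by simpa using hx), gammaPDFReal, if_neg hx, zero_smul]

/-- Putting y = b√x turns y^{a-1} e^{-y²/b²} dy into a multiple of the Gamma(a/2) density. This is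
where the square root of the Gamma variable comes from. -/
lemma integral_rpow_mul_gaussian_eq {a b : ℝ} (ha : 0 < a) (hb : 0 < b) (τ : ℝ) :
    ∫ y in Set.Ioi (0 : ℝ), ((y ^ (a - 1) : ℝ) : ℂ) *
        Complex.exp (-((y : ℂ) ^ 2 / b ^ 2) - Complex.I * τ * y) =
      ((b ^ a * Real.Gamma (a / 2) / 2 : ℝ) : ℂ) *
        ∫ x, Complex.exp (-(Complex.I * (τ * (b * Real.sqrt x) : ℝ))) ∂gammaMeasure (a / 2) 1 := by
  have hb' : (b : ℂ) ≠ 0 := by exact_mod_cast hb.ne'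
  have hΓ : Real.Gamma (a / 2) ≠ 0 := (Real.Gamma_pos_of_pos (by positivity)).ne'
  -- Both sides are written as integrals in one variable z, with x = z² on the right and y = bz on
  -- the left.
  rw [integral_gammaMeasure (by positivity), ← integral_comp_rpow_Ioi_of_pos
    (g := fun x : ℝ => ((x ^ (a / 2 - 1) * Real.exp (-x) / Real.Gamma (a / 2) : ℝ) : ℂ) *
      Complex.exp (-(Complex.I * ((τ * (b * Real.sqrt x) : ℝ) : ℂ)))) two_pos]
  have h1 := integral_comp_mul_left_Ioi (fun y : ℝ => ((y ^ (a - 1) : ℝ) : ℂ) *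
        Complex.exp (-((y : ℂ) ^ 2 / b ^ 2) - Complex.I * τ * y)) 0 hb
  rw [mul_zero, eq_inv_smul_iff₀ hb.ne', Complex.real_smul] at h1
  rw [← h1, ← integral_const_mul, ← integral_const_mul]
  refine setIntegral_congr_fun measurableSet_Ioi fun z hz => ?_
  have hz0 : (0 : ℝ) < z := hz
  have e1 : z ^ (2 : ℝ) = z ^ 2 := by norm_cast
  have e2 : Real.sqrt (z ^ 2) = z := Real.sqrt_sq hz0.le
  have e3 : (z ^ 2) ^ (a / 2 - 1) = z ^ (a - 1) / z := by
    rw [← e1, ← Real.rpow_mul hz0.le, ← Real.rpow_sub_one hz0.ne']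
    congr 1
    ring
  have e4 : (b * z) ^ (a - 1) = b ^ a / b * z ^ (a - 1) := by
    rw [Real.mul_rpow hb.le hz0.le, Real.rpow_sub_one hb.ne']
  have e5 : z ^ ((2 : ℝ) - 1) = z := by norm_num
  have e6 : Complex.exp (-(((b * z : ℝ) : ℂ) ^ 2 / b ^ 2) - Complex.I * τ * ((b * z : ℝ) : ℂ)) =
      Complex.exp (-(z : ℂ) ^ 2) * Complex.exp (-(Complex.I * (τ * (b * z) : ℝ))) := by
    rw [← Complex.exp_add]
    congr 1
    push_cast
    field_simp
    ring
  rw [e1, e2, e3, e4, e5, e6, Complex.real_smul]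
  push_cast
  have hz' : (z : ℂ) ≠ 0 := by exact_mod_cast hz0.ne'
  have hΓ' : (Real.Gamma (a / 2) : ℂ) ≠ 0 := by exact_mod_cast hΓ
  field_simp

lemma pi_div_cpow_ne_zero {A : ℝ} (hA : 0 < A) : ((Real.pi : ℂ) / A) ^ (1 / 2 : ℂ) ≠ 0 := by
  have h1 : (Real.pi : ℂ) ≠ 0 := by exact_mod_cast Real.pi_ne_zero
  have h2 : (A : ℂ) ≠ 0 := by exact_mod_cast hA.ne'
  rw [Complex.cpow_def_of_ne_zero (div_ne_zero h1 h2)]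
  exact Complex.exp_ne_zero _

/-- The limit integrals for `s = 2`. -/
lemma integral_circleLimit_two_eq_gamma {A θ : ℝ} (hA : 0 < A) (hθ : 0 < θ) :
    ∃ c : ℂ, c ≠ 0 ∧ ∀ σ : ℝ,
      ∫ v : ℝ, circleLimit θ A 2 (Complex.I * σ) (1 + Complex.I * v) =
        c * (Complex.exp (σ ^ 2 / (4 * A)) *
          ∫ x, Complex.exp (-(Complex.I * (σ / Real.sqrt A * Real.sqrt x : ℝ)))
            ∂gammaMeasure (θ / 2) 1) := by
  have hAC : (A : ℂ) ≠ 0 := by exact_mod_cast hA.ne'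
  have hΓ : (Real.Gamma θ : ℂ) ≠ 0 := by exact_mod_cast (Real.Gamma_pos_of_pos hθ).ne'
  have hsA : 0 < Real.sqrt A := Real.sqrt_pos.2 hA
  have hb : 0 < 2 * Real.sqrt A := by positivity
  have hb2 : (2 * Real.sqrt A) ^ 2 = 4 * A := by rw [mul_pow, Real.sq_sqrt hA.le]; norm_num
  refine ⟨(Real.Gamma θ : ℂ)⁻¹ * ((Real.pi / A : ℂ) ^ (1 / 2 : ℂ) *
    (((2 * Real.sqrt A) ^ θ * Real.Gamma (θ / 2) / 2 : ℝ) : ℂ)), ?_, fun σ => ?_⟩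
  · refine mul_ne_zero (inv_ne_zero hΓ) (mul_ne_zero (pi_div_cpow_ne_zero hA) ?_)
    have := Real.Gamma_pos_of_pos (show 0 < θ / 2 by positivity)
    have h2 : 0 < (2 * Real.sqrt A) ^ θ * Real.Gamma (θ / 2) / 2 := by positivity
    exact_mod_cast h2.ne'
  have h := integral_circleLimit_eq (s := 2) (by norm_num) le_rfl hA hθ (Complex.I * σ)
  -- Expanding -(iσ + y)²/(4A) gives σ²/(4A) - y²/(4A) - iσy/(2A), and 4A is the square of b = 2√A.
  have h' : ∫ y in Set.Ioi (0 : ℝ), ((y ^ (θ - 1) : ℝ) : ℂ) *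
        ∫ v : ℝ, circleLimit 0 A 2 (Complex.I * σ + y) (1 + Complex.I * v) =
      (Real.pi / A : ℂ) ^ (1 / 2 : ℂ) * Complex.exp (σ ^ 2 / (4 * A)) *
      ∫ y in Set.Ioi (0 : ℝ), ((y ^ (θ - 1) : ℝ) : ℂ) *
        Complex.exp (-((y : ℂ) ^ 2 / (2 * Real.sqrt A : ℝ) ^ 2)
          - Complex.I * (σ / (2 * A) : ℝ) * y) := by
    rw [← integral_const_mul]
    refine setIntegral_congr_fun measurableSet_Ioi fun y _ => ?_
    have hb2C : ((2 * Real.sqrt A : ℝ) : ℂ) ^ 2 = 4 * A := by exact_mod_cast hb2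
    rw [integral_circleLimit_two hA, hb2C]
    have : Complex.exp (-((Complex.I * σ + y) ^ 2 / (4 * A))) =
        Complex.exp (σ ^ 2 / (4 * A)) * Complex.exp (-((y : ℂ) ^ 2 / (4 * A))
          - Complex.I * (σ / (2 * A) : ℝ) * y) := by
      rw [← Complex.exp_add]
      congr 1
      push_cast
      field_simp
      linear_combination (-2 * (σ : ℂ) ^ 2) * Complex.I_sq
    rw [this]
    ring
  rw [h', integral_rpow_mul_gaussian_eq hθ hb] at h
  have e : ∀ x : ℝ, σ / (2 * A) * (2 * Real.sqrt A * Real.sqrt x) =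
      σ / Real.sqrt A * Real.sqrt x := by
    intro x
    have : A = Real.sqrt A * Real.sqrt A := (Real.mul_self_sqrt hA.le).symm
    nth_rewrite 1 [this]
    field_simp
  simp_rw [e] at h
  rw [← mul_right_inj' hΓ, h]
  field_simp

section

variable {θ κ : ℕ → ℝ} {r : ℝ} {s A θs C m b : ℝ}

/-- Gaussian limits when the second derivative is finite. -/
theorem convergesInLaw_gaussian_two (hθ : ∀ j : ℕ, 1 ≤ j → 0 ≤ θ j)
    (hκ : ∀ j : ℕ, 1 ≤ j → 0 ≤ κ j) (hna : NonArithmetic κ) (hr : 0 < r)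
    (hβs : Summable fun j => genCoeff κ j * r ^ j)
    (hαs : ∀ ξ : ℝ, 0 < ξ → Summable fun j : ℕ => genCoeff θ j * r ^ j * Real.exp (-(ξ * j)))
    (hm : ∑' j : ℕ, genCoeff κ j * r ^ j = m) (hb : 0 < b) (hv : 0 < m - 1 / b)
    (hEβ : (fun w => lap (fun j => genCoeff κ j * r ^ j) w - m + w - (b / 2 : ℝ) * w ^ 2)
      =o[𝓝[{w : ℂ | 0 < w.re}] 0] fun w => ‖w‖ ^ 2)
    (hEα : Tendsto (fun w => lap (fun j => genCoeff θ j * r ^ j) w)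
      (𝓝[{w : ℂ | 0 < w.re}] 0) (𝓝 (C : ℂ))) :
    ConvergesInLaw θ κ (normalizedTotal m (m - 1 / b)) (id : ℝ → ℝ) (gaussianReal 0 1) := by
  have hA : 0 < b / 2 := by positivity
  have h0 : ∫ x : ℝ, circleLimit 0 (b / 2) 2 0 (1 + Complex.I * x) ≠ 0 := by
    rw [integral_circleLimit_two hA]
    exact mul_ne_zero (pi_div_cpow_ne_zero hA) (Complex.exp_ne_zero _)
  have h2C : ((2 : ℝ) : ℂ) = ((2 : ℕ) : ℂ) := by norm_num
  -- With A = b/2 and q² = -t²/v the ratio of limit integrals is e^{t²/(2bv)}. The total exponent is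
  -- -(m - 1/b)t²/(2v) = -t²/2, which is why v = m - 1/b.
  have h := convergesInLaw_of_circle (s := 2) (A := b / 2) (θs := 0) (C := C) (e := 1)
    (Z := (id : ℝ → ℝ)) (P := gaussianReal 0 1) hθ hκ hna hr hβs
    hαs (by norm_num) le_rfl hA le_rfl
    (by
      rw [hm]
      simpa only [h2C, Complex.cpow_natCast, Real.rpow_two] using hEβ) (by simpa using hEα) hv
    (by norm_num) aemeasurable_id h0 (fun t => by
      rw [Measure.map_id, charFun_gaussianReal, integral_circleLimit_two hA,
        integral_circleLimit_two hA, mul_div_mul_left _ _ (pi_div_cpow_ne_zero hA),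
        ← Complex.exp_sub, ← Complex.exp_add, hm]
      congr 1
      set v := m - 1 / b with hvdef
      have e1 : (t / Real.sqrt v * 1) ^ 2 = t ^ 2 / v := by
        rw [mul_one, div_pow, Real.sq_sqrt hv.le]
      have e2 : (Complex.I * ((t / Real.sqrt v * 1 : ℝ) : ℂ)) ^ 2 = -(t ^ 2 / v) := by
        rw [mul_pow, Complex.I_sq]
        have : (((t / Real.sqrt v * 1 : ℝ) : ℂ)) ^ 2 = t ^ 2 / v := by exact_mod_cast e1
        rw [this]
        ring
      have hv' : (v : ℂ) ≠ 0 := by exact_mod_cast hv.ne'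
      have hb' : (b : ℂ) ≠ 0 := by exact_mod_cast hb.ne'
      have hmv : (m : ℂ) = v + 1 / b := by rw [hvdef]; push_cast; ring
      rw [e2, hmv]
      push_cast
      field_simp
      ring)
  rwa [hm] at h

/-- Gaussian limits when the second derivative is infinite. -/
theorem convergesInLaw_gaussian_of_lt_two (hθ : ∀ j : ℕ, 1 ≤ j → 0 ≤ θ j)
    (hκ : ∀ j : ℕ, 1 ≤ j → 0 ≤ κ j) (hna : NonArithmetic κ) (hr : 0 < r)
    (hβs : Summable fun j => genCoeff κ j * r ^ j)
    (hαs : ∀ ξ : ℝ, 0 < ξ → Summable fun j : ℕ => genCoeff θ j * r ^ j * Real.exp (-(ξ * j)))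
    (hm : ∑' j : ℕ, genCoeff κ j * r ^ j = m) (hm0 : 0 < m)
    (hs : 1 < s) (hs2 : s < 2) (hA : 0 < A) (hθs : 0 ≤ θs)
    (hEβ : (fun w => lap (fun j => genCoeff κ j * r ^ j) w - m + w - A * w ^ (s : ℂ))
      =o[𝓝[{w : ℂ | 0 < w.re}] 0] fun w => ‖w‖ ^ s)
    (hEα : Tendsto (fun w => lap (fun j => genCoeff θ j * r ^ j) w + θs * Complex.log w)
      (𝓝[{w : ℂ | 0 < w.re}] 0) (𝓝 (C : ℂ))) :
    ConvergesInLaw θ κ (normalizedTotal m m) (id : ℝ → ℝ) (gaussianReal 0 1) := by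
  subst hm
  have h0 : ∫ x : ℝ, circleLimit θs A s 0 (1 + Complex.I * x) ≠ 0 :=
    integral_circleLimit_ne_zero hs hs2 hA hθs
      (exists_nonneg_integral_circleLimit (β := fun j => genCoeff κ j * r ^ j)
        (fun j => mul_nonneg (genCoeff_nonneg hκ j) (by positivity)) (by simp) hβs
        (hna.genCoeff_mul_pow hr) hs hs2.le hA hEβ)
  have hs0 : 0 < s := by linarith
  have hlt : 0 < 1 / s - 1 / 2 := by
    rw [sub_pos]
    exact one_div_lt_one_div_of_lt hs0 hs2
  refine convergesInLaw_of_circle (s := s) (A := A) (θs := θs) (C := C) (e := 0)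
    (Z := (id : ℝ → ℝ)) (P := gaussianReal 0 1) hθ hκ hna hr hβs
    hαs hs hs2.le hA hθs hEβ hEα hm0 ?_ aemeasurable_id h0 fun t => ?_
  -- Since 1/2 < 1/s the limit `e` is 0: the limit integral does not depend on t and only e^{-t²/2}
  -- is left.
  · have := (tendsto_rpow_neg_atTop hlt).comp (tendsto_natCast_atTop_atTop (R := ℝ))
    rw [neg_sub] at this
    exact this
  · rw [Measure.map_id, charFun_gaussianReal, mul_zero, Complex.ofReal_zero, mul_zero,
      mul_zero, div_self h0]
    have hm' : ((∑' j : ℕ, genCoeff κ j * r ^ j : ℝ) : ℂ) ≠ 0 := by exact_mod_cast hm0.ne'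
    rw [mul_one]
    congr 1
    field_simp
    simp

/-- The limit law in the critical case with a logarithmic singularity. -/
theorem convergesInLaw_gamma (hθ : ∀ j : ℕ, 1 ≤ j → 0 ≤ θ j)
    (hκ : ∀ j : ℕ, 1 ≤ j → 0 ≤ κ j) (hna : NonArithmetic κ) (hr : 0 < r)
    (hβs : Summable fun j => genCoeff κ j * r ^ j)
    (hαs : ∀ ξ : ℝ, 0 < ξ → Summable fun j : ℕ => genCoeff θ j * r ^ j * Real.exp (-(ξ * j)))
    (hm : ∑' j : ℕ, genCoeff κ j * r ^ j = m) (hb : 0 < b) (hv : 0 < m - 1 / b) (hθs : 0 < θs)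
    (hEβ : (fun w => lap (fun j => genCoeff κ j * r ^ j) w - m + w - (b / 2 : ℝ) * w ^ 2)
      =o[𝓝[{w : ℂ | 0 < w.re}] 0] fun w => ‖w‖ ^ 2)
    (hEα : Tendsto (fun w => lap (fun j => genCoeff θ j * r ^ j) w + θs * Complex.log w)
      (𝓝[{w : ℂ | 0 < w.re}] 0) (𝓝 (C : ℂ)))
    {Ω : Type*} [MeasurableSpace Ω] (P : Measure Ω) [IsProbabilityMeasure P] {Z X : Ω → ℝ}
    (hZ : HasLaw Z (gaussianReal 0 1) P) (hX : HasLaw X (gammaMeasure (θs / 2) 1) P)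
    (hZX : IndepFun Z X P) :
    ConvergesInLaw θ κ (normalizedTotal m (m - 1 / b))
      (fun ω => Z ω - Real.sqrt (2 * X ω / (m * b - 1))) P := by
  have hA : 0 < b / 2 := by positivity
  have h2C : ((2 : ℝ) : ℂ) = ((2 : ℕ) : ℂ) := by norm_num
  set v := m - 1 / b with hvdef
  have hmb : m * b - 1 = v * b := by rw [hvdef]; field_simp
  obtain ⟨c, hc, hJ⟩ := integral_circleLimit_two_eq_gamma hA hθs
  have := isProbabilityMeasure_gammaMeasure (show 0 < θs / 2 by positivity) one_pos
  have hJ0 : ∫ x : ℝ, circleLimit θs (b / 2) 2 0 (1 + Complex.I * x) = c := by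
    have := hJ 0
    simpa using this
  set ψ : ℝ → ℝ := fun x => -Real.sqrt (2 * x / (m * b - 1)) with hψ
  have hψm : Measurable ψ := by fun_prop
  have hYm : AEMeasurable (ψ ∘ X) P := hψm.comp_aemeasurable hX.aemeasurable
  have hsum : (fun ω => Z ω - Real.sqrt (2 * X ω / (m * b - 1))) = Z + ψ ∘ X := by
    funext ω
    simp [hψ, sub_eq_add_neg]
  rw [hsum]
  have h := convergesInLaw_of_circle (s := 2) (A := b / 2) (θs := θs) (C := C) (e := 1)
    (Z := Z + ψ ∘ X) (P := P) hθ hκ hna hr hβs hαs (by norm_num) le_rfl hA hθs.le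
    (by
      rw [hm]
      simpa only [h2C, Complex.cpow_natCast, Real.rpow_two] using hEβ) hEα hv
    (by norm_num) (hZ.aemeasurable.add hYm) (by rwa [hJ0]) (fun t => by
      rw [IndepFun.charFun_map_add_eq_mul hZ.aemeasurable hYm
        (hZX.comp measurable_id hψm), Pi.mul_apply, hZ.map_eq, charFun_gaussianReal,
        ← AEMeasurable.map_map_of_aemeasurable hψm.aemeasurable hX.aemeasurable, hX.map_eq,
        charFun_apply_real, integral_map hψm.aemeasurable (by fun_prop), hJ, hJ0,
        mul_div_cancel_left₀ _ hc, hm, ← mul_assoc]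
      congr 1
      · rw [← Complex.exp_add]
        congr 1
        have e1 : (t / Real.sqrt v * 1) ^ 2 = t ^ 2 / v := by
          rw [mul_one, div_pow, Real.sq_sqrt hv.le]
        have e2 : ((t / Real.sqrt v * 1 : ℝ) : ℂ) ^ 2 = t ^ 2 / v := by exact_mod_cast e1
        have hv' : (v : ℂ) ≠ 0 := by exact_mod_cast hv.ne'
        have hb' : (b : ℂ) ≠ 0 := by exact_mod_cast hb.ne'
        have hmv : (m : ℂ) = v + 1 / b := by rw [hvdef]; push_cast; ring
        rw [e2, hmv]
        push_cast
        field_simp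
        ring
      · refine integral_congr_ae (Eventually.of_forall fun x => ?_)
        simp only
        congr 1
        -- Because mb - 1 = vb, the shift (σ/√A)√x with σ = t/√v and A = b/2 is t times the square
        -- root of 2x/(mb - 1).
        have e3 : Real.sqrt (2 * x / (m * b - 1)) =
            1 / Real.sqrt v * 1 / Real.sqrt (b / 2) * Real.sqrt x := by
          rw [hmb, mul_one, div_div, one_div, ← Real.sqrt_mul hv.le, ← Real.sqrt_inv,
            ← Real.sqrt_mul (by positivity)]
          congr 1
          field_simp
        rw [hψ]
        simp only
        rw [e3]
        push_cast
        ring)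
  rwa [hm] at h

end

/-! ### Expansions from moments -/

lemma tendsto_lap_nhdsWithin_zero {a : ℕ → ℝ} (ha : ∀ j, 0 ≤ a j) (hs : Summable a) :
    Tendsto (lap a) (𝓝[{w : ℂ | 0 < w.re}] 0) (𝓝 ((∑' j : ℕ, a j : ℝ) : ℂ)) := by
  rw [← lap_zero, lap]
  refine tendsto_tsum_of_dominated_convergence hs (fun j => ?_) ?_
  · have : Continuous fun w : ℂ => (a j : ℂ) * Complex.exp (-(w * j)) := by fun_prop
    exact (this.tendsto 0).mono_left nhdsWithin_le_nhds
  · filter_upwards [self_mem_nhdsWithin] with w hw j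
    rw [norm_lap_term ha]
    refine mul_le_of_le_one_right (ha j) (Real.exp_le_one_iff.2 ?_)
    have : 0 < w.re := hw
    have : 0 ≤ w.re * j := by positivity
    linarith

lemma exp_neg_taylor_two (z : ℂ) : Complex.exp (-z) - 1 + z - z ^ 2 / 2 =
    Complex.exp (-z) - ∑ m ∈ Finset.range 3, (-z) ^ m / (m.factorial : ℂ) := by
  simp [Finset.sum_range_succ, Nat.factorial]
  ring

lemma norm_exp_neg_taylor_two_le {z : ℂ} (hz : ‖z‖ ≤ 1) :
    ‖Complex.exp (-z) - 1 + z - z ^ 2 / 2‖ ≤ ‖z‖ ^ 3 := by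
  rw [exp_neg_taylor_two]
  refine (Complex.exp_bound (by simpa using hz) (by norm_num)).trans ?_
  rw [norm_neg]
  exact mul_le_of_le_one_right (by positivity) (by norm_num [Nat.factorial])

/-- A bound without smallness of z, used with z = jw as the dominating function in
`lap_isLittleO_sq`; Re z ≥ 0 keeps the exponential bounded. -/
lemma norm_exp_neg_taylor_two_le_sq {z : ℂ} (hz : 0 ≤ z.re) :
    ‖Complex.exp (-z) - 1 + z - z ^ 2 / 2‖ ≤ 4 * ‖z‖ ^ 2 := by
  rcases le_or_gt ‖z‖ 1 with h | h
  · refine (norm_exp_neg_taylor_two_le h).trans ?_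
    nlinarith [sq_nonneg ‖z‖, norm_nonneg z]
  · have h1 : ‖Complex.exp (-z)‖ ≤ 1 := by
      rw [Complex.norm_exp, Real.exp_le_one_iff, Complex.neg_re]
      linarith
    calc ‖Complex.exp (-z) - 1 + z - z ^ 2 / 2‖
        ≤ ‖Complex.exp (-z)‖ + ‖(1 : ℂ)‖ + ‖z‖ + ‖z ^ 2 / 2‖ := by
          refine (norm_sub_le _ _).trans (add_le_add_left ((norm_add_le _ _).trans
            (add_le_add_left (norm_sub_le _ _) _)) _)
      _ ≤ 1 + 1 + ‖z‖ + ‖z‖ ^ 2 / 2 := by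
          have : ‖z ^ 2 / 2‖ = ‖z‖ ^ 2 / 2 := by simp
          rw [this, norm_one]
          gcongr
      _ ≤ 4 * ‖z‖ ^ 2 := by nlinarith

lemma summable_natCast_mul {β : ℕ → ℝ} (hβ : ∀ j, 0 ≤ β j)
    (h2 : Summable fun j : ℕ => (j : ℝ) ^ 2 * β j) : Summable fun j : ℕ => (j : ℝ) * β j := by
  refine Summable.of_nonneg_of_le (fun j => mul_nonneg (Nat.cast_nonneg j) (hβ j)) (fun j => ?_) h2
  refine mul_le_mul_of_nonneg_right ?_ (hβ j)
  rcases Nat.eq_zero_or_pos j with rfl | hj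
  · simp
  · have : (1 : ℝ) ≤ j := by exact_mod_cast hj
    nlinarith

/-- The second order expansion of a Laplace series with finite second moment. -/
lemma lap_isLittleO_sq {β : ℕ → ℝ} (hβ : ∀ j, 0 ≤ β j) (hs : Summable β)
    (h2 : Summable fun j : ℕ => (j : ℝ) ^ 2 * β j) :
    (fun w => lap β w - (∑' j : ℕ, β j : ℝ) + (∑' j : ℕ, (j : ℝ) * β j : ℝ) * w
      - ((∑' j : ℕ, (j : ℝ) ^ 2 * β j) / 2 : ℝ) * w ^ 2)
      =o[𝓝[{w : ℂ | 0 < w.re}] 0] fun w => ‖w‖ ^ 2 := by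
  have h1 := summable_natCast_mul hβ h2
  -- Dominated convergence for series: each remainder divided by w² tends to 0 and is at most 4j²β_j
  -- in modulus.
  have key : Tendsto (fun w : ℂ => ∑' j : ℕ, (β j : ℂ) *
      (Complex.exp (-(w * j)) - 1 + w * j - (w * j) ^ 2 / 2) / w ^ 2)
      (𝓝[{w : ℂ | 0 < w.re}] 0) (𝓝 (∑' _ : ℕ, 0)) := by
    refine tendsto_tsum_of_dominated_convergence (h2.mul_left 4) (fun j => ?_) ?_
    · have hb : Tendsto (fun w : ℂ => β j * (j : ℝ) ^ 3 * ‖w‖) (𝓝[{w : ℂ | 0 < w.re}] 0)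
          (𝓝 0) := by
        have : Continuous fun w : ℂ => β j * (j : ℝ) ^ 3 * ‖w‖ := by fun_prop
        have h := (this.tendsto 0).mono_left
          (nhdsWithin_le_nhds (s := {w : ℂ | 0 < w.re}))
        simpa using h
      have hsmall : ∀ᶠ w : ℂ in 𝓝[{w : ℂ | 0 < w.re}] (0 : ℂ), ‖w * j‖ ≤ 1 := by
        have : Continuous fun w : ℂ => ‖w * j‖ := by fun_prop
        have h := (this.tendsto 0).mono_left (nhdsWithin_le_nhds (s := {w : ℂ | 0 < w.re}))
        simp only [zero_mul, norm_zero] at h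
        exact h.eventually (eventually_le_nhds zero_lt_one)
      rw [tendsto_zero_iff_norm_tendsto_zero]
      refine squeeze_zero' (Eventually.of_forall fun _ => norm_nonneg _) ?_ hb
      filter_upwards [self_mem_nhdsWithin, hsmall] with w hw hwj
      have hw0 : 0 < ‖w‖ := by
        refine norm_pos_iff.2 fun h => ?_
        have : 0 < w.re := hw
        simp [h] at this
      rw [norm_div, norm_mul, norm_pow, div_le_iff₀ (by positivity), Complex.norm_real,
        Real.norm_of_nonneg (hβ j)]
      calc β j * _ ≤ β j * ‖w * j‖ ^ 3 :=
            mul_le_mul_of_nonneg_left (norm_exp_neg_taylor_two_le hwj) (hβ j)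
        _ = _ := by
            rw [norm_mul, Complex.norm_natCast]
            ring
    · filter_upwards [self_mem_nhdsWithin] with w hw j
      have hwre : 0 < w.re := hw
      have hw0 : 0 < ‖w‖ := by
        refine norm_pos_iff.2 fun h => ?_
        simp [h] at hwre
      rw [norm_div, norm_mul, norm_pow, div_le_iff₀ (by positivity), Complex.norm_real,
        Real.norm_of_nonneg (hβ j)]
      have hre : 0 ≤ (w * (j : ℂ)).re := by
        simp only [Complex.mul_re, Complex.natCast_re, Complex.natCast_im, mul_zero, sub_zero]
        positivity
      calc β j * _ ≤ β j * (4 * ‖w * j‖ ^ 2) :=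
            mul_le_mul_of_nonneg_left (norm_exp_neg_taylor_two_le_sq hre) (hβ j)
        _ = _ := by
            rw [norm_mul, Complex.norm_natCast]
            ring
  rw [tsum_zero] at key
  have hO : (fun w => lap β w - (∑' j : ℕ, β j : ℝ) + (∑' j : ℕ, (j : ℝ) * β j : ℝ) * w
      - ((∑' j : ℕ, (j : ℝ) ^ 2 * β j) / 2 : ℝ) * w ^ 2)
      =o[𝓝[{w : ℂ | 0 < w.re}] 0] fun w : ℂ => w ^ 2 := by
    refine (isLittleO_iff_tendsto' ?_).2 (key.congr' ?_)
    · filter_upwards [self_mem_nhdsWithin] with w hw h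
      have hwre : 0 < w.re := hw
      simp [pow_eq_zero_iff] at h
      simp [h] at hwre
    · filter_upwards [self_mem_nhdsWithin] with w hw
      have hwre : 0 < w.re := hw
      rw [tsum_div_const]
      congr 1
      have s0 := summable_lap hβ (summable_mul_exp_neg hβ hs hwre.le)
      have s1 : Summable fun j : ℕ => (β j : ℂ) := by exact_mod_cast hs
      have s2 : Summable fun j : ℕ => (((j : ℝ) * β j : ℝ) : ℂ) := by exact_mod_cast h1
      have s3 : Summable fun j : ℕ => (((j : ℝ) ^ 2 * β j : ℝ) : ℂ) := by exact_mod_cast h2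
      have e : ((∑' j : ℕ, (j : ℝ) ^ 2 * β j) / 2 : ℝ) * w ^ 2 =
          (∑' j : ℕ, (((j : ℝ) ^ 2 * β j : ℝ) : ℂ)) * (w ^ 2 / 2) := by
        push_cast
        ring
      rw [e, lap, Complex.ofReal_tsum, Complex.ofReal_tsum, ← tsum_mul_right, ← tsum_mul_right,
        ← s0.tsum_sub s1, ← (s0.sub s1).tsum_add (s2.mul_right w),
        ← ((s0.sub s1).add (s2.mul_right w)).tsum_sub (s3.mul_right _)]
      refine tsum_congr fun j => ?_
      push_cast
      ring
  refine hO.trans_isBigO (IsBigO.of_norm_le fun w => ?_)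
  rw [norm_pow]

/-- Strict positivity of the limiting variance. -/
lemma sub_one_div_pos {β : ℕ → ℝ} (hβ : ∀ j, 0 ≤ β j) (hs : Summable β)
    (h2 : Summable fun j : ℕ => (j : ℝ) ^ 2 * β j) (hna : NonArithmetic β)
    (hnd : ∃ j : ℕ, 2 ≤ j ∧ 0 < β j) (h1 : ∑' j : ℕ, (j : ℝ) * β j = 1) :
    0 < ∑' j : ℕ, (j : ℝ) ^ 2 * β j ∧
    0 < (∑' j : ℕ, β j) - 1 / ∑' j : ℕ, (j : ℝ) ^ 2 * β j := by
  have hs1 := summable_natCast_mul hβ h2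
  obtain ⟨j₁, hj₁, hb₁⟩ := hnd
  have hj₁' : (0 : ℝ) < j₁ := by exact_mod_cast (by omega : 0 < j₁)
  set b := ∑' j : ℕ, (j : ℝ) ^ 2 * β j with hb
  have hbpos : 0 < b := h2.tsum_pos (fun j => mul_nonneg (by positivity) (hβ j)) j₁ (by positivity)
  refine ⟨hbpos, ?_⟩
  have hsum : Summable fun j : ℕ => β j * (1 - j / b) ^ 2 := by
    refine ((hs.sub (hs1.mul_left (2 / b))).add (h2.mul_left (1 / b ^ 2))).congr fun j => ?_
    field_simp
    ring
  -- The limiting variance is a defect of Cauchy–Schwarz: expand the square and use that the first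
  -- moment is 1 and the second is b.
  have heq : ∑' j : ℕ, β j * (1 - j / b) ^ 2 = (∑' j : ℕ, β j) - 1 / b := by
    have e : ∀ j : ℕ, β j * (1 - j / b) ^ 2 =
        β j - 2 / b * (j * β j) + 1 / b ^ 2 * ((j : ℝ) ^ 2 * β j) := by
      intro j
      field_simp
      ring
    rw [tsum_congr e, (hs.sub (hs1.mul_left _)).tsum_add (h2.mul_left _),
      hs.tsum_sub (hs1.mul_left _), tsum_mul_left, tsum_mul_left, h1, ← hb]
    field_simp
    ring
  rw [← heq]
  -- If every index of the support equalled b, the support would be the single point `j₁` ≥ 2, which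
  -- contradicts non-arithmeticity.
  have hex : ∃ j : ℕ, 0 < β j ∧ (j : ℝ) ≠ b := by
    by_contra hcon
    push Not at hcon
    have hj₁b := hcon j₁ hb₁
    refine hna ⟨j₁, by omega, fun j hj hne => ?_⟩
    have hjb := hcon j (lt_of_le_of_ne (hβ j) (Ne.symm hne))
    have : j = j₁ := by exact_mod_cast hjb.trans hj₁b.symm
    rw [this]
  obtain ⟨j₂, hb₂, hne₂⟩ := hex
  refine hsum.tsum_pos (fun j => mul_nonneg (hβ j) (sq_nonneg _)) j₂ (mul_pos hb₂ ?_)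
  have : 1 - (j₂ : ℝ) / b ≠ 0 := by
    rw [sub_ne_zero, ne_comm, Ne, div_eq_one_iff_eq hbpos.ne']
    exact hne₂
  positivity

/-! ### Modified derivatives as power series -/

/-- Absolute convergence of `∑ c_j x^j` for `|x| < R`. -/
def SummableBelow (c : ℕ → ℝ) (R : ℝ≥0∞) : Prop :=
  ∀ ρ : ℝ, 0 ≤ ρ → ENNReal.ofReal ρ < R → Summable fun j : ℕ => |c j| * ρ ^ j

lemma summableBelow_genCoeff {a : ℕ → ℝ} {R : ℝ≥0∞} (hR : R ≤ genRadius a) :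
    SummableBelow (genCoeff a) R := by
  intro ρ hρ hlt
  have h := FormalMultilinearSeries.summable_norm_mul_pow
    (FormalMultilinearSeries.ofScalars ℝ (genCoeff a)) (r := ρ.toNNReal)
    (lt_of_lt_of_le hlt hR)
  refine h.congr fun j => ?_
  rw [FormalMultilinearSeries.ofScalars_norm, Real.coe_toNNReal _ hρ, Real.norm_eq_abs]

lemma SummableBelow.summable {c : ℕ → ℝ} {R : ℝ≥0∞} (h : SummableBelow c R) {r : ℝ} (hr : 0 ≤ r)
    (hrR : ENNReal.ofReal r < R) : Summable fun j : ℕ => c j * r ^ j := by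
  refine Summable.of_norm ((h r hr hrR).congr fun j => ?_)
  rw [norm_mul, Real.norm_eq_abs, norm_pow, Real.norm_of_nonneg hr]

/-- The factor j is absorbed by passing to a slightly larger radius, since j(ρ/ρ')^j → 0. -/
lemma SummableBelow.natCast_mul {c : ℕ → ℝ} {R : ℝ≥0∞} (h : SummableBelow c R) :
    SummableBelow (fun j => j * c j) R := by
  intro ρ hρ hlt
  obtain ⟨ρ', hρ', h1, h2⟩ := ENNReal.lt_iff_exists_real_btwn.1 hlt
  have hlt' : ρ < ρ' := by
    rwa [ENNReal.ofReal_lt_ofReal_iff_of_nonneg hρ] at h1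
  have hpos : 0 < ρ' := hρ.trans_lt hlt'
  have ht := tendsto_pow_const_mul_const_pow_of_abs_lt_one 1 (r := ρ / ρ') (by
    rw [abs_of_nonneg (by positivity), div_lt_one hpos]; exact hlt')
  refine summable_of_isBigO_nat (h ρ' hρ' h2) ?_
  have hO := (ht.isBigO_one ℝ).mul (isBigO_refl (fun j : ℕ => |c j| * ρ' ^ j) atTop)
  refine (hO.congr_left fun j => ?_).congr_right fun j => one_mul _
  rw [abs_mul, Nat.abs_cast, pow_one, div_pow]
  field_simp

lemma SummableBelow.shift {c : ℕ → ℝ} {R : ℝ≥0∞} (h : SummableBelow c R) :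
    SummableBelow (fun j => ((j + 1 : ℕ) : ℝ) * c (j + 1)) R := by
  intro ρ hρ hlt
  rcases hρ.eq_or_lt with rfl | hpos
  · refine summable_of_ne_finset_zero (s := {0}) fun j hj => ?_
    have : j ≠ 0 := by simpa using hj
    simp [this]
  · have h1 := (summable_nat_add_iff 1).2 (h.natCast_mul ρ hρ hlt)
    refine (h1.mul_left ρ⁻¹).congr fun j => ?_
    rw [pow_succ]
    field_simp

lemma SummableBelow.hasDerivAt {c : ℕ → ℝ} {R : ℝ≥0∞} (h : SummableBelow c R) {x : ℝ}
    (hx : ENNReal.ofReal |x| < R) :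
    HasDerivAt (fun y : ℝ => ∑' j : ℕ, c j * y ^ j)
      (∑' j : ℕ, ((j + 1 : ℕ) : ℝ) * c (j + 1) * x ^ j) x := by
  obtain ⟨ρ, hρ, h1, h2⟩ := ENNReal.lt_iff_exists_real_btwn.1 hx
  rw [ENNReal.ofReal_lt_ofReal_iff_of_nonneg (abs_nonneg x)] at h1
  have hs := h.shift ρ hρ h2
  have hu : Summable fun j : ℕ => |c j| * (j * ρ ^ (j - 1)) := by
    refine (summable_nat_add_iff 1).1 (hs.congr fun j => ?_)
    rw [abs_mul, Nat.abs_cast, Nat.add_sub_cancel]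
    ring
  have key := hasDerivAt_tsum_of_isPreconnected (t := Metric.ball (0 : ℝ) ρ)
    (g := fun (j : ℕ) (y : ℝ) => c j * y ^ j)
    (g' := fun (j : ℕ) (y : ℝ) => c j * (j * y ^ (j - 1))) (y₀ := x) (y := x) hu
    Metric.isOpen_ball (convex_ball 0 ρ).isPreconnected
    (fun j y _ => (hasDerivAt_pow j y).const_mul (c j)) (fun j y hy => by
      have hy' : |y| ≤ ρ := by simpa using (mem_ball_zero_iff.1 hy).le
      rw [norm_mul, norm_mul, norm_pow, Real.norm_eq_abs, Real.norm_eq_abs, Real.norm_eq_abs,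
        Nat.abs_cast]
      gcongr) (by simpa using h1) (Summable.of_norm ((h |x| (abs_nonneg x) hx).congr fun j => by
      rw [norm_mul, norm_pow, Real.norm_eq_abs, Real.norm_eq_abs])) (by simpa using h1)
  have hs' : Summable fun j : ℕ => c j * (j * x ^ (j - 1)) := by
    refine Summable.of_norm_bounded hu fun j => ?_
    rw [norm_mul, norm_mul, norm_pow, Real.norm_eq_abs, Real.norm_eq_abs, Real.norm_eq_abs,
        Nat.abs_cast]
    gcongr
  have e : ∑' j : ℕ, c j * (j * x ^ (j - 1)) =
      ∑' j : ℕ, ((j + 1 : ℕ) : ℝ) * c (j + 1) * x ^ j := by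
    rw [hs'.tsum_eq_zero_add]
    simp only [Nat.cast_zero, zero_mul, mul_zero, zero_add, Nat.add_sub_cancel]
    refine tsum_congr fun j => ?_
    ring
  rw [← e]
  exact key

lemma mul_tsum_shift {c : ℕ → ℝ} {r : ℝ} (h : Summable fun j : ℕ => (j : ℝ) * c j * r ^ j) :
    r * ∑' j : ℕ, ((j + 1 : ℕ) : ℝ) * c (j + 1) * r ^ j = ∑' j : ℕ, (j : ℝ) * c j * r ^ j := by
  rw [h.tsum_eq_zero_add, ← tsum_mul_left]
  simp only [Nat.cast_zero, zero_mul, zero_add]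
  refine tsum_congr fun j => ?_
  ring

section

variable {a : ℕ → ℝ} {R : ℝ≥0∞}

lemma modDeriv_zero (a : ℕ → ℝ) (r : ℝ) : modDeriv a 0 r = ∑' j : ℕ, genCoeff a j * r ^ j := by
  simp [modDeriv, gen]

lemma modDeriv_one (hR : R ≤ genRadius a) {r : ℝ} (hr : 0 < r) (hrR : ENNReal.ofReal r < R) :
    modDeriv a 1 r = ∑' j : ℕ, (j : ℝ) * genCoeff a j * r ^ j := by
  have h := summableBelow_genCoeff hR
  have hd := h.hasDerivAt (x := r) (by rwa [abs_of_pos hr])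
  rw [← mul_tsum_shift (h.natCast_mul.summable hr.le hrR), ← hd.deriv, modDeriv, iteratedDeriv_one,
    pow_one]
  rfl

lemma modDeriv_two (hR : R ≤ genRadius a) {r : ℝ} (hr : 0 < r) (hrR : ENNReal.ofReal r < R) :
    modDeriv a 2 r = ∑' j : ℕ, (j : ℝ) * (j - 1) * genCoeff a j * r ^ j := by
  have h := summableBelow_genCoeff hR
  obtain ⟨ρ, hρ, h1, h2⟩ := ENNReal.lt_iff_exists_real_btwn.1 hrR
  rw [ENNReal.ofReal_lt_ofReal_iff_of_nonneg hr.le] at h1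
  -- To differentiate a second time, the first derivative must be known on a neighbourhood of r.
  have hev : deriv (gen a) =ᶠ[𝓝 r]
      fun x => ∑' j : ℕ, ((j + 1 : ℕ) : ℝ) * genCoeff a (j + 1) * x ^ j := by
    filter_upwards [Ioo_mem_nhds (show (0 : ℝ) < r from hr) h1] with x hx
    refine (h.hasDerivAt (x := x) ?_).deriv
    rw [abs_of_pos hx.1]
    exact (ENNReal.ofReal_le_ofReal hx.2.le).trans_lt h2
  have hd := h.shift.hasDerivAt (x := r) (by rwa [abs_of_pos hr])
  rw [modDeriv, iteratedDeriv_succ, iteratedDeriv_one, hev.deriv_eq, hd.deriv, pow_two, mul_assoc,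
    mul_tsum_shift (c := fun j => ((j + 1 : ℕ) : ℝ) * genCoeff a (j + 1))
      (h.shift.natCast_mul.summable hr.le hrR), ← tsum_mul_left]
  have hs : Summable fun j : ℕ => (j : ℝ) * (j - 1) * genCoeff a j * r ^ j := by
    refine ((h.natCast_mul.natCast_mul.summable hr.le hrR).sub
      (h.natCast_mul.summable hr.le hrR)).congr fun j => ?_
    ring
  rw [hs.tsum_eq_zero_add]
  simp only [Nat.cast_zero, zero_mul, zero_add]
  refine tsum_congr fun j => ?_
  push_cast
  ring

/-- Abel's theorem for nonnegative coefficients. A partial sum at R is the limit of the same partial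
sum at r < R, which the supremum bounds; conversely the series at r is dominated termwise by the
series at R. -/
lemma tsum_eq_iSup {c : ℕ → ℝ} (hc : ∀ j, 0 ≤ c j) (hR0 : 0 < R) (hRt : R ≠ ⊤)
    {f : ℝ → ℝ} (hf : ∀ r : ℝ, 0 < r → ENNReal.ofReal r < R →
      (Summable fun j : ℕ => c j * r ^ j) ∧ f r = ∑' j : ℕ, c j * r ^ j)
    (hsup : (⨆ r : {r : ℝ // 0 < r ∧ ENNReal.ofReal r < R}, ((f r : ℝ) : EReal)) ≠ ⊤) :
    (Summable fun j : ℕ => c j * R.toReal ^ j) ∧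
    (⨆ r : {r : ℝ // 0 < r ∧ ENNReal.ofReal r < R}, ((f r : ℝ) : EReal)) =
      ((∑' j : ℕ, c j * R.toReal ^ j : ℝ) : EReal) := by
  set ρ := R.toReal with hρ
  have hρ0 : 0 < ρ := ENNReal.toReal_pos hR0.ne' hRt
  have hlt : ∀ r : ℝ, 0 < r → (ENNReal.ofReal r < R ↔ r < ρ) := fun r hr =>
    ENNReal.ofReal_lt_iff_lt_toReal hr.le hRt
  set S := ⨆ r : {r : ℝ // 0 < r ∧ ENNReal.ofReal r < R}, ((f r : ℝ) : EReal) with hS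
  have hle : ∀ r : ℝ, 0 < r → r < ρ → ((f r : ℝ) : EReal) ≤ S := fun r hr hrρ =>
    le_iSup (fun r : {r : ℝ // 0 < r ∧ ENNReal.ofReal r < R} => ((f r : ℝ) : EReal))
      ⟨r, hr, (hlt r hr).2 hrρ⟩
  have hbot : S ≠ ⊥ := fun h => by
    have := hle (ρ / 2) (by positivity) (by linarith)
    rw [h, le_bot_iff] at this
    exact EReal.coe_ne_bot _ this
  set M := S.toReal with hM
  have hSM : S = M := (EReal.coe_toReal hsup hbot).symm
  have hfM : ∀ r : ℝ, 0 < r → r < ρ → f r ≤ M := fun r hr hrρ => by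
    have := hle r hr hrρ
    rwa [hSM, EReal.coe_le_coe_iff] at this
  have hpart : ∀ n : ℕ, ∑ j ∈ Finset.range n, c j * ρ ^ j ≤ M := by
    intro n
    have hcont : Continuous fun r : ℝ => ∑ j ∈ Finset.range n, c j * r ^ j := by fun_prop
    have ht := (hcont.tendsto ρ).mono_left (nhdsWithin_le_nhds (s := Set.Iio ρ))
    refine le_of_tendsto ht ?_
    filter_upwards [Ioo_mem_nhdsLT hρ0] with r hr
    obtain ⟨hs, he⟩ := hf r hr.1 ((hlt r hr.1).2 hr.2)
    refine le_trans ?_ (hfM r hr.1 hr.2)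
    rw [he]
    exact hs.sum_le_tsum _ fun j _ => mul_nonneg (hc j) (pow_nonneg hr.1.le j)
  have hnn : ∀ j, 0 ≤ c j * ρ ^ j := fun j => mul_nonneg (hc j) (by positivity)
  have hsum : Summable fun j : ℕ => c j * ρ ^ j := summable_of_sum_range_le hnn hpart
  refine ⟨hsum, le_antisymm (iSup_le fun r => ?_) ?_⟩
  · obtain ⟨r, hr, hrR⟩ := r
    obtain ⟨hs, he⟩ := hf r hr hrR
    rw [EReal.coe_le_coe_iff]
    simp only
    rw [he]
    refine hs.tsum_le_tsum (fun j => ?_) hsum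
    exact mul_le_mul_of_nonneg_left (pow_le_pow_left₀ hr.le ((hlt r hr).1 hrR).le j) (hc j)
  · rw [hSM, EReal.coe_le_coe_iff]
    exact Real.tsum_le_of_sum_range_le hnn hpart

lemma modDerivAt_zero_eq (ha : ∀ j : ℕ, 1 ≤ j → 0 ≤ a j) (hR : R ≤ genRadius a) (hR0 : 0 < R)
    (hRt : R ≠ ⊤) (h : modDerivAt a 0 R ≠ ⊤) :
    (Summable fun j : ℕ => genCoeff a j * R.toReal ^ j) ∧
      modDerivAt a 0 R = ((∑' j : ℕ, genCoeff a j * R.toReal ^ j : ℝ) : EReal) :=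
  tsum_eq_iSup (genCoeff_nonneg ha) hR0 hRt (fun _ hr hrR =>
    ⟨(summableBelow_genCoeff hR).summable hr.le hrR, modDeriv_zero _ _⟩) h

lemma modDerivAt_one_eq (ha : ∀ j : ℕ, 1 ≤ j → 0 ≤ a j) (hR : R ≤ genRadius a) (hR0 : 0 < R)
    (hRt : R ≠ ⊤) (h : modDerivAt a 1 R ≠ ⊤) :
    (Summable fun j : ℕ => (j : ℝ) * genCoeff a j * R.toReal ^ j) ∧
      modDerivAt a 1 R = ((∑' j : ℕ, (j : ℝ) * genCoeff a j * R.toReal ^ j : ℝ) : EReal) :=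
  tsum_eq_iSup (fun j => mul_nonneg (Nat.cast_nonneg j) (genCoeff_nonneg ha j)) hR0 hRt
    (fun _ hr hrR => ⟨(summableBelow_genCoeff hR).natCast_mul.summable hr.le hrR,
      modDeriv_one hR hr hrR⟩) h

lemma modDerivAt_two_eq (ha : ∀ j : ℕ, 1 ≤ j → 0 ≤ a j) (hR : R ≤ genRadius a) (hR0 : 0 < R)
    (hRt : R ≠ ⊤) (h : modDerivAt a 2 R ≠ ⊤) :
    (Summable fun j : ℕ => (j : ℝ) * (j - 1) * genCoeff a j * R.toReal ^ j) ∧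
      modDerivAt a 2 R =
        ((∑' j : ℕ, (j : ℝ) * (j - 1) * genCoeff a j * R.toReal ^ j : ℝ) : EReal) := by
  refine tsum_eq_iSup (fun j => ?_) hR0 hRt (fun _ hr hrR => ⟨?_, modDeriv_two hR hr hrR⟩) h
  · rcases Nat.eq_zero_or_pos j with rfl | hj
    · simp
    · have : (1 : ℝ) ≤ j := by exact_mod_cast hj
      exact mul_nonneg (mul_nonneg (by positivity) (by linarith)) (genCoeff_nonneg ha j)
  · have h := summableBelow_genCoeff hR
    refine ((h.natCast_mul.natCast_mul.summable hr.le hrR).sub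
      (h.natCast_mul.summable hr.le hrR)).congr fun j => ?_
    ring

/-- A finite first modified derivative forces a finite radius. -/
lemma ne_top_of_modDerivAt_one_ne_top (ha : ∀ j : ℕ, 1 ≤ j → 0 ≤ a j)
    (hnd : ∃ j : ℕ, 2 ≤ j ∧ 0 < a j) (hR : R ≤ genRadius a) (h : modDerivAt a 1 R ≠ ⊤) :
    R ≠ ⊤ := by
  rintro rfl
  obtain ⟨j, hj, haj⟩ := hnd
  refine h (EReal.eq_top_iff_forall_lt _ |>.2 fun y => ?_)
  -- The first summand gives a_j r > |y|; the second gives r ≥ 1, hence r^j ≥ r.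
  set r : ℝ := (|y| + 1) / a j + 1 with hr
  have hr1 : 1 ≤ r := by
    rw [hr]
    have : 0 ≤ (|y| + 1) / a j := by positivity
    linarith
  have hr0 : 0 < r := by linarith
  have hle := le_iSup (fun r : {r : ℝ // 0 < r ∧ ENNReal.ofReal r < ⊤} =>
    ((modDeriv a 1 r : ℝ) : EReal)) ⟨r, hr0, ENNReal.ofReal_lt_top⟩
  refine lt_of_lt_of_le ?_ hle
  rw [EReal.coe_lt_coe_iff]
  simp only
  rw [modDeriv_one hR hr0 ENNReal.ofReal_lt_top]
  have hs := (summableBelow_genCoeff hR).natCast_mul.summable hr0.le ENNReal.ofReal_lt_top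
  have h1 := hs.le_tsum j fun i _ => mul_nonneg (mul_nonneg (Nat.cast_nonneg i)
    (genCoeff_nonneg ha i)) (by positivity)
  refine lt_of_lt_of_le ?_ h1
  have hj0 : (j : ℝ) ≠ 0 := by exact_mod_cast (by omega : j ≠ 0)
  have e : (j : ℝ) * genCoeff a j = a j := by
    rw [genCoeff]
    field_simp
  rw [e]
  calc y ≤ |y| := le_abs_self y
    _ < a j * r := by
        rw [hr]
        field_simp
        linarith
    _ ≤ a j * r ^ j := by
        refine mul_le_mul_of_nonneg_left ?_ haj.le
        calc r = r ^ 1 := (pow_one r).symm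
          _ ≤ r ^ j := pow_le_pow_right₀ hr1 (by omega)

/-- Existence and uniqueness of the saddle point. -/
lemma existsUnique_isSaddlePoint (ha : ∀ j : ℕ, 1 ≤ j → 0 ≤ a j)
    (hnd : ∃ j : ℕ, 2 ≤ j ∧ 0 < a j) (hR : R ≤ genRadius a) (h : 1 < modDerivAt a 1 R) :
    ∃! r₁ : ℝ, IsSaddlePoint a R r₁ := by
  have hB := (summableBelow_genCoeff hR).natCast_mul
  set f : ℝ → ℝ := fun x => ∑' j : ℕ, (j : ℝ) * genCoeff a j * x ^ j with hf
  obtain ⟨⟨r₂, hr₂, hr₂R⟩, h2⟩ := lt_iSup_iff.1 h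
  have h2' : 1 < f r₂ := by
    have : (1 : ℝ) < modDeriv a 1 r₂ := by exact_mod_cast h2
    rwa [modDeriv_one hR hr₂ hr₂R] at this
  have hcont : ContinuousOn f (Set.Icc 0 r₂) := fun x hx =>
    (hB.hasDerivAt (x := x) (by
      rw [abs_of_nonneg hx.1]
      exact (ENNReal.ofReal_le_ofReal hx.2).trans_lt hr₂R)).continuousAt.continuousWithinAt
  have hf0 : f 0 = 0 := by
    rw [hf]
    simp only
    rw [tsum_eq_single 0 fun j hj => by simp [hj]]
    simp
  obtain ⟨r₁, hr₁, h1⟩ := intermediate_value_Ioo hr₂.le hcont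
    (show (1 : ℝ) ∈ Set.Ioo (f 0) (f r₂) from ⟨by rw [hf0]; exact one_pos, h2'⟩)
  have hr₁R : ENNReal.ofReal r₁ < R := (ENNReal.ofReal_le_ofReal hr₁.2.le).trans_lt hr₂R
  have hmono : ∀ x y : ℝ, 0 < x → x < y → ENNReal.ofReal y < R → f x < f y := by
    intro x y hx hxy hy
    obtain ⟨j, hj, haj⟩ := hnd
    have hxR : ENNReal.ofReal x < R := (ENNReal.ofReal_le_ofReal hxy.le).trans_lt hy
    have hj0 : (j : ℝ) ≠ 0 := by exact_mod_cast (by omega : j ≠ 0)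
    refine (hB.summable hx.le hxR).tsum_lt_tsum (i := j) (fun i => ?_) ?_
      (hB.summable (hx.trans hxy).le hy)
    · exact mul_le_mul_of_nonneg_left (pow_le_pow_left₀ hx.le hxy.le i)
        (mul_nonneg (Nat.cast_nonneg i) (genCoeff_nonneg ha i))
    · refine mul_lt_mul_of_pos_left (pow_lt_pow_left₀ hxy hx.le (by omega)) ?_
      rw [genCoeff]
      have : (0 : ℝ) < j := by exact_mod_cast (by omega : 0 < j)
      positivity
  refine ⟨r₁, ⟨hr₁.1, hr₁R, by rw [modDeriv_one hR hr₁.1 hr₁R]; exact h1⟩, ?_⟩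
  rintro y ⟨hy, hyR, hy1⟩
  rw [modDeriv_one hR hy hyR] at hy1
  have hy1' : f y = f r₁ := hy1.trans h1.symm
  rcases lt_trichotomy y r₁ with hlt | heq | hgt
  · exact absurd hy1' (hmono y r₁ hy hlt hr₁R).ne
  · exact heq
  · exact absurd hy1' (hmono r₁ y hr₁.1 hgt hyR).ne'

end

/-! ### Gaussian limits with finite moments -/

section

variable {θ κ : ℕ → ℝ}

lemma hasPos_genCoeff_mul_pow (hnd : ∃ j : ℕ, 2 ≤ j ∧ 0 < κ j) {r : ℝ} (hr : 0 < r) :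
    ∃ j : ℕ, 2 ≤ j ∧ 0 < genCoeff κ j * r ^ j := by
  obtain ⟨j, hj, hpos⟩ := hnd
  have : (0 : ℝ) < j := by exact_mod_cast (by omega : 0 < j)
  exact ⟨j, hj, mul_pos (div_pos hpos this) (by positivity)⟩

lemma convergesInLaw_of_moments (hθ : ∀ j : ℕ, 1 ≤ j → 0 ≤ θ j)
    (hκ : ∀ j : ℕ, 1 ≤ j → 0 ≤ κ j) (hna : NonArithmetic κ) (hnd : ∃ j : ℕ, 2 ≤ j ∧ 0 < κ j)
    {r m b : ℝ} (hr : 0 < r) (hα : Summable fun j => genCoeff θ j * r ^ j)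
    (hβ : Summable fun j => genCoeff κ j * r ^ j)
    (h2 : Summable fun j : ℕ => (j : ℝ) ^ 2 * (genCoeff κ j * r ^ j))
    (h1 : ∑' j : ℕ, (j : ℝ) * (genCoeff κ j * r ^ j) = 1)
    (hm : ∑' j : ℕ, genCoeff κ j * r ^ j = m)
    (hb : ∑' j : ℕ, (j : ℝ) ^ 2 * (genCoeff κ j * r ^ j) = b) :
    0 < m - 1 / b ∧
    ConvergesInLaw θ κ (normalizedTotal m (m - 1 / b)) (id : ℝ → ℝ) (gaussianReal 0 1) := by
  have hα0 : ∀ j, 0 ≤ genCoeff θ j * r ^ j := fun j =>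
    mul_nonneg (genCoeff_nonneg hθ j) (by positivity)
  have hβ0 : ∀ j, 0 ≤ genCoeff κ j * r ^ j := fun j =>
    mul_nonneg (genCoeff_nonneg hκ j) (by positivity)
  obtain ⟨hbpos, hv⟩ := sub_one_div_pos hβ0 hβ h2 (hna.genCoeff_mul_pow hr)
    (hasPos_genCoeff_mul_pow hnd hr) h1
  rw [hb] at hbpos
  rw [hb, hm] at hv
  have hE := lap_isLittleO_sq hβ0 hβ h2
  rw [h1, hm, hb] at hE
  simp only [Complex.ofReal_one, one_mul] at hE
  exact ⟨hv, convergesInLaw_gaussian_two hθ hκ hna hr hβ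
    (fun ξ hξ => summable_mul_exp_neg hα0 hα hξ.le) hm hbpos hv hE
    (tendsto_lap_nhdsWithin_zero hα0 hα)⟩

variable {R : ℝ≥0∞}

/-- The subcritical case. -/
theorem convergesInLaw_subcritical (hθ : ∀ j : ℕ, 1 ≤ j → 0 ≤ θ j)
    (hκ : ∀ j : ℕ, 1 ≤ j → 0 ≤ κ j) (hna : NonArithmetic κ) (hnd : ∃ j : ℕ, 2 ≤ j ∧ 0 < κ j)
    (hκR : R ≤ genRadius κ) (hθR : R ≤ genRadius θ) {r : ℝ} (hr : IsSaddlePoint κ R r) :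
    0 < gen κ r - 1 / bTwo κ r ∧
      ConvergesInLaw θ κ (normalizedTotal (gen κ r) (gen κ r - 1 / bTwo κ r))
        (id : ℝ → ℝ) (gaussianReal 0 1) := by
  obtain ⟨hr0, hrR, h1⟩ := hr
  have hB := summableBelow_genCoeff hκR
  have s1 := hB.natCast_mul.summable hr0.le hrR
  have s2 := hB.natCast_mul.natCast_mul.summable hr0.le hrR
  refine convergesInLaw_of_moments hθ hκ hna hnd hr0
    ((summableBelow_genCoeff hθR).summable hr0.le hrR) (hB.summable hr0.le hrR)
    (s2.congr fun j => by ring) ?_ rfl ?_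
  · rw [← h1, modDeriv_one hκR hr0 hrR]
    exact tsum_congr fun j => by ring
  · rw [bTwo, modDeriv_one hκR hr0 hrR, modDeriv_two hκR hr0 hrR, ← s1.tsum_add
      ((s2.sub s1).congr fun j => by ring)]
    exact tsum_congr fun j => by ring

/-- The moments of the weights at a critical point on the boundary of the disc. -/
lemma moments_critical (hκ : ∀ j : ℕ, 1 ≤ j → 0 ≤ κ j) (hR : 0 < R) (hRt : R ≠ ⊤)
    (hκR : R ≤ genRadius κ) (h1 : modDerivAt κ 1 R = 1) (h2 : modDerivAt κ 2 R ≠ ⊤) :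
    (Summable fun j : ℕ => (j : ℝ) ^ 2 * (genCoeff κ j * R.toReal ^ j)) ∧
    ∑' j : ℕ, (j : ℝ) * (genCoeff κ j * R.toReal ^ j) = 1 ∧
    ∑' j : ℕ, (j : ℝ) ^ 2 * (genCoeff κ j * R.toReal ^ j) = bTwoAt κ R := by
  obtain ⟨s1, e1⟩ := modDerivAt_one_eq hκ hκR hR hRt (by rw [h1]; exact EReal.coe_ne_top 1)
  obtain ⟨s2, e2⟩ := modDerivAt_two_eq hκ hκR hR hRt h2
  refine ⟨(s1.add s2).congr fun j => by ring, ?_, ?_⟩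
  · rw [h1] at e1
    have : (1 : ℝ) = ∑' j : ℕ, (j : ℝ) * genCoeff κ j * R.toReal ^ j := by exact_mod_cast e1
    rw [this]
    exact tsum_congr fun j => by ring
  · rw [bTwoAt, e1, e2, EReal.toReal_coe, EReal.toReal_coe, ← s1.tsum_add s2]
    exact tsum_congr fun j => by ring

/-- Finiteness of the zeroth modified derivative from that of the first one. -/
lemma gen_boundary (hκ : ∀ j : ℕ, 1 ≤ j → 0 ≤ κ j) (hR : 0 < R) (hRt : R ≠ ⊤)
    (hκR : R ≤ genRadius κ) (h1 : modDerivAt κ 1 R ≠ ⊤) :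
    (Summable fun j : ℕ => genCoeff κ j * R.toReal ^ j) ∧
    ∑' j : ℕ, genCoeff κ j * R.toReal ^ j = (modDerivAt κ 0 R).toReal := by
  obtain ⟨s1, e1⟩ := modDerivAt_one_eq hκ hκR hR hRt h1
  have hle : ∀ (r : ℝ), 0 ≤ r → ∀ j : ℕ, genCoeff κ j * r ^ j ≤
      (j : ℝ) * genCoeff κ j * r ^ j := by
    intro r hr j
    rcases Nat.eq_zero_or_pos j with rfl | hj
    · simp
    · have h : (1 : ℝ) ≤ j := by exact_mod_cast hj
      have := genCoeff_nonneg hκ j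
      have h3 : 0 ≤ genCoeff κ j * r ^ j := by positivity
      nlinarith
  have htop : modDerivAt κ 0 R ≠ ⊤ := by
    refine ne_top_of_le_ne_top h1 (iSup_mono fun r => ?_)
    obtain ⟨r, hr, hrR⟩ := r
    rw [EReal.coe_le_coe_iff]
    simp only
    rw [modDeriv_zero, modDeriv_one hκR hr hrR]
    have hB := summableBelow_genCoeff hκR
    exact (hB.summable hr.le hrR).tsum_le_tsum (hle r hr.le) (hB.natCast_mul.summable hr.le hrR)
  obtain ⟨s0, e0⟩ := modDerivAt_zero_eq hκ hκR hR hRt htop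
  exact ⟨s0, by rw [e0, EReal.toReal_coe]⟩

/-- The critical case with finite moments. -/
theorem convergesInLaw_critical_finite (hθ : ∀ j : ℕ, 1 ≤ j → 0 ≤ θ j)
    (hκ : ∀ j : ℕ, 1 ≤ j → 0 ≤ κ j) (hna : NonArithmetic κ) (hnd : ∃ j : ℕ, 2 ≤ j ∧ 0 < κ j)
    (hR : 0 < R) (hκR : R ≤ genRadius κ) (hθR : R ≤ genRadius θ)
    (h1 : modDerivAt κ 1 R = 1) (h0 : modDerivAt θ 0 R < ⊤) (h2 : modDerivAt κ 2 R < ⊤) :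
    0 < (modDerivAt κ 0 R).toReal - 1 / bTwoAt κ R ∧
      ConvergesInLaw θ κ
        (normalizedTotal (modDerivAt κ 0 R).toReal
          ((modDerivAt κ 0 R).toReal - 1 / bTwoAt κ R))
        (id : ℝ → ℝ) (gaussianReal 0 1) := by
  have h1t : modDerivAt κ 1 R ≠ ⊤ := by rw [h1]; exact EReal.coe_ne_top 1
  have hRt := ne_top_of_modDerivAt_one_ne_top hκ hnd hκR h1t
  obtain ⟨s2, e1, e2⟩ := moments_critical hκ hR hRt hκR h1 h2.ne
  obtain ⟨s0, e0⟩ := gen_boundary hκ hR hRt hκR h1t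
  exact convergesInLaw_of_moments hθ hκ hna hnd (ENNReal.toReal_pos hR.ne' hRt)
    (modDerivAt_zero_eq hθ hθR hR hRt h0.ne).1 s0 s2 e1 e0 e2

end

/-! ### Singular expansions in the variable `w = -log (z / R)` -/

/-- The domain `{w ≠ 0 : Re w > -k |Im w|}`. -/
def wedge (k : ℝ) : Set ℂ := {w : ℂ | w ≠ 0 ∧ -(k * |w.im|) < w.re}

lemma halfPlane_subset_wedge {k : ℝ} (hk : 0 ≤ k) : {w : ℂ | 0 < w.re} ⊆ wedge k := by
  intro w hw
  have hw' : 0 < w.re := hw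
  refine ⟨fun h => by simp [h] at hw', ?_⟩
  have : 0 ≤ k * |w.im| := by positivity
  linarith

lemma norm_one_sub_exp_neg_sub_le {w : ℂ} (hw : ‖w‖ ≤ 1) :
    ‖1 - Complex.exp (-w) - w‖ ≤ ‖w‖ ^ 2 := by
  have h := Complex.norm_exp_sub_one_sub_id_le (x := -w) (by simpa using hw)
  rw [norm_neg] at h
  have e : 1 - Complex.exp (-w) - w = -(Complex.exp (-w) - 1 - -w) := by ring
  rwa [e, norm_neg]

lemma eventually_norm_le (S : Set ℂ) {ε : ℝ} (hε : 0 < ε) : ∀ᶠ w : ℂ in 𝓝[S] 0, ‖w‖ < ε := by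
  have h : Tendsto (fun w : ℂ => ‖w‖) (𝓝[S] 0) (𝓝 0) := by
    have := (continuous_norm.tendsto (0 : ℂ)).mono_left (nhdsWithin_le_nhds (s := S))
    rwa [norm_zero] at this
  exact h.eventually (eventually_lt_nhds hε)

lemma one_sub_exp_neg_isBigO (S : Set ℂ) :
    (fun w : ℂ => 1 - Complex.exp (-w)) =O[𝓝[S] 0] fun w => w := by
  refine IsBigO.of_bound 2 ?_
  filter_upwards [eventually_norm_le S one_pos] with w hw
  have h := norm_one_sub_exp_neg_sub_le hw.le
  calc ‖1 - Complex.exp (-w)‖ = ‖(1 - Complex.exp (-w) - w) + w‖ := by ring_nf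
    _ ≤ ‖1 - Complex.exp (-w) - w‖ + ‖w‖ := norm_add_le _ _
    _ ≤ ‖w‖ ^ 2 + ‖w‖ := by gcongr
    _ ≤ 2 * ‖w‖ := by nlinarith [norm_nonneg w]

lemma tendsto_one_sub_exp_neg_div (k : ℝ) :
    Tendsto (fun w : ℂ => (1 - Complex.exp (-w)) / w) (𝓝[wedge k] 0) (𝓝 1) := by
  rw [tendsto_iff_norm_sub_tendsto_zero]
  have h0 : Tendsto (fun w : ℂ => ‖w‖) (𝓝[wedge k] 0) (𝓝 0) := by
    have := (continuous_norm.tendsto (0 : ℂ)).mono_left (nhdsWithin_le_nhds (s := wedge k))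
    rwa [norm_zero] at this
  refine squeeze_zero' (Eventually.of_forall fun _ => norm_nonneg _) ?_ h0
  filter_upwards [self_mem_nhdsWithin, eventually_norm_le (wedge k) one_pos] with w hw h1
  have hw0 : w ≠ 0 := hw.1
  have e : (1 - Complex.exp (-w)) / w - 1 = (1 - Complex.exp (-w) - w) / w := by field_simp
  rw [e, norm_div, div_le_iff₀ (norm_pos_iff.2 hw0), ← pow_two]
  exact norm_one_sub_exp_neg_sub_le h1.le

/-- For k < 1 this keeps the argument a fixed distance away from ±π, so that multiplying w by a
factor close to 1 does not cross the branch cut. -/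
lemma abs_arg_lt_of_mem_wedge {k : ℝ} (hk0 : 0 ≤ k) (hk : k ≤ 1) {w : ℂ} (hw : w ∈ wedge k) :
    |w.arg| < Real.arccos (-k) := by
  have hw0 : 0 < ‖w‖ := norm_pos_iff.2 hw.1
  have h1 : -k < Real.cos |w.arg| := by
    rw [Real.cos_abs, Complex.cos_arg hw.1, lt_div_iff₀ hw0]
    have := mul_le_mul_of_nonneg_left (Complex.abs_im_le_norm w) hk0
    linarith [hw.2]
  by_contra! hcon
  have h2 := Real.cos_le_cos_of_nonneg_of_le_pi (Real.arccos_nonneg _)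
    (Complex.abs_arg_le_pi w) hcon
  rw [Real.cos_arccos (by linarith) (by linarith)] at h2
  linarith

/-- `log (1 - e^{-w}) = log w + log ((1 - e^{-w}) / w)` near `0` in a wedge. -/
lemma eventually_log_one_sub_exp_neg {k : ℝ} (hk0 : 0 ≤ k) (hk : k < 1) :
    ∀ᶠ w : ℂ in 𝓝[wedge k] 0, 1 - Complex.exp (-w) ≠ 0 ∧ Complex.log (1 - Complex.exp (-w)) =
      Complex.log w + Complex.log ((1 - Complex.exp (-w)) / w) := by
  have ht := tendsto_one_sub_exp_neg_div k
  have harg : Tendsto (fun w : ℂ => |((1 - Complex.exp (-w)) / w).arg|) (𝓝[wedge k] 0) (𝓝 0) := by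
    have h := ((Complex.continuousAt_arg Complex.one_mem_slitPlane).tendsto.comp ht).abs
    rwa [Complex.arg_one, abs_zero] at h
  have hpos : 0 < Real.pi - Real.arccos (-k) := by
    have : Real.arccos (-k) < Real.arccos (-1) := Real.arccos_lt_arccos le_rfl (by linarith)
      (by linarith)
    rw [Real.arccos_neg_one] at this
    linarith
  filter_upwards [self_mem_nhdsWithin, harg.eventually (eventually_lt_nhds hpos),
    ht.eventually_ne one_ne_zero] with w hw h1 hne
  have hw0 : w ≠ 0 := hw.1
  have hprod : w * ((1 - Complex.exp (-w)) / w) = 1 - Complex.exp (-w) := by field_simp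
  refine ⟨fun h => hne (by rw [h, zero_div]), ?_⟩
  conv_lhs => rw [← hprod]
  have h2 := abs_lt.1 (abs_arg_lt_of_mem_wedge hk0 hk.le hw)
  have h3 := abs_lt.1 h1
  exact Complex.log_mul hw0 hne ⟨by linarith [h2.1, h3.1], by linarith [h2.2, h3.2]⟩

lemma tendsto_log_div {k : ℝ} :
    Tendsto (fun w : ℂ => Complex.log ((1 - Complex.exp (-w)) / w)) (𝓝[wedge k] 0) (𝓝 0) := by
  have h := (continuousAt_clog Complex.one_mem_slitPlane).tendsto.comp
    (tendsto_one_sub_exp_neg_div k)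
  rwa [Complex.log_one] at h

lemma tendsto_log_one_sub_exp_neg {k : ℝ} (hk0 : 0 ≤ k) (hk : k < 1) :
    Tendsto (fun w : ℂ => Complex.log (1 - Complex.exp (-w)) - Complex.log w) (𝓝[wedge k] 0)
      (𝓝 0) := by
  refine tendsto_log_div.congr' ?_
  filter_upwards [eventually_log_one_sub_exp_neg hk0 hk] with w hw
  rw [hw.2]
  ring

/-- In the wedge (1 - e^{-w})^s = w^s ((1 - e^{-w})/w)^s with principal branches, and the second
factor tends to 1. -/
lemma cpow_one_sub_exp_neg_isLittleO {k : ℝ} (hk0 : 0 ≤ k) (hk : k < 1) (s : ℝ) :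
    (fun w : ℂ => (1 - Complex.exp (-w)) ^ (s : ℂ) - w ^ (s : ℂ)) =o[𝓝[wedge k] 0]
      fun w => ‖w‖ ^ s := by
  have h1 : Tendsto (fun w : ℂ => Complex.exp (Complex.log ((1 - Complex.exp (-w)) / w) * s) - 1)
      (𝓝[wedge k] 0) (𝓝 0) := by
    have h := ((Complex.continuous_exp.tendsto _).comp
      ((tendsto_log_div (k := k)).mul_const (s : ℂ))).sub_const 1
    simpa [Function.comp_def] using h
  have hO : (fun w : ℂ => w ^ (s : ℂ)) =O[𝓝[wedge k] 0] fun w => ‖w‖ ^ s := by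
    refine IsBigO.of_bound 1 (Eventually.of_forall fun w => ?_)
    rw [Complex.norm_cpow_real, one_mul, Real.norm_of_nonneg (by positivity)]
  have h2 := hO.mul_isLittleO ((isLittleO_one_iff ℝ).2 h1)
  simp only [mul_one] at h2
  refine h2.congr' ?_ EventuallyEq.rfl
  filter_upwards [eventually_log_one_sub_exp_neg hk0 hk, self_mem_nhdsWithin] with w hw hw'
  rw [Complex.cpow_def_of_ne_zero hw.1, Complex.cpow_def_of_ne_zero hw'.1, hw.2, add_mul,
    Complex.exp_add]
  ring

/-- Under `z = R e^{-w}`, small elements of a wedge are mapped to the domain `Δ₀`. -/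
lemma tendsto_mul_exp_neg {R η φ : ℝ} (hR : 0 < R) (hη : 0 < η) (hφ : 0 < φ)
    (hφ2 : φ < Real.pi / 2) :
    Tendsto (fun w : ℂ => (R : ℂ) * Complex.exp (-w)) (𝓝[wedge (Real.cos φ / 2)] 0)
      (𝓝[deltaDomain R η φ] (R : ℂ)) := by
  have hcos : 0 < Real.cos φ := Real.cos_pos_of_mem_Ioo ⟨by linarith, hφ2⟩
  have hcos1 : Real.cos φ ≤ 1 := Real.cos_le_one φ
  have hcont : Tendsto (fun w : ℂ => (R : ℂ) * Complex.exp (-w)) (𝓝[wedge (Real.cos φ / 2)] 0)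
      (𝓝 (R : ℂ)) := by
    have : Continuous fun w : ℂ => (R : ℂ) * Complex.exp (-w) := by fun_prop
    have h := (this.tendsto 0).mono_left (nhdsWithin_le_nhds (s := wedge (Real.cos φ / 2)))
    simpa using h
  refine tendsto_nhdsWithin_iff.2 ⟨hcont, ?_⟩
  have hbig : ‖(R : ℂ)‖ < ‖(R : ℂ) * (1 + (η : ℂ) * Complex.exp (Complex.I * (φ : ℂ)))‖ := by
    rw [norm_mul]
    have hRpos : 0 < ‖(R : ℂ)‖ := by simpa using hR.ne'
    refine lt_mul_of_one_lt_right hRpos ?_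
    refine lt_of_lt_of_le ?_ (Complex.re_le_norm _)
    have : (1 + (η : ℂ) * Complex.exp (Complex.I * (φ : ℂ))).re = 1 + η * Real.cos φ := by
      rw [mul_comm Complex.I, Complex.exp_mul_I, ← Complex.ofReal_cos, ← Complex.ofReal_sin]
      simp only [Complex.add_re, Complex.one_re, Complex.re_ofReal_mul, Complex.ofReal_re,
        Complex.mul_I_re, Complex.ofReal_im, neg_zero, add_zero]
    rw [this]
    have : 0 < η * Real.cos φ := by positivity
    linarith
  have hnorm := (continuous_norm.tendsto (R : ℂ)).comp hcont
  filter_upwards [self_mem_nhdsWithin,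
    eventually_norm_le (wedge (Real.cos φ / 2)) (show 0 < Real.cos φ / 4 by positivity),
    hnorm.eventually (eventually_lt_nhds hbig)] with w hw hsmall hlt
  have hw0 : 0 < ‖w‖ := norm_pos_iff.2 hw.1
  have hq := norm_one_sub_exp_neg_sub_le (show ‖w‖ ≤ 1 by linarith)
  set q : ℂ := Complex.exp (-w) - 1 with hqdef
  have hq' : ‖q + w‖ ≤ ‖w‖ ^ 2 := by
    have e : q + w = -(1 - Complex.exp (-w) - w) := by rw [hqdef]; ring
    rwa [e, norm_neg]
  have hqlow : ‖w‖ - ‖w‖ ^ 2 ≤ ‖q‖ := by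
    have : ‖w‖ ≤ ‖q + w‖ + ‖q‖ := by
      calc ‖w‖ = ‖(q + w) - q‖ := by ring_nf
        _ ≤ _ := norm_sub_le _ _
    linarith
  have hqpos : 0 < ‖q‖ := by nlinarith
  have hqre : q.re ≤ -w.re + ‖w‖ ^ 2 := by
    have h := (Complex.re_le_norm (q + w)).trans hq'
    rw [Complex.add_re] at h
    linarith
  have hzR : (R : ℂ) * Complex.exp (-w) - R = R * q := by rw [hqdef]; ring
  refine ⟨hlt, fun h => ?_, ?_⟩
  · rw [h, sub_self] at hzR
    have hRC : (R : ℂ) ≠ 0 := by exact_mod_cast hR.ne'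
    have : q = 0 := (mul_eq_zero.1 hzR.symm).resolve_left hRC
    rw [this, norm_zero] at hqpos
    exact lt_irrefl _ hqpos
  · rw [hzR, Complex.arg_real_mul _ hR]
    -- Otherwise q = e^{-w} - 1 would satisfy Re q ≥ cos φ |q|. But q ≈ -w gives Re q ≤ (cos φ /
    -- 2)|w| + |w|² and |q| ≥ |w| - |w|², which is incompatible with |w| < cos φ / 4.
    by_contra! hcon
    have h2 := Real.cos_le_cos_of_nonneg_of_le_pi (abs_nonneg _) (by linarith) hcon
    rw [Real.cos_abs, Complex.cos_arg (norm_pos_iff.1 hqpos), le_div_iff₀ hqpos] at h2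
    have h3 := hw.2
    have h4 : Real.cos φ / 2 * |w.im| ≤ Real.cos φ / 2 * ‖w‖ :=
      mul_le_mul_of_nonneg_left (Complex.abs_im_le_norm w) (by positivity)
    nlinarith

section

variable {R η φ : ℝ}

lemma HasExpansion.comp_exp_neg {G F : ℂ → ℂ} {t : ℝ} (h : HasExpansion R η φ G F t) (hR : 0 < R)
    (hη : 0 < η) (hφ : 0 < φ) (hφ2 : φ < Real.pi / 2) (ht : 0 ≤ t) :
    (fun w : ℂ => G (R * Complex.exp (-w)) - F (R * Complex.exp (-w)))
      =O[𝓝[wedge (Real.cos φ / 2)] 0] fun w => ‖w‖ ^ t := by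
  have h1 := IsBigO.comp_tendsto h (tendsto_mul_exp_neg hR hη hφ hφ2)
  refine IsBigO.trans h1 ?_
  have hRC : (R : ℂ) ≠ 0 := by exact_mod_cast hR.ne'
  have h2 := (one_sub_exp_neg_isBigO (wedge (Real.cos φ / 2))).norm_norm.rpow ht
    (Eventually.of_forall fun _ => norm_nonneg _)
  refine h2.congr_left fun w => ?_
  simp only [Function.comp]
  rw [mul_div_cancel_left₀ _ hRC]

lemma isLittleO_rpow_rpow_norm (S : Set ℂ) {s t : ℝ} (hs : 0 ≤ s) (hst : s < t) :
    (fun w : ℂ => ‖w‖ ^ t) =o[𝓝[S] 0] fun w => ‖w‖ ^ s := by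
  have h : Tendsto (fun w : ℂ => ‖w‖ ^ (t - s)) (𝓝[S] 0) (𝓝 0) := by
    have hc : Continuous fun w : ℂ => ‖w‖ ^ (t - s) :=
      continuous_norm.rpow_const fun _ => Or.inr (by linarith)
    have := (hc.tendsto 0).mono_left (nhdsWithin_le_nhds (s := S))
    rwa [norm_zero, Real.zero_rpow (by linarith)] at this
  have h1 := (isBigO_refl (fun w : ℂ => ‖w‖ ^ s) (𝓝[S] 0)).mul_isLittleO
    ((isLittleO_one_iff ℝ).2 h)
  simp only [mul_one] at h1
  refine h1.congr_left fun w => ?_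
  rw [← Real.rpow_add_of_nonneg (norm_nonneg w) hs (by linarith)]
  congr 1
  ring

/-- The values of a continuation are those of the Laplace series. -/
lemma IsContinuation.eq_lap {a : ℕ → ℝ} {G : ℂ → ℂ} (h : IsContinuation a R η φ G) (hR : 0 < R)
    {w : ℂ} (hw : 0 < w.re) :
    G (R * Complex.exp (-w)) = lap (fun j => genCoeff a j * R ^ j) w := by
  rw [h.2, genC, lap]
  · refine tsum_congr fun j => ?_
    rw [mul_pow, ← Complex.exp_nat_mul]
    push_cast
    rw [mul_assoc]
    congr 3
    ring
  · rw [norm_mul, Complex.norm_real, Real.norm_of_nonneg hR.le, Complex.norm_exp]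
    refine mul_lt_of_lt_one_right hR ?_
    rw [Real.exp_lt_one_iff]
    simpa using hw

/-- A logarithmic singularity, in the variable `w`. -/
lemma tendsto_add_log {G : ℂ → ℂ} {θs δ : ℝ} (hR : 0 < R)
    (hη : 0 < η) (hφ : 0 < φ) (hφ2 : φ < Real.pi / 2) (hδ : 0 < δ)
    (h : HasExpansion R η φ G (fun z => -(θs : ℂ) * Complex.log (1 - z / R)) δ) :
    Tendsto (fun w : ℂ => G (R * Complex.exp (-w)) + θs * Complex.log w)
      (𝓝[wedge (Real.cos φ / 2)] 0) (𝓝 0) := by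
  have hRC : (R : ℂ) ≠ 0 := by exact_mod_cast hR.ne'
  have hcos : 0 < Real.cos φ := Real.cos_pos_of_mem_Ioo ⟨by linarith, hφ2⟩
  have hk : Real.cos φ / 2 < 1 := by linarith [Real.cos_le_one φ]
  have h1 := h.comp_exp_neg hR hη hφ hφ2 hδ.le
  have h2 : Tendsto (fun w : ℂ => ‖w‖ ^ δ) (𝓝[wedge (Real.cos φ / 2)] 0) (𝓝 0) := by
    have := isLittleO_rpow_rpow_norm (wedge (Real.cos φ / 2)) le_rfl hδ
    simp only [Real.rpow_zero] at this
    exact (isLittleO_one_iff ℝ).1 this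
  have h3 := (h1.trans_tendsto h2).sub
    ((tendsto_log_one_sub_exp_neg (k := Real.cos φ / 2) (by positivity) hk).const_mul (θs : ℂ))
  rw [mul_zero, sub_zero] at h3
  refine h3.congr fun w => ?_
  rw [mul_div_cancel_left₀ _ hRC]
  ring

end

/-! ### The critical cases with singular expansions -/

section

variable {θ κ : ℕ → ℝ} {R : ℝ≥0∞}

lemma summable_genCoeff_mul_exp_neg (hR : 0 < R) (hRt : R ≠ ⊤)
    (hθR : R ≤ genRadius θ) (ξ : ℝ) (hξ : 0 < ξ) :
    Summable fun j : ℕ => genCoeff θ j * R.toReal ^ j * Real.exp (-(ξ * j)) := by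
  have hρ : 0 < R.toReal := ENNReal.toReal_pos hR.ne' hRt
  have h1 : R.toReal * Real.exp (-ξ) < R.toReal :=
    mul_lt_of_lt_one_right hρ (Real.exp_lt_one_iff.2 (by linarith))
  have h2 : 0 ≤ R.toReal * Real.exp (-ξ) := by positivity
  refine ((summableBelow_genCoeff hθR).summable h2
    ((ENNReal.ofReal_lt_iff_lt_toReal h2 hRt).2 h1)).congr fun j => ?_
  rw [mul_pow, ← Real.exp_nat_mul, mul_assoc]
  congr 3
  ring

lemma one_sub_exp_neg_sub_isBigO (S : Set ℂ) :
    (fun w : ℂ => 1 - Complex.exp (-w) - w) =O[𝓝[S] 0] fun w => ‖w‖ ^ (2 : ℝ) := by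
  refine IsBigO.of_bound 1 ?_
  filter_upwards [eventually_norm_le S one_pos] with w hw
  rw [one_mul, Real.norm_of_nonneg (by positivity), Real.rpow_two]
  exact norm_one_sub_exp_neg_sub_le hw.le

/-- The critical case with infinite second derivative. -/
theorem convergesInLaw_critical_infinite (hθ : ∀ j : ℕ, 1 ≤ j → 0 ≤ θ j)
    (hκ : ∀ j : ℕ, 1 ≤ j → 0 ≤ κ j) (hna : NonArithmetic κ) (hnd : ∃ j : ℕ, 2 ≤ j ∧ 0 < κ j)
    (hR : 0 < R) (hκR : R ≤ genRadius κ) (hθR : R ≤ genRadius θ)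
    {η φ δ s a θs : ℝ} {Gθ Gκ : ℂ → ℂ} (hη : 0 < η) (hφ : 0 < φ) (hφ2 : φ < Real.pi / 2)
    (hδ : 0 < δ) (hs : 1 < s) (hs2 : s < 2) (ha : 0 < a) (hθs : 0 ≤ θs)
    (hcθ : IsContinuation θ R.toReal η φ Gθ) (hcκ : IsContinuation κ R.toReal η φ Gκ)
    (h1 : modDerivAt κ 1 R = 1)
    (hEθ : HasExpansion R.toReal η φ Gθ
      (fun z => -(θs : ℂ) * Complex.log (1 - z / R.toReal)) δ)
    (hEκ : HasExpansion R.toReal η φ Gκ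
      (fun z => ((modDerivAt κ 0 R).toReal : ℂ) - (1 - z / R.toReal)
        + (a : ℂ) * (1 - z / R.toReal) ^ (s : ℂ)) (s + δ)) :
    ConvergesInLaw θ κ
      (normalizedTotal (modDerivAt κ 0 R).toReal (modDerivAt κ 0 R).toReal)
      (id : ℝ → ℝ) (gaussianReal 0 1) := by
  have h1t : modDerivAt κ 1 R ≠ ⊤ := by rw [h1]; exact EReal.coe_ne_top 1
  have hRt := ne_top_of_modDerivAt_one_ne_top hκ hnd hκR h1t
  obtain ⟨s0, e0⟩ := gen_boundary hκ hR hRt hκR h1t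
  have hρ : 0 < R.toReal := ENNReal.toReal_pos hR.ne' hRt
  set ρ := R.toReal with hρdef
  set m := (modDerivAt κ 0 R).toReal with hm
  have hm0 : 0 < m := by
    rw [← e0]
    obtain ⟨j, _, hj⟩ := hasPos_genCoeff_mul_pow hnd hρ
    exact s0.tsum_pos (fun j => mul_nonneg (genCoeff_nonneg hκ j) (by positivity)) j hj
  have hcos : 0 < Real.cos φ := Real.cos_pos_of_mem_Ioo ⟨by linarith, hφ2⟩
  have hk : Real.cos φ / 2 < 1 := by linarith [Real.cos_le_one φ]
  have hρC : (ρ : ℂ) ≠ 0 := by exact_mod_cast hρ.ne'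
  have hle : 𝓝[{w : ℂ | 0 < w.re}] 0 ≤ 𝓝[wedge (Real.cos φ / 2)] (0 : ℂ) :=
    nhdsWithin_mono _ (halfPlane_subset_wedge (by positivity))
  refine convergesInLaw_gaussian_of_lt_two (C := 0) hθ hκ hna hρ s0
    (summable_genCoeff_mul_exp_neg hR hRt hθR) e0 hm0 hs hs2 ha hθs ?_ ?_
  -- Three errors, all o(|w|^s): the remainder of the hypothesis, the replacement of 1 - e^{-w} by w
  -- (order 2 > s), and the same replacement inside the power.
  · have hO1 := (hEκ.comp_exp_neg hρ hη hφ hφ2 (by linarith)).trans_isLittleO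
      (isLittleO_rpow_rpow_norm _ (by linarith) (show s < s + δ by linarith))
    have hO2 := (one_sub_exp_neg_sub_isBigO (wedge (Real.cos φ / 2))).trans_isLittleO
      (isLittleO_rpow_rpow_norm _ (by linarith) hs2)
    have hO3 := (cpow_one_sub_exp_neg_isLittleO (show 0 ≤ Real.cos φ / 2 by positivity) hk
      s).const_mul_left (a : ℂ)
    refine (((hO1.sub hO2).add hO3).mono hle).congr' ?_ EventuallyEq.rfl
    filter_upwards [self_mem_nhdsWithin] with w hw
    rw [hcκ.eq_lap hρ hw, mul_div_cancel_left₀ _ hρC]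
    ring
  · refine ((tendsto_add_log hρ hη hφ hφ2 hδ hEθ).mono_left hle).congr' ?_
    filter_upwards [self_mem_nhdsWithin] with w hw
    rw [hcθ.eq_lap hρ hw]

/-- The critical case with finite second derivative and a logarithmic singularity. -/
theorem convergesInLaw_critical_log (hθ : ∀ j : ℕ, 1 ≤ j → 0 ≤ θ j)
    (hκ : ∀ j : ℕ, 1 ≤ j → 0 ≤ κ j) (hna : NonArithmetic κ) (hnd : ∃ j : ℕ, 2 ≤ j ∧ 0 < κ j)
    (hR : 0 < R) (hκR : R ≤ genRadius κ) (hθR : R ≤ genRadius θ)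
    {η φ δ θs : ℝ} {Gθ : ℂ → ℂ} (hη : 0 < η) (hφ : 0 < φ) (hφ2 : φ < Real.pi / 2)
    (hδ : 0 < δ) (hθs : 0 < θs)
    (hcθ : IsContinuation θ R.toReal η φ Gθ)
    (h1 : modDerivAt κ 1 R = 1) (h2 : modDerivAt κ 2 R < ⊤)
    (hEθ : HasExpansion R.toReal η φ Gθ
      (fun z => -(θs : ℂ) * Complex.log (1 - z / R.toReal)) δ) :
    0 < (modDerivAt κ 0 R).toReal - 1 / bTwoAt κ R ∧
    ∀ {Ω : Type*} [MeasurableSpace Ω] (P : Measure Ω) [IsProbabilityMeasure P] (Z X : Ω → ℝ),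
      HasLaw Z (gaussianReal 0 1) P → HasLaw X (gammaMeasure (θs / 2) 1) P → IndepFun Z X P →
      ConvergesInLaw θ κ
        (normalizedTotal (modDerivAt κ 0 R).toReal
          ((modDerivAt κ 0 R).toReal - 1 / bTwoAt κ R))
        (fun ω => Z ω
          - Real.sqrt (2 * X ω / ((modDerivAt κ 0 R).toReal * bTwoAt κ R - 1))) P := by
  have h1t : modDerivAt κ 1 R ≠ ⊤ := by rw [h1]; exact EReal.coe_ne_top 1
  have hRt := ne_top_of_modDerivAt_one_ne_top hκ hnd hκR h1t
  obtain ⟨s0, e0⟩ := gen_boundary hκ hR hRt hκR h1t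
  obtain ⟨s2, e1, e2⟩ := moments_critical hκ hR hRt hκR h1 h2.ne
  have hρ : 0 < R.toReal := ENNReal.toReal_pos hR.ne' hRt
  set ρ := R.toReal with hρdef
  set m := (modDerivAt κ 0 R).toReal with hm
  set b := bTwoAt κ R with hbdef
  obtain ⟨hbpos, hv⟩ := sub_one_div_pos
    (fun j => mul_nonneg (genCoeff_nonneg hκ j) (pow_nonneg hρ.le j)) s0 s2
    (hna.genCoeff_mul_pow hρ) (hasPos_genCoeff_mul_pow hnd hρ) e1
  rw [e2] at hbpos
  rw [e0, e2] at hv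
  refine ⟨hv, fun P _ Z X hZ hX hZX => ?_⟩
  have hcos : 0 < Real.cos φ := Real.cos_pos_of_mem_Ioo ⟨by linarith, hφ2⟩
  have hρC : (ρ : ℂ) ≠ 0 := by exact_mod_cast hρ.ne'
  have hle : 𝓝[{w : ℂ | 0 < w.re}] 0 ≤ 𝓝[wedge (Real.cos φ / 2)] (0 : ℂ) :=
    nhdsWithin_mono _ (halfPlane_subset_wedge (by positivity))
  -- The contour stays in the right half-plane, where finite moments already give the second-order
  -- expansion.
  have hE := lap_isLittleO_sq
    (fun j => mul_nonneg (genCoeff_nonneg hκ j) (pow_nonneg hρ.le j)) s0 s2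
  rw [e1, e0, e2] at hE
  simp only [Complex.ofReal_one, one_mul] at hE
  refine convergesInLaw_gamma (C := 0) hθ hκ hna hρ s0
    (summable_genCoeff_mul_exp_neg hR hRt hθR) e0 hbpos hv hθs hE ?_ P hZ hX hZX
  refine ((tendsto_add_log hρ hη hφ hφ2 hδ hEθ).mono_left hle).congr' ?_
  filter_upwards [self_mem_nhdsWithin] with w hw
  rw [hcθ.eq_lap hρ hw]

end

/-! ### Contours in a wedge -/

/-- On an open convex set the integrals of a holomorphic function over segments are differences
of values of a primitive. -/
lemma exists_primitive_segment {f : ℂ → ℂ} {S : Set ℂ} (hc : Convex ℝ S) (ho : IsOpen S)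
    (hf : DifferentiableOn ℂ f S) :
    ∃ F : ℂ → ℂ, ∀ (p ζ : ℂ) (T : ℝ), 0 ≤ T → p ∈ S → p + ζ * T ∈ S →
      ζ * ∫ t in (0 : ℝ)..T, f (p + ζ * t) = F (p + ζ * T) - F p := by
  obtain ⟨F, hF⟩ := hc.exists_forall_hasDerivWithinAt hf
  refine ⟨F, fun p ζ T hT hp hq => ?_⟩
  have hmem : ∀ t ∈ Set.uIcc (0 : ℝ) T, p + ζ * t ∈ S := by
    intro t ht
    rw [Set.uIcc_of_le hT] at ht
    rcases hT.eq_or_lt with rfl | hT0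
    · have : t = 0 := le_antisymm ht.2 ht.1
      simpa [this] using hp
    have h := hc.add_smul_sub_mem hp hq (t := t / T)
      ⟨div_nonneg ht.1 hT, (div_le_one hT0).2 ht.2⟩
    have e : p + (t / T) • (p + ζ * T - p) = p + ζ * t := by
      rw [Complex.real_smul]
      have : (T : ℂ) ≠ 0 := by exact_mod_cast hT0.ne'
      push_cast
      field_simp
      ring
    rwa [e] at h
  have hline : ∀ t : ℝ, HasDerivAt (fun t : ℝ => p + ζ * (t : ℂ)) ζ t := by
    intro t
    have h := ((hasDerivAt_id t).ofReal_comp.const_mul ζ).const_add p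
    simpa using h
  have hder : ∀ t ∈ Set.uIcc (0 : ℝ) T,
      HasDerivAt (fun t : ℝ => F (p + ζ * t)) (ζ * f (p + ζ * t)) t := by
    intro t ht
    have h1 := (hF _ (hmem t ht)).hasDerivAt (ho.mem_nhds (hmem t ht))
    have h2 := h1.comp t (hline t)
    rwa [mul_comm] at h2
  have hcont : ContinuousOn (fun t : ℝ => ζ * f (p + ζ * t)) (Set.uIcc 0 T) := by
    refine continuousOn_const.mul (hf.continuousOn.comp ?_ hmem)
    exact Continuous.continuousOn (by fun_prop)
  rw [← intervalIntegral.integral_const_mul,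
    intervalIntegral.integral_eq_sub_of_hasDerivAt hder hcont.intervalIntegrable]
  simp

/-- For k > 0 the wedge opens by more than π and is not convex. Its upper and lower parts are
handled in half-planes contained in it, where primitives exist. -/
lemma convex_halfPlane (c d : ℝ) : Convex ℝ {w : ℂ | 0 < c * w.re + d * w.im} := by
  intro x hx y hy a b ha hb hab
  have hx' : 0 < c * x.re + d * x.im := hx
  have hy' : 0 < c * y.re + d * y.im := hy
  have e : c * (a • x + b • y).re + d * (a • x + b • y).im =
      a * (c * x.re + d * x.im) + b * (c * y.re + d * y.im) := by
    simp only [Complex.add_re, Complex.add_im, Complex.real_smul, Complex.re_ofReal_mul,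
      Complex.im_ofReal_mul]
    ring
  change 0 < c * (a • x + b • y).re + d * (a • x + b • y).im
  rw [e]
  rcases ha.eq_or_lt with rfl | ha'
  · have : b = 1 := by linarith
    subst this
    linarith
  · have := mul_pos ha' hx'
    have := mul_nonneg hb hy'.le
    linarith

lemma isOpen_halfPlane (c d : ℝ) : IsOpen {w : ℂ | 0 < c * w.re + d * w.im} := by
  refine isOpen_lt continuous_const ?_
  exact (continuous_const.mul Complex.continuous_re).add
    (continuous_const.mul Complex.continuous_im)

lemma norm_le_abs_re_add_abs_im {w : ℂ} {x y : ℝ} (hx : |w.re| ≤ x) (hy : |w.im| ≤ y) :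
    ‖w‖ ≤ x + y :=
  (Complex.norm_le_abs_re_add_abs_im w).trans (add_le_add hx hy)

/-- Deformation of half of a vertical segment into a segment of the ray in the direction
`-k' + σ i`, followed by a horizontal segment. -/
lemma segment_eq_ray {f : ℂ → ℂ} {k k' r₀ a ε σ : ℝ} (hk' : 0 < k') (hkk : k' < k)
    (ha : 0 < a) (hε : 0 < ε) (hr : a + k' * ε + ε < r₀) (hσ : σ ^ 2 = 1)
    (hf : DifferentiableOn ℂ f (wedge k ∩ Metric.ball 0 r₀)) :
    (σ * Complex.I) * ∫ y in (0 : ℝ)..ε, f (a + (σ * Complex.I) * y) =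
      (-k' + σ * Complex.I) * (∫ y in (0 : ℝ)..ε, f (a + (-k' + σ * Complex.I) * y)) +
        ∫ x in (0 : ℝ)..(k' * ε), f (a - k' * ε + σ * Complex.I * ε + x) := by
  -- σ = ±1 selects the side of the real axis. On this convex subset of the wedge f has a primitive,
  -- and the three segments form a closed triangle.
  set S : Set ℂ := {w : ℂ | 0 < 1 * w.re + k * σ * w.im} ∩ Metric.ball 0 r₀ with hS
  have hk0 : 0 < k := hk'.trans hkk
  have habs : |σ| = 1 := by
    rw [← sq_abs] at hσ
    nlinarith [abs_nonneg σ]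
  have hsub : S ⊆ wedge k ∩ Metric.ball 0 r₀ := by
    rintro w ⟨hw, hb⟩
    have hw' : 0 < 1 * w.re + k * σ * w.im := hw
    refine ⟨⟨fun h => ?_, ?_⟩, hb⟩
    · rw [h] at hw'
      simp at hw'
    · have h1 : σ * w.im ≤ |w.im| := by
        calc σ * w.im ≤ |σ * w.im| := le_abs_self _
          _ = |w.im| := by rw [abs_mul, habs, one_mul]
      nlinarith
  have hmem : ∀ w : ℂ, 0 < w.re + k * (σ * w.im) → |w.re| ≤ a + k' * ε → |w.im| ≤ ε → w ∈ S := by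
    intro w h1 h2 h3
    refine ⟨?_, ?_⟩
    · change 0 < 1 * w.re + k * σ * w.im
      linarith
    · rw [mem_ball_zero_iff]
      exact (norm_le_abs_re_add_abs_im h2 h3).trans_lt hr
  obtain ⟨F, hF⟩ := exists_primitive_segment
    ((convex_halfPlane 1 (k * σ)).inter (convex_ball 0 r₀))
    ((isOpen_halfPlane 1 (k * σ)).inter Metric.isOpen_ball) (hf.mono hsub)
  have hkε : 0 < k' * ε := by positivity
  have hm0 : (a : ℂ) ∈ S := hmem _ (by simpa using ha)
    (by rw [Complex.ofReal_re, abs_of_pos ha]; linarith) (by simpa using hε.le)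
  have hσε : |σ * ε| ≤ ε := by rw [abs_mul, habs, one_mul, abs_of_pos hε]
  have hm1 : (a : ℂ) + (σ * Complex.I) * ε ∈ S := by
    refine hmem _ ?_ ?_ ?_
    · simp
      rw [← mul_assoc σ σ, ← pow_two, hσ]
      nlinarith
    · simp
      rw [abs_of_pos ha]
      linarith
    · simpa using hσε
  have hm2 : (a : ℂ) + (-k' + σ * Complex.I) * ε ∈ S := by
    refine hmem _ ?_ ?_ ?_
    · simp
      rw [← mul_assoc σ σ, ← pow_two, hσ]
      nlinarith
    · simp
      rw [abs_le]
      constructor <;> linarith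
    · simpa using hσε
  have h1 := hF a (σ * Complex.I) ε hε.le hm0 hm1
  have h2 := hF a (-k' + σ * Complex.I) ε hε.le hm0 hm2
  have e3 : (a : ℂ) + (-k' + σ * Complex.I) * ε + 1 * ((k' * ε : ℝ) : ℂ) =
      a + (σ * Complex.I) * ε := by push_cast; ring
  have h3 := hF (a + (-k' + σ * Complex.I) * ε) 1 (k' * ε) hkε.le hm2 (by rw [e3]; exact hm1)
  rw [e3, one_mul] at h3
  have e4 : ∫ x in (0 : ℝ)..(k' * ε), f (a - k' * ε + σ * Complex.I * ε + x) =
      ∫ x in (0 : ℝ)..(k' * ε), f (a + (-k' + σ * Complex.I) * ε + 1 * x) := by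
    refine intervalIntegral.integral_congr fun x _ => ?_
    congr 1
    ring
  rw [h1, h2, e4, h3]
  ring

/-- Splitting a symmetric integral. -/
lemma integral_symm_eq {f : ℂ → ℂ} {a ε : ℝ}
    (hf : ContinuousOn (fun y : ℝ => f (a + Complex.I * y)) (Set.uIcc (-ε) ε)) (hε : 0 ≤ ε) :
    Complex.I * ∫ y in (-ε)..ε, f (a + Complex.I * y) =
      (((1 : ℝ) : ℂ) * Complex.I) *
        (∫ y in (0 : ℝ)..ε, f (a + (((1 : ℝ) : ℂ) * Complex.I) * y)) -
      (((-1 : ℝ) : ℂ) * Complex.I) *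
        ∫ y in (0 : ℝ)..ε, f (a + (((-1 : ℝ) : ℂ) * Complex.I) * y) := by
  have h1 : IntervalIntegrable (fun y : ℝ => f (a + Complex.I * y)) volume (-ε) 0 :=
    (hf.mono (by
      rw [Set.uIcc_of_le (by linarith), Set.uIcc_of_le (by linarith)]
      exact Set.Icc_subset_Icc le_rfl hε)).intervalIntegrable
  have h2 : IntervalIntegrable (fun y : ℝ => f (a + Complex.I * y)) volume 0 ε :=
    (hf.mono (by
      rw [Set.uIcc_of_le (by linarith), Set.uIcc_of_le (by linarith)]
      exact Set.Icc_subset_Icc (by linarith) le_rfl)).intervalIntegrable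
  rw [← intervalIntegral.integral_add_adjacent_intervals h1 h2]
  have e : ∫ y in (-ε)..0, f (a + Complex.I * y) =
      ∫ y in (0 : ℝ)..ε, f (a + (((-1 : ℝ) : ℂ) * Complex.I) * y) := by
    have := intervalIntegral.integral_comp_neg (a := 0) (b := ε)
      (fun y : ℝ => f (a + Complex.I * y))
    rw [neg_zero] at this
    rw [← this]
    refine intervalIntegral.integral_congr fun y _ => ?_
    simp
  rw [e]
  push_cast
  ring_nf

/-- The difference of the integrals over the two rays issuing from `1`. -/
noncomputable def wedgeIntegral (k' : ℝ) (g : ℂ → ℂ) : ℂ :=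
  (-k' + ((1 : ℝ) : ℂ) * Complex.I) *
      (∫ r in Set.Ioi (0 : ℝ), g (1 + (-k' + ((1 : ℝ) : ℂ) * Complex.I) * r)) -
    (-k' + ((-1 : ℝ) : ℂ) * Complex.I) *
      ∫ r in Set.Ioi (0 : ℝ), g (1 + (-k' + ((-1 : ℝ) : ℂ) * Complex.I) * r)

/-! ### Hankel integrals -/

/-- The integrand of Hankel's contour integral for the Gamma function. -/
noncomputable def hankelIntegrand (q lam : ℝ) (x : ℂ) : ℂ :=
  x ^ (q : ℂ) * Complex.exp (lam * x)

lemma rpow_le_mul_exp (q : ℝ) {d c : ℝ} (hd : 0 < d) (hc : 0 < c) :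
    ∃ C : ℝ, 0 < C ∧ ∀ t : ℝ, c ≤ t → t ^ q ≤ C * Real.exp (d * t) := by
  rcases le_or_gt q 0 with hq | hq
  · refine ⟨c ^ q, by positivity, fun t ht => ?_⟩
    have h1 : t ^ q ≤ c ^ q := Real.rpow_le_rpow_of_nonpos hc ht hq
    have h2 : 1 ≤ Real.exp (d * t) := Real.one_le_exp (by nlinarith)
    have : 0 < c ^ q := by positivity
    nlinarith
  · refine ⟨(q / d) ^ q, by positivity, fun t ht => ?_⟩
    have ht0 : 0 < t := hc.trans_le ht
    have e : t = q / d * (d * t / q) := by field_simp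
    have h1 : d * t / q ≤ Real.exp (d * t / q) := by
      linarith [Real.add_one_le_exp (d * t / q)]
    calc t ^ q = (q / d) ^ q * (d * t / q) ^ q := by
          rw [← Real.mul_rpow (by positivity) (by positivity), ← e]
      _ ≤ (q / d) ^ q * Real.exp (d * t / q) ^ q := by gcongr
      _ = (q / d) ^ q * Real.exp (d * t) := by
          rw [← Real.exp_mul]
          congr 2
          field_simp

section

variable {k' σ lam : ℝ}

lemma ray_re (k' σ r : ℝ) : ((1 : ℂ) + (-k' + σ * Complex.I) * r).re = 1 - k' * r := by
  simp
  ring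

lemma ray_im (k' σ r : ℝ) : ((1 : ℂ) + (-k' + σ * Complex.I) * r).im = σ * r := by
  simp

lemma ray_norm_ge (hk' : 0 < k') (hk1 : k' < 1) (hσ : σ ^ 2 = 1) (r : ℝ) :
    1 / 2 ≤ ‖(1 : ℂ) + (-k' + σ * Complex.I) * r‖ := by
  refine le_of_sq_le_sq ?_ (norm_nonneg _)
  rw [Complex.sq_norm, Complex.normSq_apply, ray_re, ray_im]
  have h : (1 - k' * r) * (1 - k' * r) + σ * r * (σ * r) =
      (1 - k' * r) ^ 2 + σ ^ 2 * r ^ 2 := by ring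
  rw [h, hσ]
  have h1 : (k' * r) ^ 2 ≤ r ^ 2 := by
    rw [mul_pow]
    exact mul_le_of_le_one_left (sq_nonneg r) (by nlinarith)
  nlinarith [sq_nonneg (2 * (k' * r) - 1)]

lemma ray_norm_le (hk' : 0 < k') (hk1 : k' < 1) (hσ : σ ^ 2 = 1) {r : ℝ} (hr : 0 ≤ r) :
    ‖(1 : ℂ) + (-k' + σ * Complex.I) * r‖ ≤ 1 + 2 * r := by
  have habs : |σ| = 1 := by
    rw [← sq_abs] at hσ
    nlinarith [abs_nonneg σ]
  have h1 : |((1 : ℂ) + (-k' + σ * Complex.I) * r).re| ≤ 1 + r := by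
    rw [ray_re, abs_le]
    constructor <;> nlinarith
  have h2 : |((1 : ℂ) + (-k' + σ * Complex.I) * r).im| ≤ r := by
    rw [ray_im, abs_mul, habs, one_mul, abs_of_nonneg hr]
  linarith [norm_le_abs_re_add_abs_im h1 h2]

lemma ray_mem_slitPlane (hσ : σ ^ 2 = 1) (r : ℝ) :
    (1 : ℂ) + (-k' + σ * Complex.I) * r ∈ Complex.slitPlane := by
  rw [Complex.mem_slitPlane_iff, ray_re, ray_im]
  rcases eq_or_ne r 0 with rfl | hr
  · left; simp
  · right
    refine mul_ne_zero (fun h => ?_) hr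
    rw [h] at hσ
    norm_num at hσ

lemma exists_norm_hankelIntegrand_le (hk' : 0 < k') (hk1 : k' < 1) (hσ : σ ^ 2 = 1)
    (hlam : 0 < lam) (q : ℝ) :
    ∃ C : ℝ, 0 < C ∧ ∀ r : ℝ, 0 ≤ r → ‖hankelIntegrand q lam (1 + (-k' + σ * Complex.I) * r)‖ ≤
      C * Real.exp (-(lam * k' / 2) * r) := by
  obtain ⟨C, hC, hle⟩ := rpow_le_mul_exp q (show 0 < lam * k' / 4 by positivity)
    (show (0 : ℝ) < 1 / 2 by norm_num)
  refine ⟨C * Real.exp (lam * k' / 4 + lam), by positivity, fun r hr => ?_⟩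
  rw [hankelIntegrand, norm_mul, Complex.norm_cpow_real, Complex.norm_exp, Complex.re_ofReal_mul,
    ray_re]
  set x := (1 : ℂ) + (-k' + σ * Complex.I) * r
  have h1 := hle ‖x‖ (ray_norm_ge hk' hk1 hσ r)
  have h2 : ‖x‖ ≤ 1 + 2 * r := ray_norm_le hk' hk1 hσ hr
  calc ‖x‖ ^ q * Real.exp (lam * (1 - k' * r))
      ≤ C * Real.exp (lam * k' / 4 * (1 + 2 * r)) * Real.exp (lam * (1 - k' * r)) := by
        refine mul_le_mul_of_nonneg_right (h1.trans ?_) (Real.exp_pos _).le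
        gcongr
    _ = _ := by
        rw [mul_assoc, mul_assoc, ← Real.exp_add, ← Real.exp_add]
        congr 2
        ring

lemma continuous_hankel_ray (hσ : σ ^ 2 = 1) (q : ℝ) :
    Continuous fun r : ℝ => hankelIntegrand q lam (1 + (-k' + σ * Complex.I) * r) := by
  unfold hankelIntegrand
  have h : Continuous fun r : ℝ => (1 : ℂ) + (-k' + σ * Complex.I) * r := by fun_prop
  refine Continuous.mul ?_ (by fun_prop)
  exact h.cpow continuous_const fun r => ray_mem_slitPlane hσ r

lemma integrableOn_hankel_ray (hk' : 0 < k') (hk1 : k' < 1) (hσ : σ ^ 2 = 1)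
    (hlam : 0 < lam) (q : ℝ) :
    IntegrableOn (fun r : ℝ => hankelIntegrand q lam (1 + (-k' + σ * Complex.I) * r))
      (Set.Ioi 0) := by
  obtain ⟨C, _, hle⟩ := exists_norm_hankelIntegrand_le hk' hk1 hσ hlam q
  refine Integrable.mono' ((exp_neg_integrableOn_Ioi 0
    (show 0 < lam * k' / 2 by positivity)).const_mul C)
    (continuous_hankel_ray hσ q).aestronglyMeasurable ?_
  filter_upwards [ae_restrict_mem measurableSet_Ioi] with r hr
  exact hle r (le_of_lt hr)

/-- Integrate the derivative of x^q e^{λx} along the ray: it vanishes at infinity because the ray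
runs to the left, and equals e^λ at the vertex 1. -/
lemma hankel_ray_recursion (hk' : 0 < k') (hk1 : k' < 1) (hσ : σ ^ 2 = 1)
    (hlam : 0 < lam) (q : ℝ) :
    (-k' + σ * Complex.I) * (q * (∫ r in Set.Ioi (0 : ℝ),
        hankelIntegrand (q - 1) lam (1 + (-k' + σ * Complex.I) * r)) +
      lam * ∫ r in Set.Ioi (0 : ℝ), hankelIntegrand q lam (1 + (-k' + σ * Complex.I) * r)) =
      -Complex.exp lam := by
  have hi1 := integrableOn_hankel_ray hk' hk1 hσ hlam (q - 1)
  have hi2 := integrableOn_hankel_ray hk' hk1 hσ hlam q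
  set ζ : ℂ := -k' + σ * Complex.I with hζ
  have hder : ∀ r : ℝ, HasDerivAt (fun r : ℝ => hankelIntegrand q lam (1 + ζ * r))
      (ζ * (q * hankelIntegrand (q - 1) lam (1 + ζ * r) +
        lam * hankelIntegrand q lam (1 + ζ * r))) r := by
    intro r
    have hline : HasDerivAt (fun r : ℝ => (1 : ℂ) + ζ * r) ζ r := by
      have h := ((hasDerivAt_id r).ofReal_comp.const_mul ζ).const_add 1
      simpa using h
    have hmem : (1 : ℂ) + ζ * r ∈ Complex.slitPlane := ray_mem_slitPlane hσ r
    have h1 : HasDerivAt (fun x : ℂ => hankelIntegrand q lam x)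
        ((q : ℂ) * (1 + ζ * r) ^ ((q : ℂ) - 1) * 1 * Complex.exp (lam * (1 + ζ * r)) +
          (1 + ζ * r) ^ (q : ℂ) * (Complex.exp (lam * (1 + ζ * r)) * (lam * 1))) (1 + ζ * r) :=
      ((hasDerivAt_id _).cpow_const hmem).mul
        (((hasDerivAt_id (1 + ζ * (r : ℂ))).const_mul (lam : ℂ)).cexp)
    have h2 := h1.comp r hline
    refine h2.congr_deriv ?_
    rw [hankelIntegrand, hankelIntegrand]
    push_cast
    ring
  have hint : IntegrableOn (fun r : ℝ => ζ * (q * hankelIntegrand (q - 1) lam (1 + ζ * r) +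
        lam * hankelIntegrand q lam (1 + ζ * r))) (Set.Ioi 0) :=
    ((hi1.const_mul (q : ℂ)).add (hi2.const_mul (lam : ℂ))).const_mul ζ
  have hlim : Tendsto (fun r : ℝ => hankelIntegrand q lam (1 + ζ * r)) atTop (𝓝 0) := by
    obtain ⟨C, _, hle⟩ := exists_norm_hankelIntegrand_le hk' hk1 hσ hlam q
    have hb : Tendsto (fun r : ℝ => C * Real.exp (-(lam * k' / 2) * r)) atTop (𝓝 0) := by
      have h : Tendsto (fun r : ℝ => -(lam * k' / 2) * r) atTop atBot :=
        tendsto_id.const_mul_atTop_of_neg (by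
          have : 0 < lam * k' / 2 := by positivity
          linarith)
      have := (Real.tendsto_exp_atBot.comp h).const_mul C
      simpa [Function.comp_def] using this
    refine squeeze_zero_norm' ?_ hb
    filter_upwards [eventually_ge_atTop 0] with r hr
    exact hle r hr
  have h := integral_Ioi_of_hasDerivAt_of_tendsto (a := 0)
    (hder 0).continuousAt.continuousWithinAt (fun r _ => hder r) hint hlim
  rw [integral_const_mul, integral_add (hi1.const_mul (q : ℂ)) (hi2.const_mul (lam : ℂ)),
    integral_const_mul, integral_const_mul] at h
  rw [h, hankelIntegrand]
  simp

/-- The boundary terms of the two rays cancel at their common vertex. This is the functional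
equation of the Gamma function in Hankel form. -/
lemma wedgeIntegral_recursion (hk' : 0 < k') (hk1 : k' < 1) (hlam : 0 < lam) (q : ℝ) :
    q * wedgeIntegral k' (hankelIntegrand (q - 1) lam) +
      lam * wedgeIntegral k' (hankelIntegrand q lam) = 0 := by
  have h1 := hankel_ray_recursion (σ := 1) hk' hk1 (by norm_num) hlam q
  have h2 := hankel_ray_recursion (σ := -1) hk' hk1 (by norm_num) hlam q
  rw [wedgeIntegral, wedgeIntegral]
  linear_combination h1 - h2

end

/-! ### Nonvanishing of Hankel's integral. -/

section

variable {k' σ lam : ℝ}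

lemma norm_cpow_le_of_neg {q : ℝ} (hq : q < -1) (y : ℝ) :
    ‖((1 : ℂ) + Complex.I * y) ^ (q : ℂ)‖ ≤ (1 / 2) ^ q * (1 + ‖y‖) ^ q := by
  rw [Complex.norm_cpow_real, ← Real.mul_rpow (by norm_num) (by positivity)]
  refine Real.rpow_le_rpow_of_nonpos (by positivity) ?_ (by linarith)
  have h1 := one_le_norm_one_add y
  have h2 : |y| ≤ ‖(1 : ℂ) + Complex.I * y‖ := by
    have := Complex.abs_im_le_norm (1 + Complex.I * y)
    simpa using this
  rw [Real.norm_eq_abs]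
  linarith

lemma one_add_I_mul_mem_slitPlane (y : ℝ) : (1 : ℂ) + Complex.I * y ∈ Complex.slitPlane := by
  rw [Complex.mem_slitPlane_iff]
  left
  simp

lemma integrable_cpow_vertical {q : ℝ} (hq : q < -1) :
    Integrable fun y : ℝ => ((1 : ℂ) + Complex.I * y) ^ (q : ℂ) := by
  have hc : Continuous fun y : ℝ => ((1 : ℂ) + Complex.I * y) ^ (q : ℂ) := by
    refine Continuous.cpow (by fun_prop) continuous_const fun y => one_add_I_mul_mem_slitPlane y
  have hi : Integrable fun y : ℝ => (1 + ‖y‖) ^ (-(-q)) :=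
    integrable_one_add_norm (by simp; linarith)
  rw [neg_neg] at hi
  exact Integrable.mono' (hi.const_mul ((1 / 2) ^ q)) hc.aestronglyMeasurable
    (Eventually.of_forall (norm_cpow_le_of_neg hq))

lemma integrable_hankel_vertical {q : ℝ} (hq : q < -1) (lam : ℝ) :
    Integrable fun y : ℝ => hankelIntegrand q lam (1 + Complex.I * y) := by
  refine (integrable_cpow_vertical hq).mul_bdd (c := Real.exp lam)
    (Continuous.aestronglyMeasurable (by fun_prop)) (Eventually.of_forall fun y => ?_)
  rw [Complex.norm_exp]
  simp

lemma wedge_subset_slitPlane (k : ℝ) : wedge k ⊆ Complex.slitPlane := by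
  intro w hw
  rw [Complex.mem_slitPlane_iff]
  by_cases h : w.im = 0
  · left
    have := hw.2
    rw [h] at this
    simpa using this
  · exact Or.inr h

lemma differentiableOn_hankelIntegrand (q lam k : ℝ) :
    DifferentiableOn ℂ (hankelIntegrand q lam) (wedge k) := by
  intro w hw
  unfold hankelIntegrand
  refine DifferentiableAt.differentiableWithinAt ?_
  exact ((differentiableAt_id).cpow_const (wedge_subset_slitPlane k hw)).mul (by fun_prop)

/-- On a segment of length k'Y at height Y the integrand is at most Y^q e^λ, and Y^{q+1} → 0 since q
< -1. -/
lemma tendsto_horizontal (hk' : 0 < k') (hσ : σ ^ 2 = 1) (hlam : 0 < lam) {q : ℝ}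
    (hq : q < -1) :
    Tendsto (fun Y : ℝ => ∫ x in (0 : ℝ)..(k' * Y),
      hankelIntegrand q lam (((1 : ℝ) : ℂ) - k' * Y + σ * Complex.I * Y + x)) atTop (𝓝 0) := by
  have habs : |σ| = 1 := by
    rw [← sq_abs] at hσ
    nlinarith [abs_nonneg σ]
  have hb : Tendsto (fun Y : ℝ => k' * Real.exp lam * Y ^ (q + 1)) atTop (𝓝 0) := by
    have := (tendsto_rpow_neg_atTop (show 0 < -(q + 1) by linarith)).const_mul
      (k' * Real.exp lam)
    simpa using this
  refine squeeze_zero_norm' ?_ hb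
  filter_upwards [eventually_gt_atTop 0] with Y hY
  have hkY : 0 ≤ k' * Y := by positivity
  have h := intervalIntegral.norm_integral_le_of_norm_le_const (a := 0) (b := k' * Y)
    (f := fun x : ℝ => hankelIntegrand q lam
      (((1 : ℝ) : ℂ) - k' * Y + σ * Complex.I * Y + x)) (C := Y ^ q * Real.exp lam) (by
      intro x hx
      rw [Set.uIoc_of_le hkY] at hx
      rw [hankelIntegrand, norm_mul, Complex.norm_cpow_real, Complex.norm_exp,
        Complex.re_ofReal_mul]
      set z : ℂ := ((1 : ℝ) : ℂ) - k' * Y + σ * Complex.I * Y + x with hz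
      have hre : z.re = 1 - k' * Y + x := by simp [hz]
      have him : z.im = σ * Y := by simp [hz]
      have h1 : Y ≤ ‖z‖ := by
        have := Complex.abs_im_le_norm z
        rwa [him, abs_mul, habs, one_mul, abs_of_pos hY] at this
      refine mul_le_mul (Real.rpow_le_rpow_of_nonpos hY h1 (by linarith)) ?_ (Real.exp_pos _).le
        (by positivity)
      refine Real.exp_le_exp.2 ?_
      rw [hre]
      nlinarith [hx.2])
  refine h.trans (le_of_eq ?_)
  rw [sub_zero, abs_of_nonneg hkY, Real.rpow_add hY, Real.rpow_one]
  ring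

/-- For q < -1 the vertical integral converges absolutely and the rays can be unbent to the line Re
x = 1. -/
lemma wedgeIntegral_hankel_eq (hk' : 0 < k') (hk1 : k' < 1) (hlam : 0 < lam) {q : ℝ}
    (hq : q < -1) :
    wedgeIntegral k' (hankelIntegrand q lam) =
      Complex.I * ∫ y : ℝ, hankelIntegrand q lam (1 + Complex.I * y) := by
  have hray : ∀ σ : ℝ, σ ^ 2 = 1 → Tendsto (fun Y : ℝ => (-k' + σ * Complex.I) *
      (∫ y in (0 : ℝ)..Y, hankelIntegrand q lam (1 + (-k' + σ * Complex.I) * y)) +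
        ∫ x in (0 : ℝ)..(k' * Y),
          hankelIntegrand q lam (((1 : ℝ) : ℂ) - k' * Y + σ * Complex.I * Y + x)) atTop
      (𝓝 ((-k' + σ * Complex.I) * ∫ r in Set.Ioi (0 : ℝ),
        hankelIntegrand q lam (1 + (-k' + σ * Complex.I) * r))) := by
    intro σ hσ
    have h := ((intervalIntegral_tendsto_integral_Ioi 0
      (integrableOn_hankel_ray hk' hk1 hσ hlam q) tendsto_id).const_mul
      (-k' + σ * Complex.I)).add (tendsto_horizontal hk' hσ hlam hq)
    rw [add_zero] at h
    exact h
  have h1 := (hray 1 (by norm_num)).sub (hray (-1) (by norm_num))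
  have h2 := (intervalIntegral_tendsto_integral (integrable_hankel_vertical hq lam)
    tendsto_neg_atTop_atBot tendsto_id).const_mul Complex.I
  refine tendsto_nhds_unique (h1.congr' ?_) h2
  filter_upwards [eventually_gt_atTop 0] with Y hY
  have hd := (differentiableOn_hankelIntegrand q lam 1).mono
    (Set.inter_subset_left (t := Metric.ball (0 : ℂ) (1 + k' * Y + Y + 1)))
  have e1 := segment_eq_ray (σ := 1) hk' hk1 one_pos hY
    (show (1 : ℝ) + k' * Y + Y < 1 + k' * Y + Y + 1 by linarith) (by norm_num) hd
  have e2 := segment_eq_ray (σ := -1) hk' hk1 one_pos hY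
    (show (1 : ℝ) + k' * Y + Y < 1 + k' * Y + Y + 1 by linarith) (by norm_num) hd
  have hc : Continuous fun y : ℝ => hankelIntegrand q lam (((1 : ℝ) : ℂ) + Complex.I * y) := by
    unfold hankelIntegrand
    refine Continuous.mul (Continuous.cpow (by fun_prop) continuous_const fun y => ?_) (by fun_prop)
    simpa using one_add_I_mul_mem_slitPlane y
  have e3 := integral_symm_eq (a := 1) (ε := Y) hc.continuousOn hY.le
  rw [e1, e2] at e3
  simp only [Complex.ofReal_one] at e3 ⊢
  exact e3.symm

/-- Fourier inversion for the Gamma density. -/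
lemma integral_hankel_vertical_ne_zero (hlam : 0 < lam) {q : ℝ} (hq : q < -1) :
    ∫ y : ℝ, hankelIntegrand q lam (1 + Complex.I * y) ≠ 0 := by
  have hp : 0 < -q := by linarith
  -- The Fourier transform of t^{-q-1} e^{-t} on t > 0 is Γ(-q)(1 + 2πiξ)^q, integrable because q <
  -- -1. Inversion at t = λ expresses the nonzero number f(λ) as a multiple of the vertical
  -- integral.
  set f : ℝ → ℂ := (Set.Ioi (0 : ℝ)).indicator
    fun t => ((t ^ (-q - 1) : ℝ) : ℂ) * Complex.exp (-((1 : ℂ) * t)) with hf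
  have hfi : Integrable f := (integrableOn_rpow_mul_cexp hp (by simp)).integrable_indicator
    measurableSet_Ioi
  have hΓ : (Real.Gamma (-q) : ℂ) ≠ 0 := by exact_mod_cast (Real.Gamma_pos_of_pos hp).ne'
  have hF : ∀ ξ : ℝ, FourierTransform.fourier f ξ =
      Real.Gamma (-q) * ((1 : ℂ) + Complex.I * ((2 * Real.pi * ξ : ℝ) : ℂ)) ^ (q : ℂ) := by
    intro ξ
    have hr : 0 < ((1 : ℂ) + Complex.I * ((2 * Real.pi * ξ : ℝ) : ℂ)).re := by simp
    have h := integral_rpow_mul_cexp hp hr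
    rw [Real.fourier_real_eq_integral_exp_smul, Complex.cpow_def_of_ne_zero
      (Complex.slitPlane_ne_zero (one_add_I_mul_mem_slitPlane _))]
    have e : ∀ t : ℝ, Complex.exp (((-2 * Real.pi * t * ξ : ℝ) : ℂ) * Complex.I) • f t =
        (Set.Ioi (0 : ℝ)).indicator (fun t => ((t ^ (-q - 1) : ℝ) : ℂ) *
          Complex.exp (-(((1 : ℂ) + Complex.I * ((2 * Real.pi * ξ : ℝ) : ℂ)) * t))) t := by
      intro t
      by_cases ht : t ∈ Set.Ioi (0 : ℝ)
      · rw [hf, Set.indicator_of_mem ht, Set.indicator_of_mem ht, smul_eq_mul, mul_left_comm,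
          ← Complex.exp_add]
        congr 2
        push_cast
        ring
      · rw [hf, Set.indicator_of_notMem ht, Set.indicator_of_notMem ht, smul_zero]
    simp_rw [e]
    rw [integral_indicator measurableSet_Ioi, h]
    congr 2
    push_cast
    ring
  have hπ : (2 * Real.pi) ≠ 0 := by positivity
  have hFi : Integrable (FourierTransform.fourier f) := by
    have h := ((integrable_cpow_vertical hq).comp_mul_left' hπ).const_mul
      (Real.Gamma (-q) : ℂ)
    exact h.congr (Eventually.of_forall fun ξ => (hF ξ).symm)
  have hcont : ContinuousAt f lam := by
    have h1 : ContinuousAt (fun t : ℝ => ((t ^ (-q - 1) : ℝ) : ℂ) *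
        Complex.exp (-((1 : ℂ) * t))) lam := by
      refine ContinuousAt.mul ?_ (Continuous.continuousAt (by fun_prop))
      exact Complex.continuous_ofReal.continuousAt.comp
        (Real.continuousAt_rpow_const _ _ (Or.inl hlam.ne'))
    refine h1.congr ?_
    filter_upwards [Ioi_mem_nhds hlam] with t ht
    rw [hf, Set.indicator_of_mem ht]
  have hinv := hfi.fourierInv_fourier_eq hFi hcont
  rw [Real.fourierInv_eq'] at hinv
  have hflam : f lam ≠ 0 := by
    rw [hf, Set.indicator_of_mem (show lam ∈ Set.Ioi (0 : ℝ) from hlam)]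
    refine mul_ne_zero ?_ (Complex.exp_ne_zero _)
    exact_mod_cast (Real.rpow_pos_of_pos hlam _).ne'
  intro hzero
  apply hflam
  rw [← hinv]
  have e2 : ∀ ξ : ℝ, Complex.exp (((2 * Real.pi * inner ℝ ξ lam : ℝ) : ℂ) * Complex.I) •
      FourierTransform.fourier f ξ = (Real.Gamma (-q) * Complex.exp (-lam)) *
        hankelIntegrand q lam (1 + Complex.I * ((2 * Real.pi * ξ : ℝ) : ℂ)) := by
    intro ξ
    have e4 : Complex.exp (lam * (1 + Complex.I * ((2 * Real.pi * ξ : ℝ) : ℂ))) =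
        Complex.exp lam *
          Complex.exp (((2 * Real.pi * inner ℝ ξ lam : ℝ) : ℂ) * Complex.I) := by
      rw [← Complex.exp_add]
      congr 1
      simp
      ring
    have e5 : Complex.exp (-lam) * Complex.exp lam = 1 := by
      rw [← Complex.exp_add]; simp
    rw [hF, hankelIntegrand, e4, smul_eq_mul]
    linear_combination (-(Complex.exp (((2 * Real.pi * inner ℝ ξ lam : ℝ) : ℂ) * Complex.I) *
      Real.Gamma (-q) * (1 + Complex.I * ((2 * Real.pi * ξ : ℝ) : ℂ)) ^ (q : ℂ))) * e5
  simp_rw [e2]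
  rw [integral_const_mul, Measure.integral_comp_mul_left
    (fun y : ℝ => hankelIntegrand q lam (1 + Complex.I * y)), hzero, smul_zero, mul_zero]

/-- Hankel's integral does not vanish unless the exponent is a natural number. -/
theorem wedgeIntegral_hankel_ne_zero (hk' : 0 < k') (hk1 : k' < 1) (hlam : 0 < lam) {q : ℝ}
    (hq : ∀ n : ℕ, q ≠ n) : wedgeIntegral k' (hankelIntegrand q lam) ≠ 0 := by
  -- The recursion lowers q by one at a time until q < -1. The factor q that appears is never 0,
  -- since no q along the way is a natural number.
  have key : ∀ n : ℕ, ∀ q : ℝ, q < n - 1 → (∀ n : ℕ, q ≠ n) →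
      wedgeIntegral k' (hankelIntegrand q lam) ≠ 0 := by
    intro n
    induction n with
    | zero =>
      intro q hq1 _
      rw [wedgeIntegral_hankel_eq hk' hk1 hlam (by simpa using hq1)]
      exact mul_ne_zero Complex.I_ne_zero
        (integral_hankel_vertical_ne_zero hlam (by simpa using hq1))
    | succ n ih =>
      intro q hq1 hq0 hzero
      have h := wedgeIntegral_recursion hk' hk1 hlam q
      rw [hzero, mul_zero, add_zero] at h
      have hq' : (q : ℂ) ≠ 0 := by
        have := hq0 0
        exact_mod_cast this
      refine ih (q - 1) (by push_cast at hq1; linarith) (fun j hj => hq0 (j + 1) ?_)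
        ((mul_eq_zero.1 h).resolve_left hq')
      push_cast
      linarith
  obtain ⟨n, hn⟩ := exists_nat_gt (q + 1)
  exact key n q (by linarith) hq

end

/-! ### Coefficients of functions with a dominant singularity -/

section

variable {α β : ℕ → ℝ} {F : ℂ → ℂ} {T : Set ℂ} {m c k k' r₀ : ℝ} {τ : ℕ → ℝ}

/-- The continuation of `phase`. -/
noncomputable def contPhase (Fα Fβ : ℂ → ℂ) (m : ℝ) (u : ℂ) (N : ℕ) (w : ℂ) : ℂ :=
  u * Fα w + N * (u * (Fβ w - m) + w)

/-- As u → 1, the function u(F - m) + w is (1 - c)w up to an arbitrarily small multiple of |w|,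
uniformly for large N. -/
lemma exists_re_linear_le
    (hE : (fun w => F w - m + c * w) =o[𝓝[T] 0] fun w => w) (hτ0 : Tendsto τ atTop (𝓝 0))
    {κ : ℝ} (hκ : 0 < κ) :
    ∃ δ : ℝ, 0 < δ ∧ ∀ᶠ N : ℕ in atTop, ∀ w ∈ T, ‖w‖ < δ →
      (Complex.exp (Complex.I * τ N) * (F w - m) + w).re ≤ (1 - c) * w.re + κ * ‖w‖ := by
  have h1 := isLittleO_iff.1 hE (half_pos hκ)
  rw [eventually_nhdsWithin_iff, Metric.eventually_nhds_iff] at h1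
  obtain ⟨δ, hδ, h1⟩ := h1
  refine ⟨δ, hδ, ?_⟩
  have h2 : Tendsto (fun N => |c| * |τ N|) atTop (𝓝 0) := by
    have := hτ0.abs.const_mul |c|
    rwa [abs_zero, mul_zero] at this
  filter_upwards [h2.eventually (eventually_lt_nhds (half_pos hκ))] with N hN w hw hwδ
  have h3 := h1 (by simpa using hwδ) hw
  set u := Complex.exp (Complex.I * τ N) with hu
  have hu1 : ‖u‖ = 1 := by simp [hu, Complex.norm_exp]
  have e : u * (F w - m) + w = ((1 - c : ℝ) : ℂ) * w + (c * (1 - u) * w + u * (F w - m + c * w)) := by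
    push_cast
    ring
  rw [e, Complex.add_re, Complex.re_ofReal_mul]
  refine add_le_add le_rfl ((Complex.re_le_norm _).trans ((norm_add_le _ _).trans ?_))
  rw [norm_mul, norm_mul, norm_mul, hu1, one_mul, Complex.norm_real, Real.norm_eq_abs,
    norm_sub_rev]
  have h4 : |c| * ‖u - 1‖ * ‖w‖ ≤ κ / 2 * ‖w‖ := by
    refine mul_le_mul_of_nonneg_right (le_trans ?_ hN.le) (norm_nonneg _)
    exact mul_le_mul_of_nonneg_left (norm_exp_I_mul_sub_one_le _) (abs_nonneg c)
  linarith

/-- Scaling limit of the exponent. -/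
lemma tendsto_linear_scaled
    (hE : (fun w => F w - m + c * w) =o[𝓝[T] 0] fun w => w) (hτ0 : Tendsto τ atTop (𝓝 0))
    {x : ℂ} (hx : x ≠ 0) (hT : ∀ᶠ N : ℕ in atTop, x / N ∈ T) :
    Tendsto (fun N : ℕ => (N : ℂ) * (Complex.exp (Complex.I * τ N) * (F (x / N) - m) + x / N))
      atTop (𝓝 ((1 - c : ℝ) * x)) := by
  have hw : Tendsto (fun N : ℕ => x / N) atTop (𝓝[T] 0) :=
    tendsto_nhdsWithin_iff.2 ⟨tendsto_const_div_atTop_nhds_zero_nat x, hT⟩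
  have hu := tendsto_exp_I_mul hτ0
  have h1 : Tendsto (fun N : ℕ => (N : ℂ) * (F (x / N) - m + c * (x / N))) atTop (𝓝 0) := by
    have h := (isBigO_refl (fun N : ℕ => (N : ℂ)) atTop).mul_isLittleO (hE.comp_tendsto hw)
    have h2 : (fun N : ℕ => (N : ℂ) * ((fun w => w) ∘ fun N : ℕ => x / N) N) =ᶠ[atTop]
        fun _ => x := by
      filter_upwards [eventually_gt_atTop 0] with N hN
      have : (N : ℂ) ≠ 0 := by exact_mod_cast hN.ne'
      simp only [Function.comp]
      field_simp
    exact (isLittleO_const_iff hx).1 (h.trans_eventuallyEq h2)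
  have h3 := ((hu.mul h1).sub ((hu.mul_const (c * x)))).add_const x
  have e : (1 : ℂ) * 0 - 1 * (c * x) + x = (1 - c : ℝ) * x := by
    push_cast
    ring
  rw [e] at h3
  refine h3.congr' ?_
  filter_upwards [eventually_gt_atTop 0] with N hN
  have : (N : ℂ) ≠ 0 := by exact_mod_cast hN.ne'
  field_simp
  ring

lemma ray_mem_wedge (hkk : k' < k) {σ : ℝ} (hσ : σ ^ 2 = 1) {r : ℝ}
    (hr : 0 ≤ r) : (1 : ℂ) + (-k' + σ * Complex.I) * r ∈ wedge k := by
  refine ⟨Complex.slitPlane_ne_zero (ray_mem_slitPlane hσ r), ?_⟩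
  have habs : |σ| = 1 := by
    rw [← sq_abs] at hσ
    nlinarith [abs_nonneg σ]
  rw [ray_re, ray_im, abs_mul, habs, one_mul, abs_of_nonneg hr]
  nlinarith

lemma div_natCast_mem_wedge {x : ℂ} (hx : x ∈ wedge k) {N : ℕ} (hN : 0 < N) :
    x / N ∈ wedge k := by
  have hN' : (0 : ℝ) < N := by exact_mod_cast hN
  refine ⟨div_ne_zero hx.1 (by exact_mod_cast hN.ne'), ?_⟩
  rw [Complex.div_natCast_re, Complex.div_natCast_im, abs_div, Nat.abs_cast, ← mul_div_assoc,
    ← neg_div]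
  exact div_lt_div_of_pos_right hx.2 hN'

/-- Cauchy's estimate, which turns the expansion F = m - cw + o(w) into closeness of F' to -c. -/
lemma norm_deriv_add_le {U : Set ℂ} (hd : DifferentiableOn ℂ F U) {w : ℂ} {ρ B : ℝ}
    (hρ : 0 < ρ) (hU : Metric.closedBall w ρ ⊆ U)
    (hB : ∀ v ∈ Metric.sphere w ρ, ‖F v - m + c * v‖ ≤ B) : ‖deriv F w + c‖ ≤ B / ρ := by
  have hF : DifferentiableAt ℂ F w := (hd w (hU (Metric.mem_closedBall_self hρ.le))).differentiableAt
    (mem_of_superset (Metric.closedBall_mem_nhds w hρ) hU)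
  have h : HasDerivAt (fun v : ℂ => F v - m + c * v) (deriv F w + c * 1) w :=
    (hF.hasDerivAt.sub_const (m : ℂ)).add ((hasDerivAt_id w).const_mul (c : ℂ))
  have hdq : DifferentiableOn ℂ (fun v : ℂ => F v - m + c * v) U :=
    (hd.sub_const (m : ℂ)).add (differentiable_id.const_mul (c : ℂ)).differentiableOn
  have hb := Complex.norm_deriv_le_of_forall_mem_sphere_norm_le hρ (hdq.diffContOnCl_ball hU) hB
  rwa [h.deriv, mul_one] at hb

/-- Room for Cauchy's estimate: with δ₀ = (k - k')/4 one has k' + δ₀ < k(1 - δ₀), so a disc of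
radius δ₀ε around a point of the horizontal segment does not leave the wider wedge. -/
lemma closeBall_subset_wedge (hk' : 0 < k') (hkk : k' < k) (hk1 : k < 1) {ε : ℝ} (hε : 0 < ε)
    (hε2 : 4 * ε < r₀) {w v : ℂ} (him : |w.im| = ε) (hre1 : -(k' * ε) ≤ w.re) (hre2 : w.re ≤ ε)
    (hvw : ‖v - w‖ ≤ (k - k') / 4 * ε) :
    v ∈ wedge k ∩ Metric.ball 0 r₀ ∧ ‖v‖ ≤ 3 * ε := by
  set δ₀ := (k - k') / 4 with hδ₀
  have hδ₀pos : 0 < δ₀ := by rw [hδ₀]; linarith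
  have hδ₀1 : δ₀ < 1 := by rw [hδ₀]; linarith
  have hi := (Complex.abs_im_le_norm (v - w)).trans hvw
  have hr := abs_le.1 ((Complex.abs_re_le_norm (v - w)).trans hvw)
  rw [Complex.sub_im] at hi
  rw [Complex.sub_re] at hr
  have hi2 : ε - δ₀ * ε ≤ |v.im| := by
    have : |w.im| ≤ |v.im| + |v.im - w.im| := by
      calc |w.im| = |v.im - (v.im - w.im)| := by ring_nf
        _ ≤ _ := abs_sub _ _
    linarith
  have hvpos : 0 < |v.im| := lt_of_lt_of_le (by nlinarith) hi2
  have hw : ‖w‖ ≤ ε + ε := norm_le_abs_re_add_abs_im (abs_le.2 ⟨by nlinarith, hre2⟩) him.le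
  have hv : ‖v‖ ≤ 3 * ε := by
    calc ‖v‖ = ‖w + (v - w)‖ := by ring_nf
      _ ≤ ‖w‖ + ‖v - w‖ := norm_add_le _ _
      _ ≤ 3 * ε := by nlinarith
  refine ⟨⟨⟨fun h => ?_, ?_⟩, ?_⟩, hv⟩
  · rw [h] at hvpos
    simp at hvpos
  · have h5 : k * (ε - δ₀ * ε) ≤ k * |v.im| :=
      mul_le_mul_of_nonneg_left hi2 (by linarith)
    have h6 : (k' + δ₀) * ε < k * (ε - δ₀ * ε) := by
      have : k' + δ₀ < k * (1 - δ₀) := by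
        have : δ₀ * (1 + k) < k - k' := by rw [hδ₀]; nlinarith
        nlinarith
      nlinarith
    nlinarith [hr.1]
  · rw [mem_ball_zero_iff]
    linarith

/-- On short horizontal segments the real part of the exponent is increasing. -/
lemma exists_re_horizontal_le (hk' : 0 < k') (hkk : k' < k) (hk1 : k < 1) (hc : c < 1)
    (hr₀ : 0 < r₀)
    (hd : DifferentiableOn ℂ F (wedge k ∩ Metric.ball 0 r₀))
    (hE : (fun w => F w - m + c * w) =o[𝓝[wedge k] 0] fun w => w)
    (hτ0 : Tendsto τ atTop (𝓝 0)) :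
    ∃ ε₁ : ℝ, 0 < ε₁ ∧ ∀ ε : ℝ, 0 < ε → ε < ε₁ → ∀ᶠ N : ℕ in atTop, ∀ σ : ℝ, σ ^ 2 = 1 →
      ∀ x ∈ Set.Icc 0 (k' * ε),
      (Complex.exp (Complex.I * τ N) *
          (F ((N : ℂ)⁻¹ - k' * ε + σ * Complex.I * ε + x) - m) +
        ((N : ℂ)⁻¹ - k' * ε + σ * Complex.I * ε + x)).re ≤
      (Complex.exp (Complex.I * τ N) * (F ((N : ℂ)⁻¹ + Complex.I * (σ * ε : ℝ)) - m) +
        ((N : ℂ)⁻¹ + Complex.I * (σ * ε : ℝ))).re := by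
  set δ₀ := (k - k') / 4 with hδ₀
  have hδ₀pos : 0 < δ₀ := by rw [hδ₀]; linarith
  have hδ₀1 : δ₀ < 1 := by rw [hδ₀]; linarith
  set lam := 1 - c with hlam
  have hlampos : 0 < lam := by rw [hlam]; linarith
  -- Points of the disc satisfy |v| ≤ 3ε and its radius is δ₀ε, so Cauchy's estimate gives |F' + c|
  -- ≤ 3λ/32 ≤ λ/8. The effect of u ≠ 1 is at most another λ/8, and 1 - c = λ keeps the derivative's
  -- real part positive.
  have h1 := isLittleO_iff.1 hE (show 0 < lam * δ₀ / 32 by positivity)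
  rw [eventually_nhdsWithin_iff, Metric.eventually_nhds_iff] at h1
  obtain ⟨ρ₁, hρ₁, h1⟩ := h1
  refine ⟨min ρ₁ r₀ / 4, by positivity, fun ε hε hεlt => ?_⟩
  have hε1 : 4 * ε < ρ₁ := by linarith [min_le_left ρ₁ r₀]
  have hε2 : 4 * ε < r₀ := by linarith [min_le_right ρ₁ r₀]
  have h2 : Tendsto (fun N => |c| * |τ N|) atTop (𝓝 0) := by
    have := hτ0.abs.const_mul |c|
    rwa [abs_zero, mul_zero] at this
  have h3 : Tendsto (fun N : ℕ => (N : ℝ)⁻¹) atTop (𝓝 0) := tendsto_inv_atTop_nhds_zero_nat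
  filter_upwards [h2.eventually (eventually_lt_nhds (show 0 < lam / 8 by positivity)),
    h3.eventually (eventually_lt_nhds hε)] with N hN hNε σ hσ
  have hN0 : (0 : ℝ) ≤ (N : ℝ)⁻¹ := by positivity
  have habs : |σ| = 1 := by
    rw [← sq_abs] at hσ
    nlinarith [abs_nonneg σ]
  set u := Complex.exp (Complex.I * τ N) with hu
  have hu1 : ‖u‖ = 1 := by simp [hu, Complex.norm_exp]
  have hkε : 0 ≤ k' * ε := by positivity
  -- geometry of the segment
  have hball : ∀ w v : ℂ, |w.im| = ε → -(k' * ε) ≤ w.re → w.re ≤ ε → ‖v - w‖ ≤ δ₀ * ε →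
      v ∈ wedge k ∩ Metric.ball 0 r₀ ∧ ‖v‖ ≤ 3 * ε := fun w v =>
    closeBall_subset_wedge hk' hkk hk1 hε hε2
  have hwedge_open : ∀ w : ℂ, |w.im| = ε → -(k' * ε) ≤ w.re → w.re ≤ ε →
      DifferentiableAt ℂ F w := by
    intro w h1 h2 h3
    refine (hd w (hball w w h1 h2 h3 (by simp; positivity)).1).differentiableAt ?_
    refine mem_of_superset (Metric.ball_mem_nhds w (show 0 < δ₀ * ε by positivity)) fun v hv => ?_
    exact (hball w v h1 h2 h3 (by simpa [dist_eq_norm] using (Metric.mem_ball.1 hv).le)).1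
  have hderiv : ∀ w : ℂ, |w.im| = ε → -(k' * ε) ≤ w.re → w.re ≤ ε →
      0 ≤ (u * deriv F w + 1).re := by
    intro w hw1 hw2 hw3
    have hb := norm_deriv_add_le (m := m) (c := c) hd (w := w) (show 0 < δ₀ * ε by positivity)
      (fun v hv => (hball w v hw1 hw2 hw3 (by simpa [dist_eq_norm] using hv)).1)
      (B := lam * δ₀ / 32 * (3 * ε)) (fun v hv => by
        have hv' := hball w v hw1 hw2 hw3 (by
          rw [mem_sphere_iff_norm] at hv
          exact hv.le)
        have := h1 (y := v) (by
          rw [dist_zero_right]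
          linarith [hv'.2]) hv'.1.1
        exact this.trans (mul_le_mul_of_nonneg_left hv'.2 (by positivity)))
    have hb2 : ‖deriv F w + c‖ ≤ lam / 8 := by
      refine hb.trans ?_
      rw [div_le_iff₀ (by positivity)]
      nlinarith [mul_pos (mul_pos hlampos hδ₀pos) hε]
    have e : u * deriv F w + 1 = (lam : ℂ) + (c * (1 - u) + u * (deriv F w + c)) := by
      rw [hlam]
      push_cast
      ring
    have hb3 : ‖c * (1 - u) + u * (deriv F w + c)‖ ≤ lam / 8 + lam / 8 := by
      refine (norm_add_le _ _).trans (add_le_add ?_ ?_)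
      · rw [norm_mul, Complex.norm_real, Real.norm_eq_abs, norm_sub_rev]
        exact (mul_le_mul_of_nonneg_left (norm_exp_I_mul_sub_one_le _) (abs_nonneg c)).trans hN.le
      · rwa [norm_mul, hu1, one_mul]
    rw [e, Complex.add_re, Complex.ofReal_re]
    have := (abs_le.1 ((Complex.abs_re_le_norm _).trans hb3)).1
    linarith
  -- monotonicity along the segment
  set a₀ : ℂ := (N : ℂ)⁻¹ - k' * ε + σ * Complex.I * ε with ha₀
  have hinv : ((N : ℂ)⁻¹) = (((N : ℝ)⁻¹ : ℝ) : ℂ) := by push_cast; rfl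
  have hre : ∀ x : ℝ, (a₀ + x).re = (N : ℝ)⁻¹ - k' * ε + x := by
    intro x
    rw [ha₀, hinv]
    simp
  have him : ∀ x : ℝ, |(a₀ + x).im| = ε := by
    intro x
    have : (a₀ + x).im = σ * ε := by
      rw [ha₀, hinv]
      simp
    rw [this, abs_mul, habs, one_mul, abs_of_pos hε]
  have hder : ∀ x ∈ Set.Icc 0 (k' * ε),
      HasDerivAt (fun x : ℝ => (u * (F (a₀ + x) - m) + (a₀ + x)).re)
        (u * deriv F (a₀ + x) + 1).re x := by
    intro x hx
    have hF := (hwedge_open (a₀ + x) (him x) (by rw [hre]; linarith [hx.1])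
      (by rw [hre]; linarith [hx.2])).hasDerivAt
    have h5 : HasDerivAt (fun w : ℂ => u * (F w - m) + w) (u * deriv F (a₀ + x) + 1) (a₀ + x) :=
      ((hF.sub_const (m : ℂ)).const_mul u).add (hasDerivAt_id _)
    have h6 : HasDerivAt (fun z : ℂ => u * (F (a₀ + z) - m) + (a₀ + z))
        (u * deriv F (a₀ + x) + 1) (x : ℂ) := by
      have := h5.comp_const_add a₀ (x : ℂ)
      exact this
    exact h6.real_of_complex
  have hmono : MonotoneOn (fun x : ℝ => (u * (F (a₀ + x) - m) + (a₀ + x)).re)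
      (Set.Icc 0 (k' * ε)) := by
    refine monotoneOn_of_deriv_nonneg (convex_Icc _ _)
      (fun x hx => (hder x hx).continuousAt.continuousWithinAt)
      (fun x hx => (hder x (interior_subset hx)).differentiableAt.differentiableWithinAt)
      fun x hx => ?_
    have hx' := interior_subset hx
    rw [(hder x hx').deriv]
    exact hderiv _ (him x) (by rw [hre]; linarith [hx'.1]) (by rw [hre]; linarith [hx'.2])
  intro x hx
  have hfin := hmono hx (Set.right_mem_Icc.2 hkε) hx.2
  have e : (N : ℂ)⁻¹ + Complex.I * (σ * ε : ℝ) = a₀ + ((k' * ε : ℝ) : ℂ) := by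
    rw [ha₀]
    push_cast
    ring
  rw [e]
  exact hfin

end

/-! ### Exponentially small sides and integrals over the rays. -/

section

variable {α β : ℕ → ℝ} {Fα Fβ : ℂ → ℂ} {c k k' r₀ K p : ℝ} {τ : ℕ → ℝ}

/-- The choice ξ = 1/N matches the scale of the singularity and keeps the loss Nξ bounded. -/
lemma exists_norm_exp_phase_inv_le (hα : ∀ j, 0 ≤ α j) (hβ : ∀ j, 0 ≤ β j)
    (hβs : Summable β) (hna : NonArithmetic β)
    (hαs : ∀ ξ : ℝ, 0 < ξ → Summable fun j : ℕ => α j * Real.exp (-(ξ * j)))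
    (hτK : ∀ᶠ N : ℕ in atTop, N * τ N ^ 2 ≤ K)
    (hαp : ∀ᶠ N : ℕ in atTop,
      Real.exp (∑' j : ℕ, α j * Real.exp (-((N : ℝ)⁻¹ * j))) ≤ K * (N : ℝ) ^ p)
    {ε : ℝ} (hε : 0 < ε) :
    ∃ c > 0, ∃ K' : ℝ, ∀ᶠ N : ℕ in atTop, ∀ y : ℝ, ε ≤ |y| → |y| ≤ Real.pi →
      ‖Complex.exp (phase α β (Complex.exp (Complex.I * τ N)) N N
        ((((N : ℝ)⁻¹ : ℝ) : ℂ) + Complex.I * y))‖ ≤ K' * (N : ℝ) ^ p * Real.exp (-(c * N)) := by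
  refine exists_norm_exp_phase_le (K := max K 1) (ξ := fun N => (N : ℝ)⁻¹) (n := fun N => N)
    hα hβ hβs hna hαs ?_ (hτK.mono fun N h => h.trans (le_max_left _ _)) ?_ ?_
    (fun _ => le_rfl) hε
  · filter_upwards [eventually_gt_atTop 0] with N hN
    have hN' : (1 : ℝ) ≤ N := by exact_mod_cast hN
    exact ⟨by positivity, inv_le_one_of_one_le₀ hN'⟩
  · filter_upwards [eventually_gt_atTop 0] with N hN
    have hN' : (0 : ℝ) < N := by exact_mod_cast hN
    have h1 : ∑' j : ℕ, β j * Real.exp (-((N : ℝ)⁻¹ * j)) ≤ ∑' j : ℕ, β j := by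
      refine (summable_mul_exp_neg hβ hβs (by positivity)).tsum_le_tsum (fun j => ?_) hβs
      refine mul_le_of_le_one_right (hβ j) (Real.exp_le_one_iff.2 ?_)
      have : 0 ≤ (N : ℝ)⁻¹ * j := by positivity
      linarith
    have h2 : (N : ℝ) * (N : ℝ)⁻¹ = 1 := mul_inv_cancel₀ hN'.ne'
    refine le_trans ?_ (le_max_right _ _)
    nlinarith
  · filter_upwards [hαp] with N hN
    exact hN.trans (mul_le_mul_of_nonneg_right (le_max_left _ _) (by positivity))

lemma contPhase_eq_phase (heα : ∀ w : ℂ, 0 < w.re → Fα w = lap α w)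
    (heβ : ∀ w : ℂ, 0 < w.re → Fβ w = lap β w) (u : ℂ) (N : ℕ) {w : ℂ} (hw : 0 < w.re) :
    contPhase Fα Fβ (∑' j : ℕ, β j) u N w = phase α β u N N w := by
  rw [contPhase, phase, heα w hw, heβ w hw]
  ring

/-- Exponential smallness on the horizontal segments. -/
lemma exists_norm_exp_horizontal_le (hα : ∀ j, 0 ≤ α j) (hβ : ∀ j, 0 ≤ β j)
    (hβs : Summable β) (hna : NonArithmetic β)
    (hαs : ∀ ξ : ℝ, 0 < ξ → Summable fun j : ℕ => α j * Real.exp (-(ξ * j)))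
    (hk' : 0 < k') (hkk : k' < k) (hk1 : k < 1) (hc : c < 1) (hr₀ : 0 < r₀)
    (hdα : DifferentiableOn ℂ Fα (wedge k ∩ Metric.ball 0 r₀))
    (hdβ : DifferentiableOn ℂ Fβ (wedge k ∩ Metric.ball 0 r₀))
    (heα : ∀ w : ℂ, 0 < w.re → Fα w = lap α w) (heβ : ∀ w : ℂ, 0 < w.re → Fβ w = lap β w)
    (hE : (fun w => Fβ w - (∑' j : ℕ, β j : ℝ) + c * w) =o[𝓝[wedge k] 0] fun w => w)
    (hτ0 : Tendsto τ atTop (𝓝 0)) (hτK : ∀ᶠ N : ℕ in atTop, N * τ N ^ 2 ≤ K)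
    (hαp : ∀ᶠ N : ℕ in atTop,
      Real.exp (∑' j : ℕ, α j * Real.exp (-((N : ℝ)⁻¹ * j))) ≤ K * (N : ℝ) ^ p) :
    ∃ ε₁ : ℝ, 0 < ε₁ ∧ ∀ ε : ℝ, 0 < ε → ε < ε₁ → ε ≤ Real.pi →
      ∃ c₀ > 0, ∃ K' : ℝ, ∀ᶠ N : ℕ in atTop, ∀ σ : ℝ, σ ^ 2 = 1 → ∀ x ∈ Set.Icc 0 (k' * ε),
      ‖Complex.exp (contPhase Fα Fβ (∑' j : ℕ, β j) (Complex.exp (Complex.I * τ N)) N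
        ((((N : ℝ)⁻¹ : ℝ) : ℂ) - k' * ε + σ * Complex.I * ε + x))‖ ≤
        K' * (N : ℝ) ^ p * Real.exp (-(c₀ * N)) := by
  obtain ⟨ε₁, hε₁, h1⟩ := exists_re_horizontal_le hk' hkk hk1 hc hr₀ hdβ hE hτ0
  refine ⟨min ε₁ (r₀ / 4), by positivity, fun ε hε hεlt hεπ => ?_⟩
  have hε1 : ε < ε₁ := hεlt.trans_le (min_le_left _ _)
  have hε2 : 4 * ε < r₀ := by linarith [hεlt.trans_le (min_le_right ε₁ (r₀ / 4))]
  obtain ⟨c₀, hc₀, K', hK'⟩ := exists_norm_exp_phase_inv_le hα hβ hβs hna hαs hτK hαp hε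
  -- These segments lie at height ±ε, away from the singularity 0, so the first function is bounded
  -- on them uniformly in N.
  have hcomp : IsCompact (Set.Icc (-(k' * ε)) ε ×ℂ {ε, -ε}) :=
    isCompact_Icc.reProdIm (Set.toFinite _).isCompact
  have hsub : ∀ w ∈ (Set.Icc (-(k' * ε)) ε ×ℂ {ε, -ε} : Set ℂ),
      w ∈ wedge k ∩ Metric.ball 0 r₀ := by
    intro w hw
    have him : |w.im| = ε := by
      rcases hw.2 with h | h
      · rw [h, abs_of_pos hε]
      · rw [show w.im = -ε from h, abs_neg, abs_of_pos hε]
    refine (closeBall_subset_wedge hk' hkk hk1 hε hε2 him hw.1.1 hw.1.2 (v := w) ?_).1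
    rw [sub_self, norm_zero]
    have : 0 < k - k' := by linarith
    positivity
  obtain ⟨M, hM⟩ := hcomp.exists_bound_of_continuousOn (hdα.continuousOn.mono hsub)
  refine ⟨c₀, hc₀, Real.exp M * (K' * Real.exp M), ?_⟩
  have h3 : Tendsto (fun N : ℕ => (N : ℝ)⁻¹) atTop (𝓝 0) := tendsto_inv_atTop_nhds_zero_nat
  filter_upwards [h1 ε hε hε1, hK', h3.eventually (eventually_lt_nhds hε),
    eventually_gt_atTop 0] with N hN1 hN2 hNε hN0 σ hσ x hx
  have hN0' : (0 : ℝ) < N := by exact_mod_cast hN0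
  have hN1' : 0 < (N : ℝ)⁻¹ := by positivity
  have habs : |σ| = 1 := by
    rw [← sq_abs] at hσ
    nlinarith [abs_nonneg σ]
  have hσ' : σ * ε = ε ∨ σ * ε = -ε := by
    rcases eq_or_eq_neg_of_abs_eq habs with h | h <;> simp [h]
  set u := Complex.exp (Complex.I * τ N) with hu
  have hu1 : ‖u‖ = 1 := by simp [hu, Complex.norm_exp]
  set w : ℂ := (((N : ℝ)⁻¹ : ℝ) : ℂ) - k' * ε + σ * Complex.I * ε + x with hw
  set w₁ : ℂ := (((N : ℝ)⁻¹ : ℝ) : ℂ) + Complex.I * (σ * ε : ℝ) with hw₁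
  have hkε : 0 < k' * ε := by positivity
  have hwmem : w ∈ (Set.Icc (-(k' * ε)) ε ×ℂ {ε, -ε} : Set ℂ) := by
    have hre : w.re = (N : ℝ)⁻¹ - k' * ε + x := by simp [hw]
    have him : w.im = σ * ε := by simp [hw]
    refine ⟨?_, ?_⟩
    · show w.re ∈ Set.Icc (-(k' * ε)) ε
      rw [hre]
      exact ⟨by linarith [hx.1], by linarith [hx.2]⟩
    · show w.im ∈ ({ε, -ε} : Set ℝ)
      rw [him]
      exact hσ'
  have hw₁re : w₁.re = (N : ℝ)⁻¹ := by simp [hw₁]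
  have hw₁mem : w₁ ∈ (Set.Icc (-(k' * ε)) ε ×ℂ {ε, -ε} : Set ℂ) := by
    have him : w₁.im = σ * ε := by simp [hw₁]
    refine ⟨?_, ?_⟩
    · show w₁.re ∈ Set.Icc (-(k' * ε)) ε
      rw [hw₁re]
      exact ⟨by linarith, hNε.le⟩
    · show w₁.im ∈ ({ε, -ε} : Set ℝ)
      rw [him]
      exact hσ'
  have hle : ∀ v : ℂ, v ∈ (Set.Icc (-(k' * ε)) ε ×ℂ {ε, -ε} : Set ℂ) → |(u * Fα v).re| ≤ M := by
    intro v hv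
    refine (Complex.abs_re_le_norm _).trans ?_
    rw [norm_mul, hu1, one_mul]
    exact hM v hv
  -- By monotonicity of the real part the segment is controlled by its right end `w₁`, which lies on
  -- Re w = 1/N at height ±ε, where non-arithmeticity gives exponential decay.
  have h5 := hN1 σ hσ x hx
  have e1 : ((N : ℂ)⁻¹ - k' * ε + σ * Complex.I * ε + x) = w := by rw [hw]; push_cast; rfl
  have e2 : ((N : ℂ)⁻¹ + Complex.I * (σ * ε : ℝ)) = w₁ := by rw [hw₁]; push_cast; rfl
  rw [e1, e2] at h5
  have h6 := hN2 (σ * ε) (by rw [abs_mul, habs, one_mul, abs_of_pos hε])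
    (by rw [abs_mul, habs, one_mul, abs_of_pos hε]; exact hεπ)
  rw [← hw₁, ← contPhase_eq_phase heα heβ u N (by rw [hw₁re]; exact hN1')] at h6
  set m := ∑' j : ℕ, β j
  have hre : ∀ v : ℂ, (contPhase Fα Fβ m u N v).re =
      (u * Fα v).re + N * (u * (Fβ v - m) + v).re := by
    intro v
    rw [contPhase, Complex.add_re]
    congr 1
    exact Complex.re_ofReal_mul (N : ℝ) _
  rw [Complex.norm_exp, hre] at h6
  rw [Complex.norm_exp, hre]
  have h7 := (abs_le.1 (hle w hwmem)).2
  have h8 := (abs_le.1 (hle w₁ hw₁mem)).1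
  have h9 := mul_le_mul_of_nonneg_left h5 hN0'.le
  calc Real.exp ((u * Fα w).re + N * (u * (Fβ w - m) + w).re)
      ≤ Real.exp (M + (((u * Fα w₁).re + N * (u * (Fβ w₁ - m) + w₁).re) + M)) :=
        Real.exp_le_exp.2 (by linarith)
    _ = Real.exp M *
        (Real.exp ((u * Fα w₁).re + N * (u * (Fβ w₁ - m) + w₁).re) * Real.exp M) := by
        rw [Real.exp_add, Real.exp_add]
    _ ≤ Real.exp M * ((K' * (N : ℝ) ^ p * Real.exp (-(c₀ * N))) * Real.exp M) := by gcongr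
    _ = _ := by ring

/-- For functions holomorphic in a disc, the integrals over the rays are an integral over a vertical
segment. -/
lemma rays_eq_vertical {E : ℂ → ℂ} {a ε : ℝ} (hk' : 0 < k') (ha : 0 < a) (hε : 0 < ε)
    (hr : a + k' * ε + ε < r₀) (hE : DifferentiableOn ℂ E (Metric.ball 0 r₀)) :
    (-k' + ((1 : ℝ) : ℂ) * Complex.I) *
        (∫ y in (0 : ℝ)..ε, E (a + (-k' + ((1 : ℝ) : ℂ) * Complex.I) * y)) -
      (-k' + ((-1 : ℝ) : ℂ) * Complex.I) *
        (∫ y in (0 : ℝ)..ε, E (a + (-k' + ((-1 : ℝ) : ℂ) * Complex.I) * y)) =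
      Complex.I * ∫ y in (-ε)..ε, E ((a - k' * ε : ℝ) + Complex.I * y) := by
  obtain ⟨F, hF⟩ := exists_primitive_segment (convex_ball (0 : ℂ) r₀) Metric.isOpen_ball hE
  have hkε : 0 < k' * ε := by positivity
  have hmem : ∀ x y : ℝ, |x| ≤ a + k' * ε → |y| ≤ ε →
      ∀ w : ℂ, w.re = x → w.im = y → w ∈ Metric.ball (0 : ℂ) r₀ := by
    intro x y hx hy w h1 h2
    rw [mem_ball_zero_iff]
    exact (norm_le_abs_re_add_abs_im (h1 ▸ hx) (h2 ▸ hy)).trans_lt hr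
  have h0 : (a : ℂ) ∈ Metric.ball (0 : ℂ) r₀ :=
    hmem a 0 (by rw [abs_of_pos ha]; linarith) (by simpa using hε.le) _ (by simp) (by simp)
  have h1 : ((a - k' * ε : ℝ) : ℂ) ∈ Metric.ball (0 : ℂ) r₀ :=
    hmem (a - k' * ε) 0 (by rw [abs_le]; constructor <;> linarith) (by simpa using hε.le) _
      (by simp) (by simp)
  have h2 : ∀ σ : ℝ, |σ| = 1 → ((a - k' * ε : ℝ) : ℂ) + (σ * Complex.I) * ε ∈
      Metric.ball (0 : ℂ) r₀ := by
    intro σ hσ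
    refine hmem (a - k' * ε) (σ * ε) (by rw [abs_le]; constructor <;> linarith)
      (by rw [abs_mul, hσ, one_mul, abs_of_pos hε]) _ (by simp) (by simp)
  have e : ∀ σ : ℝ, (a : ℂ) + (-k' + σ * Complex.I) * ε =
      ((a - k' * ε : ℝ) : ℂ) + (σ * Complex.I) * ε := by
    intro σ
    push_cast
    ring
  have r1 := hF a (-k' + ((1 : ℝ) : ℂ) * Complex.I) ε hε.le h0 (by rw [e]; exact h2 1 (by simp))
  have r2 := hF a (-k' + ((-1 : ℝ) : ℂ) * Complex.I) ε hε.le h0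
    (by rw [e]; exact h2 (-1) (by simp))
  have v1 := hF ((a - k' * ε : ℝ) : ℂ) (((1 : ℝ) : ℂ) * Complex.I) ε hε.le h1 (h2 1 (by simp))
  have v2 := hF ((a - k' * ε : ℝ) : ℂ) (((-1 : ℝ) : ℂ) * Complex.I) ε hε.le h1 (h2 (-1) (by simp))
  have hcont : ContinuousOn (fun y : ℝ => E ((a - k' * ε : ℝ) + Complex.I * y))
      (Set.uIcc (-ε) ε) := by
    refine hE.continuousOn.comp (Continuous.continuousOn (by fun_prop)) fun y hy => ?_
    rw [Set.uIcc_of_le (by linarith)] at hy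
    refine hmem (a - k' * ε) y (by rw [abs_le]; constructor <;> linarith)
      (abs_le.2 hy) _ (by simp) (by simp)
  rw [integral_symm_eq hcont hε.le, r1, r2, v1, v2, e, e]
  ring

/-- Rescaled integrals over a ray. -/
lemma tendsto_ray_integral {h : ℕ → ℂ → ℂ} {ζ : ℂ} {q ε C μ : ℝ} {G : ℝ → ℂ} (hε : 0 < ε)
    (hμ : 0 < μ)
    (hcont : ∀ᶠ N : ℕ in atTop,
      ContinuousOn (fun r : ℝ => h N ((1 + ζ * r) / N)) (Set.Icc 0 (N * ε)))
    (hdom : ∀ᶠ N : ℕ in atTop, ∀ r : ℝ, 0 ≤ r → r ≤ N * ε →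
      ‖(((N : ℝ) ^ (q - 1) : ℝ) : ℂ) * h N ((1 + ζ * r) / N)‖ ≤ C * Real.exp (-μ * r))
    (hlim : ∀ r : ℝ, 0 ≤ r → Tendsto (fun N : ℕ => (((N : ℝ) ^ (q - 1) : ℝ) : ℂ) *
      h N ((1 + ζ * r) / N)) atTop (𝓝 (G r))) :
    Tendsto (fun N : ℕ => (((N : ℝ) ^ q : ℝ) : ℂ) *
      ∫ y in (0 : ℝ)..ε, h N ((((N : ℝ)⁻¹ : ℝ) : ℂ) + ζ * y)) atTop
      (𝓝 (∫ r in Set.Ioi (0 : ℝ), G r)) := by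
  set F : ℕ → ℝ → ℂ := fun N => (Set.Ioc 0 (N * ε)).indicator fun r =>
    (((N : ℝ) ^ (q - 1) : ℝ) : ℂ) * h N ((1 + ζ * r) / N) with hF
  have hFint : ∀ᶠ N : ℕ in atTop, ∫ r in Set.Ioi (0 : ℝ), F N r = (((N : ℝ) ^ q : ℝ) : ℂ) *
      ∫ y in (0 : ℝ)..ε, h N ((((N : ℝ)⁻¹ : ℝ) : ℂ) + ζ * y) := by
    filter_upwards [eventually_gt_atTop 0] with N hN
    have hN' : (0 : ℝ) < N := by exact_mod_cast hN
    have hNC : (N : ℂ) ≠ 0 := by exact_mod_cast hN.ne'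
    have h1 := intervalIntegral.integral_comp_mul_left (a := 0) (b := N * ε)
      (fun y : ℝ => h N ((((N : ℝ)⁻¹ : ℝ) : ℂ) + ζ * y)) (inv_ne_zero hN'.ne')
    rw [mul_zero, inv_mul_cancel_left₀ hN'.ne', inv_inv, Complex.real_smul] at h1
    have h2 : ∀ r : ℝ, (((N : ℝ)⁻¹ : ℝ) : ℂ) + ζ * (((N : ℝ)⁻¹ * r : ℝ) : ℂ) =
        (1 + ζ * r) / N := by
      intro r
      push_cast
      field_simp
    simp_rw [h2] at h1
    rw [hF]
    simp only
    rw [setIntegral_indicator measurableSet_Ioc,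
      Set.inter_eq_self_of_subset_right (fun x hx => hx.1),
      ← intervalIntegral.integral_of_le (by positivity), intervalIntegral.integral_const_mul, h1,
      ← mul_assoc]
    congr 1
    rw [Real.rpow_sub_one hN'.ne']
    push_cast
    field_simp
  refine Tendsto.congr' hFint ?_
  refine tendsto_integral_filter_of_dominated_convergence (fun r => C * Real.exp (-μ * r)) ?_ ?_
    ((exp_neg_integrableOn_Ioi 0 hμ).const_mul C) ?_
  · filter_upwards [hcont] with N hN
    rw [hF]
    refine AEStronglyMeasurable.restrict ?_
    refine (aestronglyMeasurable_indicator_iff measurableSet_Ioc).2 ?_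
    refine ContinuousOn.aestronglyMeasurable ?_ measurableSet_Ioc
    exact continuousOn_const.mul (hN.mono Set.Ioc_subset_Icc_self)
  · filter_upwards [hdom] with N hN
    filter_upwards [ae_restrict_mem measurableSet_Ioi] with r hr
    rw [hF]
    simp only
    by_cases hm : r ∈ Set.Ioc 0 (N * ε)
    · rw [Set.indicator_of_mem hm]
      exact hN r (le_of_lt hr) hm.2
    · rw [Set.indicator_of_notMem hm, norm_zero]
      have h0 := hN 0 le_rfl (by positivity)
      have hC : 0 ≤ C := by
        have := (norm_nonneg _).trans h0
        simpa using this
      positivity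
  · filter_upwards [ae_restrict_mem measurableSet_Ioi] with r hr
    refine (hlim r (le_of_lt hr)).congr' ?_
    have h2 : Tendsto (fun N : ℕ => (N : ℝ) * ε) atTop atTop :=
      tendsto_natCast_atTop_atTop.atTop_mul_const hε
    filter_upwards [h2.eventually (eventually_ge_atTop r)] with N hN
    rw [hF]
    simp only
    rw [Set.indicator_of_mem (show r ∈ Set.Ioc 0 (N * ε) from ⟨hr, hN⟩)]

end

/-! ### Assembling the deformed contour. -/

section

variable {k k' r₀ : ℝ}

lemma ray_div_mem (hk' : 0 < k') (hkk : k' < k) (hk1 : k' < 1) {σ ε : ℝ} (hσ : σ ^ 2 = 1)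
    (hεr : 3 * ε ≤ r₀) {N : ℕ} (hN : 0 < N) (hNε : (N : ℝ)⁻¹ < ε) {r : ℝ} (hr : 0 ≤ r)
    (hrN : r ≤ N * ε) :
    ((1 : ℂ) + (-k' + σ * Complex.I) * r) / N ∈ wedge k ∩ Metric.ball 0 r₀ := by
  have hN' : (0 : ℝ) < N := by exact_mod_cast hN
  refine ⟨div_natCast_mem_wedge (ray_mem_wedge hkk hσ hr) hN, ?_⟩
  rw [mem_ball_zero_iff, norm_div, Complex.norm_natCast, div_lt_iff₀ hN']
  have h1 := ray_norm_le hk' hk1 hσ hr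
  have h2 : 1 < ε * N := by rwa [inv_eq_one_div, div_lt_iff₀ hN'] at hNε
  have h3 : 3 * ε * N ≤ r₀ * N := mul_le_mul_of_nonneg_right hεr hN'.le
  linarith

lemma tendsto_rpow_mul_of_norm_le {a : ℕ → ℂ} {K p c₀ q : ℝ} (hc₀ : 0 < c₀)
    (h : ∀ᶠ N : ℕ in atTop, ‖a N‖ ≤ K * (N : ℝ) ^ p * Real.exp (-(c₀ * N))) :
    Tendsto (fun N : ℕ => (((N : ℝ) ^ q : ℝ) : ℂ) * a N) atTop (𝓝 0) := by
  have hlim := (tendsto_rpow_mul_exp_neg_natCast (q + p) hc₀).mul_const K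
  rw [zero_mul] at hlim
  refine squeeze_zero_norm' ?_ hlim
  filter_upwards [h, eventually_gt_atTop 0] with N hN hN0
  have hN' : (0 : ℝ) < N := by exact_mod_cast hN0
  rw [norm_mul, Complex.norm_real, Real.norm_of_nonneg (by positivity), Real.rpow_add hN']
  calc (N : ℝ) ^ q * ‖a N‖ ≤ (N : ℝ) ^ q * (K * (N : ℝ) ^ p * Real.exp (-(c₀ * N))) := by gcongr
    _ = _ := by ring

/-- Deformation of a vertical segment into two rays: the main contribution comes from a
neighbourhood of the vertex. -/
lemma tendsto_integral_wedge {f E : ℕ → ℂ → ℂ} {q ε C μ K p c₀ K₂ p₂ c₂ : ℝ} {g : ℂ → ℂ}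
    (hk' : 0 < k') (hkk : k' < k) (hk1 : k' < 1) (hε : 0 < ε) (hεr : 3 * ε ≤ r₀)
    (hμ : 0 < μ) (hc₀ : 0 < c₀) (hc₂ : 0 < c₂)
    (hf : ∀ N, DifferentiableOn ℂ (f N) (wedge k ∩ Metric.ball 0 r₀))
    (hE : ∀ N, DifferentiableOn ℂ (E N) (Metric.ball 0 r₀))
    (hhor : ∀ᶠ N : ℕ in atTop, ∀ σ : ℝ, σ ^ 2 = 1 → ∀ x ∈ Set.Icc 0 (k' * ε),
      ‖f N ((((N : ℝ)⁻¹ : ℝ) : ℂ) - k' * ε + σ * Complex.I * ε + x)‖ ≤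
        K * (N : ℝ) ^ p * Real.exp (-(c₀ * N)))
    (hver : ∀ᶠ N : ℕ in atTop, ∀ y : ℝ, |y| ≤ ε →
      ‖E N (((N : ℝ)⁻¹ - k' * ε : ℝ) + Complex.I * y)‖ ≤
        K₂ * (N : ℝ) ^ p₂ * Real.exp (-(c₂ * N)))
    (hdom : ∀ᶠ N : ℕ in atTop, ∀ σ : ℝ, σ ^ 2 = 1 → ∀ r : ℝ, 0 ≤ r → r ≤ N * ε →
      ‖(((N : ℝ) ^ (q - 1) : ℝ) : ℂ) * (f N ((1 + (-k' + σ * Complex.I) * r) / N) -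
        E N ((1 + (-k' + σ * Complex.I) * r) / N))‖ ≤ C * Real.exp (-μ * r))
    (hlim : ∀ σ : ℝ, σ ^ 2 = 1 → ∀ r : ℝ, 0 ≤ r → Tendsto (fun N : ℕ =>
      (((N : ℝ) ^ (q - 1) : ℝ) : ℂ) * (f N ((1 + (-k' + σ * Complex.I) * r) / N) -
        E N ((1 + (-k' + σ * Complex.I) * r) / N))) atTop
      (𝓝 (g (1 + (-k' + σ * Complex.I) * r)))) :
    Tendsto (fun N : ℕ => (((N : ℝ) ^ q : ℝ) : ℂ) *
      (Complex.I * ∫ y in (-ε)..ε, f N ((((N : ℝ)⁻¹ : ℝ) : ℂ) + Complex.I * y))) atTop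
      (𝓝 (wedgeIntegral k' g)) := by
  have hs1 : (1 : ℝ) ^ 2 = 1 := by norm_num
  have hs2 : (-1 : ℝ) ^ 2 = 1 := by norm_num
  have hkε : 0 < k' * ε := by positivity
  have hNε : ∀ᶠ N : ℕ in atTop, (N : ℝ)⁻¹ < ε ∧ 0 < N :=
    ((tendsto_inv_atTop_nhds_zero_nat (𝕜 := ℝ)).eventually (eventually_lt_nhds hε)).and
      (eventually_gt_atTop 0)
  -- the rays
  have hdiff : ∀ N, DifferentiableOn ℂ (fun w => f N w - E N w) (wedge k ∩ Metric.ball 0 r₀) :=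
    fun N => (hf N).sub ((hE N).mono Set.inter_subset_right)
  have hray : ∀ σ : ℝ, σ ^ 2 = 1 → Tendsto (fun N : ℕ => (((N : ℝ) ^ q : ℝ) : ℂ) *
      ∫ y in (0 : ℝ)..ε, (f N ((((N : ℝ)⁻¹ : ℝ) : ℂ) + (-k' + σ * Complex.I) * y) -
        E N ((((N : ℝ)⁻¹ : ℝ) : ℂ) + (-k' + σ * Complex.I) * y))) atTop
      (𝓝 (∫ r in Set.Ioi (0 : ℝ), g (1 + (-k' + σ * Complex.I) * r))) := by
    intro σ hσ
    refine tendsto_ray_integral (h := fun N w => f N w - E N w) hε hμ ?_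
      (hdom.mono fun N h => h σ hσ) (hlim σ hσ)
    filter_upwards [hNε] with N hN
    refine (hdiff N).continuousOn.comp (Continuous.continuousOn (by fun_prop)) fun r hr => ?_
    exact ray_div_mem hk' hkk hk1 hσ hεr hN.2 hN.1 hr.1 hr.2
  -- the horizontal segments
  have hhor' : ∀ σ : ℝ, σ ^ 2 = 1 → Tendsto (fun N : ℕ => (((N : ℝ) ^ q : ℝ) : ℂ) *
      ∫ x in (0 : ℝ)..(k' * ε),
        f N ((((N : ℝ)⁻¹ : ℝ) : ℂ) - k' * ε + σ * Complex.I * ε + x)) atTop (𝓝 0) := by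
    intro σ hσ
    refine tendsto_rpow_mul_of_norm_le (K := K * |k' * ε - 0|) (p := p) hc₀ ?_
    filter_upwards [hhor] with N hN
    refine (intervalIntegral.norm_integral_le_of_norm_le_const fun x hx => hN σ hσ x ?_).trans
      (le_of_eq (by ring))
    rw [Set.uIoc_of_le hkε.le] at hx
    exact ⟨hx.1.le, hx.2⟩
  -- the vertical segment
  have hver' : Tendsto (fun N : ℕ => (((N : ℝ) ^ q : ℝ) : ℂ) *
      ∫ y in (-ε)..ε, E N (((N : ℝ)⁻¹ - k' * ε : ℝ) + Complex.I * y)) atTop (𝓝 0) := by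
    refine tendsto_rpow_mul_of_norm_le (K := K₂ * |ε - -ε|) (p := p₂) hc₂ ?_
    filter_upwards [hver] with N hN
    refine (intervalIntegral.norm_integral_le_of_norm_le_const fun y hy => hN y ?_).trans
      (le_of_eq (by ring))
    rw [Set.uIoc_of_le (by linarith)] at hy
    exact abs_le.2 ⟨hy.1.le, hy.2⟩
  -- On the rays f is split as (f - E) + E. The first part gives the limit; for E, holomorphic in
  -- the whole disc, the two rays are traded for a vertical segment to the left of 0, which is
  -- negligible like the horizontal sides.
  have htot := ((((hray 1 hs1).const_mul (-k' + ((1 : ℝ) : ℂ) * Complex.I)).sub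
    ((hray (-1) hs2).const_mul (-k' + ((-1 : ℝ) : ℂ) * Complex.I))).add
    ((hver'.const_mul Complex.I))).add ((hhor' 1 hs1).sub (hhor' (-1) hs2))
  rw [mul_zero, sub_zero, add_zero, add_zero, ← wedgeIntegral] at htot
  refine htot.congr' ?_
  filter_upwards [hNε] with N ⟨hN, hN0⟩
  have hN' : (0 : ℝ) < N := by exact_mod_cast hN0
  have ha : 0 < (N : ℝ)⁻¹ := by positivity
  have hr : (N : ℝ)⁻¹ + k' * ε + ε < r₀ := by nlinarith
  have hcont : ContinuousOn (fun y : ℝ => f N ((((N : ℝ)⁻¹ : ℝ) : ℂ) + Complex.I * y))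
      (Set.uIcc (-ε) ε) := by
    refine (hf N).continuousOn.comp (Continuous.continuousOn (by fun_prop)) fun y hy => ?_
    rw [Set.uIcc_of_le (by linarith)] at hy
    refine ⟨halfPlane_subset_wedge (hk'.trans hkk).le ?_, ?_⟩
    · show 0 < ((((N : ℝ)⁻¹ : ℝ) : ℂ) + Complex.I * y).re
      simpa using hN'
    · rw [mem_ball_zero_iff]
      have h1 : |((((N : ℝ)⁻¹ : ℝ) : ℂ) + Complex.I * y).re| ≤ (N : ℝ)⁻¹ := by simp
      have h2 : |((((N : ℝ)⁻¹ : ℝ) : ℂ) + Complex.I * y).im| ≤ ε := by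
        simpa using abs_le.2 hy
      linarith [norm_le_abs_re_add_abs_im h1 h2]
  have hseg : ∀ σ : ℝ, σ ^ 2 = 1 →
      (σ * Complex.I) * (∫ y in (0 : ℝ)..ε, f N ((((N : ℝ)⁻¹ : ℝ) : ℂ) + (σ * Complex.I) * y)) =
      (-k' + σ * Complex.I) * (∫ y in (0 : ℝ)..ε,
        (f N ((((N : ℝ)⁻¹ : ℝ) : ℂ) + (-k' + σ * Complex.I) * y) -
          E N ((((N : ℝ)⁻¹ : ℝ) : ℂ) + (-k' + σ * Complex.I) * y))) +
      (-k' + σ * Complex.I) * (∫ y in (0 : ℝ)..ε,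
          E N ((((N : ℝ)⁻¹ : ℝ) : ℂ) + (-k' + σ * Complex.I) * y)) +
        ∫ x in (0 : ℝ)..(k' * ε),
          f N ((((N : ℝ)⁻¹ : ℝ) : ℂ) - k' * ε + σ * Complex.I * ε + x) := by
    intro σ hσ
    have hmaps : Set.MapsTo
        (fun y : ℝ => (((N : ℝ)⁻¹ : ℝ) : ℂ) + (-k' + σ * Complex.I) * y)
        (Set.uIcc 0 ε) (wedge k ∩ Metric.ball 0 r₀) := by
      intro y hy
      rw [Set.uIcc_of_le hε.le] at hy
      have h := ray_div_mem hk' hkk hk1 hσ hεr hN0 hN (r := N * y)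
        (mul_nonneg hN'.le hy.1) (mul_le_mul_of_nonneg_left hy.2 hN'.le)
      have e : ((1 : ℂ) + (-k' + σ * Complex.I) * ((N * y : ℝ) : ℂ)) / N =
          (((N : ℝ)⁻¹ : ℝ) : ℂ) + (-k' + σ * Complex.I) * y := by
        have : (N : ℂ) ≠ 0 := by exact_mod_cast hN0.ne'
        push_cast
        field_simp
      rwa [e] at h
    have hlin : Continuous fun y : ℝ =>
        (((N : ℝ)⁻¹ : ℝ) : ℂ) + (-k' + σ * Complex.I) * y := by fun_prop
    have h1 : IntervalIntegrable
        (fun y : ℝ => f N ((((N : ℝ)⁻¹ : ℝ) : ℂ) + (-k' + σ * Complex.I) * y)) volume 0 ε :=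
      ((hf N).continuousOn.comp hlin.continuousOn hmaps).intervalIntegrable
    have h2 : IntervalIntegrable
        (fun y : ℝ => E N ((((N : ℝ)⁻¹ : ℝ) : ℂ) + (-k' + σ * Complex.I) * y)) volume 0 ε :=
      (((hE N).mono Set.inter_subset_right).continuousOn.comp hlin.continuousOn
        hmaps).intervalIntegrable
    rw [segment_eq_ray hk' hkk ha hε hr hσ (hf N), intervalIntegral.integral_sub h1 h2]
    ring
  rw [integral_symm_eq hcont hε.le, hseg 1 hs1, hseg (-1) hs2]
  linear_combination (-(((N : ℝ) ^ q : ℝ) : ℂ)) * rays_eq_vertical hk' ha hε hr (hE N)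

/-- The asymptotics of the coefficients of `exp (u (g_θ + N g_κ))` when the dominant singularity
is not accompanied by a saddle point. -/
theorem tendsto_expCoeff_wedge {α β : ℕ → ℝ} {Fα Fβ : ℂ → ℂ} {c K p : ℝ} {τ : ℕ → ℝ}
    (hα : ∀ j, 0 ≤ α j) (hβ : ∀ j, 0 ≤ β j) (hα0 : α 0 = 0) (hβ0 : β 0 = 0)
    (hβs : Summable β) (hna : NonArithmetic β)
    (hαs : ∀ ξ : ℝ, 0 < ξ → Summable fun j : ℕ => α j * Real.exp (-(ξ * j)))
    (hk' : 0 < k') (hkk : k' < k) (hk1 : k < 1) (hc : c < 1) (hr₀ : 0 < r₀)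
    (hdα : DifferentiableOn ℂ Fα (wedge k ∩ Metric.ball 0 r₀))
    (hdβ : DifferentiableOn ℂ Fβ (wedge k ∩ Metric.ball 0 r₀))
    (heα : ∀ w : ℂ, 0 < w.re → Fα w = lap α w) (heβ : ∀ w : ℂ, 0 < w.re → Fβ w = lap β w)
    (hEβ : (fun w => Fβ w - (∑' j : ℕ, β j : ℝ) + c * w) =o[𝓝[wedge k] 0] fun w => w)
    (hτ0 : Tendsto τ atTop (𝓝 0)) (hτK : ∀ᶠ N : ℕ in atTop, N * τ N ^ 2 ≤ K)
    (hαp : ∀ᶠ N : ℕ in atTop,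
      Real.exp (∑' j : ℕ, α j * Real.exp (-((N : ℝ)⁻¹ * j))) ≤ K * (N : ℝ) ^ p)
    {E : ℕ → ℂ → ℂ} {q : ℝ} {g : ℂ → ℂ}
    (hE : ∀ N, DifferentiableOn ℂ (E N) (Metric.ball 0 r₀))
    (hver : ∃ ε₁ : ℝ, 0 < ε₁ ∧ ∀ ε : ℝ, 0 < ε → ε < ε₁ → ∃ c₀ > 0, ∃ K' p' : ℝ,
      ∀ᶠ N : ℕ in atTop, ∀ y : ℝ, |y| ≤ ε →
        ‖E N (((N : ℝ)⁻¹ - k' * ε : ℝ) + Complex.I * y)‖ ≤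
          K' * (N : ℝ) ^ p' * Real.exp (-(c₀ * N)))
    (hdom : ∃ δ > 0, ∃ μ > 0, ∃ C : ℝ, ∀ᶠ N : ℕ in atTop, ∀ σ : ℝ, σ ^ 2 = 1 →
      ∀ r : ℝ, 0 ≤ r → r ≤ N * δ →
      ‖(((N : ℝ) ^ (q - 1) : ℝ) : ℂ) *
        (Complex.exp (contPhase Fα Fβ (∑' j : ℕ, β j) (Complex.exp (Complex.I * τ N)) N
          ((1 + (-k' + σ * Complex.I) * r) / N)) -
        E N ((1 + (-k' + σ * Complex.I) * r) / N))‖ ≤ C * Real.exp (-μ * r))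
    (hlim : ∀ σ : ℝ, σ ^ 2 = 1 → ∀ r : ℝ, 0 ≤ r → Tendsto (fun N : ℕ =>
      (((N : ℝ) ^ (q - 1) : ℝ) : ℂ) *
        (Complex.exp (contPhase Fα Fβ (∑' j : ℕ, β j) (Complex.exp (Complex.I * τ N)) N
          ((1 + (-k' + σ * Complex.I) * r) / N)) -
        E N ((1 + (-k' + σ * Complex.I) * r) / N))) atTop
      (𝓝 (g (1 + (-k' + σ * Complex.I) * r)))) :
    Tendsto (fun N : ℕ => (((N : ℝ) ^ q : ℝ) : ℂ) *
      (Complex.exp (-(Complex.exp (Complex.I * τ N) * N * (∑' j : ℕ, β j : ℝ))) *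
        expCoeff (fun j => Complex.exp (Complex.I * τ N) * ((α j : ℂ) + N * (β j : ℂ))) N)) atTop
      (𝓝 (wedgeIntegral k' g / (2 * Real.pi * Complex.I))) := by
  have hπ := Real.pi_pos
  obtain ⟨ε₁, hε₁, hhor⟩ := exists_norm_exp_horizontal_le hα hβ hβs hna hαs hk' hkk hk1 hc hr₀
    hdα hdβ heα heβ hEβ hτ0 hτK hαp
  obtain ⟨ε₂, hε₂, hver⟩ := hver
  obtain ⟨δ, hδ, μ, hμ, C, hdom⟩ := hdom
  -- The halves give the strict inequalities required of ε, and r₀/3 keeps rays of height ε in the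
  -- disc, since their points have modulus below 3ε for large N.
  set ε : ℝ := min (min (ε₁ / 2) (ε₂ / 2)) (min (min δ Real.pi) (r₀ / 3)) with hεdef
  have hε : 0 < ε := by positivity
  have hεπ : ε ≤ Real.pi :=
    (min_le_right _ _).trans ((min_le_left _ _).trans (min_le_right _ _))
  have hεδ : ε ≤ δ := (min_le_right _ _).trans ((min_le_left _ _).trans (min_le_left _ _))
  have hεr : ε ≤ r₀ / 3 := (min_le_right _ _).trans (min_le_right _ _)
  have h1 : ε ≤ ε₁ / 2 := (min_le_left _ _).trans (min_le_left _ _)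
  have h2 : ε ≤ ε₂ / 2 := (min_le_left _ _).trans (min_le_right _ _)
  obtain ⟨c₀, hc₀, K₀, hhor⟩ := hhor ε hε (by linarith) hεπ
  obtain ⟨c₂, hc₂, K₂, p₂, hver⟩ := hver ε hε (by linarith)
  obtain ⟨c₁, hc₁, K₁, hout⟩ := exists_norm_exp_phase_inv_le hα hβ hβs hna hαs hτK hαp hε
  have houter := tendsto_outer_integral hc₁ hε hεπ hout q
  have hinner := tendsto_integral_wedge hk' hkk (hkk.trans hk1) hε (by linarith) hμ hc₀ hc₂
    (f := fun N w => Complex.exp (contPhase Fα Fβ (∑' j : ℕ, β j)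
      (Complex.exp (Complex.I * τ N)) N w)) (fun N => by
        unfold contPhase
        exact ((hdα.const_mul _).add ((((hdβ.sub_const _).const_mul _).add
          differentiableOn_id).const_mul _)).cexp)
    hE hhor hver
    (hdom.mono fun N h σ hσ r hr hrN => h σ hσ r hr
      (hrN.trans (mul_le_mul_of_nonneg_left hεδ (Nat.cast_nonneg _)))) hlim
  have htot := ((houter.const_mul Complex.I).add hinner).div_const (2 * Real.pi * Complex.I)
  rw [mul_zero, zero_add] at htot
  refine htot.congr' ?_
  filter_upwards [eventually_gt_atTop 0] with N hN
  have hN' : (0 : ℝ) < (N : ℝ)⁻¹ := by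
    have : (0 : ℝ) < N := by exact_mod_cast hN
    positivity
  have hβe := summable_mul_exp_neg hβ hβs hN'.le
  set G : ℝ → ℂ := fun y => Complex.exp
    (phase α β (Complex.exp (Complex.I * τ N)) N N ((((N : ℝ)⁻¹ : ℝ) : ℂ) + Complex.I * y)) with hG
  have hcont : Continuous G := Complex.continuous_exp.comp
    (continuous_phase_line hα hβ (hαs _ hN') hβe _ _ _)
  have hI := integral_exp_phase hα hβ hα0 hβ0 (hαs _ hN') hβe (Complex.exp (Complex.I * τ N)) N N
  have hsplit : (∫ y in (-Real.pi)..Real.pi, G y) = (∫ y in (-Real.pi)..(-ε), G y) +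
      (∫ y in (-ε)..ε, G y) + ∫ y in ε..Real.pi, G y := by
    rw [intervalIntegral.integral_add_adjacent_intervals (hcont.intervalIntegrable _ _)
      (hcont.intervalIntegrable _ _), intervalIntegral.integral_add_adjacent_intervals
      (hcont.intervalIntegrable _ _) (hcont.intervalIntegrable _ _)]
  rw [hsplit] at hI
  have hGf : ∀ y : ℝ, Complex.exp (contPhase Fα Fβ (∑' j : ℕ, β j)
      (Complex.exp (Complex.I * τ N)) N ((((N : ℝ)⁻¹ : ℝ) : ℂ) + Complex.I * y)) = G y := by
    intro y
    rw [contPhase_eq_phase heα heβ _ _ (by simpa using hN)]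
  simp_rw [hGf]
  have hπC : (Real.pi : ℂ) ≠ 0 := by exact_mod_cast hπ.ne'
  have hIC := Complex.I_ne_zero
  rw [div_eq_iff (by simp [hπC])]
  linear_combination ((((N : ℝ) ^ q : ℝ) : ℂ) * Complex.I) * hI

end

/-! ### A logarithmic singularity without a saddle point. -/

section

variable {k k' r₀ c m : ℝ} {F : ℂ → ℂ} {τ : ℕ → ℝ}

lemma eventually_norm_ray_div_lt (hk' : 0 < k') (hk1 : k' < 1) {ρ : ℝ} (hρ : 0 < ρ) :
    ∀ᶠ N : ℕ in atTop, ∀ σ : ℝ, σ ^ 2 = 1 → ∀ r : ℝ, 0 ≤ r → r ≤ N * (ρ / 4) →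
      ‖((1 : ℂ) + (-k' + σ * Complex.I) * r) / N‖ < ρ := by
  filter_upwards [(tendsto_inv_atTop_nhds_zero_nat (𝕜 := ℝ)).eventually
    (eventually_lt_nhds (half_pos hρ)), eventually_gt_atTop 0] with N hN hN0 σ hσ r hr hrN
  have hN' : (0 : ℝ) < N := by exact_mod_cast hN0
  rw [norm_div, Complex.norm_natCast, div_lt_iff₀ hN']
  have h1 := ray_norm_le hk' hk1 hσ hr
  have h2 : 1 < ρ / 2 * N := by rwa [inv_eq_one_div, div_lt_iff₀ hN'] at hN
  linarith

/-- Decay of the exponent along the rays. -/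
lemma exists_re_ray_le (hk' : 0 < k') (hkk : k' < k) (hk1 : k < 1) (hc : c < 1)
    (hE : (fun w => F w - m + c * w) =o[𝓝[wedge k] 0] fun w => w)
    (hτ0 : Tendsto τ atTop (𝓝 0)) :
    ∃ δ > 0, ∀ᶠ N : ℕ in atTop, ∀ σ : ℝ, σ ^ 2 = 1 → ∀ r : ℝ, 0 ≤ r → r ≤ N * δ →
      ((N : ℂ) * (Complex.exp (Complex.I * τ N) * (F ((1 + (-k' + σ * Complex.I) * r) / N) - m) +
        (1 + (-k' + σ * Complex.I) * r) / N)).re ≤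
      2 * (1 - c) - (1 - c) * k' / 2 * r := by
  have hlam : 0 < 1 - c := by linarith
  -- On the rays |x| ≤ 1 + 2r, so this error uses up half of the decay (1 - c)k'r.
  obtain ⟨δ, hδ, h⟩ := exists_re_linear_le hE hτ0 (show 0 < (1 - c) * k' / 4 by positivity)
  refine ⟨δ / 4, by positivity, ?_⟩
  filter_upwards [h, eventually_norm_ray_div_lt hk' (hkk.trans hk1) hδ, eventually_gt_atTop 0] with
    N hN hN2 hN0 σ hσ r hr hrN
  have hN' : (0 : ℝ) < N := by exact_mod_cast hN0
  have h1 := hN _ (div_natCast_mem_wedge (ray_mem_wedge hkk hσ hr) hN0) (hN2 σ hσ r hr hrN)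
  have h2 := ray_norm_le hk' (hkk.trans hk1) hσ hr
  have e : ∀ z : ℂ, ((N : ℂ) * z).re = N * z.re := fun z => Complex.re_ofReal_mul (N : ℝ) z
  rw [e]
  refine (mul_le_mul_of_nonneg_left h1 hN'.le).trans ?_
  rw [norm_div, Complex.norm_natCast, Complex.div_natCast_re, ray_re]
  have e2 : (N : ℝ) * ((1 - c) * ((1 - k' * r) / N) +
      (1 - c) * k' / 4 * (‖(1 : ℂ) + (-k' + σ * Complex.I) * r‖ / N)) =
      (1 - c) * (1 - k' * r) + (1 - c) * k' / 4 * ‖(1 : ℂ) + (-k' + σ * Complex.I) * r‖ := by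
    field_simp
  rw [e2]
  have h3 : (1 - c) * k' / 4 * ‖(1 : ℂ) + (-k' + σ * Complex.I) * r‖ ≤
      (1 - c) * k' / 4 * (1 + 2 * r) := mul_le_mul_of_nonneg_left h2 (by positivity)
  nlinarith

lemma log_div_natCast {x : ℂ} (hx : x ≠ 0) {N : ℕ} (hN : 0 < N) :
    Complex.log (x / N) = Complex.log x - Real.log N := by
  have hN' : (0 : ℝ) < (N : ℝ)⁻¹ := by
    have : (0 : ℝ) < N := by exact_mod_cast hN
    positivity
  have h := Complex.log_ofReal_mul hN' hx
  rw [Real.log_inv] at h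
  push_cast at h
  rw [div_eq_inv_mul, h]
  push_cast
  ring

/-- On the rescaled rays log w is of order log N at most, which makes (u - 1) log w negligible
because τ log N → 0. -/
lemma norm_log_le {w : ℂ} {N : ℕ} (hN : 0 < N) (h1 : 1 / 2 / N ≤ ‖w‖) (h2 : ‖w‖ ≤ 1) :
    ‖Complex.log w‖ ≤ Real.log N + 5 := by
  have hN' : (0 : ℝ) < N := by exact_mod_cast hN
  have h0 : 0 < ‖w‖ := lt_of_lt_of_le (by positivity) h1
  have h3 : |(Complex.log w).re| ≤ Real.log N + 1 := by
    rw [Complex.log_re, abs_of_nonpos (Real.log_nonpos h0.le h2)]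
    have h4 := Real.log_le_log (by positivity) h1
    rw [Real.log_div (by norm_num) hN'.ne', Real.log_div (by norm_num) (by norm_num),
      Real.log_one] at h4
    linarith [Real.log_two_lt_d9]
  have h5 : |(Complex.log w).im| ≤ 4 := by
    rw [Complex.log_im]
    exact (Complex.abs_arg_le_pi w).trans Real.pi_le_four
  linarith [norm_le_abs_re_add_abs_im h3 h5]

lemma tendsto_exp_sub_one_mul_log (hτlog : Tendsto (fun N : ℕ => τ N * Real.log N) atTop (𝓝 0)) :
    Tendsto (fun N : ℕ => (Complex.exp (Complex.I * τ N) - 1) * Real.log N) atTop (𝓝 0) := by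
  have := hτlog.abs
  rw [abs_zero] at this
  refine squeeze_zero_norm (fun N => ?_) this
  rw [norm_mul, Complex.norm_real, Real.norm_eq_abs, abs_mul]
  exact mul_le_mul_of_nonneg_right (norm_exp_I_mul_sub_one_le _) (abs_nonneg _)

variable {α β : ℕ → ℝ} {Fα Fβ : ℂ → ℂ} {θ K : ℝ}

/-- Domination for a logarithmic singularity of the first function. -/
lemma exists_norm_exp_log_ray_le (hk' : 0 < k') (hkk : k' < k) (hk1 : k < 1) (hc : c < 1)
    (hE : (fun w => Fβ w - m + c * w) =o[𝓝[wedge k] 0] fun w => w)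
    (hEα : Tendsto (fun w => Fα w + θ * Complex.log w) (𝓝[wedge k] 0) (𝓝 0))
    (hθ : 0 ≤ θ) (hτ0 : Tendsto τ atTop (𝓝 0))
    (hτlog : Tendsto (fun N : ℕ => τ N * Real.log N) atTop (𝓝 0)) :
    ∃ δ > 0, ∃ μ > 0, ∃ C : ℝ, ∀ᶠ N : ℕ in atTop, ∀ σ : ℝ, σ ^ 2 = 1 →
      ∀ r : ℝ, 0 ≤ r → r ≤ N * δ →
      ‖(((N : ℝ) ^ (-θ) : ℝ) : ℂ) *
        Complex.exp (contPhase Fα Fβ m (Complex.exp (Complex.I * τ N)) N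
          ((1 + (-k' + σ * Complex.I) * r) / N))‖ ≤ C * Real.exp (-μ * r) := by
  have hlam : 0 < 1 - c := by linarith
  obtain ⟨δ₁, hδ₁, h1⟩ := exists_re_ray_le hk' hkk hk1 hc hE hτ0
  have h2 := hEα.norm.eventually_lt_const (u := 1) (by simp)
  rw [eventually_nhdsWithin_iff, Metric.eventually_nhds_iff] at h2
  obtain ⟨ρ, hρ, h2⟩ := h2
  have hρ1 : 0 < min ρ 1 := by positivity
  have h3 : Tendsto (fun N : ℕ => θ * (|τ N * Real.log N| + |τ N| * 5)) atTop (𝓝 0) := by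
    have := ((hτlog.abs.add (hτ0.abs.mul_const 5))).const_mul θ
    simpa using this
  refine ⟨min δ₁ (min ρ 1 / 4), by positivity, (1 - c) * k' / 2, by positivity,
    2 ^ θ * Real.exp (2 + 2 * (1 - c)), ?_⟩
  filter_upwards [h1, eventually_norm_ray_div_lt hk' (hkk.trans hk1) hρ1,
    h3.eventually (eventually_lt_nhds one_pos), eventually_gt_atTop 0] with
    N hN1 hN2 hN3 hN0 σ hσ r hr hrN
  have hN' : (0 : ℝ) < N := by exact_mod_cast hN0
  have hN1' : (1 : ℝ) ≤ N := by exact_mod_cast hN0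
  set x : ℂ := 1 + (-k' + σ * Complex.I) * r with hx
  have hx0 : x ≠ 0 := Complex.slitPlane_ne_zero (ray_mem_slitPlane hσ r)
  have hxn := ray_norm_ge hk' (hkk.trans hk1) hσ r
  rw [← hx] at hxn
  have hre := hN1 σ hσ r hr (hrN.trans (mul_le_mul_of_nonneg_left (min_le_left _ _) hN'.le))
  have hw := hN2 σ hσ r hr (hrN.trans (mul_le_mul_of_nonneg_left (min_le_right _ _) hN'.le))
  rw [← hx] at hre hw
  have hα := h2 (y := x / N) (by
    rw [dist_zero_right]
    exact hw.trans_le (min_le_left _ _)) (div_natCast_mem_wedge (ray_mem_wedge hkk hσ hr) hN0)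
  set u := Complex.exp (Complex.I * τ N) with hu
  have hu1 : ‖u‖ = 1 := by simp [hu, Complex.norm_exp]
  have hlog := norm_log_le (w := x / N) hN0 (by
    rw [norm_div, Complex.norm_natCast]
    gcongr) (hw.le.trans (min_le_right _ _))
  have hl0 : 0 ≤ Real.log N := Real.log_nonneg hN1'
  have hA : (u * Fα (x / N)).re ≤ 2 - θ * (Real.log ‖x‖ - Real.log N) := by
    -- The factor u in front of the logarithm is replaced by 1; the price is controlled by |τ|(log N
    -- + 5).
    have e : u * Fα (x / N) = (u * (Fα (x / N) + θ * Complex.log (x / N)) -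
        θ * ((u - 1) * Complex.log (x / N))) - θ * Complex.log (x / N) := by ring
    have hn : ‖u * (Fα (x / N) + θ * Complex.log (x / N)) -
        θ * ((u - 1) * Complex.log (x / N))‖ ≤ 2 := by
      refine (norm_sub_le _ _).trans ?_
      rw [norm_mul, hu1, one_mul, norm_mul, norm_mul, Complex.norm_real, Real.norm_of_nonneg hθ]
      have h4 : ‖u - 1‖ * ‖Complex.log (x / N)‖ ≤ |τ N| * (Real.log N + 5) :=
        mul_le_mul (norm_exp_I_mul_sub_one_le _) hlog (norm_nonneg _) (abs_nonneg _)
      have h5 : θ * (|τ N| * (Real.log N + 5)) ≤ 1 := by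
        rw [abs_mul, abs_of_nonneg hl0] at hN3
        linarith
      linarith [mul_le_mul_of_nonneg_left h4 hθ]
    have e2 : (Complex.log (x / N)).re = Real.log ‖x‖ - Real.log N := by
      rw [log_div_natCast hx0 hN0, Complex.sub_re, Complex.log_re, Complex.ofReal_re]
    rw [e, Complex.sub_re, Complex.re_ofReal_mul, e2]
    linarith [(Complex.re_le_norm _).trans hn]
  rw [norm_mul, Complex.norm_real, Real.norm_of_nonneg (by positivity), Complex.norm_exp, contPhase,
    Complex.add_re]
  have hxθ : ‖x‖ ^ (-θ) ≤ 2 ^ θ := by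
    have := Real.rpow_le_rpow_of_nonpos (z := -θ) (by norm_num) hxn (by linarith)
    rwa [one_div, Real.inv_rpow (by norm_num), ← Real.rpow_neg (by norm_num), neg_neg] at this
  have hxpos : 0 < ‖x‖ := by linarith
  calc (N : ℝ) ^ (-θ) * Real.exp ((u * Fα (x / N)).re + ((N : ℂ) * (u * (Fβ (x / N) - m) + x / N)).re)
      ≤ (N : ℝ) ^ (-θ) * Real.exp ((2 - θ * (Real.log ‖x‖ - Real.log N)) +
        (2 * (1 - c) - (1 - c) * k' / 2 * r)) := by gcongr
    _ = ‖x‖ ^ (-θ) * Real.exp (2 + 2 * (1 - c)) * Real.exp (-((1 - c) * k' / 2) * r) := by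
        rw [Real.rpow_def_of_pos hN', Real.rpow_def_of_pos hxpos, ← Real.exp_add, ← Real.exp_add,
          ← Real.exp_add]
        congr 1
        ring
    _ ≤ _ := by gcongr

/-- The factor N^{-θ} cancels the log N in log(x/N) = log x - log N, except for (u - 1) log N, which
tends to 0. -/
lemma tendsto_exp_log_ray
    (hE : (fun w => Fβ w - m + c * w) =o[𝓝[wedge k] 0] fun w => w)
    (hEα : Tendsto (fun w => Fα w + θ * Complex.log w) (𝓝[wedge k] 0) (𝓝 0))
    (hτ0 : Tendsto τ atTop (𝓝 0))
    (hτlog : Tendsto (fun N : ℕ => τ N * Real.log N) atTop (𝓝 0)) {x : ℂ} (hx : x ∈ wedge k) :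
    Tendsto (fun N : ℕ => (((N : ℝ) ^ (-θ) : ℝ) : ℂ) *
        Complex.exp (contPhase Fα Fβ m (Complex.exp (Complex.I * τ N)) N (x / N))) atTop
      (𝓝 (hankelIntegrand (-θ) (1 - c) x)) := by
  have hT : ∀ᶠ N : ℕ in atTop, x / N ∈ wedge k :=
    (eventually_gt_atTop 0).mono fun N hN => div_natCast_mem_wedge hx hN
  have h1 := tendsto_linear_scaled hE hτ0 hx.1 hT
  have hu := tendsto_exp_I_mul hτ0
  have hw : Tendsto (fun N : ℕ => x / N) atTop (𝓝[wedge k] 0) :=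
    tendsto_nhdsWithin_iff.2 ⟨tendsto_const_div_atTop_nhds_zero_nat x, hT⟩
  have h2 := hu.mul (hEα.comp hw)
  have h3 := (hu.mul_const (θ * Complex.log x))
  have h4 := (tendsto_exp_sub_one_mul_log hτlog).const_mul (θ : ℂ)
  have h5 := (((h2.sub h3).add h4).add h1).cexp
  have e : Complex.exp (1 * 0 - 1 * (θ * Complex.log x) + θ * 0 + (1 - c : ℝ) * x) =
      hankelIntegrand (-θ) (1 - c) x := by
    rw [hankelIntegrand, Complex.cpow_def_of_ne_zero hx.1, ← Complex.exp_add]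
    congr 1
    push_cast
    ring
  rw [e] at h5
  refine h5.congr' ?_
  filter_upwards [eventually_gt_atTop 0] with N hN
  have hN' : (0 : ℝ) < N := by exact_mod_cast hN
  rw [Real.rpow_def_of_pos hN', Complex.ofReal_exp, ← Complex.exp_add, contPhase, Function.comp,
    log_div_natCast hx.1 hN]
  congr 1
  push_cast
  ring

/-- The supercritical case with a logarithmic singularity of the first function. -/
theorem tendsto_expCoeff_wedge_log
    (hα : ∀ j, 0 ≤ α j) (hβ : ∀ j, 0 ≤ β j) (hα0 : α 0 = 0) (hβ0 : β 0 = 0)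
    (hβs : Summable β) (hna : NonArithmetic β)
    (hαs : ∀ ξ : ℝ, 0 < ξ → Summable fun j : ℕ => α j * Real.exp (-(ξ * j)))
    (hk' : 0 < k') (hkk : k' < k) (hk1 : k < 1) (hc : c < 1) (hr₀ : 0 < r₀)
    (hdα : DifferentiableOn ℂ Fα (wedge k ∩ Metric.ball 0 r₀))
    (hdβ : DifferentiableOn ℂ Fβ (wedge k ∩ Metric.ball 0 r₀))
    (heα : ∀ w : ℂ, 0 < w.re → Fα w = lap α w) (heβ : ∀ w : ℂ, 0 < w.re → Fβ w = lap β w)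
    (hEβ : (fun w => Fβ w - (∑' j : ℕ, β j : ℝ) + c * w) =o[𝓝[wedge k] 0] fun w => w)
    (hEα : Tendsto (fun w => Fα w + θ * Complex.log w) (𝓝[wedge k] 0) (𝓝 0))
    (hθ : 0 ≤ θ)
    (hτ0 : Tendsto τ atTop (𝓝 0)) (hτK : ∀ᶠ N : ℕ in atTop, N * τ N ^ 2 ≤ K)
    (hτlog : Tendsto (fun N : ℕ => τ N * Real.log N) atTop (𝓝 0)) :
    Tendsto (fun N : ℕ => (((N : ℝ) ^ (1 - θ) : ℝ) : ℂ) *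
      (Complex.exp (-(Complex.exp (Complex.I * τ N) * N * (∑' j : ℕ, β j : ℝ))) *
        expCoeff (fun j => Complex.exp (Complex.I * τ N) * ((α j : ℂ) + N * (β j : ℂ))) N)) atTop
      (𝓝 (wedgeIntegral k' (hankelIntegrand (-θ) (1 - c)) / (2 * Real.pi * Complex.I))) := by
  have hq : 1 - θ - 1 = -θ := by ring
  have hk0 : 0 < k := hk'.trans hkk
  -- Nothing is subtracted: the logarithm acts at leading order, with w^{-θ} as the main factor of
  -- the integrand.
  refine tendsto_expCoeff_wedge (E := fun _ _ => 0) (K := max K (Real.exp 1)) (p := θ) hα hβ hα0 hβ0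
    hβs hna hαs hk' hkk hk1 hc hr₀ hdα hdβ heα heβ hEβ hτ0
    (hτK.mono fun N h => h.trans (le_max_left _ _)) ?_ (fun _ => differentiableOn_const 0) ?_ ?_ ?_
  · have hw : Tendsto (fun N : ℕ => (1 : ℂ) / N) atTop (𝓝[wedge k] 0) :=
      tendsto_nhdsWithin_iff.2 ⟨tendsto_const_div_atTop_nhds_zero_nat 1,
        (eventually_gt_atTop 0).mono fun N hN => div_natCast_mem_wedge
          (halfPlane_subset_wedge hk0.le (by simp)) hN⟩
    filter_upwards [(hEα.comp hw).norm.eventually_lt_const (u := 1) (by simp),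
      eventually_gt_atTop 0] with N hN hN0
    have hN' : (0 : ℝ) < N := by exact_mod_cast hN0
    have e : (1 : ℂ) / N = (((N : ℝ)⁻¹ : ℝ) : ℂ) := by push_cast; simp
    rw [Function.comp, log_div_natCast one_ne_zero hN0, e, heα _ (by simpa using hN0), lap_ofReal,
      Complex.log_one, zero_sub, ← Complex.ofReal_neg, ← Complex.ofReal_mul, ← Complex.ofReal_add,
      Complex.norm_real] at hN
    have h2 := (abs_lt.1 hN).2
    refine (Real.exp_le_exp.2 (show _ ≤ 1 + Real.log N * θ by linarith)).trans ?_
    rw [Real.exp_add, ← Real.rpow_def_of_pos hN']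
    exact mul_le_mul_of_nonneg_right (le_max_right _ _) (by positivity)
  · refine ⟨1, one_pos, fun ε _ _ => ⟨1, one_pos, 0, 0, Eventually.of_forall fun N y _ => ?_⟩⟩
    simp
  · obtain ⟨δ, hδ, μ, hμ, C, h⟩ := exists_norm_exp_log_ray_le hk' hkk hk1 hc hEβ hEα hθ hτ0 hτlog
    refine ⟨δ, hδ, μ, hμ, C, h.mono fun N hN σ hσ r hr hrN => ?_⟩
    rw [sub_zero, hq]
    exact hN σ hσ r hr hrN
  · intro σ hσ r hr
    simp_rw [sub_zero, hq]
    exact tendsto_exp_log_ray hEβ hEα hτ0 hτlog (ray_mem_wedge hkk hσ hr)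

end

/-! ### The supercritical cases -/

section

variable {θ κ : ℕ → ℝ} {ρ η φ m : ℝ}

lemma exists_mul_exp_neg_mem_deltaDomain (hρ : 0 < ρ) (hη : 0 < η) (hφ : 0 < φ)
    (hφ2 : φ < Real.pi / 2) :
    ∃ r₀ > 0, ∀ w ∈ wedge (Real.cos φ / 2) ∩ Metric.ball 0 r₀,
      (ρ : ℂ) * Complex.exp (-w) ∈ deltaDomain ρ η φ := by
  have h := (tendsto_nhdsWithin_iff.1 (tendsto_mul_exp_neg hρ hη hφ hφ2)).2
  rw [eventually_nhdsWithin_iff, Metric.eventually_nhds_iff] at h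
  obtain ⟨r₀, hr₀, h⟩ := h
  exact ⟨r₀, hr₀, fun w hw => h (y := w) hw.2 hw.1⟩

lemma IsContinuation.differentiableOn_comp {a : ℕ → ℝ} {G : ℂ → ℂ}
    (h : IsContinuation a ρ η φ G) {S : Set ℂ}
    (hS : ∀ w ∈ S, (ρ : ℂ) * Complex.exp (-w) ∈ deltaDomain ρ η φ) :
    DifferentiableOn ℂ (fun w => G (ρ * Complex.exp (-w))) S :=
  h.1.comp (Differentiable.differentiableOn (by fun_prop)) hS

/-- If the coefficients of the tilted generating functions are asymptotically insensitive to the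
tilt, then the limit law is normal. -/
theorem convergesInLaw_of_insensitive (hθ : ∀ j : ℕ, 1 ≤ j → 0 ≤ θ j)
    (hκ : ∀ j : ℕ, 1 ≤ j → 0 ≤ κ j) (hm : 0 < m) {D : ℕ → ℂ} {W : ℂ} (hW : W ≠ 0)
    (h : ∀ (τ : ℕ → ℝ) (K : ℝ), Tendsto τ atTop (𝓝 0) →
      (∀ᶠ N : ℕ in atTop, N * τ N ^ 2 ≤ K) →
      Tendsto (fun N : ℕ => τ N * Real.log N) atTop (𝓝 0) →
      Tendsto (fun N : ℕ => D N * (Complex.exp (-(Complex.exp (Complex.I * τ N) * N * m)) *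
        expCoeff (fun j => Complex.exp (Complex.I * τ N) *
          (((genCoeff θ j * ρ ^ j : ℝ) : ℂ) + N * ((genCoeff κ j * ρ ^ j : ℝ) : ℂ))) N))
        atTop (𝓝 W)) :
    ConvergesInLaw θ κ (normalizedTotal m m) (id : ℝ → ℝ) (gaussianReal 0 1) := by
  refine convergesInLaw_of_tilted (r := ρ) hθ hκ hm aemeasurable_id D (fun _ => W) (fun t => ?_)
    hW fun t => ?_
  · refine h (fun N => t / Real.sqrt (N * m)) (t ^ 2 / m) (tendsto_div_sqrt_mul t m) ?_
      (tendsto_div_sqrt_mul_log t m)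
    filter_upwards [eventually_gt_atTop 0] with N hN
    exact (natCast_mul_div_sqrt_sq hm t hN).le
  · rw [Measure.map_id, charFun_gaussianReal, div_self hW]
    have hm' : (m : ℂ) ≠ 0 := by exact_mod_cast hm.ne'
    rw [mul_one]
    congr 1
    field_simp
    simp [sq]

lemma norm_rpow_isLittleO_id (S : Set ℂ) {t : ℝ} (ht : 1 < t) :
    (fun w : ℂ => ‖w‖ ^ t) =o[𝓝[S] 0] fun w => w := by
  have h := isLittleO_rpow_rpow_norm S zero_le_one ht
  simp only [Real.rpow_one] at h
  exact h.of_norm_right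

variable {R : ℝ≥0∞} {δ s a θs : ℝ} {Gθ Gκ : ℂ → ℂ}

/-- The value at the boundary is positive. -/
lemma modDerivAt_zero_pos (hκ : ∀ j : ℕ, 1 ≤ j → 0 ≤ κ j)
    (hnd : ∃ j : ℕ, 2 ≤ j ∧ 0 < κ j) (hR : 0 < R) (hκR : R ≤ genRadius κ)
    (h1 : modDerivAt κ 1 R ≠ ⊤) : 0 < (modDerivAt κ 0 R).toReal := by
  have hRt := ne_top_of_modDerivAt_one_ne_top hκ hnd hκR h1
  obtain ⟨s0, e0⟩ := gen_boundary hκ hR hRt hκR h1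
  have hρ : 0 < R.toReal := ENNReal.toReal_pos hR.ne' hRt
  rw [← e0]
  obtain ⟨j, _, hj⟩ := hasPos_genCoeff_mul_pow hnd hρ
  exact s0.tsum_pos (fun j => mul_nonneg (genCoeff_nonneg hκ j) (by positivity)) j hj

lemma ereal_toReal_lt_one {x : EReal} (h : x < 1) : x.toReal < 1 := by
  induction x with
  | bot => simp
  | top => simp at h
  | coe x => exact_mod_cast h

/-- The supercritical case with a logarithmic singularity of the first function. -/
theorem convergesInLaw_supercritical_log (hθ : ∀ j : ℕ, 1 ≤ j → 0 ≤ θ j)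
    (hκ : ∀ j : ℕ, 1 ≤ j → 0 ≤ κ j) (hna : NonArithmetic κ) (hnd : ∃ j : ℕ, 2 ≤ j ∧ 0 < κ j)
    (hR : 0 < R) (hκR : R ≤ genRadius κ) (hθR : R ≤ genRadius θ)
    (hη : 0 < η) (hφ : 0 < φ) (hφ2 : φ < Real.pi / 2) (hδ : 0 < δ) (hθs : 0 < θs)
    (hcθ : IsContinuation θ R.toReal η φ Gθ) (hcκ : IsContinuation κ R.toReal η φ Gκ)
    (h1 : modDerivAt κ 1 R < 1)
    (hEθ : HasExpansion R.toReal η φ Gθ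
      (fun z => -(θs : ℂ) * Complex.log (1 - z / R.toReal)) δ)
    (hEκ : HasExpansion R.toReal η φ Gκ
      (fun z => ((modDerivAt κ 0 R).toReal : ℂ)
        - ((modDerivAt κ 1 R).toReal : ℂ) * (1 - z / R.toReal)) (1 + δ)) :
    ConvergesInLaw θ κ
      (normalizedTotal (modDerivAt κ 0 R).toReal (modDerivAt κ 0 R).toReal)
      (id : ℝ → ℝ) (gaussianReal 0 1) := by
  have h1t : modDerivAt κ 1 R ≠ ⊤ := h1.ne_top
  have hRt := ne_top_of_modDerivAt_one_ne_top hκ hnd hκR h1t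
  obtain ⟨s0, e0⟩ := gen_boundary hκ hR hRt hκR h1t
  have hρ : 0 < R.toReal := ENNReal.toReal_pos hR.ne' hRt
  have hm0 := modDerivAt_zero_pos hκ hnd hR hκR h1t
  have hc := ereal_toReal_lt_one h1
  set c := (modDerivAt κ 1 R).toReal
  set ρ := R.toReal with hρdef
  rw [← e0] at hEκ hm0 ⊢
  have hcos : 0 < Real.cos φ := Real.cos_pos_of_mem_Ioo ⟨by linarith, hφ2⟩
  have hk : Real.cos φ / 2 < 1 := by linarith [Real.cos_le_one φ]
  -- The rays are taken with half the slope parameter cos φ / 2 of the wedge which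
  -- `tendsto_mul_exp_neg` maps into Δ₀.
  have hk' : 0 < Real.cos φ / 4 := by positivity
  have hkk : Real.cos φ / 4 < Real.cos φ / 2 := by linarith
  have hρC : (ρ : ℂ) ≠ 0 := by exact_mod_cast hρ.ne'
  obtain ⟨r₀, hr₀, hmaps⟩ := exists_mul_exp_neg_mem_deltaDomain hρ hη hφ hφ2
  -- The exponent is negative, hence not a natural number.
  have hne := wedgeIntegral_hankel_ne_zero hk' (hkk.trans hk) (sub_pos.2 hc) (q := -θs)
    (fun n h => by
      have : (0 : ℝ) ≤ n := Nat.cast_nonneg n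
      linarith)
  refine convergesInLaw_of_insensitive (ρ := ρ) hθ hκ hm0 (div_ne_zero hne Complex.two_pi_I_ne_zero)
    (D := fun N => (((N : ℝ) ^ (1 - θs) : ℝ) : ℂ)) fun τ K hτ0 hτK hτlog => ?_
  refine tendsto_expCoeff_wedge_log (α := fun j => genCoeff θ j * ρ ^ j)
    (β := fun j => genCoeff κ j * ρ ^ j) (Fα := fun w => Gθ (ρ * Complex.exp (-w)))
    (Fβ := fun w => Gκ (ρ * Complex.exp (-w)))
    (fun j => mul_nonneg (genCoeff_nonneg hθ j) (by positivity))
    (fun j => mul_nonneg (genCoeff_nonneg hκ j) (by positivity)) (by simp) (by simp) s0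
    (hna.genCoeff_mul_pow hρ) (summable_genCoeff_mul_exp_neg hR hRt hθR) hk' hkk hk hc hr₀
    (hcθ.differentiableOn_comp hmaps) (hcκ.differentiableOn_comp hmaps)
    (fun w hw => hcθ.eq_lap hρ hw) (fun w hw => hcκ.eq_lap hρ hw) ?_
    (tendsto_add_log hρ hη hφ hφ2 hδ hEθ) hθs.le hτ0 hτK hτlog
  have hO1 := (hEκ.comp_exp_neg hρ hη hφ hφ2 (by linarith)).trans_isLittleO
    (norm_rpow_isLittleO_id _ (show 1 < 1 + δ by linarith))
  have hO2 := ((one_sub_exp_neg_sub_isBigO (wedge (Real.cos φ / 2))).trans_isLittleO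
    (norm_rpow_isLittleO_id _ one_lt_two)).const_mul_left (c : ℂ)
  refine (hO1.sub hO2).congr_left fun w => ?_
  rw [mul_div_cancel_left₀ _ hρC]
  ring

end

/-! ### Algebraic singularities in the supercritical case -/

lemma norm_exp_sub_exp_le {x y : ℂ} {M : ℝ} (hx : x.re ≤ M) (hy : y.re ≤ M) :
    ‖Complex.exp x - Complex.exp y‖ ≤ Real.exp M * ‖x - y‖ := by
  refine (convex_halfSpace_re_le M).norm_image_sub_le_of_norm_hasDerivWithin_le
    (f := Complex.exp) (f' := Complex.exp)
    (fun z _ => (Complex.hasDerivAt_exp z).hasDerivWithinAt) (fun z hz => ?_) hy hx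
  rw [Complex.norm_exp]
  exact Real.exp_le_exp.2 hz

lemma wedgeIntegral_const_mul (k' : ℝ) (L : ℂ) (g : ℂ → ℂ) :
    wedgeIntegral k' (fun x => L * g x) = L * wedgeIntegral k' g := by
  unfold wedgeIntegral
  rw [integral_const_mul, integral_const_mul]
  ring

section

variable {k k' r₀ c m s K : ℝ} {A : ℂ} {Fα Fβ Eα Eβ : ℂ → ℂ} {τ : ℕ → ℝ}

lemma tendsto_rpow_mul_sub
    (hD : (fun w => Fβ w - Eβ w - A * w ^ (s : ℂ)) =o[𝓝[wedge k] 0] fun w => ‖w‖ ^ s)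
    {x : ℂ} (hx : x ∈ wedge k) :
    Tendsto (fun N : ℕ => (((N : ℝ) ^ s : ℝ) : ℂ) * (Fβ (x / N) - Eβ (x / N))) atTop
      (𝓝 (A * x ^ (s : ℂ))) := by
  have hT : ∀ᶠ N : ℕ in atTop, x / N ∈ wedge k :=
    (eventually_gt_atTop 0).mono fun N hN => div_natCast_mem_wedge hx hN
  have hw : Tendsto (fun N : ℕ => x / N) atTop (𝓝[wedge k] 0) :=
    tendsto_nhdsWithin_iff.2 ⟨tendsto_const_div_atTop_nhds_zero_nat x, hT⟩
  have hxn : 0 < ‖x‖ := norm_pos_iff.2 hx.1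
  have h1 : Tendsto (fun N : ℕ => (((N : ℝ) ^ s : ℝ) : ℂ) *
      (Fβ (x / N) - Eβ (x / N) - A * (x / N) ^ (s : ℂ))) atTop (𝓝 0) := by
    have h := (isBigO_refl (fun N : ℕ => (((N : ℝ) ^ s : ℝ) : ℂ)) atTop).norm_right.mul_isLittleO
      (hD.comp_tendsto hw)
    have h2 : (fun N : ℕ => ‖(((N : ℝ) ^ s : ℝ) : ℂ)‖ *
        ((fun w : ℂ => ‖w‖ ^ s) ∘ fun N : ℕ => x / N) N) =ᶠ[atTop] fun _ => ‖x‖ ^ s := by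
      filter_upwards [eventually_gt_atTop 0] with N hN
      have hN' : (0 : ℝ) < N := by exact_mod_cast hN
      rw [Function.comp, Complex.norm_real, Real.norm_of_nonneg (by positivity),
        norm_div, Complex.norm_natCast, Real.div_rpow hxn.le hN'.le]
      have : (N : ℝ) ^ s ≠ 0 := by positivity
      field_simp
    exact (isLittleO_const_iff (by positivity)).1 (h.trans_eventuallyEq h2)
  have h3 := h1.add_const (A * x ^ (s : ℂ))
  rw [zero_add] at h3
  refine h3.congr' ?_
  filter_upwards [eventually_gt_atTop 0] with N hN
  have hN' : (0 : ℝ) < N := by exact_mod_cast hN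
  have e : (x / N) ^ (s : ℂ) = ((((N : ℝ) ^ s : ℝ) : ℂ))⁻¹ * x ^ (s : ℂ) := by
    have h := ofReal_mul_cpow (inv_pos.2 hN') hx.1 s
    rw [Real.inv_rpow hN'.le] at h
    push_cast at h ⊢
    rw [← h, div_eq_inv_mul]
  have hne : (((N : ℝ) ^ s : ℝ) : ℂ) ≠ 0 := by
    have : (N : ℝ) ^ s ≠ 0 := by positivity
    exact_mod_cast this
  rw [e]
  field_simp
  ring

/-- The difference is e^{E}(e^{h} - 1), where E is the regular phase and h = Nu(Fβ - Eβ) ≈ A x^s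
N^{1-s} tends to 0 because s > 1. Hence N^{s-1}(e^{h} - 1) → A x^s, while E tends to Eα(0) + (1 -
c)x. -/
lemma tendsto_exp_sub_exp_ray (hs : 1 < s) (hr₀ : 0 < r₀)
    (hα : ∀ w ∈ wedge k ∩ Metric.ball 0 r₀, Fα w = Eα w) (hcα : ContinuousAt Eα 0)
    (hEβ : (fun w => Eβ w - m + c * w) =o[𝓝 0] fun w => w)
    (hD : (fun w => Fβ w - Eβ w - A * w ^ (s : ℂ)) =o[𝓝[wedge k] 0] fun w => ‖w‖ ^ s)
    (hτ0 : Tendsto τ atTop (𝓝 0)) {x : ℂ} (hx : x ∈ wedge k) :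
    Tendsto (fun N : ℕ => (((N : ℝ) ^ (s - 1) : ℝ) : ℂ) *
        (Complex.exp (contPhase Fα Fβ m (Complex.exp (Complex.I * τ N)) N (x / N)) -
          Complex.exp (contPhase Eα Eβ m (Complex.exp (Complex.I * τ N)) N (x / N)))) atTop
      (𝓝 (A * Complex.exp (Eα 0) * hankelIntegrand s (1 - c) x)) := by
  have hu := tendsto_exp_I_mul hτ0
  have hw : Tendsto (fun N : ℕ => x / N) atTop (𝓝 0) := tendsto_const_div_atTop_nhds_zero_nat x
  have hT : ∀ᶠ N : ℕ in atTop, x / N ∈ wedge k ∩ Metric.ball 0 r₀ := by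
    filter_upwards [eventually_gt_atTop 0, hw.eventually (Metric.ball_mem_nhds 0 hr₀)] with N h1 h2
    exact ⟨div_natCast_mem_wedge hx h1, h2⟩
  rw [← nhdsWithin_univ] at hEβ
  have h1 := ((hu.mul (hcα.tendsto.comp hw)).add
    (tendsto_linear_scaled hEβ hτ0 hx.1 (Eventually.of_forall fun _ => Set.mem_univ _))).cexp
  rw [one_mul] at h1
  set h : ℕ → ℂ := fun N => N * (Complex.exp (Complex.I * τ N) * (Fβ (x / N) - Eβ (x / N))) with hh
  have h2 : Tendsto (fun N : ℕ => (((N : ℝ) ^ (s - 1) : ℝ) : ℂ) * h N) atTop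
      (𝓝 (A * x ^ (s : ℂ))) := by
    have := hu.mul (tendsto_rpow_mul_sub hD hx)
    rw [one_mul] at this
    refine this.congr' ?_
    filter_upwards [eventually_gt_atTop 0] with N hN
    have hN' : (0 : ℝ) < N := by exact_mod_cast hN
    have hNC : (N : ℂ) ≠ 0 := by exact_mod_cast hN.ne'
    rw [hh, Real.rpow_sub_one hN'.ne']
    push_cast
    field_simp
  have h3 : Tendsto h atTop (𝓝 0) := by
    have h4 : Tendsto (fun N : ℕ => (((N : ℝ) ^ (-(s - 1)) : ℝ) : ℂ)) atTop (𝓝 0) := by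
      have := (tendsto_rpow_neg_atTop (show 0 < s - 1 by linarith)).comp
        (tendsto_natCast_atTop_atTop (R := ℝ))
      simpa [Function.comp_def] using (Complex.continuous_ofReal.tendsto 0).comp this
    have := h4.mul h2
    rw [zero_mul] at this
    refine this.congr' ?_
    filter_upwards [eventually_gt_atTop 0] with N hN
    have hN' : (0 : ℝ) < N := by exact_mod_cast hN
    rw [← mul_assoc, ← Complex.ofReal_mul, ← Real.rpow_add hN', neg_add_cancel, Real.rpow_zero,
      Complex.ofReal_one, one_mul]
  have h5 : Tendsto (fun N : ℕ => (((N : ℝ) ^ (s - 1) : ℝ) : ℂ) * (Complex.exp (h N) - 1)) atTop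
      (𝓝 (A * x ^ (s : ℂ))) := by
    have h6 : Tendsto (fun N : ℕ => (((N : ℝ) ^ (s - 1) : ℝ) : ℂ) *
        (Complex.exp (h N) - 1 - h N)) atTop (𝓝 0) := by
      have h7 := h2.norm.mul h3.norm
      rw [norm_zero, mul_zero] at h7
      refine squeeze_zero_norm' ?_ h7
      filter_upwards [h3.norm.eventually_lt_const (u := 1) (by simp)] with N hN
      rw [norm_mul, norm_mul, mul_assoc, ← sq]
      exact mul_le_mul_of_nonneg_left (Complex.norm_exp_sub_one_sub_id_le hN.le) (norm_nonneg _)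
    have := h6.add h2
    rw [zero_add] at this
    refine this.congr fun N => ?_
    ring
  have h8 := h1.mul h5
  have e : Complex.exp (Eα 0 + (1 - c : ℝ) * x) * (A * x ^ (s : ℂ)) =
      A * Complex.exp (Eα 0) * hankelIntegrand s (1 - c) x := by
    rw [hankelIntegrand, Complex.exp_add]
    ring
  rw [e] at h8
  refine h8.congr' ?_
  filter_upwards [hT] with N hN
  have e2 : contPhase Fα Fβ m (Complex.exp (Complex.I * τ N)) N (x / N) =
      contPhase Eα Eβ m (Complex.exp (Complex.I * τ N)) N (x / N) + h N := by
    rw [contPhase, contPhase, hα _ hN, hh]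
    ring
  rw [e2, Complex.exp_add _ (h N), contPhase, Function.comp]
  ring

/-- Both exponents have real part at most a constant minus (1 - c)k'r/2, so the mean value
inequality bounds the difference by that exponential times N|Fβ - Eβ|, which is of order |x|^s
N^{1-s}. -/
lemma exists_norm_exp_sub_exp_ray_le (hk' : 0 < k') (hkk : k' < k) (hk1 : k < 1) (hc : c < 1)
    (hr₀ : 0 < r₀)
    (hα : ∀ w ∈ wedge k ∩ Metric.ball 0 r₀, Fα w = Eα w) (hcα : ContinuousAt Eα 0)
    (hFβ : (fun w => Fβ w - m + c * w) =o[𝓝[wedge k] 0] fun w => w)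
    (hEβ : (fun w => Eβ w - m + c * w) =o[𝓝 0] fun w => w)
    (hD : (fun w => Fβ w - Eβ w - A * w ^ (s : ℂ)) =o[𝓝[wedge k] 0] fun w => ‖w‖ ^ s)
    (hτ0 : Tendsto τ atTop (𝓝 0)) :
    ∃ δ > 0, ∃ μ > 0, ∃ C : ℝ, ∀ᶠ N : ℕ in atTop, ∀ σ : ℝ, σ ^ 2 = 1 →
      ∀ r : ℝ, 0 ≤ r → r ≤ N * δ →
      ‖(((N : ℝ) ^ (s - 1) : ℝ) : ℂ) *
        (Complex.exp (contPhase Fα Fβ m (Complex.exp (Complex.I * τ N)) N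
          ((1 + (-k' + σ * Complex.I) * r) / N)) -
        Complex.exp (contPhase Eα Eβ m (Complex.exp (Complex.I * τ N)) N
          ((1 + (-k' + σ * Complex.I) * r) / N)))‖ ≤ C * Real.exp (-μ * r) := by
  have hlam : 0 < 1 - c := by linarith
  obtain ⟨δ₁, hδ₁, h1⟩ := exists_re_ray_le hk' hkk hk1 hc hFβ hτ0
  obtain ⟨δ₂, hδ₂, h2⟩ := exists_re_ray_le hk' hkk hk1 hc (hEβ.mono nhdsWithin_le_nhds) hτ0
  obtain ⟨C₀, hC₀, hpow⟩ := rpow_le_mul_exp s (show 0 < (1 - c) * k' / 8 by positivity)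
    (show (0 : ℝ) < 1 / 2 by norm_num)
  have h3 := isLittleO_iff.1 hD one_pos
  rw [eventually_nhdsWithin_iff, Metric.eventually_nhds_iff] at h3
  obtain ⟨δ₃, hδ₃, h3⟩ := h3
  obtain ⟨δ₄, hδ₄, h4⟩ := Metric.eventually_nhds_iff.1
    (hcα.norm.eventually_lt_const (u := ‖Eα 0‖ + 1) (by simp))
  set ρ := min (min δ₃ δ₄) r₀ with hρdef
  have hρ : 0 < ρ := by positivity
  -- Half of the rate (1 - c)k'/2 is given up to absorb the growth of |x|^s.
  refine ⟨min (min δ₁ δ₂) (ρ / 4), by positivity, (1 - c) * k' / 4, by positivity,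
    Real.exp (‖Eα 0‖ + 1 + 2 * (1 - c)) * (‖A‖ + 1) * (C₀ * Real.exp ((1 - c) * k' / 8)), ?_⟩
  filter_upwards [h1, h2, eventually_norm_ray_div_lt hk' (hkk.trans hk1) hρ,
    eventually_gt_atTop 0] with N hN1 hN2 hN3 hN0 σ hσ r hr hrN
  have hN' : (0 : ℝ) < N := by exact_mod_cast hN0
  set x : ℂ := 1 + (-k' + σ * Complex.I) * r with hx
  have hxn := ray_norm_ge hk' (hkk.trans hk1) hσ r
  have hxn2 := ray_norm_le hk' (hkk.trans hk1) hσ hr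
  rw [← hx] at hxn hxn2
  have hre1 := hN1 σ hσ r hr (hrN.trans (mul_le_mul_of_nonneg_left
    ((min_le_left _ _).trans (min_le_left _ _)) hN'.le))
  have hre2 := hN2 σ hσ r hr (hrN.trans (mul_le_mul_of_nonneg_left
    ((min_le_left _ _).trans (min_le_right _ _)) hN'.le))
  have hw := hN3 σ hσ r hr (hrN.trans (mul_le_mul_of_nonneg_left (min_le_right _ _) hN'.le))
  rw [← hx] at hre1 hre2 hw
  have hwedge : x / N ∈ wedge k := div_natCast_mem_wedge (ray_mem_wedge hkk hσ hr) hN0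
  have hFE : Fα (x / N) = Eα (x / N) :=
    hα _ ⟨hwedge, mem_ball_zero_iff.2 (hw.trans_le (min_le_right _ _))⟩
  have hM := h4 (y := x / N) (by
    rw [dist_zero_right]
    exact hw.trans_le ((min_le_left _ _).trans (min_le_right _ _)))
  have hdiff := h3 (y := x / N) (by
    rw [dist_zero_right]
    exact hw.trans_le ((min_le_left _ _).trans (min_le_left _ _))) hwedge
  set u := Complex.exp (Complex.I * τ N) with hu
  have hu1 : ‖u‖ = 1 := by simp [hu, Complex.norm_exp]
  have hEre : (u * Eα (x / N)).re ≤ ‖Eα 0‖ + 1 := by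
    refine (Complex.re_le_norm _).trans ?_
    rw [norm_mul, hu1, one_mul]
    exact hM.le
  have hb := norm_exp_sub_exp_le (x := contPhase Fα Fβ m u N (x / N))
    (y := contPhase Eα Eβ m u N (x / N))
    (M := ‖Eα 0‖ + 1 + (2 * (1 - c) - (1 - c) * k' / 2 * r))
    (by rw [contPhase, Complex.add_re, hFE]; linarith)
    (by rw [contPhase, Complex.add_re]; linarith)
  have e : contPhase Fα Fβ m u N (x / N) - contPhase Eα Eβ m u N (x / N) =
      N * (u * (Fβ (x / N) - Eβ (x / N))) := by
    rw [contPhase, contPhase, hFE]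
    ring
  have hd2 : ‖Fβ (x / N) - Eβ (x / N)‖ ≤ (‖A‖ + 1) * (‖x‖ ^ s / (N : ℝ) ^ s) := by
    have e2 : ‖x / N‖ ^ s = ‖x‖ ^ s / (N : ℝ) ^ s := by
      rw [norm_div, Complex.norm_natCast, Real.div_rpow (norm_nonneg _) hN'.le]
    rw [← e2]
    calc ‖Fβ (x / N) - Eβ (x / N)‖
        = ‖(Fβ (x / N) - Eβ (x / N) - A * (x / N) ^ (s : ℂ)) + A * (x / N) ^ (s : ℂ)‖ := by ring_nf
      _ ≤ 1 * ‖‖x / N‖ ^ s‖ + ‖A‖ * ‖x / N‖ ^ s := by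
          refine (norm_add_le _ _).trans (add_le_add hdiff ?_)
          rw [norm_mul, Complex.norm_cpow_real]
      _ = _ := by
          rw [Real.norm_of_nonneg (by positivity)]
          ring
  rw [e, norm_mul, norm_mul, hu1, one_mul, Complex.norm_natCast] at hb
  have hxs : ‖x‖ ^ s ≤ C₀ * Real.exp ((1 - c) * k' / 8 * (1 + 2 * r)) := by
    refine (hpow _ hxn).trans ?_
    gcongr
  rw [norm_mul, Complex.norm_real, Real.norm_of_nonneg (by positivity)]
  calc (N : ℝ) ^ (s - 1) * ‖Complex.exp (contPhase Fα Fβ m u N (x / N)) -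
        Complex.exp (contPhase Eα Eβ m u N (x / N))‖
      ≤ (N : ℝ) ^ (s - 1) * (Real.exp (‖Eα 0‖ + 1 + (2 * (1 - c) - (1 - c) * k' / 2 * r)) *
        (N * ((‖A‖ + 1) * (‖x‖ ^ s / (N : ℝ) ^ s)))) := by
        refine mul_le_mul_of_nonneg_left (hb.trans ?_) (by positivity)
        gcongr
    _ = Real.exp (‖Eα 0‖ + 1 + (2 * (1 - c) - (1 - c) * k' / 2 * r)) * (‖A‖ + 1) * ‖x‖ ^ s := by
        rw [Real.rpow_sub_one hN'.ne']
        have : (N : ℝ) ^ s ≠ 0 := by positivity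
        field_simp
    _ ≤ Real.exp (‖Eα 0‖ + 1 + (2 * (1 - c) - (1 - c) * k' / 2 * r)) * (‖A‖ + 1) *
        (C₀ * Real.exp ((1 - c) * k' / 8 * (1 + 2 * r))) := by gcongr
    _ = (‖A‖ + 1) * C₀ * (Real.exp (‖Eα 0‖ + 1 + (2 * (1 - c) - (1 - c) * k' / 2 * r)) *
        Real.exp ((1 - c) * k' / 8 * (1 + 2 * r))) := by ring
    _ = (‖A‖ + 1) * C₀ * (Real.exp (‖Eα 0‖ + 1 + 2 * (1 - c)) * Real.exp ((1 - c) * k' / 8) *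
        Real.exp (-((1 - c) * k' / 4) * r)) := by
        rw [← Real.exp_add, ← Real.exp_add, ← Real.exp_add]
        congr 2
        ring
    _ = _ := by ring

/-- The regular part is exponentially small to the left of the singularity. -/
lemma exists_norm_exp_vertical_le (hk' : 0 < k') (hk1 : k' < 1) (hc : c < 1)
    (hcα : ContinuousAt Eα 0)
    (hEβ : (fun w => Eβ w - m + c * w) =o[𝓝 0] fun w => w) (hτ0 : Tendsto τ atTop (𝓝 0)) :
    ∃ ε₁ : ℝ, 0 < ε₁ ∧ ∀ ε : ℝ, 0 < ε → ε < ε₁ → ∃ c₀ > 0, ∃ K' p' : ℝ,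
      ∀ᶠ N : ℕ in atTop, ∀ y : ℝ, |y| ≤ ε →
        ‖Complex.exp (contPhase Eα Eβ m (Complex.exp (Complex.I * τ N)) N
          (((N : ℝ)⁻¹ - k' * ε : ℝ) + Complex.I * y))‖ ≤
          K' * (N : ℝ) ^ p' * Real.exp (-(c₀ * N)) := by
  have hlam : 0 < 1 - c := by linarith
  rw [← nhdsWithin_univ] at hEβ
  obtain ⟨δ₁, hδ₁, h1⟩ := exists_re_linear_le hEβ hτ0 (show 0 < (1 - c) * k' / 8 by positivity)
  obtain ⟨δ₂, hδ₂, h2⟩ := Metric.eventually_nhds_iff.1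
    (hcα.norm.eventually_lt_const (u := ‖Eα 0‖ + 1) (by simp))
  refine ⟨min δ₁ δ₂ / 3, by positivity, fun ε hε hεlt => ?_⟩
  -- Re w is at most -(3/4)k'ε once 1/N < k'ε/4, and the error (1 - c)k'/8 times |w| ≤ 3ε takes back
  -- 3/8.
  refine ⟨3 / 8 * ((1 - c) * k' * ε), by positivity, Real.exp (‖Eα 0‖ + 1), 0, ?_⟩
  filter_upwards [h1, (tendsto_inv_atTop_nhds_zero_nat (𝕜 := ℝ)).eventually
    (eventually_lt_nhds (show 0 < k' * ε / 4 by positivity)), eventually_gt_atTop 0] with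
    N hN1 hN2 hN0 y hy
  have hN' : (0 : ℝ) < N := by exact_mod_cast hN0
  have hNi : 0 < (N : ℝ)⁻¹ := by positivity
  have hkε : k' * ε ≤ ε := mul_le_of_le_one_left hε.le hk1.le
  have hkε0 : 0 < k' * ε := by positivity
  set w : ℂ := ((N : ℝ)⁻¹ - k' * ε : ℝ) + Complex.I * y with hw
  have hre : w.re = (N : ℝ)⁻¹ - k' * ε := by rw [hw]; simp
  have him : w.im = y := by rw [hw]; simp
  have hwn : ‖w‖ ≤ 3 * ε := by
    refine (norm_le_abs_re_add_abs_im (x := 2 * ε) (y := ε) ?_ (him ▸ hy)).trans (by linarith)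
    rw [hre, abs_le]
    constructor <;> linarith
  have hw1 : ‖w‖ < δ₁ := by linarith [min_le_left δ₁ δ₂]
  have hw2 : ‖w‖ < δ₂ := by linarith [min_le_right δ₁ δ₂]
  have h3 := hN1 w (Set.mem_univ _) hw1
  have h4 := h2 (y := w) (by rwa [dist_zero_right])
  set u := Complex.exp (Complex.I * τ N) with hu
  have hu1 : ‖u‖ = 1 := by simp [hu, Complex.norm_exp]
  have hEre : (u * Eα w).re ≤ ‖Eα 0‖ + 1 := by
    refine (Complex.re_le_norm _).trans ?_
    rw [norm_mul, hu1, one_mul]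
    exact h4.le
  have h5 : (u * (Eβ w - m) + w).re ≤ -(3 / 8 * ((1 - c) * k' * ε)) := by
    rw [hre] at h3
    have h6 : (1 - c) * k' / 8 * ‖w‖ ≤ (1 - c) * k' / 8 * (3 * ε) := by gcongr
    have h7 : (1 - c) * ((N : ℝ)⁻¹ - k' * ε) ≤ (1 - c) * (-(3 / 4) * (k' * ε)) :=
      mul_le_mul_of_nonneg_left (by linarith) hlam.le
    nlinarith
  rw [Complex.norm_exp, contPhase, Complex.add_re,
    show ((N : ℂ) * (u * (Eβ w - m) + w)).re = N * (u * (Eβ w - m) + w).re from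
      Complex.re_ofReal_mul (N : ℝ) _, Real.rpow_zero, mul_one, ← Real.exp_add]
  refine Real.exp_le_exp.2 (add_le_add hEre ?_)
  have := mul_le_mul_of_nonneg_left h5 hN'.le
  linarith

/-- The supercritical case with an algebraic singularity of the second function. -/
theorem tendsto_expCoeff_wedge_algebraic {α β : ℕ → ℝ}
    (hα : ∀ j, 0 ≤ α j) (hβ : ∀ j, 0 ≤ β j) (hα0 : α 0 = 0) (hβ0 : β 0 = 0)
    (hβs : Summable β) (hna : NonArithmetic β)
    (hαs : ∀ ξ : ℝ, 0 < ξ → Summable fun j : ℕ => α j * Real.exp (-(ξ * j)))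
    (hk' : 0 < k') (hkk : k' < k) (hk1 : k < 1) (hc : c < 1) (hr₀ : 0 < r₀) (hs : 1 < s)
    (hdβ : DifferentiableOn ℂ Fβ (wedge k ∩ Metric.ball 0 r₀))
    (heα : ∀ w : ℂ, 0 < w.re → Fα w = lap α w) (heβ : ∀ w : ℂ, 0 < w.re → Fβ w = lap β w)
    (hdEα : DifferentiableOn ℂ Eα (Metric.ball 0 r₀)) (hdEβ : Differentiable ℂ Eβ)
    (hFE : ∀ w ∈ wedge k ∩ Metric.ball 0 r₀, Fα w = Eα w)
    (hEβ : (fun w => Eβ w - (∑' j : ℕ, β j : ℝ) + c * w) =o[𝓝 0] fun w => w)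
    (hD : (fun w => Fβ w - Eβ w - A * w ^ (s : ℂ)) =o[𝓝[wedge k] 0] fun w => ‖w‖ ^ s)
    (hτ0 : Tendsto τ atTop (𝓝 0)) (hτK : ∀ᶠ N : ℕ in atTop, N * τ N ^ 2 ≤ K) :
    Tendsto (fun N : ℕ => (((N : ℝ) ^ s : ℝ) : ℂ) *
      (Complex.exp (-(Complex.exp (Complex.I * τ N) * N * (∑' j : ℕ, β j : ℝ))) *
        expCoeff (fun j => Complex.exp (Complex.I * τ N) * ((α j : ℂ) + N * (β j : ℂ))) N)) atTop
      (𝓝 (A * Complex.exp (Eα 0) * wedgeIntegral k' (hankelIntegrand s (1 - c)) /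
        (2 * Real.pi * Complex.I))) := by
  have hk0 : 0 < k := hk'.trans hkk
  have hcα : ContinuousAt Eα 0 :=
    hdEα.continuousOn.continuousAt (Metric.ball_mem_nhds 0 hr₀)
  have hFβ : (fun w => Fβ w - (∑' j : ℕ, β j : ℝ) + c * w) =o[𝓝[wedge k] 0] fun w => w := by
    have hO : (fun w : ℂ => A * w ^ (s : ℂ)) =O[𝓝[wedge k] 0] fun w => ‖w‖ ^ s := by
      refine IsBigO.of_bound ‖A‖ (Eventually.of_forall fun w => ?_)
      rw [norm_mul, Complex.norm_cpow_real, Real.norm_of_nonneg (by positivity)]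
    have h := ((hD.isBigO.add hO).trans_isLittleO (norm_rpow_isLittleO_id _ hs)).add
      (hEβ.mono nhdsWithin_le_nhds)
    refine h.congr_left fun w => ?_
    ring
  rw [← wedgeIntegral_const_mul]
  have hdα : DifferentiableOn ℂ Fα (wedge k ∩ Metric.ball 0 r₀) :=
    (hdEα.mono Set.inter_subset_right).congr hFE
  -- The exponential of the regular phase is subtracted: it is larger than the singular part on the
  -- rays but contributes only an exponentially small amount to the coefficient.
  refine tendsto_expCoeff_wedge (K := max K (Real.exp (‖Eα 0‖ + 1))) (p := 0)
    (E := fun N w => Complex.exp (contPhase Eα Eβ (∑' j : ℕ, β j) (Complex.exp (Complex.I * τ N))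
      N w)) hα hβ hα0 hβ0
    hβs hna hαs hk' hkk hk1 hc hr₀ hdα hdβ heα heβ hFβ hτ0
    (hτK.mono fun N h => h.trans (le_max_left _ _)) ?_ (fun N => ?_)
    (exists_norm_exp_vertical_le hk' (hkk.trans hk1) hc hcα hEβ hτ0)
    (exists_norm_exp_sub_exp_ray_le hk' hkk hk1 hc hr₀ hFE hcα hFβ hEβ hD hτ0)
    (fun σ hσ r hr => tendsto_exp_sub_exp_ray hs hr₀ hFE hcα hEβ hD hτ0 (ray_mem_wedge hkk hσ hr))
  · have hw : Tendsto (fun N : ℕ => (1 : ℂ) / N) atTop (𝓝 0) :=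
      tendsto_const_div_atTop_nhds_zero_nat 1
    filter_upwards [(hcα.tendsto.comp hw).norm.eventually_lt_const (u := ‖Eα 0‖ + 1) (by simp),
      hw.eventually (Metric.ball_mem_nhds 0 hr₀), eventually_gt_atTop 0] with N hN hNb hN0
    have e : (1 : ℂ) / N = (((N : ℝ)⁻¹ : ℝ) : ℂ) := by push_cast; simp
    have hmem : (1 : ℂ) / N ∈ wedge k :=
      div_natCast_mem_wedge (halfPlane_subset_wedge hk0.le (by simp)) hN0
    rw [Function.comp, ← hFE _ ⟨hmem, hNb⟩, e, heα _ (by simpa using hN0), lap_ofReal,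
      Complex.norm_real] at hN
    rw [Real.rpow_zero, mul_one]
    exact (Real.exp_le_exp.2 ((Real.le_norm_self _).trans hN.le)).trans (le_max_right _ _)
  · unfold contPhase
    exact ((hdEα.const_mul _).add ((((hdEβ.differentiableOn.sub_const _).const_mul _).add
      differentiableOn_id).const_mul _)).cexp

end

section

variable {θ κ : ℕ → ℝ} {R : ℝ≥0∞} {η φ δ s a : ℝ} {Gθ Gκ : ℂ → ℂ}

/-- First-order expansion of a polynomial in `1 - e^{-w}`. -/
lemma sum_one_sub_exp_neg_isLittleO (b : ℕ → ℂ) {M : ℕ} (hM : 2 ≤ M) :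
    (fun w : ℂ => ∑ n ∈ Finset.range M, b n * (1 - Complex.exp (-w)) ^ n - b 0 - b 1 * w)
      =o[𝓝 0] fun w => w := by
  have h1 : HasDerivAt (fun w : ℂ => 1 - Complex.exp (-w)) 1 0 := by
    have h := (hasDerivAt_neg (0 : ℂ)).cexp.const_sub 1
    simpa using h
  have h2 : HasDerivAt (fun w : ℂ => ∑ n ∈ Finset.range M, b n * (1 - Complex.exp (-w)) ^ n)
      (∑ n ∈ Finset.range M, b n * (n * (1 - Complex.exp (-(0 : ℂ))) ^ (n - 1) * 1)) 0 :=
    HasDerivAt.fun_sum fun n _ => (h1.fun_pow n).const_mul (b n)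
  have e1 : ∑ n ∈ Finset.range M, b n * (n * (1 - Complex.exp (-(0 : ℂ))) ^ (n - 1) * 1) =
      b 1 := by
    rw [Finset.sum_eq_single_of_mem 1 (Finset.mem_range.2 (by omega))]
    · simp
    · intro n _ hn
      rcases Nat.eq_zero_or_pos n with rfl | hn0
      · simp
      · simp [show n - 1 ≠ 0 by omega]
  have e0 : ∑ n ∈ Finset.range M, b n * (1 - Complex.exp (-(0 : ℂ))) ^ n = b 0 := by
    rw [Finset.sum_eq_single_of_mem 0 (Finset.mem_range.2 (by omega))]
    · simp
    · intro n _ hn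
      simp [hn]
  rw [e1, hasDerivAt_iff_isLittleO] at h2
  simp only [e0, sub_zero, smul_eq_mul] at h2
  refine h2.congr_left fun w => ?_
  ring

/-- The supercritical case with an algebraic singularity of the second function. -/
theorem convergesInLaw_supercritical_algebraic (hθ : ∀ j : ℕ, 1 ≤ j → 0 ≤ θ j)
    (hκ : ∀ j : ℕ, 1 ≤ j → 0 ≤ κ j) (hna : NonArithmetic κ) (hnd : ∃ j : ℕ, 2 ≤ j ∧ 0 < κ j)
    (hR : 0 < R) (hκR : R ≤ genRadius κ) (hθR : R ≤ genRadius θ)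
    (hη : 0 < η) (hφ : 0 < φ) (hφ2 : φ < Real.pi / 2) (hδ : 0 < δ)
    (hs : 1 < s) (hsn : ∀ n : ℕ, s ≠ n) (ha : a ≠ 0)
    (hcθ : IsContinuation θ R.toReal η φ Gθ) (haθ : AnalyticAt ℂ Gθ (R.toReal : ℂ))
    (hcκ : IsContinuation κ R.toReal η φ Gκ)
    (h1 : modDerivAt κ 1 R < 1)
    (hEκ : HasExpansion R.toReal η φ Gκ
      (fun z => (∑ n ∈ Finset.range ⌈s⌉₊, (-1 : ℂ) ^ n * ((modDerivAt κ n R).toReal : ℂ)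
          / (n.factorial : ℂ) * (1 - z / R.toReal) ^ n)
        + (a : ℂ) * (1 - z / R.toReal) ^ (s : ℂ)) (s + δ)) :
    ConvergesInLaw θ κ
      (normalizedTotal (modDerivAt κ 0 R).toReal (modDerivAt κ 0 R).toReal)
      (id : ℝ → ℝ) (gaussianReal 0 1) := by
  have h1t : modDerivAt κ 1 R ≠ ⊤ := h1.ne_top
  have hRt := ne_top_of_modDerivAt_one_ne_top hκ hnd hκR h1t
  obtain ⟨s0, e0⟩ := gen_boundary hκ hR hRt hκR h1t
  have hρ : 0 < R.toReal := ENNReal.toReal_pos hR.ne' hRt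
  have hm0 := modDerivAt_zero_pos hκ hnd hR hκR h1t
  have hc := ereal_toReal_lt_one h1
  set b : ℕ → ℂ := fun n => (-1 : ℂ) ^ n * ((modDerivAt κ n R).toReal : ℂ) / (n.factorial : ℂ)
    with hb
  have hb0 : b 0 = ((modDerivAt κ 0 R).toReal : ℂ) := by simp [hb]
  have hb1 : b 1 = -((modDerivAt κ 1 R).toReal : ℂ) := by simp [hb]
  -- `Finset.range ⌈s⌉₊` consists of the n < s; as s > 1 it contains 0 and 1, which carry m and -c.
  have hexp := sum_one_sub_exp_neg_isLittleO b (M := ⌈s⌉₊)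
    (Nat.lt_ceil.2 (by exact_mod_cast hs))
  rw [hb0, hb1, ← e0] at hexp
  set c := (modDerivAt κ 1 R).toReal
  set ρ := R.toReal with hρdef
  rw [← e0] at hm0 ⊢
  have hcos : 0 < Real.cos φ := Real.cos_pos_of_mem_Ioo ⟨by linarith, hφ2⟩
  have hk : Real.cos φ / 2 < 1 := by linarith [Real.cos_le_one φ]
  have hk' : 0 < Real.cos φ / 4 := by positivity
  have hkk : Real.cos φ / 4 < Real.cos φ / 2 := by linarith
  have hρC : (ρ : ℂ) ≠ 0 := by exact_mod_cast hρ.ne'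
  obtain ⟨r₁, hr₁, hmaps⟩ := exists_mul_exp_neg_mem_deltaDomain hρ hη hφ hφ2
  -- Analyticity of the first function at R carries over to a full disc around w = 0, so it can
  -- serve as its own regular part.
  have hcontz : Continuous fun w : ℂ => (ρ : ℂ) * Complex.exp (-w) := by fun_prop
  have han : ∀ᶠ w : ℂ in 𝓝 0, AnalyticAt ℂ Gθ (ρ * Complex.exp (-w)) := by
    have := hcontz.tendsto 0
    rw [neg_zero, Complex.exp_zero, mul_one] at this
    exact this.eventually haθ.eventually_analyticAt
  obtain ⟨r₂, hr₂, hr₂an⟩ := Metric.eventually_nhds_iff.1 han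
  -- This is where a non-integer exponent matters: for a natural number s the term w^s would be
  -- regular and Hankel's integral would vanish.
  have hne := wedgeIntegral_hankel_ne_zero hk' (hkk.trans hk) (sub_pos.2 hc) hsn
  have haC : (a : ℂ) ≠ 0 := by exact_mod_cast ha
  refine convergesInLaw_of_insensitive (ρ := ρ) hθ hκ hm0
    (W := a * Complex.exp (Gθ (ρ * Complex.exp (-0))) *
      wedgeIntegral (Real.cos φ / 4) (hankelIntegrand s (1 - c)) / (2 * Real.pi * Complex.I))
    (div_ne_zero (mul_ne_zero (mul_ne_zero haC (Complex.exp_ne_zero _)) hne)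
      Complex.two_pi_I_ne_zero)
    (D := fun N => (((N : ℝ) ^ s : ℝ) : ℂ)) fun τ K hτ0 hτK _ => ?_
  refine tendsto_expCoeff_wedge_algebraic (α := fun j => genCoeff θ j * ρ ^ j) (r₀ := min r₁ r₂)
    (β := fun j => genCoeff κ j * ρ ^ j) (Fα := fun w => Gθ (ρ * Complex.exp (-w)))
    (Fβ := fun w => Gκ (ρ * Complex.exp (-w))) (Eα := fun w => Gθ (ρ * Complex.exp (-w)))
    (Eβ := fun w => ∑ n ∈ Finset.range ⌈s⌉₊, b n * (1 - Complex.exp (-w)) ^ n)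
    (fun j => mul_nonneg (genCoeff_nonneg hθ j) (by positivity))
    (fun j => mul_nonneg (genCoeff_nonneg hκ j) (by positivity)) (by simp) (by simp) s0
    (hna.genCoeff_mul_pow hρ) (summable_genCoeff_mul_exp_neg hR hRt hθR) hk' hkk hk hc
    (lt_min hr₁ hr₂) hs
    (hcκ.differentiableOn_comp fun w hw => hmaps w ⟨hw.1, Metric.ball_subset_ball
      (min_le_left _ _) hw.2⟩)
    (fun w hw => hcθ.eq_lap hρ hw) (fun w hw => hcκ.eq_lap hρ hw) ?_ (by fun_prop)
    (fun _ _ => rfl) ?_ ?_ hτ0 hτK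
  · intro w hw
    have hz : DifferentiableAt ℂ (fun w : ℂ => (ρ : ℂ) * Complex.exp (-w)) w := by fun_prop
    exact ((hr₂an (Metric.ball_subset_ball (min_le_right _ _) hw)).differentiableAt.comp w
      hz).differentiableWithinAt
  · refine hexp.congr_left fun w => ?_
    ring
  · have hO1 := (hEκ.comp_exp_neg hρ hη hφ hφ2 (by linarith)).trans_isLittleO
      (isLittleO_rpow_rpow_norm _ (by linarith) (show s < s + δ by linarith))
    have hO2 := (cpow_one_sub_exp_neg_isLittleO (hk'.trans hkk).le hk s).const_mul_left (a : ℂ)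
    refine (hO1.add hO2).congr_left fun w => ?_
    rw [mul_div_cancel_left₀ _ hρC]
    ring

end

end SurrogateSpatial

theorem mainTheorem4 (θ κ : ℕ → ℝ)
    (hθ : ∀ j : ℕ, 1 ≤ j → 0 ≤ θ j) (hκ : ∀ j : ℕ, 1 ≤ j → 0 ≤ κ j)
    (hna : NonArithmetic κ) (hnd : ∃ j : ℕ, 2 ≤ j ∧ 0 < κ j)
    (R : ℝ≥0∞) (hR : 0 < R) (hκR : genRadius κ = R) (hθR : R ≤ genRadius θ) :
    -- (a) the subcritical case
    (1 < modDerivAt κ 1 R →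
      (∃! r₁ : ℝ, IsSaddlePoint κ R r₁) ∧
      ∀ r₁ : ℝ, IsSaddlePoint κ R r₁ →
        0 < gen κ r₁ - 1 / bTwo κ r₁ ∧
        ConvergesInLaw θ κ (normalizedTotal (gen κ r₁) (gen κ r₁ - 1 / bTwo κ r₁))
          (id : ℝ → ℝ) (gaussianReal 0 1)) ∧
    -- (b) the supercritical case, with a logarithmic singularity of the first function
    (∀ (η φ δ θs : ℝ) (Gθ Gκ : ℂ → ℂ), 0 < η → 0 < φ → φ < Real.pi / 2 → 0 < δ → 0 < θs →
      IsContinuation θ R.toReal η φ Gθ → IsContinuation κ R.toReal η φ Gκ →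
      modDerivAt κ 1 R < 1 →
      HasExpansion R.toReal η φ Gθ
        (fun z => -(θs : ℂ) * Complex.log (1 - z / R.toReal)) δ →
      HasExpansion R.toReal η φ Gκ
        (fun z => ((modDerivAt κ 0 R).toReal : ℂ)
          - ((modDerivAt κ 1 R).toReal : ℂ) * (1 - z / R.toReal)) (1 + δ) →
      ConvergesInLaw θ κ
        (normalizedTotal (modDerivAt κ 0 R).toReal (modDerivAt κ 0 R).toReal)
        (id : ℝ → ℝ) (gaussianReal 0 1)) ∧
    -- (b) the supercritical case, with the first function regular at the point R
    (∀ (η φ δ s a : ℝ) (Gθ Gκ : ℂ → ℂ), 0 < η → 0 < φ → φ < Real.pi / 2 → 0 < δ →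
      1 < s → (∀ n : ℕ, s ≠ n) → a ≠ 0 →
      IsContinuation θ R.toReal η φ Gθ → AnalyticAt ℂ Gθ (R.toReal : ℂ) →
      IsContinuation κ R.toReal η φ Gκ →
      modDerivAt κ 1 R < 1 →
      (∀ n : ℕ, (n : ℝ) < s → modDerivAt κ n R < ⊤) →
      (∀ n : ℕ, s < (n : ℝ) → modDerivAt κ n R = ⊤) →
      HasExpansion R.toReal η φ Gκ
        (fun z => (∑ n ∈ Finset.range ⌈s⌉₊, (-1 : ℂ) ^ n * ((modDerivAt κ n R).toReal : ℂ)
            / (n.factorial : ℂ) * (1 - z / R.toReal) ^ n)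
          + (a : ℂ) * (1 - z / R.toReal) ^ (s : ℂ)) (s + δ) →
      ConvergesInLaw θ κ
        (normalizedTotal (modDerivAt κ 0 R).toReal (modDerivAt κ 0 R).toReal)
        (id : ℝ → ℝ) (gaussianReal 0 1)) ∧
    -- (c-i) the critical case, both functions finite at R, finite second derivative
    (modDerivAt κ 1 R = 1 → modDerivAt θ 0 R < ⊤ → modDerivAt κ 0 R < ⊤ →
      0 < modDerivAt κ 2 R → modDerivAt κ 2 R < ⊤ →
      0 < (modDerivAt κ 0 R).toReal - 1 / bTwoAt κ R ∧
      ConvergesInLaw θ κ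
        (normalizedTotal (modDerivAt κ 0 R).toReal
          ((modDerivAt κ 0 R).toReal - 1 / bTwoAt κ R))
        (id : ℝ → ℝ) (gaussianReal 0 1)) ∧
    -- (c-ii) the critical case, infinite second derivative
    (∀ (η φ δ s a θs : ℝ) (Gθ Gκ : ℂ → ℂ), 0 < η → 0 < φ → φ < Real.pi / 2 → 0 < δ →
      1 < s → s < 2 → 0 < a → 0 ≤ θs →
      IsContinuation θ R.toReal η φ Gθ → IsContinuation κ R.toReal η φ Gκ →
      modDerivAt κ 1 R = 1 →
      HasExpansion R.toReal η φ Gθ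
        (fun z => -(θs : ℂ) * Complex.log (1 - z / R.toReal)) δ →
      HasExpansion R.toReal η φ Gκ
        (fun z => ((modDerivAt κ 0 R).toReal : ℂ) - (1 - z / R.toReal)
          + (a : ℂ) * (1 - z / R.toReal) ^ (s : ℂ)) (s + δ) →
      ConvergesInLaw θ κ
        (normalizedTotal (modDerivAt κ 0 R).toReal (modDerivAt κ 0 R).toReal)
        (id : ℝ → ℝ) (gaussianReal 0 1)) ∧
    -- (c-iii) the critical case, finite second derivative, logarithmic singularity
    (∀ (η φ δ θs : ℝ) (Gθ Gκ : ℂ → ℂ), 0 < η → 0 < φ → φ < Real.pi / 2 → 0 < δ → 0 < θs →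
      IsContinuation θ R.toReal η φ Gθ → IsContinuation κ R.toReal η φ Gκ →
      modDerivAt κ 1 R = 1 → 0 < modDerivAt κ 2 R → modDerivAt κ 2 R < ⊤ →
      HasExpansion R.toReal η φ Gθ
        (fun z => -(θs : ℂ) * Complex.log (1 - z / R.toReal)) δ →
      HasExpansion R.toReal η φ Gκ
        (fun z => ((modDerivAt κ 0 R).toReal : ℂ) - (1 - z / R.toReal)
          + ((modDerivAt κ 2 R).toReal : ℂ) / 2 * (1 - z / R.toReal) ^ 2) (2 + δ) →
      0 < (modDerivAt κ 0 R).toReal - 1 / bTwoAt κ R ∧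
      ∀ {Ω : Type*} [MeasurableSpace Ω] (P : Measure Ω) [IsProbabilityMeasure P] (Z X : Ω → ℝ),
        HasLaw Z (gaussianReal 0 1) P → HasLaw X (gammaMeasure (θs / 2) 1) P → IndepFun Z X P →
        ConvergesInLaw θ κ
          (normalizedTotal (modDerivAt κ 0 R).toReal
            ((modDerivAt κ 0 R).toReal - 1 / bTwoAt κ R))
          (fun ω => Z ω
            - Real.sqrt (2 * X ω / ((modDerivAt κ 0 R).toReal * bTwoAt κ R - 1))) P) := by
  refine ⟨fun h => ⟨existsUnique_isSaddlePoint hκ hnd hκR.ge h, fun r₁ hr₁ =>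
    convergesInLaw_subcritical hθ hκ hna hnd hκR.ge hθR hr₁⟩, ?_, ?_,
    fun h1 h0 _ _ h2 => convergesInLaw_critical_finite hθ hκ hna hnd hR hκR.ge hθR h1 h0 h2, ?_, ?_⟩
  · intro η φ δ θs Gθ Gκ hη hφ hφ2 hδ hθs hcθ hcκ h1 hEθ hEκ
    exact convergesInLaw_supercritical_log hθ hκ hna hnd hR hκR.ge hθR hη hφ hφ2 hδ hθs
      hcθ hcκ h1 hEθ hEκ
  · intro η φ δ s a Gθ Gκ hη hφ hφ2 hδ hs hsn ha hcθ haθ hcκ h1 _ _ hEκ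
    exact convergesInLaw_supercritical_algebraic hθ hκ hna hnd hR hκR.ge hθR hη hφ hφ2 hδ hs hsn
      ha hcθ haθ hcκ h1 hEκ
  · intro η φ δ s a θs Gθ Gκ hη hφ hφ2 hδ hs hs2 ha hθs hcθ hcκ h1 hEθ hEκ
    exact convergesInLaw_critical_infinite hθ hκ hna hnd hR hκR.ge hθR hη hφ hφ2 hδ hs hs2 ha hθs
      hcθ hcκ h1 hEθ hEκ
  · intro η φ δ θs Gθ Gκ hη hφ hφ2 hδ hθs hcθ _ h1 _ h2 hEθ _
    exact convergesInLaw_critical_log hθ hκ hna hnd hR hκR.ge hθR hη hφ hφ2 hδ hθs hcθ h1 h2 hEθ
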